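/- **Theorem (existence and uniqueness for the 2D Muskat problem with viscosity jump).** Let $\mu^1,\mu^2\ge 0$ with $\mu^1+\mu^2>0$ be the viscosities and $\rho^1<\rho^2$ the densities of the upper (1) and lower (2) fluid (stable regime), and put $$A_\mu=\frac{\mu^2-\mu^1}{\mu^2+\mu^1}\in[-1,1],\qquad A_\rho=\frac{\rho^2-\rho^1}{\mu^2+\mu^1}>0 .$$ For $u\in L^2(\mathbb R)$ let $\hat u(\xi)=\frac1{2\pi}\int u(x)e^{-i\xi x}dx$ (so that $u(x)=\int\hat u(\xi)e^{i\xi x}d\xi$), $\|u\|_{\dot{\mathcal F}^{s,1}}=\int|\xi|^s|\hat u(\xi)|\,d\xi$, let $\Lambda$ be the Fourier multiplier with symbol $|\xi|$, and $\Delta_\beta u(\alpha)=\frac{u(\alpha)-u(\alpha-\beta)}{\beta}$. The interface $\{(\alpha,f(\alpha,t))\}$ evolves by the contour equation $$f_t=-A_\rho\Lambda f+\frac{A_\mu}{2}\Lambda\mathcal D(\Omega)+\frac1{2\pi}\,\mathrm{p.v.}\!\int_{\mathbb R}\frac{\partial_\alpha f(\alpha)-\Delta_\beta f(\alpha)}{1+\Delta_\beta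 f(\alpha)^2}\,\Delta_\beta f(\alpha)\,\frac{\partial_\alpha\Omega(\alpha-\beta)}{\beta}\,d\beta, \tag{1}$$ $$\Omega=A_\mu\mathcal D(\Omega)-2A_\rho f,\qquad \mathcal D(\Omega)(\alpha)=\frac1\pi\int_{\mathbb R}\frac{\Delta_\beta f(\alpha)-\partial_\alpha f(\alpha-\beta)}{1+\Delta_\beta f(\alpha)^2}\,\frac{\Omega(\alpha-\beta)}{\beta}\,d\beta . \tag{2}$$ A *solution on $[0,T]$* is a function $f$ with $f(\cdot,t)$ continuous for every $t\in[0,T]$ and $f\in L^\infty(0,T;\dot{\mathcal F}^{1,1}\cap L^2)\cap L^1(0,T;\dot{\mathcal F}^{2,1})$, for which there is $\Omega$ such that for a.e. $t$ the function $\Omega(\cdot,t)\in L^2\cap\dot{\mathcal F}^{1,1}$ is continuous and satisfies (2) (all integrals above converging absolutely), and such that (1) holds integrated in time from $0$ to $t$, for every $\alpha$ and every $t\in[0,T]$. For $m\in[0,1]$ and $a\ge0$ put $$\sigma_1(m,a)=1-\frac{2a^2(3-a^2)}{(1-a^2)^2}-m\,\frac{2a\left(2ma^5-6a^4-8ma^3+4a^2-2ma+2\right)}{(1-a^2)^2\,(1-a^2-2ma)^2},$$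 and let $c(m)$ be the supremum of all $a\in[0,1)$ such that $1-a^2-2ma>0$ and $\sigma_1(m,b)>0$ for all $b\in[0,a]$. Then $c(1)\approx0.128267$ (precisely, $|c(1)-0.128267|\le 5\cdot10^{-7}$), $c(|A_\mu|)>0$, and the following holds. Let $f_0\in L^2(\mathbb R)$ be real-valued with $$\|f_0\|_{\dot{\mathcal F}^{1,1}}<c(|A_\mu|),$$ and put $\sigma=A_\rho\,\sigma_1\big(|A_\mu|,\|f_0\|_{\dot{\mathcal F}^{1,1}}\big)$. Then $\sigma>0$ and there is a function $f$ on $\mathbb R\times[0,\infty)$ that is a solution on $[0,T]$ for every $T>0$, with $f(\cdot,0)=f_0$ (almost everywhere), and such that for all $t\ge0$ $$\|f\|_{L^2}(t)\le\|f_0\|_{L^2},\qquad \|f\|_{\dot{\mathcal F}^{1,1}}(t)+\sigma\int_0^t\|f\|_{\dot{\mathcal F}^{2,1}}(\tau)\,d\tau\le\|f_0\|_{\dot{\mathcal F}^{1,1}}<c(|A_\mu|).$$ It is unique: for every $T>0$, every solution $g$ on $[0,T]$ with $g(\cdot,0)=f_0$ a.e. and $\|g\|_{\dot{\mathcal F}^{1,1}}(t)<c(|A_\mu|)$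 for a.e. $t\in[0,T]$ coincides with $f$ on $\mathbb R\times[0,T]$. -/

import Mathlib

open MeasureTheory Set
open scoped ENNReal NNReal FourierTransform

noncomputable section

namespace Muskat

/-- The Fourier transform `û(ξ) = (1/2π) ∫ u(x) e^{-iξx} dx` of a real function `u ∈ L²(ℝ)`, so that
`u(x) = ∫ û(ξ) e^{iξx} dξ`, products become convolutions and `∂` becomes `iξ`. It is Mathlib's
`L²` Fourier transform (kernel `e^{-2πiξx}`), rescaled. Junk value `0` if `u ∉ L²`. -/
def fhat (u : ℝ → ℝ) (ξ : ℝ) : ℂ :=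
  open Classical in
  if h : MemLp (fun x => (u x : ℂ)) 2 (volume : Measure ℝ) then
    (2 * Real.pi : ℂ)⁻¹ *
      (𝓕 (h.toLp (fun x => (u x : ℂ))) : Lp (α := ℝ) ℂ 2 volume) (ξ / (2 * Real.pi))
  else 0

/-- The norm `∫ |ξ|^s |û(ξ)| dξ` of `Ḟ^{s,1}` for `u ∈ L²(ℝ)` (and `∞` if `u ∉ L²`). -/
def FNorm (s : ℝ) (u : ℝ → ℝ) : ℝ≥0∞ :=
  open Classical in
  if MemLp u 2 (volume : Measure ℝ) then
    ∫⁻ ξ : ℝ, ENNReal.ofReal (|ξ| ^ s) * ‖fhat u ξ‖ₑ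
  else ⊤

/-- The Fourier multiplier `Λ` with symbol `|ξ|`. -/
def Lam (u : ℝ → ℝ) (α : ℝ) : ℝ :=
  (∫ ξ : ℝ, ((|ξ| : ℝ) : ℂ) * fhat u ξ * Complex.exp (Complex.I * ξ * α)).re

/-- The difference quotient `Δ_β u(α) = (u(α) - u(α - β)) / β`. -/
def diffQuot (u : ℝ → ℝ) (α β : ℝ) : ℝ := (u α - u (α - β)) / β

/-- Integrand (in `β`) of the double layer potential. -/
def dlKernel (u w : ℝ → ℝ) (α β : ℝ) : ℝ :=
  (diffQuot u α β - deriv u (α - β)) / (1 + diffQuot u α β ^ 2) * (w (α - β) / β)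

/-- The double layer potential `𝒟(w)` of the graph of `u`. -/
def DL (u w : ℝ → ℝ) (α : ℝ) : ℝ := Real.pi⁻¹ * ∫ β : ℝ, dlKernel u w α β

/-- Integrand (in `β`) of the nonlinear term `N₂`. -/
def n2Kernel (u w : ℝ → ℝ) (α β : ℝ) : ℝ :=
  (deriv u α - diffQuot u α β) / (1 + diffQuot u α β ^ 2) * diffQuot u α β * (deriv w (α - β) / β)

/-- The nonlinear term `N₂`. The integral converges absolutely for the profiles at hand
(see `IsPotentialJump`), hence equals its principal value. -/
def N2 (u w : ℝ → ℝ) (α : ℝ) : ℝ := (2 * Real.pi)⁻¹ * ∫ β : ℝ, n2Kernel u w α β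

/-- `w` is the potential jump `Ω` of the interface `u`: it lies in `L² ∩ Ḟ^{1,1}` and solves
`Ω = A_μ 𝒟(Ω) - 2 A_ρ u`, and the integrals defining `𝒟(Ω)` and `N₂` converge absolutely. -/
structure IsPotentialJump (Aμ Aρ : ℝ) (u w : ℝ → ℝ) : Prop where
  continuous : Continuous w
  memLp : MemLp w 2 (volume : Measure ℝ)
  norm_lt_top : FNorm 1 w < ⊤
  integrable_dl : ∀ α, Integrable (dlKernel u w α)
  integrable_n2 : ∀ α, Integrable (n2Kernel u w α)
  eq : ∀ α, w α = Aμ * DL u w α - 2 * Aρ * u α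

/-- Right-hand side `-A_ρ Λu + (A_μ/2) Λ𝒟(Ω) + N₂` of the evolution equation. -/
def rhs (Aμ Aρ : ℝ) (u w : ℝ → ℝ) (α : ℝ) : ℝ :=
  -Aρ * Lam u α + (Aμ / 2 * Lam (DL u w) α + N2 u w α)

/-- `f` (written `f t α`) is a solution on `[0,T]` of the contour equation in the class
`L^∞(0,T; Ḟ^{1,1} ∩ L²) ∩ L¹(0,T; Ḟ^{2,1})`. Each `f t` is the continuous representative, and
`∂_t f = rhs` is understood as: for each `α`, `f · α` is absolutely continuous and is the integral
of the right-hand side. -/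
structure IsSolution (Aμ Aρ T : ℝ) (f : ℝ → ℝ → ℝ) : Prop where
  continuous : ∀ t ∈ Icc 0 T, Continuous (f t)
  bounded : ∃ M : ℝ≥0, ∀ᵐ t ∂(volume.restrict (Icc 0 T)),
    eLpNorm (f t) 2 volume ≤ M ∧ FNorm 1 (f t) ≤ M
  integrable : ∫⁻ t in Icc 0 T, FNorm 2 (f t) < ⊤
  equation : ∃ Ω : ℝ → ℝ → ℝ,
    (∀ᵐ t ∂(volume.restrict (Icc 0 T)), IsPotentialJump Aμ Aρ (f t) (Ω t)) ∧
    ∀ α, IntervalIntegrable (fun s => rhs Aμ Aρ (f s) (Ω s) α) volume 0 T ∧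
      ∀ t ∈ Icc 0 T, f t α = f 0 α + ∫ s in (0 : ℝ)..t, rhs Aμ Aρ (f s) (Ω s) α

/-- The viscosity Atwood number. -/
def atwoodμ (μ₁ μ₂ : ℝ) : ℝ := (μ₂ - μ₁) / (μ₂ + μ₁)

/-- The density parameter `A_ρ`. -/
def atwoodρ (μ₁ μ₂ ρ₁ ρ₂ : ℝ) : ℝ := (ρ₂ - ρ₁) / (μ₂ + μ₁)

/-- The dissipation constant for `A_ρ = 1`, as a function of `m = |A_μ|` and `a = ‖f₀‖_{Ḟ^{1,1}}`. -/
def sigmaOne (m a : ℝ) : ℝ :=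
  1 - 2 * a ^ 2 * (3 - a ^ 2) / (1 - a ^ 2) ^ 2
    - m * (2 * a * (2 * m * a ^ 5 - 6 * a ^ 4 - 8 * m * a ^ 3 + 4 * a ^ 2 - 2 * m * a + 2)) /
        ((1 - a ^ 2) ^ 2 * (1 - a ^ 2 - 2 * m * a) ^ 2)

/-- The threshold `c(m)`: the largest `c` such that on `[0,c)` the denominators of `sigmaOne m` have
not vanished and `sigmaOne m` is positive. -/
def threshold (m : ℝ) : ℝ :=
  sSup {a : ℝ | 0 ≤ a ∧ a < 1 ∧ 0 < 1 - a ^ 2 - 2 * m * a ∧ ∀ b ∈ Icc 0 a, 0 < sigmaOne m b}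

end Muskat

end

noncomputable section

namespace Muskat

section

variable {a m : ℝ}

/-- The Lipschitz constant of the (rescaled) nonlinearity on the ball of radius `a`. -/
def loss (m a : ℝ) : ℝ :=
  (m / 2 * (2 * (1 + a ^ 2) / (1 - a ^ 2) ^ 2) + 2 * a / (1 - a ^ 2) ^ 2) *
      (2 * a * ((1 - a ^ 2) / (1 - a ^ 2 - 2 * m * a))) +
    (m / 2 * (2 * a / (1 - a ^ 2)) + a ^ 2 / (1 - a ^ 2)) *
      ((1 - a ^ 2) / (1 - a ^ 2 - 2 * m * a) *
        (2 * m * (2 * (1 + a ^ 2) / (1 - a ^ 2) ^ 2) * a *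
          ((1 - a ^ 2) / (1 - a ^ 2 - 2 * m * a)) + 2))

/-- The admissible range of parameters: `a < 1` and `2 m a < 1 - a²`. -/
structure Adm (m a : ℝ) : Prop where
  m_nonneg : 0 ≤ m
  nonneg : 0 ≤ a
  lt_one : a < 1
  disc : 0 < 1 - a ^ 2 - 2 * m * a

lemma Adm.q_pos (h : Adm m a) : 0 < 1 - a ^ 2 := by
  nlinarith [h.nonneg, h.lt_one]

lemma loss_eq (h : Adm m a) :
    loss m a = (4 * m * a + 6 * a ^ 2) / (1 - a ^ 2 - 2 * m * a)
      + 4 * (m * a ^ 2 + a ^ 3) * (a + m) / (1 - a ^ 2 - 2 * m * a) ^ 2 := by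
  have h1 := h.q_pos.ne'
  have h2 := h.disc.ne'
  rw [loss]
  generalize hd : 1 - a ^ 2 - 2 * m * a = d at *
  generalize hq : 1 - a ^ 2 = q at *
  field_simp
  rw [← hd, ← hq]
  ring

lemma loss_eq_one_sub (h : Adm m a) : loss m a = 1 - sigmaOne m a := by
  have h1 := h.q_pos.ne'
  have h2 := h.disc.ne'
  rw [loss_eq h, sigmaOne]
  generalize hd : 1 - a ^ 2 - 2 * m * a = d at *
  generalize hq : 1 - a ^ 2 = q at *
  field_simp
  rw [← hd, ← hq]
  ring

lemma zero_mem_thresholdSet (m : ℝ) : (0 : ℝ) ∈ {a : ℝ | 0 ≤ a ∧ a < 1 ∧ 0 < 1 - a ^ 2 - 2 * m * a ∧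
    ∀ b ∈ Icc 0 a, 0 < sigmaOne m b} := by
  refine ⟨le_rfl, one_pos, by norm_num, fun b hb => ?_⟩
  obtain rfl : b = 0 := le_antisymm hb.2 hb.1
  norm_num [sigmaOne]

lemma bddAbove_thresholdSet (m : ℝ) : BddAbove {a : ℝ | 0 ≤ a ∧ a < 1 ∧ 0 < 1 - a ^ 2 - 2 * m * a ∧
    ∀ b ∈ Icc 0 a, 0 < sigmaOne m b} := ⟨1, fun _ ha => ha.2.1.le⟩

lemma adm_of_lt_threshold (hm : 0 ≤ m) (ha : 0 ≤ a) (h : a < threshold m) :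
    Adm m a ∧ loss m a < 1 := by
  obtain ⟨b, ⟨hb0, hb1, hbd, hb⟩, hab⟩ := exists_lt_of_lt_csSup ⟨0, zero_mem_thresholdSet m⟩ h
  have hA : Adm m a := ⟨hm, ha, hab.trans hb1, by nlinarith⟩
  refine ⟨hA, ?_⟩
  have := hb a ⟨ha, hab.le⟩
  rw [loss_eq_one_sub hA]
  linarith

lemma threshold_pos (hm : 0 ≤ m) (hm1 : m ≤ 1) : 0 < threshold m := by
  have : (1 / 10 : ℝ) ≤ threshold m := by
    refine le_csSup (bddAbove_thresholdSet m) ⟨by norm_num, by norm_num, by nlinarith, ?_⟩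
    intro b ⟨hb0, hb1⟩
    have hmb : m * b ≤ 1 / 10 := by nlinarith
    have hmb0 : 0 ≤ m * b := by positivity
    have hd : (79 / 100 : ℝ) ≤ 1 - b ^ 2 - 2 * m * b := by nlinarith
    have hA : Adm m b := ⟨hm, hb0, by linarith, by linarith⟩
    have h1 := loss_eq_one_sub hA
    rw [loss_eq hA] at h1
    have e1 : (4 * m * b + 6 * b ^ 2) / (1 - b ^ 2 - 2 * m * b) ≤ (46 / 100) / (79 / 100) := by
      gcongr
      nlinarith
    have e2 : 4 * (m * b ^ 2 + b ^ 3) * (b + m) / (1 - b ^ 2 - 2 * m * b) ^ 2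
        ≤ (484 / 10000) / (79 / 100) ^ 2 := by
      have : m * b ^ 2 + b ^ 3 ≤ 11 / 1000 := by
        have : b ^ 2 ≤ 1 / 100 := by nlinarith
        have : b ^ 3 ≤ 1 / 1000 := by nlinarith
        nlinarith
      have h0 : 0 ≤ m * b ^ 2 + b ^ 3 := by positivity
      gcongr
      nlinarith
    norm_num at e1 e2
    linarith
  linarith

lemma sigmaOne_one_pos_iff (h : Adm 1 a) :
    0 < sigmaOne 1 a ↔ 0 < 1 - 8 * a + 12 * a ^ 3 + 3 * a ^ 4 := by
  have h1 := loss_eq_one_sub h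
  rw [loss_eq h] at h1
  have hd := h.disc
  have h2 : sigmaOne 1 a = (1 - 8 * a + 12 * a ^ 3 + 3 * a ^ 4) / (1 - a ^ 2 - 2 * 1 * a) ^ 2 := by
    have : sigmaOne 1 a = 1 - (4 * 1 * a + 6 * a ^ 2) / (1 - a ^ 2 - 2 * 1 * a)
      - 4 * (1 * a ^ 2 + a ^ 3) * (a + 1) / (1 - a ^ 2 - 2 * 1 * a) ^ 2 := by linarith
    rw [this]
    have hd' := hd.ne'
    generalize hde : 1 - a ^ 2 - 2 * 1 * a = d at *
    field_simp
    rw [← hde]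
    ring
  rw [h2]
  constructor
  · intro h3
    by_contra h4
    exact absurd h3 (not_lt.2 (div_nonpos_of_nonpos_of_nonneg (not_lt.1 h4) (by positivity)))
  · intro h3
    positivity

lemma threshold_one : |threshold 1 - 0.128267| ≤ 0.0000005 := by
  rw [abs_sub_le_iff]
  have hlow : (0.1282665 : ℝ) ≤ threshold 1 := by
    refine le_csSup (bddAbove_thresholdSet 1) ⟨by norm_num, by norm_num, by norm_num, ?_⟩
    intro b ⟨hb0, hb1⟩
    rw [sigmaOne_one_pos_iff ⟨by norm_num, hb0, by linarith, by nlinarith⟩]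
    have h2 : b ^ 2 ≤ 0.0165 := by nlinarith
    have : 12 * b ^ 3 + 3 * b ^ 4 - 8 * b + 1 - (12 * 0.1282665 ^ 3 + 3 * 0.1282665 ^ 4
        - 8 * 0.1282665 + 1) = (0.1282665 - b) * (8 - 12 * (0.1282665 ^ 2 + 0.1282665 * b + b ^ 2)
        - 3 * (0.1282665 + b) * (0.1282665 ^ 2 + b ^ 2)) := by ring
    have h3 : 0 ≤ (0.1282665 - b) * (8 - 12 * (0.1282665 ^ 2 + 0.1282665 * b + b ^ 2)
        - 3 * (0.1282665 + b) * (0.1282665 ^ 2 + b ^ 2)) := by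
      refine mul_nonneg (by linarith) ?_
      nlinarith
    norm_num at this h3 ⊢
    linarith
  have hup : threshold 1 ≤ 0.1282675 := by
    refine csSup_le ⟨0, zero_mem_thresholdSet 1⟩ ?_
    intro a ⟨ha0, ha1, had, ha⟩
    by_contra h
    push Not at h
    have := ha 0.1282675 ⟨by norm_num, h.le⟩
    rw [sigmaOne_one_pos_iff ⟨by norm_num, by norm_num, by norm_num, by norm_num⟩] at this
    norm_num at this
  norm_num at *
  constructor <;> linarith

end

open Complex Filter Topology
open scoped SchwartzMap ComplexConjugate

section

variable {c : ℝ} {U V : ℝ → ℂ} {u v : ℝ → ℝ}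
open scoped SchwartzMap ContDiff

/-- The inverse Fourier transform `∫ U(ξ) e^{iξα} dξ`. -/
def ift (U : ℝ → ℂ) (α : ℝ) : ℂ := ∫ ξ : ℝ, U ξ * cexp (I * ξ * α)

lemma norm_cexp_I_mul (x y : ℝ) : ‖cexp (I * x * y)‖ = 1 := by
  rw [show I * (x : ℂ) * y = ((x * y : ℝ) : ℂ) * I by push_cast; ring]
  exact norm_exp_ofReal_mul_I _

lemma integrable_mul_cexp (hU : Integrable U) (α : ℝ) :
    Integrable fun ξ : ℝ => U ξ * cexp (I * ξ * α) := by
  refine hU.mul_bdd (c := 1) ?_ ?_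
  · exact (by fun_prop : Continuous fun ξ : ℝ => cexp (I * ξ * α)).aestronglyMeasurable
  · exact Eventually.of_forall fun ξ => (norm_cexp_I_mul ξ α).le

lemma norm_ift_le (U : ℝ → ℂ) (α : ℝ) : ‖ift U α‖ ≤ ∫ ξ, ‖U ξ‖ := by
  refine (norm_integral_le_integral_norm _).trans_eq ?_
  congr with ξ
  rw [norm_mul, norm_cexp_I_mul, mul_one]

lemma continuous_ift (hU : Integrable U) : Continuous (ift U) := by
  refine continuous_of_dominated (bound := fun ξ => ‖U ξ‖) ?_ ?_ hU.norm ?_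
  · exact fun α => (integrable_mul_cexp hU α).aestronglyMeasurable
  · exact fun α => Eventually.of_forall fun ξ => by rw [norm_mul, norm_cexp_I_mul, mul_one]
  · exact Eventually.of_forall fun ξ => by fun_prop

lemma ift_congr_ae (h : U =ᵐ[volume] V) (α : ℝ) : ift U α = ift V α := by
  refine integral_congr_ae ?_
  filter_upwards [h] with ξ hξ
  rw [hξ]

lemma ift_add (hU : Integrable U) (hV : Integrable V) (α : ℝ) :
    ift (fun ξ => U ξ + V ξ) α = ift U α + ift V α := by
  simp only [ift, add_mul]
  exact integral_add (integrable_mul_cexp hU α) (integrable_mul_cexp hV α)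

lemma ift_sub (hU : Integrable U) (hV : Integrable V) (α : ℝ) :
    ift (fun ξ => U ξ - V ξ) α = ift U α - ift V α := by
  simp only [ift, sub_mul]
  exact integral_sub (integrable_mul_cexp hU α) (integrable_mul_cexp hV α)

lemma ift_const_mul (c : ℂ) (U : ℝ → ℂ) (α : ℝ) :
    ift (fun ξ => c * U ξ) α = c * ift U α := by
  simp only [ift, mul_assoc]
  exact integral_const_mul _ _

lemma integral_mul_ift {φ : ℝ → ℂ} (hφ : Integrable φ) (hV : Integrable V) (c : ℝ) :
    ∫ α, φ α * ift V (c * α) = ∫ ξ, V ξ * ift φ (c * ξ) := by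
  have h1 : ∀ α, φ α * ift V (c * α) = ∫ ξ, φ α * V ξ * cexp (I * ξ * (c * α)) := by
    intro α
    rw [ift, ← integral_const_mul]
    congr with ξ
    push_cast
    ring
  have h2 : ∀ ξ, V ξ * ift φ (c * ξ) = ∫ α, φ α * V ξ * cexp (I * ξ * (c * α)) := by
    intro α
    rw [ift, ← integral_const_mul]
    congr with ξ
    push_cast
    ring_nf
  simp_rw [h1, h2]
  refine integral_integral_swap ?_
  refine (hφ.mul_prod hV).mul_bdd (c := 1) ?_ ?_
  · exact Continuous.aestronglyMeasurable (by fun_prop)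
  · refine Eventually.of_forall fun p => ?_
    have := norm_cexp_I_mul p.2 (c * p.1)
    push_cast at this
    exact this.le

lemma fourierInv_eq_ift (V : ℝ → ℂ) (α : ℝ) : 𝓕⁻ V α = ift V (2 * Real.pi * α) := by
  rw [Real.fourierInv_eq', ift]
  congr with ξ
  rw [smul_eq_mul, mul_comm]
  congr 2
  simp only [RCLike.inner_apply, conj_trivial]
  push_cast
  ring

lemma fourierInv_toLp_ae_eq (hV : Integrable V) (hV2 : MemLp V 2) :
    (𝓕⁻ (hV2.toLp V) : Lp (α := ℝ) ℂ 2 volume) =ᵐ[volume] fun x => ift V (2 * Real.pi * x) := by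
  refine ae_eq_of_integral_contDiff_smul_eq ?_ ?_ ?_
  · exact ((Lp.memLp _).locallyIntegrable (by norm_num))
  · exact ((continuous_ift hV).comp (by fun_prop)).locallyIntegrable
  intro g hg hgs
  have hgs' : HasCompactSupport fun x => (g x : ℂ) := hgs.comp_left (g := ofReal) ofReal_zero
  have hg' : ContDiff ℝ ∞ fun x => (g x : ℂ) := ofRealCLM.contDiff.comp hg
  let G : 𝓢(ℝ, ℂ) := hgs'.toSchwartzMap hg'
  have h1 : (𝓕⁻ (hV2.toLp V : 𝓢'(ℝ, ℂ))) G
      = ((𝓕⁻ (hV2.toLp V) : Lp (α := ℝ) ℂ 2 volume) : 𝓢'(ℝ, ℂ)) G := by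
    rw [Lp.fourierInv_toTemperedDistribution_eq]
  rw [TemperedDistribution.fourierInv_apply, Lp.toTemperedDistribution_apply,
    Lp.toTemperedDistribution_apply] at h1
  have h2 : ∫ x, g x • (𝓕⁻ (hV2.toLp V) : Lp (α := ℝ) ℂ 2 volume) x
      = ∫ x, G x • (𝓕⁻ (hV2.toLp V) : Lp (α := ℝ) ℂ 2 volume) x := by
    congr with x
  rw [h2, ← h1]
  have h3 : ∫ x, (𝓕⁻ G) x • (hV2.toLp V) x = ∫ ξ, V ξ * ift (fun x => (g x : ℂ)) (2 * Real.pi * ξ) := by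
    refine integral_congr_ae ?_
    filter_upwards [hV2.coeFn_toLp] with ξ hξ
    rw [hξ, SchwartzMap.fourierInv_coe, fourierInv_eq_ift, smul_eq_mul, mul_comm]
    rfl
  rw [h3, ← integral_mul_ift (hg'.continuous.integrable_of_hasCompactSupport hgs') hV]
  congr with x

/-- `U` rescaled to Mathlib's normalisation of the Fourier transform. -/
def rescale (U : ℝ → ℂ) (η : ℝ) : ℂ := 2 * Real.pi * U (2 * Real.pi * η)

lemma integrable_rescale (hU : Integrable U) : Integrable (rescale U) :=
  (hU.comp_mul_left' (by positivity)).const_mul _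

lemma memLp_comp_mul (hU : MemLp U 2) (hc : c ≠ 0) :
    MemLp (fun ξ => U (c * ξ)) 2 := by
  have hm : AEStronglyMeasurable (fun ξ => U (c * ξ)) volume :=
    hU.1.comp_quasiMeasurePreserving (Measure.quasiMeasurePreserving_smul volume hc)
  rw [memLp_two_iff_integrable_sq_norm hm]
  exact ((memLp_two_iff_integrable_sq_norm hU.1).1 hU).comp_mul_left' hc

lemma memLp_rescale (hU : MemLp U 2) : MemLp (rescale U) 2 :=
  (memLp_comp_mul hU (by positivity)).const_mul _

lemma ift_rescale (U : ℝ → ℂ) (α : ℝ) : ift (rescale U) (2 * Real.pi * α) = ift U α := by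
  have h := Measure.integral_comp_mul_left (fun ξ : ℝ => U ξ * cexp (I * ξ * α)) (2 * Real.pi)
  have hp : (2 * Real.pi : ℂ) ≠ 0 := by simp [Real.pi_ne_zero]
  rw [abs_of_pos (by positivity), real_smul] at h
  rw [ift, ift]
  simp only [rescale, mul_assoc (2 * Real.pi : ℂ)]
  rw [integral_const_mul]
  have h' : ∫ ξ : ℝ, U (2 * Real.pi * ξ) * cexp (I * ξ * ((2 * Real.pi * α : ℝ) : ℂ))
      = ∫ x : ℝ, (fun ξ : ℝ => U ξ * cexp (I * ξ * α)) (2 * Real.pi * x) := by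
    congr with ξ
    push_cast
    ring_nf
  rw [h', h]
  push_cast
  rw [← mul_assoc, mul_inv_cancel₀ hp, one_mul]

lemma memLp_ofReal (hu : MemLp u 2) : MemLp (fun x => (u x : ℂ)) 2 := hu.ofReal

lemma memLp_of_ofReal (hu : MemLp (fun x => (u x : ℂ)) 2) : MemLp u 2 := by
  simpa using hu.re

lemma fhat_eq (hu : MemLp (fun x => (u x : ℂ)) 2) (ξ : ℝ) :
    fhat u ξ = (2 * Real.pi : ℂ)⁻¹ *
      (𝓕 (hu.toLp (fun x => (u x : ℂ))) : Lp (α := ℝ) ℂ 2 volume) (ξ / (2 * Real.pi)) := by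
  rw [fhat, dif_pos hu]

lemma ae_comp_div {p : ℝ → Prop} (h : ∀ᵐ x, p x) (hc : c ≠ 0) : ∀ᵐ x : ℝ, p (x / c) := by
  have := (Measure.quasiMeasurePreserving_smul (volume : Measure ℝ) (inv_ne_zero hc)).ae h
  filter_upwards [this] with x hx
  rwa [div_eq_inv_mul]

lemma memLp_fhat (hu : MemLp u 2) : MemLp (fhat u) 2 := by
  have h : fhat u = fun ξ => (2 * Real.pi : ℂ)⁻¹ * (𝓕 ((memLp_ofReal hu).toLp (fun x => (u x : ℂ))) :
      Lp (α := ℝ) ℂ 2 volume) ((2 * Real.pi)⁻¹ * ξ) := by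
    ext ξ
    rw [fhat_eq (memLp_ofReal hu), div_eq_inv_mul]
  rw [h]
  exact (memLp_comp_mul (Lp.memLp _) (by positivity)).const_mul _

lemma integral_norm_sq_eq_norm_sq (f : Lp (α := ℝ) ℂ 2 volume) : ∫ x, ‖f x‖ ^ 2 = ‖f‖ ^ 2 := by
  have h := inner_self_eq_norm_sq (𝕜 := ℂ) f
  rw [L2.inner_def] at h
  rw [← h, ← integral_re (L2.integrable_inner f f)]
  congr with x
  rw [inner_self_eq_norm_sq]

/-- Plancherel's identity for `fhat`. -/
lemma integral_norm_sq_fhat (hu : MemLp u 2) :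
    ∫ ξ, ‖fhat u ξ‖ ^ 2 = (2 * Real.pi)⁻¹ * ∫ x, u x ^ 2 := by
  have hc := memLp_ofReal hu
  simp only [fhat_eq hc, norm_mul, mul_pow]
  rw [integral_const_mul, Measure.integral_comp_div (fun η =>
    ‖(𝓕 (hc.toLp (fun x => (u x : ℂ))) : Lp (α := ℝ) ℂ 2 volume) η‖ ^ 2),
    integral_norm_sq_eq_norm_sq, Lp.norm_fourier_eq, ← integral_norm_sq_eq_norm_sq]
  have h : ∫ x, ‖(hc.toLp (fun x => (u x : ℂ))) x‖ ^ 2 = ∫ x, u x ^ 2 := by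
    refine integral_congr_ae ?_
    filter_upwards [hc.coeFn_toLp] with x hx
    rw [hx, norm_real, Real.norm_eq_abs, sq_abs]
  rw [h, abs_of_pos (by positivity), smul_eq_mul, norm_inv]
  have : ‖(2 * Real.pi : ℂ)‖ = 2 * Real.pi := by
    rw [norm_mul, norm_real, Real.norm_eq_abs, abs_of_pos Real.pi_pos]; simp
  rw [this]
  field_simp

lemma fhat_congr_ae (h : u =ᵐ[volume] v) : fhat u = fhat v := by
  by_cases hu : MemLp (fun x => (u x : ℂ)) 2
  · have h' : (fun x => (u x : ℂ)) =ᵐ[volume] fun x => (v x : ℂ) := by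
      filter_upwards [h] with x hx
      rw [hx]
    have hv : MemLp (fun x => (v x : ℂ)) 2 := (memLp_congr_ae h').1 hu
    ext ξ
    rw [fhat_eq hu, fhat_eq hv, (MemLp.toLp_eq_toLp_iff hu hv).2 h']
  · have hv : ¬ MemLp (fun x => (v x : ℂ)) 2 := by
      rwa [← memLp_congr_ae (f := fun x => (u x : ℂ))]
      filter_upwards [h] with x hx
      rw [hx]
    ext ξ
    rw [fhat, fhat, dif_neg hu, dif_neg hv]

lemma fhat_lin (hu : MemLp u 2) (hv : MemLp v 2) (a b : ℝ) :
    fhat (fun x => a * u x + b * v x) =ᵐ[volume] fun ξ => a * fhat u ξ + b * fhat v ξ := by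
  have hw : MemLp (fun x => a * u x + b * v x) 2 := (hu.const_mul a).add (hv.const_mul b)
  have h1 : (memLp_ofReal hw).toLp (fun x => ((a * u x + b * v x : ℝ) : ℂ))
      = (a : ℂ) • (memLp_ofReal hu).toLp (fun x => (u x : ℂ))
        + (b : ℂ) • (memLp_ofReal hv).toLp (fun x => (v x : ℂ)) := by
    rw [← MemLp.toLp_const_smul, ← MemLp.toLp_const_smul, ← MemLp.toLp_add]
    rw [MemLp.toLp_eq_toLp_iff]
    refine Eventually.of_forall fun x => ?_
    simp
  have h2 : (𝓕 ((memLp_ofReal hw).toLp (fun x => ((a * u x + b * v x : ℝ) : ℂ))) :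
      Lp (α := ℝ) ℂ 2 volume) =ᵐ[volume] fun ξ =>
      (a : ℂ) * (𝓕 ((memLp_ofReal hu).toLp (fun x => (u x : ℂ))) : Lp (α := ℝ) ℂ 2 volume) ξ
      + (b : ℂ) * (𝓕 ((memLp_ofReal hv).toLp (fun x => (v x : ℂ))) : Lp (α := ℝ) ℂ 2 volume) ξ := by
    rw [h1, FourierTransform.fourier_add, FourierTransform.fourier_smul,
      FourierTransform.fourier_smul]
    filter_upwards [Lp.coeFn_add ((a : ℂ) • (𝓕 ((memLp_ofReal hu).toLp (fun x => (u x : ℂ))) : Lp (α := ℝ) ℂ 2 volume)) ((b : ℂ) • (𝓕 ((memLp_ofReal hv).toLp (fun x => (v x : ℂ))) : Lp (α := ℝ) ℂ 2 volume)),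
      Lp.coeFn_smul (a : ℂ) (𝓕 ((memLp_ofReal hu).toLp (fun x => (u x : ℂ))) : Lp (α := ℝ) ℂ 2 volume),
      Lp.coeFn_smul (b : ℂ) (𝓕 ((memLp_ofReal hv).toLp (fun x => (v x : ℂ))) : Lp (α := ℝ) ℂ 2 volume)]
      with ξ e1 e2 e3
    rw [e1, Pi.add_apply, e2, e3]
    rfl
  filter_upwards [ae_comp_div h2 (c := 2 * Real.pi) (by positivity)] with ξ hξ
  rw [fhat_eq (memLp_ofReal hw), fhat_eq (memLp_ofReal hu), fhat_eq (memLp_ofReal hv), hξ]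
  ring

/-- A real function given by an integrable, square integrable spectral density. -/
structure HasSpec (u : ℝ → ℝ) (U : ℝ → ℂ) : Prop where
  integrable : Integrable U
  memLp : MemLp U 2
  eq : ∀ α, (u α : ℂ) = ift U α

lemma HasSpec.toLp_eq (h : HasSpec u U) :
    (fun x => (u x : ℂ)) =ᵐ[volume]
      (𝓕⁻ ((memLp_rescale h.memLp).toLp (rescale U)) : Lp (α := ℝ) ℂ 2 volume) := by
  filter_upwards [fourierInv_toLp_ae_eq (integrable_rescale h.integrable) (memLp_rescale h.memLp)]
    with x hx
  rw [hx, ift_rescale, h.eq]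

lemma HasSpec.memLp_fun (h : HasSpec u U) : MemLp u 2 :=
  memLp_of_ofReal ((memLp_congr_ae h.toLp_eq).2 (Lp.memLp _))

lemma HasSpec.fhat_ae_eq (h : HasSpec u U) : fhat u =ᵐ[volume] U := by
  have hc := memLp_ofReal h.memLp_fun
  have h1 : hc.toLp (fun x => (u x : ℂ))
      = 𝓕⁻ ((memLp_rescale h.memLp).toLp (rescale U)) := by
    refine Lp.ext ?_
    filter_upwards [hc.coeFn_toLp, h.toLp_eq] with x h1 h2
    rw [h1, h2]
  have h2 : (𝓕 (hc.toLp (fun x => (u x : ℂ))) : Lp (α := ℝ) ℂ 2 volume)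
      = (memLp_rescale h.memLp).toLp (rescale U) := by
    rw [h1, FourierTransform.fourier_fourierInv_eq]
  have h3 := (memLp_rescale h.memLp).coeFn_toLp
  filter_upwards [ae_comp_div h3 (c := 2 * Real.pi) (by positivity)] with ξ hξ
  have hp : (2 * Real.pi : ℂ) ≠ 0 := by simp [Real.pi_ne_zero]
  rw [fhat_eq hc, h2, hξ, rescale, ← mul_assoc, inv_mul_cancel₀ hp, one_mul]
  congr 1
  field_simp

lemma HasSpec.continuous (h : HasSpec u U) : Continuous u := by
  have : u = fun α => (ift U α).re := by
    ext α
    rw [← h.eq, ofReal_re]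
  rw [this]
  exact continuous_re.comp (continuous_ift h.integrable)

/-- Fourier inversion for `L²` functions with integrable transform. -/
lemma ae_eq_ift_fhat (hu : MemLp u 2) (hi : Integrable (fhat u)) :
    (fun x => (u x : ℂ)) =ᵐ[volume] ift (fhat u) := by
  have hc := memLp_ofReal hu
  have hp : (2 * Real.pi : ℂ) ≠ 0 := by simp [Real.pi_ne_zero]
  have h1 : (memLp_rescale (memLp_fhat hu)).toLp (rescale (fhat u))
      = 𝓕 (hc.toLp (fun x => (u x : ℂ))) := by
    refine Lp.ext ?_
    filter_upwards [(memLp_rescale (memLp_fhat hu)).coeFn_toLp] with x h1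
    rw [h1, rescale, fhat_eq hc, ← mul_assoc, mul_inv_cancel₀ hp, one_mul]
    congr 1
    field_simp
  have h2 := fourierInv_toLp_ae_eq (integrable_rescale hi) (memLp_rescale (memLp_fhat hu))
  rw [h1, FourierTransform.fourierInv_fourier_eq] at h2
  filter_upwards [h2, hc.coeFn_toLp] with x h3 h4
  rw [← h4, h3, ift_rescale]

lemma hasSpec_fhat (hc : Continuous u) (hu : MemLp u 2) (hi : Integrable (fhat u)) :
    HasSpec u (fhat u) := by
  refine ⟨hi, memLp_fhat hu, fun α => ?_⟩
  have := Continuous.ae_eq_iff_eq (μ := (volume : Measure ℝ)) (continuous_ofReal.comp hc)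
    (continuous_ift hi)
  exact congrFun (this.1 (ae_eq_ift_fhat hu hi)) α

/-- Parseval's identity against a Schwartz function. -/
lemma exists_schwartz_dilate (φ : 𝓢(ℝ, ℂ)) : ∃ ψ : 𝓢(ℝ, ℂ), (∀ x, ψ x = φ (2 * Real.pi * x)) ∧
    ∀ α, (𝓕 ψ) α = (2 * Real.pi : ℂ)⁻¹ * ift φ (-α) := by
  let e : ℝ ≃L[ℝ] ℝ := ContinuousLinearEquiv.unitsEquivAut ℝ (Units.mk0 (2 * Real.pi) (by positivity))
  have he : ∀ x, e x = x * (2 * Real.pi) := fun x => rfl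
  let ψ : 𝓢(ℝ, ℂ) := SchwartzMap.compCLMOfContinuousLinearEquiv ℂ e φ
  have hψ : ∀ x, ψ x = φ (2 * Real.pi * x) := fun x => by
    change φ (e x) = _
    rw [he, mul_comm]
  refine ⟨ψ, hψ, fun α => ?_⟩
  have hr : ift (rescale φ) (2 * Real.pi * (-α)) = ift φ (-α) := ift_rescale _ _
  have hr' : rescale φ = fun ξ => (2 * Real.pi : ℂ) * ψ ξ := by
    ext ξ
    rw [rescale, hψ]
  have hp : (2 * Real.pi : ℂ) ≠ 0 := by simp [Real.pi_ne_zero]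
  rw [← hr, hr', ift_const_mul, ← mul_assoc, inv_mul_cancel₀ hp, one_mul, ← fourierInv_eq_ift,
    Real.fourierInv_eq_fourier_neg, neg_neg]
  rfl

lemma exists_schwartz_ift_neg (φ : 𝓢(ℝ, ℂ)) :
    ∃ ψ : 𝓢(ℝ, ℂ), (∀ α, ψ α = ift φ (-α)) ∧ ∀ ξ, ift ψ ξ = 2 * Real.pi * φ ξ := by
  have hp : (2 * Real.pi : ℂ) ≠ 0 := by simp [Real.pi_ne_zero]
  obtain ⟨χ, hχ, h2⟩ := exists_schwartz_dilate φ
  refine ⟨(2 * Real.pi : ℂ) • 𝓕 χ, fun α => ?_, fun ξ => ?_⟩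
  · rw [smul_apply, h2, smul_eq_mul, mul_inv_cancel_left₀ hp]
  · have h4 : ift ((2 * Real.pi : ℂ) • 𝓕 χ : 𝓢(ℝ, ℂ)) ξ = 2 * Real.pi * ift (𝓕 χ : 𝓢(ℝ, ℂ)) ξ := by
      rw [← ift_const_mul]; rfl
    have h5 : ift (𝓕 χ : 𝓢(ℝ, ℂ)) ξ = χ (ξ / (2 * Real.pi)) := by
      have h6 := fourierInv_eq_ift (𝓕 χ : 𝓢(ℝ, ℂ)) (ξ / (2 * Real.pi))
      rw [show 2 * Real.pi * (ξ / (2 * Real.pi)) = ξ by field_simp] at h6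
      rw [← h6, ← SchwartzMap.fourierInv_coe, FourierTransform.fourierInv_fourier_eq]
    rw [h4, h5, hχ, show 2 * Real.pi * (ξ / (2 * Real.pi)) = ξ by field_simp]

lemma integral_mul_fhat (hu : MemLp u 2) (φ : 𝓢(ℝ, ℂ)) :
    ∫ ξ, φ ξ * fhat u ξ = (2 * Real.pi : ℂ)⁻¹ * ∫ α, ift φ (-α) * u α := by
  have hc := memLp_ofReal hu
  obtain ⟨ψ, hψ, h2⟩ := exists_schwartz_dilate φ
  have h1 : (𝓕 (hc.toLp (fun x => (u x : ℂ)) : 𝓢'(ℝ, ℂ))) ψ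
      = ((𝓕 (hc.toLp (fun x => (u x : ℂ))) : Lp (α := ℝ) ℂ 2 volume) : 𝓢'(ℝ, ℂ)) ψ := by
    rw [Lp.fourier_toTemperedDistribution_eq]
  rw [TemperedDistribution.fourier_apply, Lp.toTemperedDistribution_apply,
    Lp.toTemperedDistribution_apply] at h1
  have h3 : ∫ ξ, φ ξ * fhat u ξ = ∫ x, ψ x • (𝓕 (hc.toLp (fun x => (u x : ℂ))) :
      Lp (α := ℝ) ℂ 2 volume) x := by
    have := Measure.integral_comp_div (fun x => ψ x • (𝓕 (hc.toLp (fun x => (u x : ℂ))) :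
      Lp (α := ℝ) ℂ 2 volume) x) (2 * Real.pi)
    rw [abs_of_pos (by positivity), real_smul] at this
    have hp : (2 * Real.pi : ℂ) ≠ 0 := by simp [Real.pi_ne_zero]
    have h4 : ∫ ξ, φ ξ * fhat u ξ = (2 * Real.pi : ℂ)⁻¹ * ∫ x, ψ (x / (2 * Real.pi)) •
        (𝓕 (hc.toLp (fun x => (u x : ℂ))) : Lp (α := ℝ) ℂ 2 volume) (x / (2 * Real.pi)) := by
      rw [← integral_const_mul]
      congr with ξ
      rw [fhat_eq hc, hψ, smul_eq_mul, show 2 * Real.pi * (ξ / (2 * Real.pi)) = ξ by field_simp]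
      ring
    rw [h4, this]
    push_cast
    rw [← mul_assoc, inv_mul_cancel₀ hp, one_mul]
  rw [h3, ← h1, ← integral_const_mul]
  refine integral_congr_ae ?_
  filter_upwards [hc.coeFn_toLp] with x hx
  rw [hx, h2, smul_eq_mul]
  ring

end

section

variable {C L S : ℝ} {K U V s : ℝ → ℂ}
open scoped SchwartzMap ContDiff ComplexConjugate

/-- The `L²` norm of a complex function on the line. -/
def l2 (U : ℝ → ℂ) : ℝ := √(∫ ξ, ‖U ξ‖ ^ 2)

lemma l2_nonneg (U : ℝ → ℂ) : 0 ≤ l2 U := Real.sqrt_nonneg _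

lemma l2_sq (U : ℝ → ℂ) : l2 U ^ 2 = ∫ ξ, ‖U ξ‖ ^ 2 :=
  Real.sq_sqrt (integral_nonneg fun _ => by positivity)

lemma integrable_sq (hU : MemLp U 2) : Integrable fun ξ => ‖U ξ‖ ^ 2 :=
  (memLp_two_iff_integrable_sq_norm hU.1).1 hU

lemma integrable_norm_mul (hU : MemLp U 2) (hV : MemLp V 2) :
    Integrable fun ξ => ‖U ξ‖ * ‖V ξ‖ := hU.norm.integrable_mul hV.norm

lemma integral_norm_mul_le (hU : MemLp U 2) (hV : MemLp V 2) :
    ∫ ξ, ‖U ξ‖ * ‖V ξ‖ ≤ l2 U * l2 V := by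
  have h := integral_mul_le_Lp_mul_Lq_of_nonneg (μ := (volume : Measure ℝ)) Real.HolderConjugate.two_two
    (f := fun ξ => ‖U ξ‖) (g := fun ξ => ‖V ξ‖) (Eventually.of_forall fun _ => norm_nonneg _)
    (Eventually.of_forall fun _ => norm_nonneg _) (by simpa using hU.norm) (by simpa using hV.norm)
  refine h.trans_eq ?_
  simp only [Real.rpow_ofNat, l2, Real.sqrt_eq_rpow]

/-- Smooth compactly supported approximation of a bounded function with bounded support. -/
lemma exists_smooth_approx (hs : Measurable s) (hb : ∀ ξ, ‖s ξ‖ ≤ S)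
    (hL : ∀ ξ, L < |ξ| → s ξ = 0) :
    ∃ φ : ℕ → 𝓢(ℝ, ℂ), (∀ n ξ, ‖φ n ξ‖ ≤ S) ∧ (∀ n ξ, L + 1 < |ξ| → φ n ξ = 0) ∧
      ∀ᵐ ξ, Tendsto (fun n => φ n ξ) atTop (𝓝 (s ξ)) := by
  let b : ℕ → ContDiffBump (0 : ℝ) := fun n =>
    ⟨1 / (2 * (n + 1)), 1 / (n + 1), by positivity, by
      rw [one_div_lt_one_div (by positivity) (by positivity)]
      have : (0 : ℝ) ≤ n := Nat.cast_nonneg n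
      linarith⟩
  have hloc : LocallyIntegrable s := by
    rw [locallyIntegrable_iff]
    intro K hK
    exact Measure.integrableOn_of_bounded hK.measure_lt_top.ne hs.aestronglyMeasurable
      (Eventually.of_forall hb)
  let c : ℕ → ℝ → ℂ := fun n => convolution ((b n).normed volume) s (ContinuousLinearMap.lsmul ℝ ℝ) volume
  have hc1 : ∀ n, ContDiff ℝ ∞ (c n) := fun n =>
    (b n).hasCompactSupport_normed.contDiff_convolution_left _ (b n).contDiff_normed hloc
  have hr : ∀ n, (b n).rOut ≤ 1 := fun n => by
    change 1 / ((n : ℝ) + 1) ≤ 1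
    rw [div_le_one (by positivity)]
    have : (0 : ℝ) ≤ n := Nat.cast_nonneg n
    linarith
  have hc0 : ∀ n ξ, L + 1 < |ξ| → c n ξ = 0 := by
    intro n ξ hξ
    change ∫ t, (b n).normed volume t • s (ξ - t) = 0
    refine integral_eq_zero_of_ae (Eventually.of_forall fun t => ?_)
    by_cases ht : t ∈ Metric.ball (0 : ℝ) (b n).rOut
    · have h1 : |t| < 1 := by
        rw [Metric.mem_ball, dist_zero_right, Real.norm_eq_abs] at ht
        linarith [hr n]
      have h2 : L < |ξ - t| := by linarith [abs_sub_abs_le_abs_sub ξ t]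
      simp [hL _ h2]
    · have : t ∉ Function.support ((b n).normed volume) := by rwa [(b n).support_normed_eq]
      simp [Function.notMem_support.1 this]
  have hsupp : ∀ n, HasCompactSupport (c n) := fun n =>
    HasCompactSupport.of_support_subset_isCompact (K := Icc (-(L + 1)) (L + 1)) isCompact_Icc
      (fun ξ hξ => by
        by_contra h
        refine hξ (hc0 n ξ ?_)
        by_contra h'
        exact h (abs_le.1 (not_lt.1 h')))
  refine ⟨fun n => (hsupp n).toSchwartzMap (hc1 n), fun n ξ => ?_, hc0, ?_⟩
  · change ‖∫ t, (b n).normed volume t • s (ξ - t)‖ ≤ S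
    have h1 : ∀ t, ‖(b n).normed volume t • s (ξ - t)‖ ≤ (b n).normed volume t * S := fun t => by
      rw [norm_smul, Real.norm_of_nonneg ((b n).nonneg_normed t)]
      exact mul_le_mul_of_nonneg_left (hb _) ((b n).nonneg_normed t)
    refine (norm_integral_le_of_norm_le ((b n).integrable_normed.mul_const S)
      (Eventually.of_forall h1)).trans_eq ?_
    rw [integral_mul_const, (b n).integral_normed, one_mul]
  · refine ContDiffBump.ae_convolution_tendsto_right_of_locallyIntegrable (K := 2) ?_ ?_ hloc
    · exact tendsto_one_div_add_atTop_nhds_zero_nat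
    · refine Eventually.of_forall fun n => ?_
      change 1 / ((n : ℝ) + 1) ≤ 2 * (1 / (2 * (n + 1)))
      rw [mul_one_div, mul_comm (2 : ℝ), ← div_div]
      field_simp
      rfl

lemma tendsto_integral_smooth_approx (hK : LocallyIntegrable K)
    {φ : ℕ → 𝓢(ℝ, ℂ)} (h1 : ∀ n ξ, ‖φ n ξ‖ ≤ S) (h2 : ∀ n ξ, L + 1 < |ξ| → φ n ξ = 0)
    (h3 : ∀ᵐ ξ, Tendsto (fun n => φ n ξ) atTop (𝓝 (s ξ))) :
    Tendsto (fun n => ∫ ξ, φ n ξ * K ξ) atTop (𝓝 (∫ ξ, s ξ * K ξ)) := by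
  have hS : 0 ≤ S := (norm_nonneg _).trans (h1 0 0)
  refine tendsto_integral_of_dominated_convergence
    (bound := fun ξ => S * (Icc (-(L + 1)) (L + 1)).indicator (fun ξ => ‖K ξ‖) ξ) ?_ ?_ ?_ ?_
  · exact fun n => (φ n).continuous.aestronglyMeasurable.mul hK.aestronglyMeasurable
  · exact ((integrable_indicator_iff measurableSet_Icc).2
      (hK.integrableOn_isCompact isCompact_Icc).norm).const_mul S
  · refine fun n => Eventually.of_forall fun ξ => ?_
    by_cases h : ξ ∈ Icc (-(L + 1)) (L + 1)
    · rw [indicator_of_mem h, norm_mul]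
      exact mul_le_mul_of_nonneg_right (h1 n ξ) (norm_nonneg _)
    · rw [h2 n ξ (by
        by_contra h'
        exact h (abs_le.1 (not_lt.1 h')))]
      rw [indicator_of_notMem h]
      simp
  · filter_upwards [h3] with ξ hξ
    exact hξ.mul_const _

lemma lintegral_Icc_le_of_dual (hK : LocallyIntegrable K)
    (h : ∀ (φ : 𝓢(ℝ, ℂ)) (S : ℝ), (∀ ξ, ‖φ ξ‖ ≤ S) → (∀ ξ, L + 1 < |ξ| → φ ξ = 0) →
      ‖∫ ξ, φ ξ * K ξ‖ ≤ C * S) :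
    ∫⁻ ξ in Icc (-L) L, ‖K ξ‖ₑ ≤ ENNReal.ofReal C := by
  have hKm := hK.aestronglyMeasurable
  let s : ℝ → ℂ := (Icc (-L) L).indicator fun ξ => conj (hKm.mk K ξ) / ‖hKm.mk K ξ‖
  have hsm : Measurable s := by
    refine Measurable.indicator ?_ measurableSet_Icc
    have := hKm.stronglyMeasurable_mk.measurable
    exact (continuous_conj.measurable.comp this).div (measurable_ofReal.comp this.norm)
  have hsb : ∀ ξ, ‖s ξ‖ ≤ 1 := fun ξ => by
    refine (norm_indicator_le_norm_self _ _).trans ?_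
    rw [norm_div, norm_conj, norm_real, norm_norm]
    exact div_self_le_one _
  obtain ⟨φ, h1, h2, h3⟩ := exists_smooth_approx hsm (L := L) hsb (fun ξ hξ => by
    refine indicator_of_notMem (fun h' => ?_) _
    exact absurd (abs_le.2 h') (not_le.2 hξ))
  have h4 := tendsto_integral_smooth_approx hK h1 h2 h3
  have h5 : ‖∫ ξ, s ξ * K ξ‖ ≤ C := by
    refine le_of_tendsto h4.norm (Eventually.of_forall fun n => ?_)
    simpa using h (φ n) 1 (h1 n) (h2 n)
  have h6 : ∫ ξ, s ξ * K ξ = ((∫ ξ in Icc (-L) L, ‖K ξ‖ : ℝ) : ℂ) := by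
    rw [← integral_complex_ofReal, ← integral_indicator measurableSet_Icc]
    refine integral_congr_ae ?_
    filter_upwards [hKm.ae_eq_mk] with ξ hξ
    by_cases hm : ξ ∈ Icc (-L) L
    · simp only [s, indicator_of_mem hm]
      rw [← hξ]
      by_cases h0 : K ξ = 0
      · simp [h0]
      · have : (‖K ξ‖ : ℂ) ≠ 0 := by simpa using h0
        rw [div_mul_eq_mul_div, mul_comm, mul_conj, normSq_eq_norm_sq]
        push_cast
        field_simp
    · simp [s, indicator_of_notMem hm]
  have hi : IntegrableOn K (Icc (-L) L) := hK.integrableOn_isCompact isCompact_Icc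
  rw [← ofReal_integral_norm_eq_lintegral_enorm hi]
  refine ENNReal.ofReal_le_ofReal ?_
  rw [h6, norm_real] at h5
  exact (le_abs_self _).trans h5

lemma lintegral_le_of_forall_Icc {F : ℝ → ℝ≥0∞} {c : ℝ≥0∞}
    (h : ∀ n : ℕ, ∫⁻ ξ in Icc (-(n : ℝ)) n, F ξ ≤ c) : ∫⁻ ξ, F ξ ≤ c := by
  have hm : Monotone fun n : ℕ => Icc (-(n : ℝ)) n := fun a b hab => by
    have : (a : ℝ) ≤ b := Nat.cast_le.2 hab
    exact Icc_subset_Icc (by linarith) this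
  have hU : ⋃ n : ℕ, Icc (-(n : ℝ)) n = univ := by
    refine eq_univ_of_forall fun x => mem_iUnion.2 ?_
    obtain ⟨n, hn⟩ := exists_nat_ge |x|
    exact ⟨n, abs_le.1 hn⟩
  rw [← setLIntegral_univ, ← hU, setLIntegral_iUnion_of_directed _ (directed_of_isDirected_le hm)]
  exact iSup_le h

/-- `‖K‖_{L¹} ≤ C` if `K` is bounded by `C` against smooth functions in the sup norm. -/
lemma lintegral_le_of_dual (hK : LocallyIntegrable K)
    (h : ∀ (φ : 𝓢(ℝ, ℂ)) (S : ℝ), (∀ ξ, ‖φ ξ‖ ≤ S) → ‖∫ ξ, φ ξ * K ξ‖ ≤ C * S) :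
    ∫⁻ ξ, ‖K ξ‖ₑ ≤ ENNReal.ofReal C :=
  lintegral_le_of_forall_Icc fun _ =>
    lintegral_Icc_le_of_dual hK fun φ S hS _ => h φ S hS

/-- `‖K‖_{L²} ≤ C` if `K` is bounded by `C` against smooth functions in the `L²` norm. -/
lemma lintegral_sq_le_of_dual (hK : LocallyIntegrable K)
    (h : ∀ φ : 𝓢(ℝ, ℂ), ‖∫ ξ, φ ξ * K ξ‖ ≤ C * l2 φ) :
    ∫⁻ ξ, ‖K ξ‖ₑ ^ 2 ≤ ENNReal.ofReal (C ^ 2) := by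
  have hKm := hK.aestronglyMeasurable
  have hK' := hKm.stronglyMeasurable_mk.measurable
  have key : ∀ n : ℕ, ∫⁻ ξ in Icc (-(n : ℝ)) n ∩ {ξ | ‖hKm.mk K ξ‖ ≤ n}, ‖K ξ‖ₑ ^ 2
      ≤ ENNReal.ofReal (C ^ 2) := by
    intro n
    set A : Set ℝ := Icc (-(n : ℝ)) n ∩ {ξ | ‖hKm.mk K ξ‖ ≤ n} with hA
    have hAm : MeasurableSet A := measurableSet_Icc.inter (measurableSet_le hK'.norm measurable_const)
    let s : ℝ → ℂ := A.indicator fun ξ => conj (hKm.mk K ξ)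
    have hsm : Measurable s := (continuous_conj.measurable.comp hK').indicator hAm
    have hsb : ∀ ξ, ‖s ξ‖ ≤ n := fun ξ => by
      by_cases hξ : ξ ∈ A
      · simp only [s, indicator_of_mem hξ, norm_conj]
        exact hξ.2
      · simp [s, indicator_of_notMem hξ]
    have hs0 : ∀ ξ, (n : ℝ) < |ξ| → s ξ = 0 := fun ξ hξ => by
      refine indicator_of_notMem (fun h' => ?_) _
      exact absurd (abs_le.2 h'.1) (not_le.2 hξ)
    obtain ⟨φ, h1, h2, h3⟩ := exists_smooth_approx hsm hsb hs0
    have h4 := tendsto_integral_smooth_approx hK h1 h2 h3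
    have h5 : Tendsto (fun k => ∫ ξ, ‖φ k ξ‖ ^ 2) atTop (𝓝 (∫ ξ, ‖s ξ‖ ^ 2)) := by
      refine tendsto_integral_of_dominated_convergence
        (bound := (Icc (-((n : ℝ) + 1)) (n + 1)).indicator fun _ => (n : ℝ) ^ 2) ?_ ?_ ?_ ?_
      · exact fun k => ((φ k).continuous.norm.pow 2).aestronglyMeasurable
      · exact (integrableOn_const (by simp)).integrable_indicator measurableSet_Icc
      · refine fun k => Eventually.of_forall fun ξ => ?_
        rw [norm_pow, norm_norm]
        by_cases hξ : ξ ∈ Icc (-((n : ℝ) + 1)) (n + 1)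
        · rw [indicator_of_mem hξ]
          exact pow_le_pow_left₀ (norm_nonneg _) (h1 k ξ) 2
        · rw [indicator_of_notMem hξ, h2 k ξ (by
            by_contra h'
            exact hξ (abs_le.1 (not_lt.1 h')))]
          simp
      · filter_upwards [h3] with ξ hξ
        exact hξ.norm.pow 2
    set J : ℝ := ∫ ξ, ‖s ξ‖ ^ 2 with hJ
    have hJ0 : 0 ≤ J := integral_nonneg fun _ => by positivity
    have h6 : ∫ ξ, s ξ * K ξ = (J : ℂ) := by
      rw [hJ, ← integral_complex_ofReal]
      refine integral_congr_ae ?_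
      filter_upwards [hKm.ae_eq_mk] with ξ hξ
      by_cases hm : ξ ∈ A
      · simp only [s, indicator_of_mem hm]
        rw [← hξ, mul_comm, mul_conj, normSq_eq_norm_sq, norm_conj]
      · simp [s, indicator_of_notMem hm]
    have h7 : J ≤ C * √J := by
      have := le_of_tendsto_of_tendsto' h4.norm ((h5.sqrt).const_mul C) (fun k => h (φ k))
      rw [h6, norm_real] at this
      exact (le_abs_self _).trans this
    have h8 : J ≤ C ^ 2 := by
      have hs := Real.sq_sqrt hJ0
      have hs0 := Real.sqrt_nonneg J
      rcases hs0.eq_or_lt with h0 | h0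
      · rw [← h0] at hs
        nlinarith [sq_nonneg C]
      · have : √J ≤ C := by
          by_contra hc
          push Not at hc
          nlinarith
        nlinarith
    have h9 : ∫⁻ ξ in A, ‖K ξ‖ₑ ^ 2 = ENNReal.ofReal J := by
      have hi : Integrable fun ξ => ‖s ξ‖ ^ 2 := by
        refine Measure.integrableOn_of_bounded (s := Icc (-(n : ℝ)) n) (M := (n : ℝ) ^ 2)
          (by simp) (hsm.norm.pow_const 2).aestronglyMeasurable
          (Eventually.of_forall fun ξ => ?_) |>.integrable_of_forall_notMem_eq_zero fun ξ hξ => ?_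
        · rw [norm_pow, norm_norm]
          exact pow_le_pow_left₀ (norm_nonneg _) (hsb ξ) 2
        · rw [hs0 ξ (by
            by_contra h'
            exact hξ (abs_le.1 (not_lt.1 h')))]
          simp
      rw [hJ, ofReal_integral_eq_lintegral_ofReal hi (Eventually.of_forall fun _ => by positivity),
        ← lintegral_indicator hAm]
      refine lintegral_congr_ae ?_
      filter_upwards [hKm.ae_eq_mk] with ξ hξ
      by_cases hm : ξ ∈ A
      · simp only [s, indicator_of_mem hm, norm_conj]
        rw [← hξ, ENNReal.ofReal_pow (norm_nonneg _), ofReal_norm]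
      · simp [s, indicator_of_notMem hm]
    rw [h9]
    exact ENNReal.ofReal_le_ofReal h8
  have hmono : Monotone fun n : ℕ => Icc (-(n : ℝ)) n ∩ {ξ | ‖hKm.mk K ξ‖ ≤ n} := fun a b hab => by
    have hab' : (a : ℝ) ≤ b := Nat.cast_le.2 hab
    exact inter_subset_inter (Icc_subset_Icc (by linarith) hab') fun ξ hξ => le_trans hξ hab'
  have hU : ⋃ n : ℕ, Icc (-(n : ℝ)) n ∩ {ξ | ‖hKm.mk K ξ‖ ≤ n} = univ := by
    refine eq_univ_of_forall fun x => mem_iUnion.2 ?_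
    obtain ⟨n, hn⟩ := exists_nat_ge (max |x| ‖hKm.mk K x‖)
    exact ⟨n, abs_le.1 ((le_max_left _ _).trans hn), (le_max_right _ _).trans hn⟩
  rw [← setLIntegral_univ, ← hU, setLIntegral_iUnion_of_directed _ (directed_of_isDirected_le hmono)]
  exact iSup_le key

end

section

variable {C D S β ε : ℝ} {G H V : ℝ × ℝ → ℂ} {u : ℝ → ℂ}

/-- The character `e^{i(ζα+ωβ)}` of the plane. -/
def chi (ζ ω : ℝ) (p : ℝ × ℝ) : ℂ := cexp (I * (ζ * p.1 + ω * p.2))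

lemma norm_chi (ζ ω : ℝ) (p : ℝ × ℝ) : ‖chi ζ ω p‖ = 1 := by
  rw [chi, show I * ((ζ : ℂ) * p.1 + ω * p.2) = ((ζ * p.1 + ω * p.2 : ℝ) : ℂ) * I by
    push_cast; ring]
  exact norm_exp_ofReal_mul_I _

lemma continuous_chi (ζ ω : ℝ) : Continuous (chi ζ ω) := by unfold chi; fun_prop

lemma chi_mul (ζ ω ζ' ω' : ℝ) (p : ℝ × ℝ) :
    chi ζ ω p * chi ζ' ω' p = chi (ζ + ζ') (ω + ω') p := by
  rw [chi, chi, chi, ← Complex.exp_add]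
  congr 1
  push_cast
  ring

/-- `G` belongs to the Fourier–Stieltjes algebra of the plane with norm at most `C`, expressed by
duality. -/
structure BB (G : ℝ × ℝ → ℂ) (C : ℝ) : Prop where
  meas : Measurable G
  bdd : ∀ p, ‖G p‖ ≤ C
  dual : ∀ V : ℝ × ℝ → ℂ, Integrable V → ∀ S : ℝ, (∀ ζ ω, ‖∫ p, V p * chi ζ ω p‖ ≤ S) →
    ‖∫ p, V p * G p‖ ≤ C * S

lemma BB.nonneg (h : BB G C) : 0 ≤ C := (norm_nonneg _).trans (h.bdd 0)

lemma integrable_mul_chi (hV : Integrable V) (ζ ω : ℝ) :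
    Integrable fun p => V p * chi ζ ω p :=
  hV.mul_bdd (c := 1) (continuous_chi ζ ω).aestronglyMeasurable
    (Eventually.of_forall fun p => (norm_chi ζ ω p).le)

lemma BB.integrable (h : BB G C) (hV : Integrable V) :
    Integrable fun p => V p * G p :=
  hV.mul_bdd (c := C) h.meas.aestronglyMeasurable (Eventually.of_forall h.bdd)

lemma nonneg_of_dual_bound (h : ∀ ζ ω, ‖∫ p, V p * chi ζ ω p‖ ≤ S) :
    0 ≤ S := (norm_nonneg _).trans (h 0 0)

lemma BB.mono (h : BB G C) (hCD : C ≤ D) : BB G D :=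
  ⟨h.meas, fun p => (h.bdd p).trans hCD, fun V hV S hS => (h.dual V hV S hS).trans
    (mul_le_mul_of_nonneg_right hCD (nonneg_of_dual_bound hS))⟩

lemma BB.mul (hG : BB G C) (hH : BB H D) :
    BB (fun p => G p * H p) (C * D) := by
  refine ⟨hG.meas.mul hH.meas, fun p => ?_, fun V hV S hS => ?_⟩
  · rw [norm_mul]
    exact mul_le_mul (hG.bdd p) (hH.bdd p) (norm_nonneg _) hG.nonneg
  · have h1 : ∀ ζ ω, ‖∫ p, (V p * G p) * chi ζ ω p‖ ≤ C * S := by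
      intro ζ ω
      have h2 := hG.dual (fun p => V p * chi ζ ω p) (integrable_mul_chi hV ζ ω) S (fun ζ' ω' => by
        simp only [mul_assoc, chi_mul]
        exact hS _ _)
      refine le_of_eq_of_le ?_ h2
      congr 1
      congr with p
      ring
    have h3 := hH.dual (fun p => V p * G p) (hG.integrable hV) (C * S) h1
    simp only [← mul_assoc]
    refine h3.trans_eq (by ring)

lemma BB.add (hG : BB G C) (hH : BB H D) :
    BB (fun p => G p + H p) (C + D) := by
  refine ⟨hG.meas.add hH.meas, fun p => ?_, fun V hV S hS => ?_⟩
  · exact (norm_add_le _ _).trans (add_le_add (hG.bdd p) (hH.bdd p))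
  · simp only [mul_add]
    rw [integral_add (hG.integrable hV) (hH.integrable hV), add_mul]
    exact (norm_add_le _ _).trans (add_le_add (hG.dual V hV S hS) (hH.dual V hV S hS))

lemma BB.const (c : ℂ) : BB (fun _ => c) ‖c‖ := by
  refine ⟨measurable_const, fun _ => le_rfl, fun V hV S hS => ?_⟩
  rw [integral_mul_const, norm_mul, mul_comm]
  refine mul_le_mul_of_nonneg_left ?_ (norm_nonneg _)
  have := hS 0 0
  simpa [chi] using this

lemma BB.const_mul (c : ℂ) (hG : BB G C) :
    BB (fun p => c * G p) (‖c‖ * C) := (BB.const c).mul hG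

lemma BB.neg (hG : BB G C) : BB (fun p => -G p) C := by
  have := hG.const_mul (-1)
  simpa using this

lemma BB.sub (hG : BB G C) (hH : BB H D) :
    BB (fun p => G p - H p) (C + D) := by
  have := hG.add hH.neg
  simpa [sub_eq_add_neg] using this

lemma BB.pow (hG : BB G C) (n : ℕ) : BB (fun p => G p ^ n) (C ^ n) := by
  induction n with
  | zero => simpa using BB.const 1
  | succ n ih => simpa only [pow_succ] using ih.mul hG

lemma BB.of_tendsto {G : ℕ → ℝ × ℝ → ℂ} (hG : ∀ n, BB (G n) C)
    (h : ∀ p, Tendsto (fun n => G n p) atTop (𝓝 (H p))) : BB H C := by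
  refine ⟨measurable_of_tendsto_metrizable (fun n => (hG n).meas) (tendsto_pi_nhds.2 h), fun p => ?_,
    fun V hV S hS => ?_⟩
  · exact le_of_tendsto (h p).norm (Eventually.of_forall fun n => (hG n).bdd p)
  · have : Tendsto (fun n => ∫ p, V p * G n p) atTop (𝓝 (∫ p, V p * H p)) := by
      refine tendsto_integral_of_dominated_convergence (fun p => ‖V p‖ * C)
        (fun n => ((hG n).integrable hV).aestronglyMeasurable) (hV.norm.mul_const C) ?_ ?_
      · intro n
        refine Eventually.of_forall fun p => ?_
        rw [norm_mul]
        exact mul_le_mul_of_nonneg_left ((hG n).bdd p) (norm_nonneg _)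
      · exact Eventually.of_forall fun p => (h p).const_mul _
    exact le_of_tendsto this.norm (Eventually.of_forall fun n => (hG n).dual V hV S hS)

lemma BB.inv_one_add_sq {a : ℝ} (hG : BB G a) (ha : a < 1) :
    BB (fun p => (1 + G p ^ 2)⁻¹) (1 - a ^ 2)⁻¹ := by
  have ha0 := hG.nonneg
  have ha2 : a ^ 2 < 1 := by nlinarith
  have h1 : ∀ n : ℕ, BB (fun p => ∑ k ∈ Finset.range n, (-(G p ^ 2)) ^ k)
      (∑ k ∈ Finset.range n, (a ^ 2) ^ k) := by
    intro n
    induction n with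
    | zero => simpa using BB.const 0
    | succ n ih =>
      simp only [Finset.sum_range_succ]
      exact ih.add ((hG.pow 2).neg.pow n)
  refine BB.of_tendsto (G := fun n p => ∑ k ∈ Finset.range n, (-(G p ^ 2)) ^ k)
    (fun n => (h1 n).mono ?_) fun p => ?_
  · rw [← tsum_geometric_of_lt_one (by positivity) ha2]
    exact (summable_geometric_of_lt_one (by positivity) ha2).sum_le_tsum _
      (fun i _ => by positivity)
  · have : ‖-(G p ^ 2)‖ < 1 := by
      rw [norm_neg, norm_pow]
      exact lt_of_le_of_lt (pow_le_pow_left₀ (norm_nonneg _) (hG.bdd p) 2) ha2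
    have h2 := (hasSum_geometric_of_norm_lt_one this).tendsto_sum_nat
    simpa using h2

/-- A superposition of characters has norm at most the mass of the superposition. -/
lemma BB.of_rep {X : Type*} [MeasurableSpace X] {μ : Measure X} [SFinite μ] {h : X → ℂ}
    (hh : Integrable h μ) {z w : X → ℝ} (hz : Measurable z) (hw : Measurable w)
    (hG : Measurable G) (hGC : ∀ p, ‖G p‖ ≤ ∫ x, ‖h x‖ ∂μ)
    (hrep : ∀ᵐ p, G p = ∫ x, h x * chi (z x) (w x) p ∂μ) : BB G (∫ x, ‖h x‖ ∂μ) := by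
  refine ⟨hG, hGC, fun V hV S hS => ?_⟩
  have h1 : ∫ p, V p * G p = ∫ p, ∫ x, V p * (h x * chi (z x) (w x) p) ∂μ := by
    refine integral_congr_ae ?_
    filter_upwards [hrep] with p hp
    rw [hp, integral_const_mul]
  rw [h1, integral_integral_swap]
  · have h2 : ∀ x, ∫ p, V p * (h x * chi (z x) (w x) p) = h x * ∫ p, V p * chi (z x) (w x) p := by
      intro x
      rw [← integral_const_mul]
      congr with p
      ring
    simp_rw [h2]
    rw [← integral_mul_const]
    refine norm_integral_le_of_norm_le (hh.norm.mul_const S) (Eventually.of_forall fun x => ?_)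
    rw [norm_mul]
    exact mul_le_mul_of_nonneg_left (hS _ _) (norm_nonneg _)
  · have h3 : Integrable (fun q : (ℝ × ℝ) × X => V q.1 * h q.2) (volume.prod μ) := hV.mul_prod hh
    refine (h3.mul_bdd (c := 1) (g := fun q => chi (z q.2) (w q.2) q.1) ?_ ?_).congr ?_
    · unfold chi
      refine Measurable.aestronglyMeasurable ?_
      fun_prop
    · exact Eventually.of_forall fun q => (norm_chi _ _ _).le
    · exact Eventually.of_forall fun q => by simp only [Function.uncurry]; ring

/-- Integrable regularisation of `1/β` whose Fourier transform is bounded by `π`. -/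
def vk (ε β : ℝ) : ℝ := (Real.exp (-(ε * |β|)) - Real.exp (-(ε⁻¹ * |β|))) / β

lemma vk_mul_self (hβ : β ≠ 0) :
    vk ε β * β = Real.exp (-(ε * |β|)) - Real.exp (-(ε⁻¹ * |β|)) := by
  rw [vk]
  field_simp

lemma abs_vk_mul_le (h0 : 0 < ε) (β : ℝ) : |vk ε β * β| ≤ 1 := by
  rcases eq_or_ne β 0 with rfl | hβ
  · simp
  · rw [vk_mul_self hβ, abs_le]
    have h1 : Real.exp (-(ε * |β|)) ≤ 1 := Real.exp_le_one_iff.2 (by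
      have := abs_nonneg β; nlinarith)
    have h2 : Real.exp (-(ε⁻¹ * |β|)) ≤ 1 := Real.exp_le_one_iff.2 (by
      have := abs_nonneg β; have := inv_pos.2 h0; nlinarith)
    have h3 := Real.exp_pos (-(ε * |β|))
    have h4 := Real.exp_pos (-(ε⁻¹ * |β|))
    constructor <;> linarith

lemma tendsto_vk_mul (hβ : β ≠ 0) :
    Tendsto (fun n : ℕ => vk (1 / ((n : ℝ) + 1)) β * β) atTop (𝓝 1) := by
  simp only [vk_mul_self hβ]
  have h1 : Tendsto (fun n : ℕ => Real.exp (-(1 / ((n : ℝ) + 1) * |β|))) atTop (𝓝 1) := by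
    have : Tendsto (fun n : ℕ => -(1 / ((n : ℝ) + 1) * |β|)) atTop (𝓝 (-(0 * |β|))) :=
      (tendsto_one_div_add_atTop_nhds_zero_nat.mul_const _).neg
    have h := (Real.continuous_exp.tendsto _).comp this
    simp only [zero_mul, neg_zero, Real.exp_zero] at h
    exact h
  have h2 : Tendsto (fun n : ℕ => Real.exp (-((1 / ((n : ℝ) + 1))⁻¹ * |β|))) atTop (𝓝 0) := by
    refine Real.tendsto_exp_neg_atTop_nhds_zero.comp ?_
    simp only [one_div, inv_inv]
    exact (tendsto_atTop_add_const_right _ _ tendsto_natCast_atTop_atTop).atTop_mul_const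
      (abs_pos.2 hβ)
  simpa using h1.sub h2

lemma vk_eq_integral (h0 : 0 < ε) (h1 : ε < 1) (β : ℝ) :
    (vk ε β : ℂ) = ∫ τ in Ioc ε ε⁻¹, ((SignType.sign β : ℝ) : ℂ) * (Real.exp (-(τ * |β|)) : ℂ) := by
  have hle : ε ≤ ε⁻¹ := by
    rw [le_inv_comm₀ h0 h0]
    exact h1.le.trans (by rw [le_inv_comm₀ one_pos h0]; simpa using h1.le)
  rcases eq_or_ne β 0 with rfl | hβ
  · simp [vk]
  · rw [integral_const_mul, ← intervalIntegral.integral_of_le hle, intervalIntegral.integral_ofReal,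
      ← ofReal_mul]
    have hb := abs_pos.2 hβ
    have : ∫ τ in ε..ε⁻¹, Real.exp (-(τ * |β|))
        = (Real.exp (-(ε * |β|)) - Real.exp (-(ε⁻¹ * |β|))) / |β| := by
      have hd : ∀ τ ∈ uIcc ε ε⁻¹, HasDerivAt (fun τ => -Real.exp (-(τ * |β|)) / |β|)
          (Real.exp (-(τ * |β|))) τ := by
        intro τ _
        have h2 : HasDerivAt (fun τ => -(τ * |β|)) (-|β|) τ := by
          simpa using! ((hasDerivAt_id τ).mul_const |β|).fun_neg
        refine (h2.exp.neg.div_const |β|).congr_deriv ?_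
        field_simp
      rw [intervalIntegral.integral_eq_sub_of_hasDerivAt hd
        (Continuous.intervalIntegrable (by fun_prop) _ _)]
      ring
    rw [this, vk]
    congr 1
    rcases lt_or_gt_of_ne hβ with h | h
    · rw [abs_of_neg h, sign_neg h]
      simp
      ring_nf
    · rw [abs_of_pos h, sign_pos h]
      simp

lemma integral_exp_mul_abs {τ ω : ℝ} (hτ : 0 < τ) :
    (Integrable fun β : ℝ => ((SignType.sign β : ℝ) : ℂ) * (Real.exp (-(τ * |β|)) : ℂ)) ∧
    ∫ β : ℝ, ((SignType.sign β : ℝ) : ℂ) * (Real.exp (-(τ * |β|)) : ℂ) * cexp (I * ω * β)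
      = 2 * I * ω / (τ ^ 2 + ω ^ 2) := by
  have hτ1 : (-(τ : ℂ) + I * ω).re < 0 := by simpa using hτ
  have hτ2 : 0 < ((τ : ℂ) + I * ω).re := by simpa using hτ
  have hpos : ∀ β ∈ Ioi (0 : ℝ), ((SignType.sign β : ℝ) : ℂ) * (Real.exp (-(τ * |β|)) : ℂ)
      * cexp (I * ω * β) = cexp ((-(τ : ℂ) + I * ω) * β) := by
    intro β hβ
    rw [sign_pos hβ, abs_of_pos hβ, ofReal_exp]
    simp only [SignType.coe_one, ofReal_one, one_mul]
    rw [← Complex.exp_add]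
    congr 1
    push_cast
    ring
  have hneg : ∀ β ∈ Iio (0 : ℝ), ((SignType.sign β : ℝ) : ℂ) * (Real.exp (-(τ * |β|)) : ℂ)
      * cexp (I * ω * β) = -cexp (((τ : ℂ) + I * ω) * β) := by
    intro β hβ
    rw [sign_neg hβ, abs_of_neg hβ, ofReal_exp]
    simp only [SignType.coe_neg_one, ofReal_neg, ofReal_one, neg_mul, one_mul]
    rw [← Complex.exp_add]
    congr 2
    push_cast
    ring
  have hi1 : IntegrableOn (fun β : ℝ => ((SignType.sign β : ℝ) : ℂ) * (Real.exp (-(τ * |β|)) : ℂ)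
      * cexp (I * ω * β)) (Ioi 0) :=
    (integrableOn_exp_mul_complex_Ioi hτ1 0).congr_fun (fun β hβ => (hpos β hβ).symm)
      measurableSet_Ioi
  have hi2 : IntegrableOn (fun β : ℝ => ((SignType.sign β : ℝ) : ℂ) * (Real.exp (-(τ * |β|)) : ℂ)
      * cexp (I * ω * β)) (Iio 0) :=
    ((integrableOn_exp_mul_complex_Iic hτ2 0).mono_set Iio_subset_Iic_self).neg.congr_fun
      (fun β hβ => (hneg β hβ).symm) measurableSet_Iio
  have hi2' : IntegrableOn (fun β : ℝ => ((SignType.sign β : ℝ) : ℂ) * (Real.exp (-(τ * |β|)) : ℂ)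
      * cexp (I * ω * β)) (Iic 0) := by
    rw [integrableOn_Iic_iff_integrableOn_Iio]
    exact hi2
  have hi : Integrable (fun β : ℝ => ((SignType.sign β : ℝ) : ℂ) * (Real.exp (-(τ * |β|)) : ℂ)
      * cexp (I * ω * β)) := by
    rw [← integrableOn_univ, ← Iic_union_Ioi (a := (0 : ℝ))]
    exact hi2'.union hi1
  constructor
  · have h := hi.mul_bdd (c := 1) (g := fun β : ℝ => cexp (I * (-ω : ℝ) * β))
      (by fun_prop) (Eventually.of_forall fun β => (norm_cexp_I_mul _ _).le)
    refine h.congr (Eventually.of_forall fun β => ?_)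
    simp only [mul_assoc]
    rw [← Complex.exp_add]
    simp
  · rw [← setIntegral_univ, ← Iic_union_Ioi (a := (0 : ℝ)), setIntegral_union (Iic_disjoint_Ioi le_rfl) measurableSet_Ioi hi2' hi1,
      integral_Iic_eq_integral_Iio, setIntegral_congr_fun measurableSet_Ioi hpos,
      setIntegral_congr_fun measurableSet_Iio hneg, integral_neg, ← integral_Iic_eq_integral_Iio,
      integral_exp_mul_complex_Ioi hτ1, integral_exp_mul_complex_Iic hτ2]
    have h1 : (-(τ : ℂ) + I * ω) ≠ 0 := fun h => by rw [h] at hτ1; simp at hτ1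
    have h2 : ((τ : ℂ) + I * ω) ≠ 0 := fun h => by rw [h] at hτ2; simp at hτ2
    have h3 : (τ : ℂ) ^ 2 + ω ^ 2 = -((-(τ : ℂ) + I * ω) * ((τ : ℂ) + I * ω)) := by
      ring_nf
      simp
    rw [h3]
    simp only [ofReal_zero, mul_zero, Complex.exp_zero]
    generalize hA : -(τ : ℂ) + I * ω = A at *
    generalize hB : (τ : ℂ) + I * ω = B at *
    field_simp
    rw [← hA, ← hB]
    ring

lemma measurable_sign_ofReal : Measurable fun β : ℝ => ((SignType.sign β : ℝ) : ℂ) := by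
  have : (fun β : ℝ => (SignType.sign β : ℝ)) =
      fun β : ℝ => if 0 < β then 1 else if β < 0 then -1 else 0 := by
    ext β
    rw [sign_apply]
    split_ifs <;> simp
  have h2 : Measurable fun β : ℝ => (SignType.sign β : ℝ) := by
    rw [this]
    exact Measurable.ite measurableSet_Ioi measurable_const
      (Measurable.ite measurableSet_Iio measurable_const measurable_const)
  exact measurable_ofReal.comp h2

lemma integrable_vk_aux (h0 : 0 < ε) :
    Integrable (fun q : ℝ × ℝ => ((SignType.sign q.2 : ℝ) : ℂ) * (Real.exp (-(q.1 * |q.2|)) : ℂ))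
      ((volume.restrict (Ioc ε ε⁻¹)).prod volume) := by
  have hm : Measurable (fun q : ℝ × ℝ => ((SignType.sign q.2 : ℝ) : ℂ)
      * (Real.exp (-(q.1 * |q.2|)) : ℂ)) := by
    refine (measurable_sign_ofReal.comp measurable_snd).mul ?_
    fun_prop
  have h1 : Integrable (fun q : ℝ × ℝ => (1 : ℂ) *
      (((SignType.sign q.2 : ℝ) : ℂ) * (Real.exp (-(ε * |q.2|)) : ℂ)))
      ((volume.restrict (Ioc ε ε⁻¹)).prod volume) :=
    (integrable_const (1 : ℂ)).mul_prod (integral_exp_mul_abs (ω := 0) h0).1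
  refine h1.mono hm.aestronglyMeasurable ?_
  have : ∀ᵐ q : ℝ × ℝ ∂((volume.restrict (Ioc ε ε⁻¹)).prod volume), q.1 ∈ Ioc ε ε⁻¹ :=
    Measure.quasiMeasurePreserving_fst.ae (ae_restrict_mem measurableSet_Ioc)
  filter_upwards [this] with q hq
  rw [one_mul, norm_mul, norm_mul]
  refine mul_le_mul_of_nonneg_left ?_ (norm_nonneg _)
  rw [norm_real, norm_real, Real.norm_of_nonneg (Real.exp_pos _).le,
    Real.norm_of_nonneg (Real.exp_pos _).le]
  refine Real.exp_le_exp.2 (neg_le_neg ?_)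
  exact mul_le_mul_of_nonneg_right hq.1.le (abs_nonneg _)

lemma integrable_vk (h0 : 0 < ε) (h1 : ε < 1) : Integrable fun β => (vk ε β : ℂ) := by
  refine (integrable_vk_aux h0).integral_prod_right.congr (Eventually.of_forall fun β => ?_)
  exact (vk_eq_integral h0 h1 β).symm

lemma norm_integral_vk_le (h0 : 0 < ε) (h1 : ε < 1) (ω : ℝ) :
    ‖∫ β : ℝ, (vk ε β : ℂ) * cexp (I * ω * β)‖ ≤ Real.pi := by
  have hle : ε ≤ ε⁻¹ := by
    rw [le_inv_comm₀ h0 h0]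
    exact h1.le.trans (by rw [le_inv_comm₀ one_pos h0]; simpa using h1.le)
  have e1 : ∫ β : ℝ, (vk ε β : ℂ) * cexp (I * ω * β) = ∫ β : ℝ, ∫ τ in Ioc ε ε⁻¹,
      ((SignType.sign β : ℝ) : ℂ) * (Real.exp (-(τ * |β|)) : ℂ) * cexp (I * ω * β) := by
    congr with β
    rw [vk_eq_integral h0 h1, integral_mul_const]
  have e2 : ∫ β : ℝ, (vk ε β : ℂ) * cexp (I * ω * β)
      = ∫ τ in Ioc ε ε⁻¹, 2 * I * ω / ((τ : ℂ) ^ 2 + ω ^ 2) := by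
    rw [e1, ← integral_integral_swap]
    · refine setIntegral_congr_fun measurableSet_Ioc fun τ hτ => ?_
      exact (integral_exp_mul_abs (h0.trans hτ.1)).2
    · exact (integrable_vk_aux h0).mul_bdd (c := 1) (g := fun q : ℝ × ℝ => cexp (I * ω * q.2))
        (by fun_prop) (Eventually.of_forall fun q => (norm_cexp_I_mul _ _).le)
  rcases eq_or_ne ω 0 with rfl | hω
  · rw [e2]
    simp [Real.pi_pos.le]
  have hd : ∀ τ ∈ uIcc ε ε⁻¹, HasDerivAt (fun τ : ℝ => 2 * Real.arctan (τ / ω))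
      (2 * ω / (τ ^ 2 + ω ^ 2)) τ := by
    intro τ _
    have h2 := (((hasDerivAt_id τ).div_const ω).arctan).const_mul 2
    refine h2.congr_deriv ?_
    have : τ ^ 2 + ω ^ 2 ≠ 0 := by positivity
    simp only [id]
    field_simp
    ring
  have hcont : Continuous fun τ : ℝ => 2 * ω / (τ ^ 2 + ω ^ 2) := by
    refine Continuous.div (by fun_prop) (by fun_prop) fun τ => ?_
    positivity
  have e3 : ∫ β : ℝ, (vk ε β : ℂ) * cexp (I * ω * β)
      = I * ((2 * Real.arctan (ε⁻¹ / ω) - 2 * Real.arctan (ε / ω) : ℝ) : ℂ) := by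
    rw [e2, ← intervalIntegral.integral_eq_sub_of_hasDerivAt hd (hcont.intervalIntegrable _ _),
      intervalIntegral.integral_of_le hle, ← integral_complex_ofReal, ← integral_const_mul]
    congr with τ
    push_cast
    ring
  rw [e3, norm_mul, norm_I, one_mul, norm_real, Real.norm_eq_abs, abs_le]
  have b1 := Real.arctan_lt_pi_div_two (ε⁻¹ / ω)
  have b2 := Real.neg_pi_div_two_lt_arctan (ε⁻¹ / ω)
  have b3 := Real.arctan_lt_pi_div_two (ε / ω)
  have b4 := Real.neg_pi_div_two_lt_arctan (ε / ω)
  have hi := inv_pos.2 h0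
  rcases lt_or_gt_of_ne hω with h | h
  · have c1 : Real.arctan (ε⁻¹ / ω) < 0 := Real.arctan_lt_zero.2 (div_neg_of_pos_of_neg hi h)
    have c2 : Real.arctan (ε / ω) < 0 := Real.arctan_lt_zero.2 (div_neg_of_pos_of_neg h0 h)
    constructor <;> linarith
  · have c1 : 0 < Real.arctan (ε⁻¹ / ω) := Real.arctan_pos.2 (div_pos hi h)
    have c2 : 0 < Real.arctan (ε / ω) := Real.arctan_pos.2 (div_pos h0 h)
    constructor <;> linarith

/-- The regularised Hilbert transform in `β` is bounded on the Fourier–Stieltjes algebra. -/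
lemma BB.norm_integral_vk_le (hG : BB G C) (hu : Integrable u)
    (hS : ∀ ζ, ‖ift u ζ‖ ≤ S) (h0 : 0 < ε) (h1 : ε < 1) :
    ‖∫ p : ℝ × ℝ, u p.1 * vk ε p.2 * G p‖ ≤ Real.pi * C * S := by
  have hS0 : 0 ≤ S := (norm_nonneg _).trans (hS 0)
  refine (hG.dual (fun p => u p.1 * vk ε p.2) (hu.mul_prod (integrable_vk h0 h1)) (S * Real.pi)
    fun ζ ω => ?_).trans_eq (by ring)
  have : ∫ p : ℝ × ℝ, u p.1 * vk ε p.2 * chi ζ ω p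
      = ift u ζ * ∫ β : ℝ, (vk ε β : ℂ) * cexp (I * ω * β) := by
    rw [ift, ← integral_prod_mul, Measure.volume_eq_prod]
    congr with p
    rw [chi, mul_add, Complex.exp_add]
    ring_nf
  rw [this, norm_mul]
  exact mul_le_mul (hS ζ) (Muskat.norm_integral_vk_le h0 h1 ω) (norm_nonneg _) hS0

lemma l2_ift (hu : Integrable u) (hu2 : MemLp u 2) :
    MemLp (ift u) 2 ∧ ∫ x, ‖ift u x‖ ^ 2 = 2 * Real.pi * ∫ x, ‖u x‖ ^ 2 := by
  have h := fourierInv_toLp_ae_eq hu hu2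
  have hp : (2 * Real.pi) ≠ 0 := by positivity
  have h1 : MemLp (fun x => ift u (2 * Real.pi * x)) 2 := (memLp_congr_ae h).1 (Lp.memLp _)
  have h2 : MemLp (ift u) 2 := by
    have := memLp_comp_mul h1 (c := (2 * Real.pi)⁻¹) (inv_ne_zero hp)
    refine (memLp_congr_ae (Eventually.of_forall fun x => ?_)).1 this
    congr 1
    field_simp
  refine ⟨h2, ?_⟩
  have h3 := Measure.integral_comp_mul_left (fun x => ‖ift u x‖ ^ 2) (2 * Real.pi)
  have h4 : ∫ x, ‖ift u (2 * Real.pi * x)‖ ^ 2 = ∫ x, ‖u x‖ ^ 2 := by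
    have e1 : ∫ x, ‖ift u (2 * Real.pi * x)‖ ^ 2
        = ∫ x, ‖(𝓕⁻ (hu2.toLp u) : Lp (α := ℝ) ℂ 2 volume) x‖ ^ 2 := by
      refine integral_congr_ae ?_
      filter_upwards [h] with x hx
      rw [hx]
    have e2 : ∫ x, ‖u x‖ ^ 2 = ∫ x, ‖(hu2.toLp u) x‖ ^ 2 := by
      refine integral_congr_ae ?_
      filter_upwards [hu2.coeFn_toLp] with x hx
      rw [hx]
    rw [e1, e2, integral_norm_sq_eq_norm_sq, integral_norm_sq_eq_norm_sq, ← Lp.norm_fourier_eq,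
      FourierTransform.fourier_fourierInv_eq]
  rw [h4, abs_of_pos (by positivity), smul_eq_mul] at h3
  rw [h3]
  field_simp

/-- `L²` version of the bound for the regularised Hilbert transform. -/
lemma BB.norm_integral_vk_le_l2 (hG : BB G C) {W : ℝ → ℂ}
    (hu : Integrable u) (hu2 : MemLp u 2) (hW : Integrable W) (hW2 : MemLp W 2)
    (h0 : 0 < ε) (h1 : ε < 1) :
    ‖∫ p : ℝ × ℝ, u p.1 * vk ε p.2 * (ift W (p.1 - p.2) * G p)‖
      ≤ Real.pi * C * (√(2 * Real.pi) * l2 u * l2 W) := by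
  have hV : Integrable fun p : ℝ × ℝ => u p.1 * vk ε p.2 * ift W (p.1 - p.2) := by
    refine (hu.mul_prod (integrable_vk h0 h1)).mul_bdd (c := ∫ ξ, ‖W ξ‖) ?_ ?_
    · exact ((continuous_ift hW).comp (by fun_prop)).aestronglyMeasurable
    · exact Eventually.of_forall fun p => norm_ift_le W _
  have hul : l2 (ift u) = √(2 * Real.pi) * l2 u := by
    rw [l2, (l2_ift hu hu2).2, Real.sqrt_mul (by positivity), l2]
  have key : ∀ ζ ω, ‖∫ p : ℝ × ℝ, u p.1 * vk ε p.2 * ift W (p.1 - p.2) * chi ζ ω p‖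
      ≤ Real.pi * (√(2 * Real.pi) * l2 u * l2 W) := by
    intro ζ ω
    have e1 : ∫ p : ℝ × ℝ, u p.1 * vk ε p.2 * ift W (p.1 - p.2) * chi ζ ω p
        = ∫ p : ℝ × ℝ, ∫ η, W η * ((u p.1 * vk ε p.2) * chi (ζ + η) (ω - η) p) := by
      congr with p
      rw [ift, ← integral_const_mul, ← integral_mul_const]
      congr with η
      rw [show cexp (I * η * ((p.1 - p.2 : ℝ) : ℂ)) = chi η (-η) p by
        rw [chi]; congr 1; push_cast; ring, sub_eq_add_neg, ← chi_mul]
      ring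
    have e2 : ∀ η, ∫ p : ℝ × ℝ, W η * ((u p.1 * vk ε p.2) * chi (ζ + η) (ω - η) p)
        = W η * (ift u (ζ + η) * ∫ β : ℝ, (vk ε β : ℂ) * cexp (I * ((ω - η : ℝ) : ℂ) * β)) := by
      intro η
      rw [integral_const_mul, ift, ← integral_prod_mul, Measure.volume_eq_prod]
      congr 2
      ext p
      rw [chi, mul_add, Complex.exp_add]
      ring_nf
    rw [e1, integral_integral_swap]
    · simp_rw [e2]
      have hu' : MemLp (fun η => ift u (ζ + η)) 2 :=
        (l2_ift hu hu2).1.comp_measurePreserving (measurePreserving_add_left volume ζ)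
      have hl : l2 (fun η => ift u (ζ + η)) = l2 (ift u) := by
        rw [l2, l2, integral_add_left_eq_self (fun x => ‖ift u x‖ ^ 2)]
      refine (norm_integral_le_of_norm_le ((integrable_norm_mul hW2 hu').const_mul Real.pi)
        (Eventually.of_forall fun η => ?_)).trans ?_
      · rw [norm_mul, norm_mul]
        have := Muskat.norm_integral_vk_le h0 h1 (ω - η)
        calc _ ≤ ‖W η‖ * (‖ift u (ζ + η)‖ * Real.pi) := by gcongr
          _ = _ := by ring
      · rw [integral_const_mul]
        refine mul_le_mul_of_nonneg_left ?_ Real.pi_pos.le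
        refine (integral_norm_mul_le hW2 hu').trans_eq ?_
        rw [hl, hul]
        ring
    · have h3 : Integrable (fun q : (ℝ × ℝ) × ℝ => (u q.1.1 * vk ε q.1.2) * W q.2)
          ((volume : Measure (ℝ × ℝ)).prod volume) :=
        (hu.mul_prod (integrable_vk h0 h1)).mul_prod hW
      refine (h3.mul_bdd (c := 1) (g := fun q => chi (ζ + q.2) (ω - q.2) q.1) ?_ ?_).congr ?_
      · unfold chi
        exact Continuous.aestronglyMeasurable (by fun_prop)
      · exact Eventually.of_forall fun q => (norm_chi _ _ _).le
      · exact Eventually.of_forall fun q => by simp only [Function.uncurry]; ring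
  have := hG.dual _ hV _ key
  simp only [← mul_assoc] at this ⊢
  refine this.trans_eq (by ring)

end

section

variable {β : ℝ} {U : ℝ → ℂ} {u : ℝ → ℝ}

/-- The `Ḟ^{1,1}` norm of a spectral density. -/
def n1 (U : ℝ → ℂ) : ℝ := ∫ ξ, |ξ| * ‖U ξ‖

/-- The `Ḟ^{2,1}` norm of a spectral density. -/
def n2 (U : ℝ → ℂ) : ℝ := ∫ ξ, |ξ| ^ 2 * ‖U ξ‖

lemma n1_nonneg (U : ℝ → ℂ) : 0 ≤ n1 U := integral_nonneg fun _ => by positivity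

lemma n2_nonneg (U : ℝ → ℂ) : 0 ≤ n2 U := integral_nonneg fun _ => by positivity

/-- The class `L² ∩ Ḟ^{1,1}`. -/
structure Reg1 (u : ℝ → ℝ) (U : ℝ → ℂ) : Prop extends HasSpec u U where
  int1 : Integrable fun ξ => |ξ| * ‖U ξ‖

/-- The class `L² ∩ Ḟ^{1,1} ∩ Ḟ^{2,1}`. -/
structure Reg2 (u : ℝ → ℝ) (U : ℝ → ℂ) : Prop extends Reg1 u U where
  int2 : Integrable fun ξ => |ξ| ^ 2 * ‖U ξ‖

/-- The spectral density of the derivative. -/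
def dspec (U : ℝ → ℂ) (ξ : ℝ) : ℂ := I * ξ * U ξ

lemma norm_dspec (U : ℝ → ℂ) (ξ : ℝ) : ‖dspec U ξ‖ = |ξ| * ‖U ξ‖ := by
  rw [dspec, norm_mul, norm_mul, norm_I, one_mul, norm_real, Real.norm_eq_abs]

lemma aestronglyMeasurable_dspec (hU : AEStronglyMeasurable U) :
    AEStronglyMeasurable (dspec U) :=
  AEStronglyMeasurable.mul (by fun_prop) hU

lemma integrable_dspec (hU : AEStronglyMeasurable U)
    (h : Integrable fun ξ => |ξ| * ‖U ξ‖) : Integrable (dspec U) := by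
  rw [← integrable_norm_iff (aestronglyMeasurable_dspec hU)]
  simpa only [norm_dspec] using h

lemma hasDerivAt_ift (hU : Integrable U) (h : Integrable fun ξ => |ξ| * ‖U ξ‖) (α : ℝ) :
    HasDerivAt (ift U) (ift (dspec U) α) α := by
  have := hasDerivAt_integral_of_dominated_loc_of_deriv_le (μ := (volume : Measure ℝ))
    (F := fun (α : ℝ) (ξ : ℝ) => U ξ * cexp (I * ξ * α))
    (F' := fun (α : ℝ) (ξ : ℝ) => dspec U ξ * cexp (I * ξ * α)) (x₀ := α) (s := univ)
    (bound := fun ξ => |ξ| * ‖U ξ‖) univ_mem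
    (Eventually.of_forall fun x => (integrable_mul_cexp hU x).aestronglyMeasurable)
    (integrable_mul_cexp hU α)
    (integrable_mul_cexp (integrable_dspec hU.1 h) α).aestronglyMeasurable
    (Eventually.of_forall fun ξ x _ => by rw [norm_mul, norm_cexp_I_mul, mul_one, norm_dspec])
    h (Eventually.of_forall fun ξ x _ => ?_)
  · exact this.2
  · have h1 : HasDerivAt (fun x : ℝ => I * ξ * (x : ℂ)) (I * ξ) x := by
      simpa using (ofRealCLM.hasDerivAt (x := x)).const_mul (I * (ξ : ℂ))
    have h2 := (h1.cexp).const_mul (U ξ)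
    refine h2.congr_deriv ?_
    rw [dspec]
    ring

lemma Reg1.hasDerivAt (h : Reg1 u U) (α : ℝ) :
    HasDerivAt u (ift (dspec U) α).re α := by
  have h1 := (reCLM.hasFDerivAt (x := ift U α)).comp_hasDerivAt α (hasDerivAt_ift h.integrable h.int1 α)
  refine h1.congr_of_eventuallyEq (Eventually.of_forall fun x => ?_)
  simp [← h.eq]

lemma Reg1.deriv_eq (h : Reg1 u U) (α : ℝ) :
    ((deriv u α : ℝ) : ℂ) = ift (dspec U) α := by
  have h1 := h.hasDerivAt α
  have h2 : HasDerivAt (fun x => (u x : ℂ)) ((ift (dspec U) α).re : ℂ) α := h1.ofReal_comp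
  have h3 : HasDerivAt (fun x => (u x : ℂ)) (ift (dspec U) α) α :=
    (hasDerivAt_ift h.integrable h.int1 α).congr_of_eventuallyEq
      (Eventually.of_forall fun x => h.eq x)
  rw [h1.deriv, h2.unique h3]

lemma Reg1.hasDerivAt_deriv (h : Reg1 u U) (α : ℝ) :
    HasDerivAt u (deriv u α) α := (h.hasDerivAt α).differentiableAt.hasDerivAt

lemma Reg1.integrable_dspec (h : Reg1 u U) : Integrable (dspec U) :=
  Muskat.integrable_dspec h.integrable.1 h.int1

lemma Reg1.continuous_deriv (h : Reg1 u U) : Continuous (deriv u) := by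
  have : deriv u = fun α => (ift (dspec U) α).re := by
    ext α
    rw [← h.deriv_eq, ofReal_re]
  rw [this]
  exact continuous_re.comp (continuous_ift h.integrable_dspec)

lemma HasSpec.abs_le (h : HasSpec u U) (α : ℝ) : |u α| ≤ ∫ ξ, ‖U ξ‖ := by
  rw [← Real.norm_eq_abs, ← norm_real, h.eq]
  exact norm_ift_le _ _

lemma Reg1.abs_deriv_le (h : Reg1 u U) (α : ℝ) : |deriv u α| ≤ n1 U := by
  rw [← Real.norm_eq_abs, ← norm_real, h.deriv_eq]
  refine (norm_ift_le _ _).trans_eq ?_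
  simp only [norm_dspec, n1]

lemma Reg1.abs_sub_le (h : Reg1 u U) (α γ : ℝ) :
    |u α - u γ| ≤ n1 U * |α - γ| := by
  have := Convex.norm_image_sub_le_of_norm_deriv_le (f := u) (s := univ) (C := n1 U)
    (x := γ) (y := α) (fun x _ => (h.hasDerivAt x).differentiableAt) (fun x _ => h.abs_deriv_le x)
    convex_univ trivial trivial
  simpa using this

lemma Reg2.abs_deriv_sub_le (h : Reg2 u U) (α γ : ℝ) :
    |deriv u α - deriv u γ| ≤ n2 U * |α - γ| := by
  have hd : Integrable fun ξ => |ξ| * ‖dspec U ξ‖ := by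
    refine h.int2.congr (Eventually.of_forall fun ξ => ?_)
    simp only [norm_dspec]
    ring
  have hD : ∀ x, HasDerivAt (deriv u) (ift (dspec (dspec U)) x).re x := by
    intro x
    have h1 := (reCLM.hasFDerivAt (x := ift (dspec U) x)).comp_hasDerivAt x
      (hasDerivAt_ift h.integrable_dspec hd x)
    refine h1.congr_of_eventuallyEq (Eventually.of_forall fun y => ?_)
    simp [← h.toReg1.deriv_eq]
  have := Convex.norm_image_sub_le_of_norm_deriv_le (f := deriv u) (s := univ) (C := n2 U)
    (x := γ) (y := α) (fun x _ => (hD x).differentiableAt) (fun x _ => ?_)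
    convex_univ trivial trivial
  · simpa using this
  · rw [(hD x).deriv, Real.norm_eq_abs]
    refine (abs_re_le_norm _).trans ((norm_ift_le _ _).trans_eq ?_)
    rw [n2]
    congr with ξ
    rw [norm_dspec, norm_dspec]
    ring

lemma Reg1.abs_diffQuot_le (h : Reg1 u U) (α β : ℝ) :
    |diffQuot u α β| ≤ n1 U := by
  rcases eq_or_ne β 0 with rfl | hβ
  · simp [diffQuot, n1_nonneg]
  · rw [diffQuot, abs_div, div_le_iff₀ (abs_pos.2 hβ)]
    simpa using h.abs_sub_le α (α - β)

lemma Reg1.exists_diffQuot_eq (h : Reg1 u U) (α : ℝ) (hβ : β ≠ 0) :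
    ∃ γ, |γ - α| ≤ |β| ∧ |γ - (α - β)| ≤ |β| ∧ diffQuot u α β = deriv u γ := by
  have hc : ∀ s : Set ℝ, ContinuousOn u s := fun s => h.continuous.continuousOn
  have hd : ∀ s : Set ℝ, DifferentiableOn ℝ u s := fun s x _ =>
    (h.hasDerivAt x).differentiableAt.differentiableWithinAt
  rcases lt_or_gt_of_ne hβ with hb | hb
  · obtain ⟨γ, hγ, he⟩ := exists_deriv_eq_slope u (a := α) (b := α - β) (by linarith) (hc _) (hd _)
    refine ⟨γ, ?_, ?_, ?_⟩
    · rw [abs_of_neg hb, abs_le]; constructor <;> linarith [hγ.1, hγ.2]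
    · rw [abs_of_neg hb, abs_le]; constructor <;> linarith [hγ.1, hγ.2]
    · rw [he, diffQuot, ← neg_div_neg_eq]
      congr 1 <;> ring
  · obtain ⟨γ, hγ, he⟩ := exists_deriv_eq_slope u (a := α - β) (b := α) (by linarith) (hc _) (hd _)
    refine ⟨γ, ?_, ?_, ?_⟩
    · rw [abs_of_pos hb, abs_le]; constructor <;> linarith [hγ.1, hγ.2]
    · rw [abs_of_pos hb, abs_le]; constructor <;> linarith [hγ.1, hγ.2]
    · rw [he, diffQuot]
      congr 1
      ring

/-- The decay profile `(1+β²)^{-1/2}` of the kernels. -/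
def rho (β : ℝ) : ℝ := √((1 + β ^ 2)⁻¹)

lemma rho_sq (β : ℝ) : rho β ^ 2 = (1 + β ^ 2)⁻¹ := Real.sq_sqrt (by positivity)

lemma rho_pos (β : ℝ) : 0 < rho β := Real.sqrt_pos.2 (by positivity)

lemma continuous_rho : Continuous rho := by
  unfold rho
  exact (Continuous.inv₀ (by fun_prop) fun β => by positivity).sqrt

lemma integrable_rho_sq : Integrable fun β => rho β ^ 2 := by
  simp only [rho_sq]
  exact integrable_inv_one_add_sq

lemma memLp_rho : MemLp rho 2 := by
  rw [memLp_two_iff_integrable_sq_norm continuous_rho.aestronglyMeasurable]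
  simpa using integrable_rho_sq

lemma le_mul_rho {x A B : ℝ} (hx : 0 ≤ x) (h1 : x ≤ A) (h2 : x * |β| ≤ B) :
    x ≤ (A + B) * rho β := by
  have hA : 0 ≤ A := hx.trans h1
  have hB : 0 ≤ B := (mul_nonneg hx (abs_nonneg _)).trans h2
  refine abs_le_of_sq_le_sq' ?_ (mul_nonneg (by positivity) (rho_pos β).le) |>.2
  rw [mul_pow, rho_sq, ← div_eq_mul_inv, le_div_iff₀ (by positivity)]
  have h3 : (x * |β|) ^ 2 ≤ B ^ 2 := pow_le_pow_left₀ (by positivity) h2 2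
  rw [mul_pow, sq_abs] at h3
  nlinarith

/-- A bound for the difference kernels of `u`. -/
def kerC (U : ℝ → ℂ) : ℝ := n2 U + 2 * n1 U

lemma kerC_nonneg (U : ℝ → ℂ) : 0 ≤ kerC U := by
  have := n1_nonneg U; have := n2_nonneg U; rw [kerC]; positivity

lemma Reg2.abs_ker_left (h : Reg2 u U) (α β : ℝ) :
    |(deriv u (α - β) - diffQuot u α β) / β| ≤ kerC U * rho β := by
  rcases eq_or_ne β 0 with rfl | hβ
  · simpa using mul_nonneg (kerC_nonneg U) (rho_pos 0).le
  have hb := abs_pos.2 hβ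
  refine le_mul_rho (abs_nonneg _) ?_ ?_
  · obtain ⟨γ, _, h2, h3⟩ := h.toReg1.exists_diffQuot_eq α hβ
    rw [h3, abs_div, div_le_iff₀ hb]
    refine (h.abs_deriv_sub_le _ _).trans ?_
    rw [abs_sub_comm]
    exact mul_le_mul_of_nonneg_left h2 (n2_nonneg U)
  · rw [abs_div, div_mul_cancel₀ _ hb.ne']
    refine (abs_sub _ _).trans ?_
    linarith [h.toReg1.abs_deriv_le (α - β), h.toReg1.abs_diffQuot_le α β]

lemma Reg2.abs_ker_right (h : Reg2 u U) (α β : ℝ) :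
    |(deriv u α - diffQuot u α β) / β| ≤ kerC U * rho β := by
  rcases eq_or_ne β 0 with rfl | hβ
  · simpa using mul_nonneg (kerC_nonneg U) (rho_pos 0).le
  have hb := abs_pos.2 hβ
  refine le_mul_rho (abs_nonneg _) ?_ ?_
  · obtain ⟨γ, h2, _, h3⟩ := h.toReg1.exists_diffQuot_eq α hβ
    rw [h3, abs_div, div_le_iff₀ hb]
    refine (h.abs_deriv_sub_le _ _).trans ?_
    rw [abs_sub_comm]
    exact mul_le_mul_of_nonneg_left h2 (n2_nonneg U)
  · rw [abs_div, div_mul_cancel₀ _ hb.ne']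
    refine (abs_sub _ _).trans ?_
    linarith [h.toReg1.abs_deriv_le α, h.toReg1.abs_diffQuot_le α β]

lemma Reg1.abs_diffQuot_le_rho (h : Reg1 u U) (α β : ℝ) :
    |diffQuot u α β| ≤ (n1 U + 2 * ∫ ξ, ‖U ξ‖) * rho β := by
  refine le_mul_rho (abs_nonneg _) (h.abs_diffQuot_le α β) ?_
  rcases eq_or_ne β 0 with rfl | hβ
  · have : 0 ≤ ∫ ξ, ‖U ξ‖ := integral_nonneg fun _ => norm_nonneg _
    simp only [abs_zero, mul_zero]
    positivity
  rw [diffQuot, abs_div, div_mul_cancel₀ _ (abs_pos.2 hβ).ne']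
  refine (abs_sub _ _).trans ?_
  linarith [h.abs_le α, h.abs_le (α - β)]

lemma Reg1.measurable_diffQuot (h : Reg1 u U) :
    Measurable fun p : ℝ × ℝ => diffQuot u p.1 p.2 := by
  have hc := h.continuous.measurable
  unfold diffQuot
  fun_prop

/-- The function `u'(α - sβ)` has norm `n1 U`. -/
lemma Reg1.bb_deriv (h : Reg1 u U) (s : ℝ) :
    BB (fun p => ((deriv u (p.1 - s * p.2) : ℝ) : ℂ)) (n1 U) := by
  have hn : n1 U = ∫ ξ, ‖dspec U ξ‖ := by simp only [norm_dspec, n1]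
  rw [hn]
  refine BB.of_rep h.integrable_dspec measurable_id (measurable_id.const_mul (-s)) ?_ ?_ ?_
  · have := h.continuous_deriv
    exact (by fun_prop : Continuous fun p : ℝ × ℝ => ((deriv u (p.1 - s * p.2) : ℝ) : ℂ)).measurable
  · intro p
    rw [← hn, norm_real]
    exact h.abs_deriv_le _
  · refine Eventually.of_forall fun p => ?_
    rw [h.deriv_eq, ift]
    congr with ξ
    rw [chi]
    congr 2
    simp only [id]
    push_cast
    ring

lemma integral_exp_segment (ξ β : ℝ) :
    I * ξ * β * ∫ s in Icc (0 : ℝ) 1, cexp (-(I * ξ * β * s)) = 1 - cexp (-(I * ξ * β)) := by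
  rw [integral_Icc_eq_integral_Ioc, ← intervalIntegral.integral_of_le zero_le_one]
  have hd : ∀ s ∈ uIcc (0 : ℝ) 1, HasDerivAt (fun s : ℝ => -cexp (-(I * ξ * β * s)))
      (I * ξ * β * cexp (-(I * ξ * β * s))) s := by
    intro s _
    have h1 : HasDerivAt (fun s : ℝ => -(I * ξ * β * (s : ℂ))) (-(I * ξ * β)) s := by
      simpa using! ((ofRealCLM.hasDerivAt (x := s)).const_mul (I * (ξ : ℂ) * β)).fun_neg
    refine h1.cexp.fun_neg.congr_deriv ?_
    ring
  rw [← intervalIntegral.integral_const_mul, intervalIntegral.integral_eq_sub_of_hasDerivAt hd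
    (Continuous.intervalIntegrable (by fun_prop) _ _)]
  simp
  ring

/-- The difference quotient has norm `n1 U`. -/
lemma Reg1.bb_diffQuot (h : Reg1 u U) :
    BB (fun p => (diffQuot u p.1 p.2 : ℂ)) (n1 U) := by
  have hint : Integrable (fun q : ℝ × ℝ => dspec U q.1 * (1 : ℂ))
      (volume.prod (volume.restrict (Icc (0 : ℝ) 1))) :=
    h.integrable_dspec.mul_prod (integrable_const (1 : ℂ))
  have hn : n1 U = ∫ q : ℝ × ℝ, ‖dspec U q.1 * (1 : ℂ)‖
      ∂(volume.prod (volume.restrict (Icc (0 : ℝ) 1))) := by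
    simp only [norm_mul, norm_dspec]
    rw [integral_prod_mul (fun ξ => |ξ| * ‖U ξ‖) (fun _ : ℝ => ‖(1 : ℂ)‖)]
    simp [n1]
  rw [hn]
  refine BB.of_rep hint (z := fun q => q.1) (w := fun q => -(q.2 * q.1)) (by fun_prop) (by fun_prop)
    ?_ ?_ ?_
  · exact measurable_ofReal.comp h.measurable_diffQuot
  · intro p
    rw [← hn, norm_real]
    exact h.abs_diffQuot_le _ _
  · have hae : ∀ᵐ p : ℝ × ℝ, p.2 ≠ 0 := by
      have : ∀ᵐ x : ℝ, x ≠ 0 := by simp [ae_iff, measure_singleton]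
      exact Measure.quasiMeasurePreserving_snd.ae this
    filter_upwards [hae] with p hp
    have hp' : (p.2 : ℂ) ≠ 0 := ofReal_ne_zero.2 hp
    have hint2 : Integrable (fun q : ℝ × ℝ => dspec U q.1 * 1 * chi q.1 (-(q.2 * q.1)) p)
        (volume.prod (volume.restrict (Icc (0 : ℝ) 1))) := by
      refine hint.mul_bdd (c := 1) ?_ (Eventually.of_forall fun q => (norm_chi _ _ _).le)
      unfold chi
      exact Continuous.aestronglyMeasurable (by fun_prop)
    rw [integral_prod _ hint2, diffQuot]
    push_cast
    rw [h.eq, h.eq, div_eq_iff hp', ift, ift, ← integral_sub (integrable_mul_cexp h.integrable _)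
      (integrable_mul_cexp h.integrable _), ← integral_mul_const]
    congr with ξ
    have e1 : cexp (I * ξ * ((p.1 - p.2 : ℝ) : ℂ)) = cexp (I * ξ * p.1) * cexp (-(I * ξ * p.2)) := by
      rw [← Complex.exp_add]
      congr 1
      push_cast
      ring
    have e2 : ∀ s : ℝ, dspec U ξ * 1 * chi ξ (-(s * ξ)) p
        = (U ξ * cexp (I * ξ * p.1) * (I * ξ)) * cexp (-(I * ξ * p.2 * s)) := by
      intro s
      rw [dspec, chi]
      have : cexp (I * (ξ * p.1 + ((-(s * ξ) : ℝ) : ℂ) * p.2))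
          = cexp (I * ξ * p.1) * cexp (-(I * ξ * p.2 * s)) := by
        rw [← Complex.exp_add]
        congr 1
        push_cast
        ring
      rw [this]
      ring
    simp only [e2]
    rw [integral_const_mul, e1]
    linear_combination -(U ξ * cexp (I * ξ * p.1)) * integral_exp_segment ξ p.2

end

section

variable {U V : ℝ → ℂ} {q u v : ℝ → ℝ}

lemma eLpNorm_eq_l2 (hU : MemLp U 2) : eLpNorm U 2 volume = ENNReal.ofReal (l2 U) := by
  rw [hU.eLpNorm_eq_integral_rpow_norm (by norm_num) (by norm_num), l2, Real.sqrt_eq_rpow]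
  simp

lemma l2_congr_ae (h : U =ᵐ[volume] V) : l2 U = l2 V := by
  rw [l2, l2, integral_congr_ae]
  filter_upwards [h] with x hx
  rw [hx]

lemma l2_add_le (hU : MemLp U 2) (hV : MemLp V 2) :
    l2 (fun ξ => U ξ + V ξ) ≤ l2 U + l2 V := by
  have h := eLpNorm_add_le (p := 2) hU.1 hV.1 (by norm_num)
  rw [eLpNorm_eq_l2 (hU.add hV), eLpNorm_eq_l2 hU, eLpNorm_eq_l2 hV,
    ← ENNReal.ofReal_add (l2_nonneg _) (l2_nonneg _),
    ENNReal.ofReal_le_ofReal_iff (add_nonneg (l2_nonneg _) (l2_nonneg _))] at h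
  exact h

lemma l2_const_mul (c : ℂ) (U : ℝ → ℂ) : l2 (fun ξ => c * U ξ) = ‖c‖ * l2 U := by
  simp only [l2, norm_mul, mul_pow]
  rw [integral_const_mul, Real.sqrt_mul (by positivity), Real.sqrt_sq (norm_nonneg _)]

lemma l2_neg (U : ℝ → ℂ) : l2 (fun ξ => -U ξ) = l2 U := by
  simp only [l2, norm_neg]

lemma l2_sub_le (hU : MemLp U 2) (hV : MemLp V 2) :
    l2 (fun ξ => U ξ - V ξ) ≤ l2 U + l2 V := by
  have := l2_add_le hU hV.neg
  simp only [Pi.neg_apply] at this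
  rw [show l2 (-V) = l2 V from l2_neg V] at this
  simpa only [sub_eq_add_neg] using this

lemma l2_mono (hV : MemLp V 2) (h : ∀ᵐ ξ, ‖U ξ‖ ≤ ‖V ξ‖) : l2 U ≤ l2 V := by
  refine Real.sqrt_le_sqrt (integral_mono_of_nonneg (Eventually.of_forall fun _ => by positivity)
    (integrable_sq hV) ?_)
  filter_upwards [h] with ξ hξ
  exact pow_le_pow_left₀ (norm_nonneg _) hξ 2

lemma exists_subseq_ae {U : ℕ → ℝ → ℂ} (hU : ∀ n, MemLp (U n) 2) (hV : MemLp V 2)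
    (h : Tendsto (fun n => l2 (fun ξ => U n ξ - V ξ)) atTop (𝓝 0)) :
    ∃ ns : ℕ → ℕ, StrictMono ns ∧ ∀ᵐ ξ, Tendsto (fun n => U (ns n) ξ) atTop (𝓝 (V ξ)) := by
  refine (tendstoInMeasure_of_tendsto_eLpNorm (p := 2) (by norm_num) (fun n => (hU n).1) hV.1
    ?_).exists_seq_tendsto_ae
  have h1 : ∀ n, eLpNorm (U n - V) 2 volume = ENNReal.ofReal (l2 (fun ξ => U n ξ - V ξ)) :=
    fun n => eLpNorm_eq_l2 ((hU n).sub hV)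
  simp only [h1]
  simpa using ENNReal.tendsto_ofReal h

/-- Lower semicontinuity of weighted norms under `L²` convergence. -/
lemma lintegral_le_of_tendsto_l2 {U : ℕ → ℝ → ℂ} (hU : ∀ n, MemLp (U n) 2)
    (hV : MemLp V 2) (h : Tendsto (fun n => l2 (fun ξ => U n ξ - V ξ)) atTop (𝓝 0))
    {q : ℝ → ℝ≥0∞} (hq : Measurable q) (hq' : ∀ ξ, q ξ ≠ ⊤) {e : ℕ} {c : ℝ≥0∞}
    (hc : ∀ n, ∫⁻ ξ, q ξ * ‖U n ξ‖ₑ ^ e ≤ c) : ∫⁻ ξ, q ξ * ‖V ξ‖ₑ ^ e ≤ c := by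
  obtain ⟨ns, _, h2⟩ := exists_subseq_ae hU hV h
  calc ∫⁻ ξ, q ξ * ‖V ξ‖ₑ ^ e = ∫⁻ ξ, liminf (fun n => q ξ * ‖U (ns n) ξ‖ₑ ^ e) atTop := by
        refine lintegral_congr_ae ?_
        filter_upwards [h2] with ξ hξ
        refine (Tendsto.liminf_eq ?_).symm
        exact ENNReal.Tendsto.const_mul (ENNReal.Tendsto.pow hξ.enorm) (Or.inr (hq' ξ))
    _ ≤ liminf (fun n => ∫⁻ ξ, q ξ * ‖U (ns n) ξ‖ₑ ^ e) atTop :=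
        lintegral_liminf_le' fun n => hq.aemeasurable.mul ((hU _).1.enorm.pow_const _)
    _ ≤ c := liminf_le_of_le ⟨0, by simp⟩ fun b hb => by
        obtain ⟨n, hn⟩ := hb.exists
        exact hn.trans (hc _)

lemma integrable_of_lintegral_le (hU : AEStronglyMeasurable U)
    (hq : Measurable q) (hq0 : ∀ ξ, 0 ≤ q ξ) {c : ℝ} (hc0 : 0 ≤ c)
    (hc : ∫⁻ ξ, ENNReal.ofReal (q ξ) * ‖U ξ‖ₑ ≤ ENNReal.ofReal c) :
    (Integrable fun ξ => q ξ * ‖U ξ‖) ∧ ∫ ξ, q ξ * ‖U ξ‖ ≤ c := by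
  have he : ∀ ξ, ENNReal.ofReal (q ξ * ‖U ξ‖) = ENNReal.ofReal (q ξ) * ‖U ξ‖ₑ := fun ξ => by
    rw [ENNReal.ofReal_mul (hq0 ξ), ofReal_norm]
  have hm : AEStronglyMeasurable fun ξ => q ξ * ‖U ξ‖ := hq.aestronglyMeasurable.mul hU.norm
  have h0 : 0 ≤ᵐ[volume] fun ξ => q ξ * ‖U ξ‖ :=
    Eventually.of_forall fun ξ => mul_nonneg (hq0 ξ) (norm_nonneg _)
  have hi : Integrable fun ξ => q ξ * ‖U ξ‖ := by
    refine ⟨hm, ?_⟩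
    rw [hasFiniteIntegral_iff_ofReal h0]
    simp only [he]
    exact hc.trans_lt ENNReal.ofReal_lt_top
  refine ⟨hi, ?_⟩
  rw [← ENNReal.ofReal_le_ofReal_iff hc0, ofReal_integral_eq_lintegral_ofReal hi h0]
  simpa only [he] using hc

lemma lintegral_eq_ofReal_integral (hq0 : ∀ ξ, 0 ≤ q ξ)
    (hi : Integrable fun ξ => q ξ * ‖U ξ‖) :
    ∫⁻ ξ, ENNReal.ofReal (q ξ) * ‖U ξ‖ₑ = ENNReal.ofReal (∫ ξ, q ξ * ‖U ξ‖) := by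
  rw [ofReal_integral_eq_lintegral_ofReal hi
    (Eventually.of_forall fun ξ => mul_nonneg (hq0 ξ) (norm_nonneg _))]
  congr with ξ
  rw [ENNReal.ofReal_mul (hq0 ξ), ofReal_norm]

/-- A density in `L²` with finite `Ḟ^{1,1}` norm is integrable. -/
lemma integrable_of_memLp_of_int1 (hU : MemLp U 2)
    (h : Integrable fun ξ => |ξ| * ‖U ξ‖) : Integrable U := by
  have h1 : IntegrableOn U (Icc (-1) 1) :=
    (hU.restrict (Icc (-1) 1)).integrable (by norm_num)
  have h2 : IntegrableOn U (Icc (-1) 1)ᶜ := by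
    refine Integrable.mono' h.integrableOn hU.1.restrict ?_
    refine (ae_restrict_iff' measurableSet_Icc.compl).2 (Eventually.of_forall fun ξ hξ => ?_)
    have : 1 ≤ |ξ| := by
      by_contra hc
      exact hξ (abs_le.1 (not_le.1 hc).le)
    nlinarith [norm_nonneg (U ξ)]
  rw [← integrableOn_univ, ← union_compl_self (Icc (-1 : ℝ) 1)]
  exact h1.union h2

lemma HasSpec.ae_unique (hU : HasSpec u U) (hV : HasSpec u V) :
    U =ᵐ[volume] V := hU.fhat_ae_eq.symm.trans hV.fhat_ae_eq

lemma HasSpec.congr (hU : HasSpec u U) (h : U =ᵐ[volume] V) :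
    HasSpec u V :=
  ⟨hU.integrable.congr h, (memLp_congr_ae h).1 hU.memLp, fun α => by
    rw [hU.eq, ift_congr_ae h]⟩

lemma HasSpec.add (hU : HasSpec u U) (hV : HasSpec v V) :
    HasSpec (fun α => u α + v α) (fun ξ => U ξ + V ξ) :=
  ⟨hU.integrable.add hV.integrable, hU.memLp.add hV.memLp, fun α => by
    rw [ift_add hU.integrable hV.integrable, ← hU.eq, ← hV.eq]; push_cast; rfl⟩

lemma HasSpec.sub (hU : HasSpec u U) (hV : HasSpec v V) :
    HasSpec (fun α => u α - v α) (fun ξ => U ξ - V ξ) :=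
  ⟨hU.integrable.sub hV.integrable, hU.memLp.sub hV.memLp, fun α => by
    rw [ift_sub hU.integrable hV.integrable, ← hU.eq, ← hV.eq]; push_cast; rfl⟩

lemma HasSpec.const_mul (hU : HasSpec u U) (c : ℝ) :
    HasSpec (fun α => c * u α) (fun ξ => c * U ξ) :=
  ⟨hU.integrable.const_mul _, hU.memLp.const_mul _, fun α => by
    rw [ift_const_mul, ← hU.eq]; push_cast; rfl⟩

lemma hasSpec_zero : HasSpec (fun _ => 0) (fun _ => 0) :=
  ⟨integrable_zero _ _ _, MemLp.zero, fun α => by simp [ift]⟩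

lemma n1_congr_ae (h : U =ᵐ[volume] V) : n1 U = n1 V := by
  rw [n1, n1, integral_congr_ae]
  filter_upwards [h] with x hx
  rw [hx]

lemma n2_congr_ae (h : U =ᵐ[volume] V) : n2 U = n2 V := by
  rw [n2, n2, integral_congr_ae]
  filter_upwards [h] with x hx
  rw [hx]

lemma Reg1.congr (hU : Reg1 u U) (h : U =ᵐ[volume] V) : Reg1 u V :=
  { hU.toHasSpec.congr h with
    int1 := hU.int1.congr (h.mono fun x hx => by simp only [hx]) }

lemma integrable_weight_sub (hq0 : ∀ ξ, 0 ≤ q ξ) (hq : Measurable q)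
    (hU : Integrable fun ξ => q ξ * ‖U ξ‖) (hV : Integrable fun ξ => q ξ * ‖V ξ‖)
    (hUm : AEStronglyMeasurable U) (hVm : AEStronglyMeasurable V) :
    Integrable fun ξ => q ξ * ‖U ξ - V ξ‖ := by
  refine (hU.add hV).mono' (hq.aestronglyMeasurable.mul (hUm.sub hVm).norm)
    (Eventually.of_forall fun ξ => ?_)
  rw [Real.norm_of_nonneg (mul_nonneg (hq0 ξ) (norm_nonneg _)), Pi.add_apply, ← mul_add]
  exact mul_le_mul_of_nonneg_left (norm_sub_le _ _) (hq0 ξ)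

lemma integrable_weight_add (hq0 : ∀ ξ, 0 ≤ q ξ) (hq : Measurable q)
    (hU : Integrable fun ξ => q ξ * ‖U ξ‖) (hV : Integrable fun ξ => q ξ * ‖V ξ‖)
    (hUm : AEStronglyMeasurable U) (hVm : AEStronglyMeasurable V) :
    Integrable fun ξ => q ξ * ‖U ξ + V ξ‖ := by
  have := integrable_weight_sub hq0 hq hU (V := fun ξ => -V ξ) (by simpa using hV) hUm hVm.neg
  simpa using this

lemma n1_add_le (hU : Integrable fun ξ => |ξ| * ‖U ξ‖)
    (hV : Integrable fun ξ => |ξ| * ‖V ξ‖) : n1 (fun ξ => U ξ + V ξ) ≤ n1 U + n1 V := by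
  rw [n1, n1, n1, ← integral_add hU hV]
  refine integral_mono_of_nonneg (Eventually.of_forall fun _ => by positivity) (hU.add hV)
    (Eventually.of_forall fun ξ => ?_)
  simp only [← mul_add]
  exact mul_le_mul_of_nonneg_left (norm_add_le _ _) (abs_nonneg _)

lemma n1_sub_le (hU : Integrable fun ξ => |ξ| * ‖U ξ‖)
    (hV : Integrable fun ξ => |ξ| * ‖V ξ‖) : n1 (fun ξ => U ξ - V ξ) ≤ n1 U + n1 V := by
  have := n1_add_le hU (V := fun ξ => -V ξ) (by simpa using hV)
  simpa [n1, sub_eq_add_neg] using this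

lemma n1_const_mul (c : ℂ) (U : ℝ → ℂ) : n1 (fun ξ => c * U ξ) = ‖c‖ * n1 U := by
  rw [n1, n1, ← integral_const_mul]
  congr with ξ
  rw [norm_mul]
  ring

lemma Reg1.sub (hU : Reg1 u U) (hV : Reg1 v V) :
    Reg1 (fun α => u α - v α) (fun ξ => U ξ - V ξ) :=
  { hU.toHasSpec.sub hV.toHasSpec with
    int1 := integrable_weight_sub abs_nonneg measurable_id.abs hU.int1 hV.int1 hU.integrable.1
      hV.integrable.1 }

lemma Reg1.const_mul (hU : Reg1 u U) (c : ℝ) :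
    Reg1 (fun α => c * u α) (fun ξ => c * U ξ) :=
  { hU.toHasSpec.const_mul c with
    int1 := (hU.int1.const_mul |c|).congr (Eventually.of_forall fun ξ => by
      simp only [norm_mul, norm_real, Real.norm_eq_abs]; ring) }

lemma ift_conj (U : ℝ → ℂ) (α : ℝ) : ift (fun ξ => conj (U (-ξ))) α = conj (ift U α) := by
  rw [ift, ift, ← integral_conj, ← integral_neg_eq_self]
  congr with ξ
  rw [map_mul, ← exp_conj]
  simp

lemma memLp_comp_neg (hU : MemLp U 2) : MemLp (fun ξ => U (-ξ)) 2 :=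
  hU.comp_measurePreserving (Measure.measurePreserving_neg volume)

lemma memLp_conj (hU : MemLp U 2) : MemLp (fun ξ => conj (U ξ)) 2 :=
  hU.of_le (continuous_conj.comp_aestronglyMeasurable hU.1)
    (Eventually.of_forall fun ξ => by simp)

lemma integrable_conj (hU : Integrable U) : Integrable fun ξ => conj (U ξ) :=
  hU.mono (continuous_conj.comp_aestronglyMeasurable hU.1)
    (Eventually.of_forall fun ξ => by simp)

/-- The spectral density of a real function is conjugate symmetric. -/
lemma HasSpec.conj_symm (h : HasSpec u U) :
    ∀ᵐ ξ, conj (U (-ξ)) = U ξ := by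
  have h2 : HasSpec u (fun ξ => conj (U (-ξ))) :=
    ⟨integrable_conj h.integrable.comp_neg, memLp_conj (memLp_comp_neg h.memLp), fun α => by
      rw [ift_conj, ← h.eq, conj_ofReal]⟩
  exact h2.ae_unique h

/-- The real part of the function with spectral density `U`. -/
def phys (U : ℝ → ℂ) (α : ℝ) : ℝ := (ift U α).re

lemma hasSpec_phys (hU : Integrable U) (hU2 : MemLp U 2)
    (h : ∀ᵐ ξ, conj (U (-ξ)) = U ξ) : HasSpec (phys U) U := by
  refine ⟨hU, hU2, fun α => ?_⟩
  have h1 : conj (ift U α) = ift U α := by rw [← ift_conj, ift_congr_ae h]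
  rw [phys, conj_eq_iff_re.1 h1]

/-- The symmetrization of a spectral density. -/
def sym (U : ℝ → ℂ) (ξ : ℝ) : ℂ := (U ξ + conj (U (-ξ))) / 2

lemma norm_sym_le (U : ℝ → ℂ) (ξ : ℝ) : ‖sym U ξ‖ ≤ (‖U ξ‖ + ‖U (-ξ)‖) / 2 := by
  rw [sym, norm_div]
  have := norm_add_le (U ξ) (conj (U (-ξ)))
  rw [norm_conj] at this
  simp only [Complex.norm_ofNat]
  linarith

lemma hasSpec_sym (hU : Integrable U) (hU2 : MemLp U 2) :
    HasSpec (phys U) (sym U) := by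
  have hi := integrable_conj hU.comp_neg
  have hs : sym U = fun ξ => (2 : ℂ)⁻¹ * (U ξ + conj (U (-ξ))) := by
    ext ξ
    rw [sym]
    ring
  rw [hs]
  refine ⟨(hU.add hi).const_mul _, (hU2.add (memLp_conj (memLp_comp_neg hU2))).const_mul _,
    fun α => ?_⟩
  rw [ift_const_mul, ift_add hU hi, ift_conj, add_conj, phys]
  push_cast
  ring

lemma integral_weight_sym_le (hq0 : ∀ ξ, 0 ≤ q ξ) (hqe : ∀ ξ, q (-ξ) = q ξ)
    (hq : Measurable q) (hU : AEStronglyMeasurable U)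
    (h : Integrable fun ξ => q ξ * ‖U ξ‖) :
    (Integrable fun ξ => q ξ * ‖sym U ξ‖) ∧ ∫ ξ, q ξ * ‖sym U ξ‖ ≤ ∫ ξ, q ξ * ‖U ξ‖ := by
  have hn : Integrable fun ξ => q ξ * ‖U (-ξ)‖ := by
    refine h.comp_neg.congr (Eventually.of_forall fun ξ => ?_)
    simp only [hqe]
  have hb : ∀ ξ, q ξ * ‖sym U ξ‖ ≤ (q ξ * ‖U ξ‖ + q ξ * ‖U (-ξ)‖) / 2 := fun ξ => by
    rw [← mul_add, mul_div_assoc]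
    exact mul_le_mul_of_nonneg_left (norm_sym_le U ξ) (hq0 ξ)
  have hm : AEStronglyMeasurable (sym U) := by
    have h1 : AEStronglyMeasurable fun ξ => U (-ξ) :=
      hU.comp_measurePreserving (Measure.measurePreserving_neg volume)
    exact (hU.add (continuous_conj.comp_aestronglyMeasurable h1)).mul_const (2 : ℂ)⁻¹
  have hi : Integrable fun ξ => q ξ * ‖sym U ξ‖ := by
    refine ((h.add hn).div_const 2).mono' (hq.aestronglyMeasurable.mul hm.norm)
      (Eventually.of_forall fun ξ => ?_)
    rw [Real.norm_of_nonneg (mul_nonneg (hq0 ξ) (norm_nonneg _))]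
    exact hb ξ
  refine ⟨hi, (integral_mono hi ((h.add hn).div_const 2) hb).trans_eq ?_⟩
  have he : ∫ ξ, q ξ * ‖U (-ξ)‖ = ∫ ξ, q ξ * ‖U ξ‖ := by
    rw [← integral_neg_eq_self]
    simp [hqe]
  rw [integral_div]
  simp only [Pi.add_apply]
  rw [integral_add h hn, he]
  ring

/-- Multiplication of the density by a bounded even real symbol. -/
lemma HasSpec.mul_symbol (h : HasSpec u U) {m : ℝ → ℝ} {M : ℝ}
    (hm : Measurable m) (hM : ∀ ξ, |m ξ| ≤ M) (he : ∀ ξ, m (-ξ) = m ξ) :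
    HasSpec (phys fun ξ => m ξ * U ξ) (fun ξ => m ξ * U ξ) := by
  have hmm : AEStronglyMeasurable fun ξ => (m ξ : ℂ) :=
    (measurable_ofReal.comp hm).aestronglyMeasurable
  have hb : ∀ᵐ ξ : ℝ, ‖(m ξ : ℂ)‖ ≤ M := Eventually.of_forall fun ξ => by
    rw [norm_real]; exact hM ξ
  refine hasSpec_phys (h.integrable.bdd_mul hmm hb) ?_ ?_
  · exact MemLp.of_le_mul (c := M) h.memLp (hmm.mul h.memLp.1) (hb.mono fun ξ hξ => by
      rw [norm_mul]; exact mul_le_mul_of_nonneg_right hξ (norm_nonneg _))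
  · filter_upwards [h.conj_symm] with ξ hξ
    rw [map_mul, hξ, conj_ofReal, he]

lemma memLp_ift_neg (φ : 𝓢(ℝ, ℂ)) : MemLp (fun α => ift φ (-α)) 2 :=
  (l2_ift φ.integrable (φ.memLp 2)).1.comp_measurePreserving (Measure.measurePreserving_neg volume)

lemma exists_schwartz_dspec (φ : 𝓢(ℝ, ℂ)) : ∃ ψ : 𝓢(ℝ, ℂ), ∀ ξ, ψ ξ = dspec φ ξ := by
  have hg : (fun ξ : ℝ => I * (ξ : ℂ)).HasTemperateGrowth := by fun_prop
  refine ⟨SchwartzMap.smulLeftCLM ℂ (fun ξ : ℝ => I * (ξ : ℂ)) φ, fun ξ => ?_⟩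
  rw [SchwartzMap.smulLeftCLM_apply_apply hg, dspec, smul_eq_mul]

/-- The Fourier transform turns differentiation into multiplication. -/
lemma fhat_deriv_ae_eq {u' : ℝ → ℝ} (hu : MemLp u 2) (hu' : MemLp u' 2)
    (hd : ∀ α, HasDerivAt u (u' α) α) : fhat u' =ᵐ[volume] dspec (fhat u) := by
  have hK1 : LocallyIntegrable (fhat u') := (memLp_fhat hu').locallyIntegrable (by norm_num)
  have hK2 : LocallyIntegrable (dspec (fhat u)) := by
    have := (memLp_fhat hu).locallyIntegrable (μ := (volume : Measure ℝ)) (by norm_num)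
    have h2 : Continuous fun ξ : ℝ => I * (ξ : ℂ) := by fun_prop
    rw [← locallyIntegrableOn_univ] at this ⊢
    exact this.continuousOn_mul h2.continuousOn isOpen_univ.isLocallyClosed
  have key : ∫⁻ ξ, ‖fhat u' ξ - dspec (fhat u) ξ‖ₑ ≤ ENNReal.ofReal 0 := by
    refine lintegral_le_of_dual (hK1.sub hK2) fun φ S _ => ?_
    obtain ⟨ψ, hψ⟩ := exists_schwartz_dspec φ
    have i1 : Integrable fun ξ => φ ξ * fhat u' ξ := (φ.memLp 2).integrable_mul (memLp_fhat hu')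
    have e2 : ∀ ξ, φ ξ * dspec (fhat u) ξ = ψ ξ * fhat u ξ := fun ξ => by
      rw [hψ, dspec, dspec]; ring
    have i2 : Integrable fun ξ => φ ξ * dspec (fhat u) ξ := by
      simp only [e2]
      exact (ψ.memLp 2).integrable_mul (memLp_fhat hu)
    have e3 : ∫ ξ, φ ξ * (fhat u' ξ - dspec (fhat u) ξ) = 0 := by
      simp only [mul_sub]
      rw [integral_sub i1 i2]
      simp only [e2]
      rw [integral_mul_fhat hu', integral_mul_fhat hu, ← mul_sub]
      have hib : ∫ α, ift φ (-α) * (u' α : ℂ) = - ∫ α, -(ift ψ (-α)) * (u α : ℂ) := by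
        have hφd : ∀ α : ℝ, HasDerivAt (fun α => ift φ (-α)) (-(ift ψ (-α))) α := by
          intro α
          have h1 := hasDerivAt_ift φ.integrable (by
            have := (ψ.integrable (μ := (volume : Measure ℝ))).norm
            simpa only [hψ, norm_dspec] using this) (-α)
          have h2 := h1.scomp α (hasDerivAt_neg α)
          have h3 : ift (dspec φ) = ift ψ := by
            rw [show dspec φ = ψ from funext fun ξ => (hψ ξ).symm]
          rw [h3] at h2
          simpa [Function.comp_def] using! h2
        refine integral_mul_deriv_eq_deriv_mul_of_integrable (fun x _ => hφd x)
          (fun x _ => (hd x).ofReal_comp) ?_ ?_ ?_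
        · exact (memLp_ift_neg φ).integrable_mul (memLp_ofReal hu')
        · exact (memLp_ift_neg ψ).neg.integrable_mul (memLp_ofReal hu)
        · exact (memLp_ift_neg φ).integrable_mul (memLp_ofReal hu)
      rw [hib]
      simp only [neg_mul, integral_neg, neg_neg, sub_self, mul_zero]
    refine le_of_eq_of_le (congrArg norm e3) ?_
    simp
  have hm : AEMeasurable fun ξ => ‖fhat u' ξ - dspec (fhat u) ξ‖ₑ :=
    (hK1.aestronglyMeasurable.sub hK2.aestronglyMeasurable).enorm
  rw [ENNReal.ofReal_zero, nonpos_iff_eq_zero, lintegral_eq_zero_iff' hm] at key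
  filter_upwards [key] with ξ hξ
  exact sub_eq_zero.1 (by simpa using hξ)

end

section

variable {C D D' : ℝ} {W u : ℝ → ℂ} {w : ℝ → ℝ} {k k' : ℝ → ℝ → ℝ}

/-- The integral operator `w ↦ ∫ k(α,β) w(α-β) dβ`. -/
def tk (k : ℝ → ℝ → ℝ) (w : ℝ → ℝ) (α : ℝ) : ℝ := ∫ β, k α β * w (α - β)

/-- A measurable kernel with the decay `D(1+β²)^{-1/2}`. -/
structure KBound (k : ℝ → ℝ → ℝ) (D : ℝ) : Prop where
  meas : Measurable fun p : ℝ × ℝ => k p.1 p.2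
  le : ∀ α β, |k α β| ≤ D * rho β

lemma KBound.nonneg (h : KBound k D) : 0 ≤ D := by
  have := (abs_nonneg _).trans (h.le 0 0)
  exact nonneg_of_mul_nonneg_left this (rho_pos 0)

lemma KBound.sub (h : KBound k D) (h' : KBound k' D') :
    KBound (fun α β => k α β - k' α β) (D + D') :=
  ⟨h.meas.sub h'.meas, fun α β => (abs_sub _ _).trans (by
    rw [add_mul]; exact add_le_add (h.le α β) (h'.le α β))⟩

lemma memLp_rho_complex : MemLp (fun β => (rho β : ℂ)) 2 := memLp_ofReal memLp_rho

/-- The `L²` norm of the decay profile. -/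
def rhoNorm : ℝ := l2 fun β => (rho β : ℂ)

lemma memLp_comp_sub {w : ℝ → ℂ} (hw : MemLp w 2) (α : ℝ) : MemLp (fun β => w (α - β)) 2 :=
  hw.comp_measurePreserving (Measure.measurePreserving_sub_left volume α)

lemma l2_comp_sub (w : ℝ → ℂ) (α : ℝ) : l2 (fun β => w (α - β)) = l2 w := by
  rw [l2, l2, integral_sub_left_eq_self (fun x => ‖w x‖ ^ 2)]

lemma HasSpec.l2_eq (h : HasSpec w W) :
    l2 (fun x => (w x : ℂ)) = √(2 * Real.pi) * l2 W := by
  have := (l2_ift h.integrable h.memLp).2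
  rw [l2, l2, ← Real.sqrt_mul (by positivity), ← this]
  simp only [h.eq]

lemma integrable_rho_mul {w : ℝ → ℂ} (hw : MemLp w 2) (α : ℝ) :
    (Integrable fun γ => rho (α - γ) * ‖w γ‖) ∧ ∫ γ, rho (α - γ) * ‖w γ‖ ≤ rhoNorm * l2 w := by
  have hr : MemLp (fun γ => (rho (α - γ) : ℂ)) 2 := memLp_comp_sub memLp_rho_complex α
  have e : ∀ γ, ‖(rho (α - γ) : ℂ)‖ * ‖w γ‖ = rho (α - γ) * ‖w γ‖ := fun γ => by
    rw [norm_real, Real.norm_of_nonneg (rho_pos _).le]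
  have h1 := integrable_norm_mul hr hw
  have h2 := integral_norm_mul_le hr hw
  simp only [e] at h1 h2
  rw [l2_comp_sub (fun β => (rho β : ℂ)) α] at h2
  exact ⟨h1, h2⟩

lemma KBound.integrable (h : KBound k D) (hw : MemLp w 2)
    (α : ℝ) : (Integrable fun β => k α β * w (α - β)) ∧
      ∫ β, |k α β * w (α - β)| ≤ D * (rhoNorm * l2 fun x => (w x : ℂ)) := by
  have hw' := memLp_ofReal hw
  have h1 := integrable_rho_mul (memLp_comp_sub hw' α) 0
  have e : ∀ β : ℝ, rho (0 - β) = rho β := fun β => by simp [rho]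
  simp only [e, norm_real, Real.norm_eq_abs] at h1
  rw [l2_comp_sub (fun x => (w x : ℂ)) α] at h1
  have hb : ∀ β, |k α β * w (α - β)| ≤ D * (rho β * |w (α - β)|) := fun β => by
    rw [abs_mul, ← mul_assoc]
    exact mul_le_mul_of_nonneg_right (h.le α β) (abs_nonneg _)
  have hwm : AEStronglyMeasurable fun β => w (α - β) :=
    hw.1.comp_measurePreserving (Measure.measurePreserving_sub_left volume α)
  have hkm : AEStronglyMeasurable fun β => k α β :=
    (h.meas.comp (measurable_const.prodMk measurable_id)).aestronglyMeasurable
  have hi : Integrable fun β => k α β * w (α - β) :=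
    (h1.1.const_mul D).mono' (hkm.mul hwm) (Eventually.of_forall hb)
  refine ⟨hi, (integral_mono hi.abs (h1.1.const_mul D) hb).trans ?_⟩
  rw [integral_const_mul]
  exact mul_le_mul_of_nonneg_left h1.2 h.nonneg

lemma KBound.abs_tk_le (h : KBound k D) (hw : MemLp w 2)
    (α : ℝ) : |tk k w α| ≤ D * (rhoNorm * l2 fun x => (w x : ℂ)) :=
  (abs_integral_le_integral_abs).trans (h.integrable hw α).2

lemma tk_sub (h : KBound k D) {v : ℝ → ℝ} (hv : MemLp v 2)
    (hw : MemLp w 2) (α : ℝ) : tk k (fun x => v x - w x) α = tk k v α - tk k w α := by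
  rw [tk, tk, tk, ← integral_sub (h.integrable hv α).1 (h.integrable hw α).1]
  congr with β
  ring

lemma tk_kernel_sub (h : KBound k D) (h' : KBound k' D')
    (hw : MemLp w 2) (α : ℝ) : tk (fun α β => k α β - k' α β) w α = tk k w α - tk k' w α := by
  rw [tk, tk, tk, ← integral_sub (h.integrable hw α).1 (h'.integrable hw α).1]
  congr with β
  ring

lemma KBound.integrable_prod (h : KBound k D)
    (hw : HasSpec w W) (hu : Integrable u) :
    Integrable fun p : ℝ × ℝ => u p.1 * ((k p.1 p.2 * w (p.1 - p.2) : ℝ) : ℂ) := by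
  have hwm := hw.continuous.measurable
  have hm : Measurable fun p : ℝ × ℝ => ((k p.1 p.2 * w (p.1 - p.2) : ℝ) : ℂ) :=
    measurable_ofReal.comp (h.meas.mul (hwm.comp (measurable_fst.sub measurable_snd)))
  have hum : AEStronglyMeasurable (fun p : ℝ × ℝ => u p.1) (volume.prod volume) := hu.1.comp_fst
  have hmm := hum.mul hm.aestronglyMeasurable
  rw [Measure.volume_eq_prod]
  refine (integrable_prod_iff hmm).2 ⟨Eventually.of_forall fun α => ?_, ?_⟩
  · exact ((h.integrable hw.memLp_fun α).1.ofReal).const_mul (u α)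
  · refine (hu.norm.mul_const (D * (rhoNorm * l2 fun x => (w x : ℂ)))).mono'
      hmm.norm.integral_prod_right' (Eventually.of_forall fun α => ?_)
    rw [Real.norm_of_nonneg (integral_nonneg fun _ => norm_nonneg _)]
    simp only [Pi.mul_apply, norm_mul ((u α)), norm_real, Real.norm_eq_abs]
    rw [integral_const_mul]
    exact mul_le_mul_of_nonneg_left (h.integrable hw.memLp_fun α).2 (norm_nonneg _)

lemma KBound.measurable_tk (h : KBound k D)
    (hw : HasSpec w W) : Measurable (tk k w) := by
  have hwm := hw.continuous.measurable
  have hm : Measurable fun p : ℝ × ℝ => k p.1 p.2 * w (p.1 - p.2) :=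
    h.meas.mul (hwm.comp (measurable_fst.sub measurable_snd))
  exact (hm.stronglyMeasurable.integral_prod_right' (ν := volume)).measurable

lemma KBound.tendsto_vk (h : KBound k D)
    (hw : HasSpec w W) (hu : Integrable u) :
    Tendsto (fun n : ℕ => ∫ p : ℝ × ℝ, u p.1 * vk (1 / (((n + 1 : ℕ) : ℝ) + 1)) p.2 *
        (ift W (p.1 - p.2) * ((k p.1 p.2 * p.2 : ℝ) : ℂ))) atTop
      (𝓝 (∫ α, u α * tk k w α)) := by
  have hi := h.integrable_prod hw hu
  have e0 : ∫ α, u α * tk k w α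
      = ∫ p : ℝ × ℝ, u p.1 * ((k p.1 p.2 * w (p.1 - p.2) : ℝ) : ℂ) := by
    rw [Measure.volume_eq_prod] at hi ⊢
    rw [integral_prod _ hi]
    congr with α
    simp only [integral_const_mul, tk, integral_complex_ofReal]
  have e1 : ∀ (n : ℕ) (p : ℝ × ℝ), u p.1 * vk (1 / (((n + 1 : ℕ) : ℝ) + 1)) p.2 *
        (ift W (p.1 - p.2) * ((k p.1 p.2 * p.2 : ℝ) : ℂ))
      = ((vk (1 / (((n + 1 : ℕ) : ℝ) + 1)) p.2 * p.2 : ℝ) : ℂ) *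
        (u p.1 * ((k p.1 p.2 * w (p.1 - p.2) : ℝ) : ℂ)) := by
    intro n p
    rw [← hw.eq]
    push_cast
    ring
  rw [e0]
  simp only [e1]
  refine tendsto_integral_of_dominated_convergence
    (fun p => ‖u p.1 * ((k p.1 p.2 * w (p.1 - p.2) : ℝ) : ℂ)‖) ?_ hi.norm ?_ ?_
  · intro n
    refine AEStronglyMeasurable.mul ?_ hi.1
    have : Measurable fun p : ℝ × ℝ => vk (1 / (((n + 1 : ℕ) : ℝ) + 1)) p.2 * p.2 := by
      unfold vk; fun_prop
    exact (measurable_ofReal.comp this).aestronglyMeasurable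
  · intro n
    refine Eventually.of_forall fun p => ?_
    rw [norm_mul, norm_real, Real.norm_eq_abs]
    exact mul_le_of_le_one_left (norm_nonneg _) (abs_vk_mul_le (by positivity) _)
  · have hae : ∀ᵐ p : ℝ × ℝ, p.2 ≠ 0 := by
      have : ∀ᵐ x : ℝ, x ≠ 0 := by simp [ae_iff, measure_singleton]
      exact Measure.quasiMeasurePreserving_snd.ae this
    filter_upwards [hae] with p hp
    have h1 := ((tendsto_vk_mul hp).comp (tendsto_add_atTop_nat 1)).ofReal
    simpa [Function.comp_def] using h1.mul_const (u p.1 * ((k p.1 p.2 * w (p.1 - p.2) : ℝ) : ℂ))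

lemma one_div_lt_one_aux (n : ℕ) :
    (0 : ℝ) < 1 / (((n + 1 : ℕ) : ℝ) + 1) ∧ 1 / (((n + 1 : ℕ) : ℝ) + 1) < 1 := by
  refine ⟨by positivity, ?_⟩
  rw [div_lt_one (by positivity)]
  push_cast
  have : (0 : ℝ) ≤ n := n.cast_nonneg
  linarith

lemma KBound.norm_integral_le_l2 (h : KBound k D)
    (hbb : BB (fun p => ((k p.1 p.2 * p.2 : ℝ) : ℂ)) C)
    (hw : HasSpec w W) (hu : Integrable u) (hu2 : MemLp u 2) :
    ‖∫ α, u α * tk k w α‖ ≤ Real.pi * C * (√(2 * Real.pi) * l2 u * l2 W) :=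
  le_of_tendsto (h.tendsto_vk hw hu).norm (Eventually.of_forall fun n =>
    hbb.norm_integral_vk_le_l2 hu hu2 hw.integrable hw.memLp (one_div_lt_one_aux n).1
      (one_div_lt_one_aux n).2)

/-- The function `v(α - β)` has norm `∫ ‖V‖`. -/
lemma bb_ift_sub {V : ℝ → ℂ} (hV : Integrable V) :
    BB (fun p => ift V (p.1 - p.2)) (∫ ξ, ‖V ξ‖) := by
  refine BB.of_rep hV measurable_id measurable_id.neg ?_ (fun p => norm_ift_le _ _) ?_
  · exact ((continuous_ift hV).comp (by fun_prop)).measurable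
  · refine Eventually.of_forall fun p => ?_
    rw [ift]
    congr with ξ
    rw [chi]
    congr 2
    simp only [id, Pi.neg_apply]
    push_cast
    ring

lemma KBound.norm_integral_le_sup (h : KBound k D)
    (hbb : BB (fun p => ((k p.1 p.2 * p.2 : ℝ) : ℂ)) C)
    (hw : HasSpec w W) (hu : Integrable u) {S : ℝ} (hS : ∀ ζ, ‖ift u ζ‖ ≤ S) :
    ‖∫ α, u α * tk k w α‖ ≤ Real.pi * ((∫ ξ, ‖W ξ‖) * C) * S :=
  le_of_tendsto (h.tendsto_vk hw hu).norm (Eventually.of_forall fun n =>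
    ((bb_ift_sub hw.integrable).mul hbb).norm_integral_vk_le hu hS (one_div_lt_one_aux n).1
      (one_div_lt_one_aux n).2)

/-- The `L²` bound for the operator. -/
lemma KBound.memLp_tk (h : KBound k D)
    (hbb : BB (fun p => ((k p.1 p.2 * p.2 : ℝ) : ℂ)) C)
    (hw : HasSpec w W) :
    MemLp (tk k w) 2 ∧ l2 (fhat (tk k w)) ≤ Real.pi * C * l2 W := by
  set M := D * (rhoNorm * l2 fun x => (w x : ℂ)) with hM
  have hC := hbb.nonneg
  have hm : Measurable fun α => (tk k w α : ℂ) := measurable_ofReal.comp (h.measurable_tk hw)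
  have hloc : LocallyIntegrable fun α => (tk k w α : ℂ) := by
    refine (locallyIntegrable_const M).mono hm.aestronglyMeasurable (Eventually.of_forall fun α => ?_)
    rw [norm_real, Real.norm_eq_abs, Real.norm_eq_abs]
    exact (h.abs_tk_le hw.memLp_fun α).trans (le_abs_self _)
  have h0 : 0 ≤ Real.pi * C * (√(2 * Real.pi) * l2 W) :=
    mul_nonneg (mul_nonneg Real.pi_pos.le hC) (mul_nonneg (by positivity) (l2_nonneg _))
  have key := lintegral_sq_le_of_dual hloc (C := Real.pi * C * (√(2 * Real.pi) * l2 W))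
    (fun φ => (h.norm_integral_le_l2 hbb hw φ.integrable (φ.memLp 2)).trans_eq (by ring))
  have hq : ∀ α, ENNReal.ofReal (tk k w α ^ 2) = ‖(tk k w α : ℂ)‖ₑ ^ 2 := fun α => by
    rw [← ofReal_norm, norm_real, ← ENNReal.ofReal_pow (norm_nonneg _), Real.norm_eq_abs, sq_abs]
  have hi : Integrable fun α => tk k w α ^ 2 := by
    refine ⟨((h.measurable_tk hw).pow_const 2).aestronglyMeasurable, ?_⟩
    rw [hasFiniteIntegral_iff_ofReal (Eventually.of_forall fun α => sq_nonneg _)]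
    simp only [hq]
    exact key.trans_lt ENNReal.ofReal_lt_top
  have hmem : MemLp (tk k w) 2 :=
    (memLp_two_iff_integrable_sq (h.measurable_tk hw).aestronglyMeasurable).2 hi
  refine ⟨hmem, ?_⟩
  have h2 : ∫ α, tk k w α ^ 2 ≤ (Real.pi * C * (√(2 * Real.pi) * l2 W)) ^ 2 := by
    rw [← ENNReal.ofReal_le_ofReal_iff (by positivity),
      ofReal_integral_eq_lintegral_ofReal hi (Eventually.of_forall fun α => sq_nonneg _)]
    simpa only [hq] using key
  have hp := Real.pi_pos
  refine Real.sqrt_le_iff.2 ⟨mul_nonneg (by positivity) (l2_nonneg _), ?_⟩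
  rw [integral_norm_sq_fhat hmem]
  refine (mul_le_mul_of_nonneg_left h2 (by positivity)).trans_eq ?_
  have h3 : √(2 * Real.pi) ^ 2 = 2 * Real.pi := Real.sq_sqrt (by positivity)
  field_simp
  rw [h3]
  ring

/-- The `L¹` bound for the spectral density of the operator. -/
lemma KBound.lintegral_fhat_tk_le (h : KBound k D)
    (hbb : BB (fun p => ((k p.1 p.2 * p.2 : ℝ) : ℂ)) C)
    (hw : HasSpec w W) :
    ∫⁻ ξ, ‖fhat (tk k w) ξ‖ₑ ≤ ENNReal.ofReal (Real.pi * C * ∫ ξ, ‖W ξ‖) := by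
  have hmem := (h.memLp_tk hbb hw).1
  have hp := Real.pi_pos
  refine lintegral_le_of_dual ((memLp_fhat hmem).locallyIntegrable (by norm_num)) fun φ S hS => ?_
  rw [integral_mul_fhat hmem]
  have hφi : Integrable (𝓕⁻ φ : 𝓢(ℝ, ℂ)) := (𝓕⁻ φ : 𝓢(ℝ, ℂ)).integrable
  have hpt : ∀ α, ift φ (-α) = (𝓕⁻ φ : 𝓢(ℝ, ℂ)) (-α / (2 * Real.pi)) := fun α => by
    rw [SchwartzMap.fourierInv_coe, fourierInv_eq_ift]
    congr 1
    field_simp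
  have hui : Integrable fun α => ift φ (-α) := by
    simp only [hpt]
    have := (hφi.comp_div (R := 2 * Real.pi) (by positivity)).comp_neg
    simpa using this
  have hinv : ∀ ζ, ift (fun α => ift φ (-α)) ζ = 2 * Real.pi * φ ζ := by
    intro ζ
    have h1 : (𝓕 (𝓕⁻ φ : 𝓢(ℝ, ℂ)) : 𝓢(ℝ, ℂ)) ζ = φ ζ := by simp
    rw [SchwartzMap.fourier_coe, Real.fourier_real_eq_integral_exp_smul] at h1
    rw [← h1, ift]
    have h2 := Measure.integral_comp_div (fun v : ℝ => cexp (((-2 * Real.pi * v * ζ : ℝ) : ℂ) * I) •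
      (𝓕⁻ φ : 𝓢(ℝ, ℂ)) v) (-(2 * Real.pi))
    have h3 : |(-(2 * Real.pi))| = 2 * Real.pi := by rw [abs_neg, abs_of_pos (by positivity)]
    rw [h3] at h2
    rw [real_smul] at h2
    push_cast at h2 ⊢
    rw [← h2]
    congr with α
    rw [hpt, smul_eq_mul, mul_comm]
    congr 2
    · field_simp
    · ring
  have := h.norm_integral_le_sup hbb hw hui (S := 2 * Real.pi * S) (fun ζ => by
    rw [hinv, norm_mul, norm_mul]
    simp only [Complex.norm_ofNat, norm_real, Real.norm_eq_abs, abs_of_pos hp]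
    exact mul_le_mul_of_nonneg_left (hS ζ) (by positivity))
  rw [norm_mul, norm_inv, norm_mul]
  simp only [Complex.norm_ofNat, norm_real, Real.norm_eq_abs, abs_of_pos hp]
  refine (mul_le_mul_of_nonneg_left this (by positivity)).trans_eq ?_
  field_simp

end

section

variable {C D N c x y : ℝ} {W : ℝ → ℂ} {H H' w w' : ℝ → ℝ} {A k l : ℝ → ℝ → ℝ}

lemma integral_eq_zero_of_hasDerivAt_ne (hc : ContinuousAt H c)
    (hd : ∀ x, x ≠ c → HasDerivAt H (H' x) x) (hH : Integrable H) (hH' : Integrable H') :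
    ∫ x, H' x = 0 := by
  have t1 : Tendsto H atTop (𝓝 0) :=
    tendsto_zero_of_hasDerivAt_of_integrableOn_Ioi (a := c) (fun x hx => hd x (ne_of_gt hx))
      hH'.integrableOn hH.integrableOn
  have t2 : Tendsto H atBot (𝓝 0) :=
    tendsto_zero_of_hasDerivAt_of_integrableOn_Iic (a := c - 1)
      (fun x hx => hd x (by have : x ≤ c - 1 := hx; intro h; linarith))
      hH'.integrableOn hH.integrableOn
  have e1 := integral_Ioi_of_hasDerivAt_of_tendsto hc.continuousWithinAt
    (fun x hx => hd x (ne_of_gt hx)) hH'.integrableOn t1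
  have e2 := integral_Iic_of_hasDerivAt_of_tendsto hc.continuousWithinAt
    (fun x hx => hd x (ne_of_lt hx)) hH'.integrableOn t2
  rw [← intervalIntegral.integral_Iic_add_Ioi hH'.integrableOn hH'.integrableOn, e1, e2]
  ring

lemma abs_sub_le_of_hasDerivAt_ne {L : ℝ} {s : Set ℝ} (hs : s.OrdConnected)
    (hc : ContinuousAt H c) (hd : ∀ x, x ≠ c → HasDerivAt H (H' x) x)
    (hL : ∀ x ∈ s, |H' x| ≤ L) (hx : x ∈ s) (hy : y ∈ s) : |H x - H y| ≤ L * |x - y| := by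
  have hcont : Continuous H := continuous_iff_continuousAt.2 fun z => by
    rcases eq_or_ne z c with rfl | hz
    exacts [hc, (hd z hz).continuousAt]
  have aux : ∀ x y, x ≤ y → Icc x y ⊆ s → c ∉ Ioo x y → |H y - H x| ≤ L * (y - x) := by
    intro x y hxy hsub hcn
    rcases hxy.eq_or_lt with rfl | hlt
    · simp
    obtain ⟨z, hz, he⟩ := exists_hasDerivAt_eq_slope H H' hlt hcont.continuousOn
      (fun z hz => hd z (by rintro rfl; exact hcn hz))
    have h1 := hL z (hsub (Ioo_subset_Icc_self hz))
    rw [he, abs_div, abs_of_pos (sub_pos.2 hlt), div_le_iff₀ (sub_pos.2 hlt)] at h1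
    exact h1
  have main : ∀ x y, x ≤ y → x ∈ s → y ∈ s → |H y - H x| ≤ L * (y - x) := by
    intro x y hxy hx hy
    have hsub := hs.out hx hy
    by_cases hcm : c ∈ Ioo x y
    · have h1 := aux x c hcm.1.le ((Icc_subset_Icc_right hcm.2.le).trans hsub) (by simp)
      have h2 := aux c y hcm.2.le ((Icc_subset_Icc_left hcm.1.le).trans hsub) (by simp)
      have := abs_sub_le (H y) (H c) (H x)
      linarith
    · exact aux x y hxy hsub hcm
  rcases le_total x y with hxy | hxy
  · rw [abs_sub_comm, abs_sub_comm x y, abs_of_nonneg (sub_nonneg.2 hxy)]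
    exact main x y hxy hx hy
  · rw [abs_of_nonneg (sub_nonneg.2 hxy)]
    exact main y x hxy hy hx

lemma rho_le_two_mul (h : |x - y| ≤ 1) : rho x ≤ 2 * rho y := by
  have h1 := rho_sq x
  have h2 := rho_sq y
  refine abs_le_of_sq_le_sq' ?_ (by linarith [rho_pos y]) |>.2
  rw [mul_pow, h1, h2, ← one_div, ← div_eq_mul_inv, div_le_div_iff₀ (by positivity) (by positivity)]
  obtain ⟨h3, h4⟩ := abs_le.1 h
  nlinarith [sq_nonneg (x + (x - y)), sq_nonneg (2 * x - y)]

/-- A pair of kernels derived from a potential `A(α,γ)` (`γ = α - β`): `k = -∂_γ A`, `l = ∂_α A`. -/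
structure Ker (k l A : ℝ → ℝ → ℝ) (D : ℝ) : Prop where
  hk : KBound k D
  hl : KBound l D
  meas : Measurable fun p : ℝ × ℝ => A p.1 p.2
  le : ∀ α γ, |A α γ| ≤ D * rho (α - γ)
  cont_right : ∀ α, ContinuousAt (A α) α
  cont_left : ∀ γ, ContinuousAt (fun α => A α γ) γ
  deriv_right : ∀ α γ, γ ≠ α → HasDerivAt (A α) (-(k α (α - γ))) γ
  deriv_left : ∀ α γ, α ≠ γ → HasDerivAt (fun α => A α γ) (l α (α - γ)) α

lemma Ker.sub {k' l' A' : ℝ → ℝ → ℝ} {D' : ℝ} (h : Ker k l A D) (h' : Ker k' l' A' D') :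
    Ker (fun α β => k α β - k' α β) (fun α β => l α β - l' α β) (fun α β => A α β - A' α β)
      (D + D') where
  hk := h.hk.sub h'.hk
  hl := h.hl.sub h'.hl
  meas := h.meas.sub h'.meas
  le α γ := (abs_sub _ _).trans (by rw [add_mul]; exact add_le_add (h.le α γ) (h'.le α γ))
  cont_right α := (h.cont_right α).sub (h'.cont_right α)
  cont_left γ := (h.cont_left γ).sub (h'.cont_left γ)
  deriv_right α γ hne := ((h.deriv_right α γ hne).sub (h'.deriv_right α γ hne)).congr_deriv (by ring)
  deriv_left α γ hne := (h.deriv_left α γ hne).sub (h'.deriv_left α γ hne)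

lemma HasSpec.deriv (hw : Reg1 w W) (hW : MemLp (dspec W) 2) :
    HasSpec (deriv w) (dspec W) := ⟨hw.integrable_dspec, hW, hw.deriv_eq⟩

lemma Ker.integrable_pot (h : Ker k l A D)
    (hw : MemLp w 2) (α : ℝ) : Integrable fun γ => A α γ * w γ := by
  have h1 := (integrable_rho_mul (memLp_ofReal hw) α).1
  refine (h1.const_mul D).mono' ?_ (Eventually.of_forall fun γ => ?_)
  · exact (h.meas.comp (measurable_const.prodMk measurable_id)).aestronglyMeasurable.mul hw.1
  · rw [norm_mul, norm_real, ← mul_assoc, Real.norm_eq_abs]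
    exact mul_le_mul_of_nonneg_right (h.le α γ) (norm_nonneg _)

lemma tk_eq_integral (k : ℝ → ℝ → ℝ) (w : ℝ → ℝ) (α : ℝ) :
    tk k w α = ∫ γ, k α (α - γ) * w γ := by
  rw [tk, ← integral_sub_left_eq_self (fun γ => k α (α - γ) * w γ) volume α]
  simp

lemma KBound.integrable' (h : KBound k D) (hw : MemLp w 2)
    (α : ℝ) : Integrable fun γ => k α (α - γ) * w γ := by
  have := (h.integrable hw α).1.comp_sub_left α
  simpa using this

lemma Ker.tk_eq (h : Ker k l A D) (hw : MemLp w 2)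
    (hw' : MemLp w' 2) (hd : ∀ x, HasDerivAt w (w' x) x) (α : ℝ) :
    tk k w α = ∫ γ, A α γ * w' γ := by
  have i1 := h.hk.integrable' hw α
  have i2 := h.integrable_pot hw' α
  have := integral_eq_zero_of_hasDerivAt_ne (H := fun γ => A α γ * w γ)
    (H' := fun γ => A α γ * w' γ - k α (α - γ) * w γ) (c := α)
    ((h.cont_right α).mul (hd α).continuousAt)
    (fun γ hγ => ((h.deriv_right α γ hγ).mul (hd γ)).congr_deriv (by ring))
    (h.integrable_pot hw α) (i2.sub i1)
  rw [integral_sub i2 i1] at this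
  rw [tk_eq_integral]
  linarith

/-- Differentiation of the operator. -/
lemma Ker.hasDerivAt (h : Ker k l A D) (hw : MemLp w 2)
    (hw' : MemLp w' 2) (hd : ∀ x, HasDerivAt w (w' x) x) (α : ℝ) :
    HasDerivAt (tk k w) (tk l w' α) α := by
  have e : tk k w = fun α => ∫ γ, A α γ * w' γ := funext fun α => h.tk_eq hw hw' hd α
  have hD := h.hk.nonneg
  rw [e, tk_eq_integral]
  refine (hasDerivAt_integral_of_dominated_loc_of_lip (F := fun α γ => A α γ * w' γ)
    (F' := fun γ => l α (α - γ) * w' γ) (s := Metric.ball α 1)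
    (bound := fun γ => 2 * D * (rho (α - γ) * ‖(w' γ : ℂ)‖)) (Metric.ball_mem_nhds α one_pos)
    (Eventually.of_forall fun x => (h.integrable_pot hw' x).1) (h.integrable_pot hw' α)
    (h.hl.integrable' hw' α).1 ?_ ((integrable_rho_mul (memLp_ofReal hw') α).1.const_mul _) ?_).2
  · refine Eventually.of_forall fun γ => LipschitzOnWith.of_dist_le_mul fun x hx y hy => ?_
    have hr := rho_pos (α - γ)
    have h1 := abs_sub_le_of_hasDerivAt_ne (H := fun x => A x γ) (H' := fun x => l x (x - γ))
      (c := γ) (L := D * (2 * rho (α - γ))) (s := Metric.ball α 1)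
      (convex_ball α 1).ordConnected (h.cont_left γ) (fun x hx => h.deriv_left x γ hx)
      (fun x hx => (h.hl.le x (x - γ)).trans
        (mul_le_mul_of_nonneg_left (rho_le_two_mul (by
          rw [sub_sub_sub_cancel_right, ← Real.dist_eq]
          exact (Metric.mem_ball.1 hx).le)) hD)) hx hy
    have hn : 0 ≤ 2 * D * (rho (α - γ) * ‖(w' γ : ℂ)‖) := by positivity
    rw [Real.dist_eq, Real.dist_eq, ← sub_mul, abs_mul, Real.coe_nnabs, abs_of_nonneg hn, norm_real,
      Real.norm_eq_abs]
    calc |A x γ - A y γ| * |w' γ| ≤ D * (2 * rho (α - γ)) * |x - y| * |w' γ| :=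
          mul_le_mul_of_nonneg_right h1 (abs_nonneg _)
      _ = _ := by ring
  · have hae : ∀ᵐ γ : ℝ, γ ≠ α := by simp [ae_iff, measure_singleton]
    filter_upwards [hae] with γ hγ
    exact (h.deriv_left α γ hγ.symm).mul_const _

lemma fhat_sub {u v : ℝ → ℝ} (hu : MemLp u 2) (hv : MemLp v 2) :
    fhat (fun x => u x - v x) =ᵐ[volume] fun ξ => fhat u ξ - fhat v ξ := by
  have h := fhat_lin hu hv 1 (-1)
  simpa [sub_eq_add_neg] using h

/-- Kernel pairs with a bound `C` for both kernels. -/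
structure KerBB (k l A : ℝ → ℝ → ℝ) (D C : ℝ) : Prop extends Ker k l A D where
  bbk : BB (fun p => ((k p.1 p.2 * p.2 : ℝ) : ℂ)) C
  bbl : BB (fun p => ((l p.1 p.2 * p.2 : ℝ) : ℂ)) C

lemma KerBB.dspec_fhat (h : KerBB k l A D C)
    (hw : Reg1 w W) (hW : MemLp (dspec W) 2) :
    fhat (tk l (deriv w)) =ᵐ[volume] dspec (fhat (tk k w)) :=
  fhat_deriv_ae_eq (h.hk.memLp_tk h.bbk hw.toHasSpec).1
    (h.hl.memLp_tk h.bbl (HasSpec.deriv hw hW)).1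
    (h.hasDerivAt hw.memLp_fun (HasSpec.deriv hw hW).memLp_fun hw.hasDerivAt_deriv)

/-- The `Ḣ¹` bound. -/
lemma KerBB.l2_dspec_le (h : KerBB k l A D C)
    (hw : Reg1 w W) (hW : MemLp (dspec W) 2) :
    MemLp (dspec (fhat (tk k w))) 2 ∧ l2 (dspec (fhat (tk k w))) ≤ Real.pi * C * l2 (dspec W) := by
  have h1 := h.hl.memLp_tk h.bbl (HasSpec.deriv hw hW)
  have h2 := h.dspec_fhat hw hW
  exact ⟨(memLp_congr_ae h2).1 (memLp_fhat h1.1), by rw [← l2_congr_ae h2]; exact h1.2⟩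

lemma KerBB.lintegral_le_of_memLp (h : KerBB k l A D C)
    (hw : Reg1 w W) (hW : MemLp (dspec W) 2) :
    ∫⁻ ξ, ENNReal.ofReal |ξ| * ‖fhat (tk k w) ξ‖ₑ ≤ ENNReal.ofReal (Real.pi * C * n1 W) := by
  have h1 := h.hl.lintegral_fhat_tk_le h.bbl (HasSpec.deriv hw hW)
  simp only [norm_dspec] at h1
  refine (lintegral_congr_ae ?_).trans_le h1
  filter_upwards [h.dspec_fhat hw hW] with ξ hξ
  rw [hξ, ← ofReal_norm (dspec _ _), norm_dspec, ENNReal.ofReal_mul (abs_nonneg _), ofReal_norm]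

/-- The indicator of `[-N, N]`. -/
def cut (N ξ : ℝ) : ℝ := if |ξ| ≤ N then 1 else 0

lemma measurable_cut (N : ℝ) : Measurable (cut N) :=
  Measurable.ite (measurableSet_le measurable_id.abs measurable_const) measurable_const
    measurable_const

lemma abs_cut_le (N ξ : ℝ) : |cut N ξ| ≤ 1 := by
  unfold cut; split_ifs <;> simp

lemma cut_neg (N ξ : ℝ) : cut N (-ξ) = cut N ξ := by simp [cut]

lemma cut_nonneg (N ξ : ℝ) : 0 ≤ cut N ξ := by unfold cut; split_ifs <;> simp

lemma abs_mul_cut_le (hN : 0 ≤ N) (ξ : ℝ) : |ξ| * |cut N ξ| ≤ N := by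
  unfold cut; split_ifs with h <;> simp [h, hN]

lemma tendsto_cut (ξ : ℝ) : Tendsto (fun n : ℕ => cut n ξ) atTop (𝓝 1) := by
  refine tendsto_const_nhds.congr' ?_
  filter_upwards [eventually_ge_atTop ⌈|ξ|⌉₊] with n hn
  rw [cut, if_pos (Nat.ceil_le.1 hn)]

lemma HasSpec.cut (hw : HasSpec w W) (hN : 0 ≤ N) :
    Reg1 (phys fun ξ => cut N ξ * W ξ) (fun ξ => cut N ξ * W ξ) ∧
      MemLp (dspec fun ξ => cut N ξ * W ξ) 2 := by
  have h1 := hw.mul_symbol (measurable_cut N) (abs_cut_le N) (cut_neg N)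
  have hb : ∀ ξ : ℝ, |ξ| * ‖(Muskat.cut N ξ : ℂ) * W ξ‖ ≤ N * ‖W ξ‖ := fun ξ => by
    rw [norm_mul, norm_real, Real.norm_eq_abs, ← mul_assoc]
    exact mul_le_mul_of_nonneg_right (abs_mul_cut_le hN ξ) (norm_nonneg _)
  refine ⟨{ h1 with int1 := ?_ }, ?_⟩
  · refine (hw.integrable.norm.const_mul N).mono'
      (measurable_id.abs.aestronglyMeasurable.mul h1.integrable.1.norm)
      (Eventually.of_forall fun ξ => ?_)
    rw [Real.norm_of_nonneg (by positivity)]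
    exact hb ξ
  · refine MemLp.of_le_mul (c := N) hw.memLp (aestronglyMeasurable_dspec h1.integrable.1)
      (Eventually.of_forall fun ξ => ?_)
    rw [norm_dspec]
    exact hb ξ

lemma norm_cut_mul_sub_le (N ξ : ℝ) (z : ℂ) : ‖(cut N ξ : ℂ) * z - z‖ ≤ ‖z‖ := by
  unfold cut; split_ifs <;> simp

lemma tendsto_norm_cut_mul_sub (ξ : ℝ) (z : ℂ) :
    Tendsto (fun n : ℕ => ‖(cut n ξ : ℂ) * z - z‖) atTop (𝓝 0) := by
  have h := (((tendsto_cut ξ).ofReal.mul_const z).sub_const z).norm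
  simpa using h

lemma tendsto_l2_cut (hW : MemLp W 2) :
    Tendsto (fun n : ℕ => l2 fun ξ => cut n ξ * W ξ - W ξ) atTop (𝓝 0) := by
  have : Tendsto (fun n : ℕ => ∫ ξ, ‖(cut n ξ : ℂ) * W ξ - W ξ‖ ^ 2) atTop (𝓝 (∫ _ : ℝ, (0 : ℝ))) := by
    refine tendsto_integral_of_dominated_convergence (fun ξ => ‖W ξ‖ ^ 2) (fun n => ?_)
      (integrable_sq hW) (fun n => Eventually.of_forall fun ξ => ?_)
      (Eventually.of_forall fun ξ => ?_)
    · exact ((((measurable_ofReal.comp (measurable_cut n)).aestronglyMeasurable.mul hW.1).sub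
        hW.1).norm.pow 2)
    · rw [Real.norm_of_nonneg (by positivity)]
      exact pow_le_pow_left₀ (norm_nonneg _) (norm_cut_mul_sub_le _ _ _) 2
    · simpa using (tendsto_norm_cut_mul_sub ξ (W ξ)).pow 2
  simpa [l2] using this.sqrt

lemma tendsto_n1_cut (hWm : AEStronglyMeasurable W)
    (hW : Integrable fun ξ => |ξ| * ‖W ξ‖) :
    Tendsto (fun n : ℕ => n1 fun ξ => cut n ξ * W ξ - W ξ) atTop (𝓝 0) := by
  have : Tendsto (fun n : ℕ => ∫ ξ : ℝ, |ξ| * ‖(cut n ξ : ℂ) * W ξ - W ξ‖) atTop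
      (𝓝 (∫ _ : ℝ, (0 : ℝ))) := by
    refine tendsto_integral_of_dominated_convergence (fun ξ => |ξ| * ‖W ξ‖) (fun n => ?_)
      hW (fun n => Eventually.of_forall fun ξ => ?_) (Eventually.of_forall fun ξ => ?_)
    · exact measurable_id.abs.aestronglyMeasurable.mul
        (((measurable_ofReal.comp (measurable_cut n)).aestronglyMeasurable.mul hWm).sub hWm).norm
    · rw [Real.norm_of_nonneg (by positivity)]
      exact mul_le_mul_of_nonneg_left (norm_cut_mul_sub_le _ _ _) (abs_nonneg _)
    · simpa using (tendsto_norm_cut_mul_sub ξ (W ξ)).const_mul |ξ|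
  simpa [n1] using this

lemma n1_mul_cut_le (hW : Integrable fun ξ => |ξ| * ‖W ξ‖) (N : ℝ) :
    n1 (fun ξ => cut N ξ * W ξ) ≤ n1 W := by
  refine integral_mono_of_nonneg (Eventually.of_forall fun _ => by positivity) hW
    (Eventually.of_forall fun ξ => ?_)
  simp only [norm_mul, norm_real, Real.norm_eq_abs]
  exact mul_le_mul_of_nonneg_left (mul_le_of_le_one_left (norm_nonneg _) (abs_cut_le N ξ))
    (abs_nonneg _)

/-- The `Ḟ^{1,1}` bound. -/
lemma KerBB.reg1 (h : KerBB k l A D C)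
    (hw : Reg1 w W) :
    Reg1 (tk k w) (fhat (tk k w)) ∧ n1 (fhat (tk k w)) ≤ Real.pi * C * n1 W := by
  have hC := h.bbk.nonneg
  have hp := Real.pi_pos
  have hS := h.hk.memLp_tk h.bbk hw.toHasSpec
  set v : ℕ → ℝ → ℝ := fun n => phys fun ξ => cut n ξ * W ξ with hv
  have hvr : ∀ n, Reg1 (v n) (fun ξ => cut n ξ * W ξ) := fun n =>
    (hw.toHasSpec.cut n.cast_nonneg).1
  have hvd : ∀ n : ℕ, MemLp (dspec fun ξ => cut n ξ * W ξ) 2 := fun n =>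
    (hw.toHasSpec.cut n.cast_nonneg).2
  have hSn : ∀ n, MemLp (tk k (v n)) 2 := fun n => (h.hk.memLp_tk h.bbk (hvr n).toHasSpec).1
  have hdiff : ∀ n, HasSpec (fun x => v n x - w x) (fun ξ => cut n ξ * W ξ - W ξ) := fun n =>
    (hvr n).toHasSpec.sub hw.toHasSpec
  have hsubtk : ∀ n, tk k (fun x => v n x - w x) = fun α => tk k (v n) α - tk k w α := fun n =>
    funext fun α => tk_sub h.hk (hvr n).memLp_fun hw.memLp_fun α
  have hl2 : Tendsto (fun n => l2 fun ξ => fhat (tk k (v n)) ξ - fhat (tk k w) ξ) atTop (𝓝 0) := by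
    have h0 := (tendsto_l2_cut hw.memLp).const_mul (Real.pi * C)
    rw [mul_zero] at h0
    refine squeeze_zero (fun _ => l2_nonneg _) (fun n => ?_) h0
    have h1 := (h.hk.memLp_tk h.bbk (hdiff n)).2
    rw [hsubtk] at h1
    rwa [l2_congr_ae (fhat_sub (hSn n) hS.1)] at h1
  have hfat : ∫⁻ ξ, ENNReal.ofReal |ξ| * ‖fhat (tk k w) ξ‖ₑ ≤ ENNReal.ofReal (Real.pi * C * n1 W) := by
    have := lintegral_le_of_tendsto_l2 (fun n => memLp_fhat (hSn n)) (memLp_fhat hS.1) hl2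
      (q := fun ξ => ENNReal.ofReal |ξ|) (by fun_prop) (fun _ => ENNReal.ofReal_ne_top) (e := 1)
      (c := ENNReal.ofReal (Real.pi * C * n1 W)) (fun n => by
        simp only [pow_one]
        refine (h.lintegral_le_of_memLp (hvr n) (hvd n)).trans (ENNReal.ofReal_le_ofReal ?_)
        exact mul_le_mul_of_nonneg_left (n1_mul_cut_le hw.int1 n) (by positivity))
    simpa only [pow_one] using this
  have hb := integrable_of_lintegral_le (memLp_fhat hS.1).1 measurable_id.abs abs_nonneg
    (mul_nonneg (by positivity) (n1_nonneg W)) hfat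
  have hcont : Continuous (tk k w) := by
    have hu : TendstoUniformly (fun n => tk k (v n)) (tk k w) atTop := by
      rw [Metric.tendstoUniformly_iff]
      intro ε hε
      have h0 := (tendsto_l2_cut hw.memLp).const_mul (D * (rhoNorm * √(2 * Real.pi)))
      rw [mul_zero] at h0
      filter_upwards [h0.eventually (gt_mem_nhds hε)] with n hn α
      rw [dist_comm, Real.dist_eq]
      have h1 := h.hk.abs_tk_le (hdiff n).memLp_fun α
      rw [hsubtk, (hdiff n).l2_eq] at h1
      exact h1.trans_lt (by linarith)
    refine hu.continuous (Eventually.of_forall fun n => ?_).frequently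
    exact continuous_iff_continuousAt.2 fun α => (h.hasDerivAt (hvr n).memLp_fun
      (HasSpec.deriv (hvr n) (hvd n)).memLp_fun (hvr n).hasDerivAt_deriv α).continuousAt
  refine ⟨{ hasSpec_fhat hcont hS.1 (integrable_of_memLp_of_int1 (memLp_fhat hS.1) hb.1) with
    int1 := hb.1 }, hb.2⟩

end

section

variable {C a α γ : ℝ} {G : ℝ × ℝ → ℂ} {F : ℝ → ℂ} {P P' f g p Φ : ℝ → ℝ} {k : ℝ → ℝ → ℝ}

lemma BB.congr_ae {H : ℝ × ℝ → ℂ} (h : BB G C) (hH : Measurable H) (hb : ∀ p, ‖H p‖ ≤ C)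
    (he : H =ᵐ[volume] G) : BB H C := by
  refine ⟨hH, hb, fun V hV S hS => ?_⟩
  refine (congrArg norm (integral_congr_ae ?_)).trans_le (h.dual V hV S hS)
  filter_upwards [he] with p hp
  rw [hp]

/-- A profile `p` with primitive `Φ`, and bounds `P`, `P'` for the substitution operator. -/
structure Prof (p Φ P P' : ℝ → ℝ) : Prop where
  meas : Measurable p
  hasDerivAt : ∀ x, HasDerivAt Φ (p x) x
  le_one : ∀ x, |p x| ≤ 1
  zero : Φ 0 = 0
  bb : ∀ (G : ℝ × ℝ → ℝ) (a : ℝ), a < 1 → BB (fun q => (G q : ℂ)) a →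
    BB (fun q => ((p (G q) : ℝ) : ℂ)) (P a)
  bb_sub : ∀ (G H : ℝ × ℝ → ℝ) (a b : ℝ), a < 1 → BB (fun q => (G q : ℂ)) a →
    BB (fun q => (H q : ℂ)) a → BB (fun q => (G q : ℂ) - H q) b →
    BB (fun q => ((p (G q) : ℝ) : ℂ) - (p (H q) : ℝ)) (P' a * b)

lemma Prof.abs_le (h : Prof p Φ P P') (x : ℝ) : |Φ x| ≤ |x| := by
  have := Convex.norm_image_sub_le_of_norm_deriv_le (f := Φ) (s := univ) (C := 1)
    (x := 0) (y := x) (fun x _ => (h.hasDerivAt x).differentiableAt)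
    (fun x _ => by rw [(h.hasDerivAt x).deriv]; exact h.le_one x) convex_univ trivial trivial
  simpa [h.zero] using this

/-- The profile of the double layer potential. -/
def prof0 (x : ℝ) : ℝ := (1 + x ^ 2)⁻¹

/-- The profile of the nonlinear term. -/
def prof1 (x : ℝ) : ℝ := x * (1 + x ^ 2)⁻¹

lemma isProf_prof0 : Prof prof0 Real.arctan (fun a => (1 - a ^ 2)⁻¹)
    (fun a => 2 * a * ((1 - a ^ 2)⁻¹) ^ 2) where
  meas := by unfold prof0; fun_prop
  hasDerivAt x := by simpa [prof0] using Real.hasDerivAt_arctan x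
  le_one x := by
    rw [prof0, abs_of_pos (by positivity)]
    exact inv_le_one_of_one_le₀ (by nlinarith [sq_nonneg x])
  zero := Real.arctan_zero
  bb G a ha hG := by
    simpa [prof0] using hG.inv_one_add_sq ha
  bb_sub G H a b ha hG hH hGH := by
    have h := ((hH.add hG).mul hGH.neg).mul ((hG.inv_one_add_sq ha).mul (hH.inv_one_add_sq ha))
    have he : (fun q => ((prof0 (G q) : ℝ) : ℂ) - (prof0 (H q) : ℝ)) = fun q =>
        (((H q : ℂ) + G q) * -((G q : ℂ) - H q)) * ((1 + (G q : ℂ) ^ 2)⁻¹ * (1 + (H q : ℂ) ^ 2)⁻¹) := by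
      ext q
      have h1 : ((1 + G q ^ 2 : ℝ) : ℂ) ≠ 0 := ofReal_ne_zero.2 (by positivity)
      have h2 : ((1 + H q ^ 2 : ℝ) : ℂ) ≠ 0 := ofReal_ne_zero.2 (by positivity)
      push_cast at h1 h2
      rw [prof0, prof0]
      push_cast
      field_simp
      ring
    rw [he]
    convert h using 1
    ring

lemma isProf_prof1 : Prof prof1 (fun x => 2⁻¹ * Real.log (1 + x ^ 2)) (fun a => a * (1 - a ^ 2)⁻¹)
    (fun a => (1 + a ^ 2) * ((1 - a ^ 2)⁻¹) ^ 2) where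
  meas := by unfold prof1; fun_prop
  hasDerivAt x := by
    have h1 : HasDerivAt (fun x : ℝ => 1 + x ^ 2) (2 * x) x := by
      simpa using (hasDerivAt_pow 2 x).const_add 1
    have h2 := (h1.log (by positivity)).const_mul (2⁻¹ : ℝ)
    refine h2.congr_deriv ?_
    rw [prof1]
    field_simp
  le_one x := by
    rw [prof1, abs_mul, abs_inv, abs_of_pos (by positivity : (0 : ℝ) < 1 + x ^ 2),
      ← div_eq_mul_inv, div_le_one (by positivity), ← sq_abs]
    nlinarith [sq_nonneg (|x| - 1), abs_nonneg x]
  zero := by simp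
  bb G a ha hG := by
    simpa [prof1] using hG.mul (hG.inv_one_add_sq ha)
  bb_sub G H a b ha hG hH hGH := by
    have h1 : BB (fun _ : ℝ × ℝ => (1 : ℂ)) 1 := by simpa using BB.const 1
    have h := ((h1.sub (hG.mul hH)).mul hGH).mul
      ((hG.inv_one_add_sq ha).mul (hH.inv_one_add_sq ha))
    have he : (fun q => ((prof1 (G q) : ℝ) : ℂ) - (prof1 (H q) : ℝ)) = fun q =>
        ((1 - (G q : ℂ) * H q) * ((G q : ℂ) - H q)) *
          ((1 + (G q : ℂ) ^ 2)⁻¹ * (1 + (H q : ℂ) ^ 2)⁻¹) := by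
      ext q
      have h1 : ((1 + G q ^ 2 : ℝ) : ℂ) ≠ 0 := ofReal_ne_zero.2 (by positivity)
      have h2 : ((1 + H q ^ 2 : ℝ) : ℂ) ≠ 0 := ofReal_ne_zero.2 (by positivity)
      push_cast at h1 h2
      rw [prof1, prof1]
      push_cast
      field_simp
      ring
    rw [he]
    convert h using 1
    ring

/-- The kernel `p(Δ)(f'(α-β) - Δ)/β`. -/
def kk (p f : ℝ → ℝ) (α β : ℝ) : ℝ :=
  p (diffQuot f α β) * ((deriv f (α - β) - diffQuot f α β) / β)

/-- The kernel `p(Δ)(f'(α) - Δ)/β`. -/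
def lk (p f : ℝ → ℝ) (α β : ℝ) : ℝ :=
  p (diffQuot f α β) * ((deriv f α - diffQuot f α β) / β)

/-- The potential of the kernels `kk` and `lk`. -/
def pot (Φ f : ℝ → ℝ) (α γ : ℝ) : ℝ := Φ (dslope f α γ)

lemma dslope_eq_diffQuot (f : ℝ → ℝ) (h : γ ≠ α) :
    dslope f α γ = diffQuot f α (α - γ) := by
  rw [dslope_of_ne _ h, slope_def_field, diffQuot, sub_sub_cancel, ← neg_div_neg_eq]
  congr 1 <;> ring

lemma dslope_symm (f : ℝ → ℝ) (α γ : ℝ) : dslope f α γ = dslope f γ α := by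
  rcases eq_or_ne γ α with rfl | h
  · rfl
  · rw [dslope_of_ne _ h, dslope_of_ne _ h.symm, slope_comm]

lemma Reg1.abs_dslope_le (h : Reg1 f F) (α γ : ℝ) :
    |dslope f α γ| ≤ (n1 F + 2 * ∫ ξ, ‖F ξ‖) * rho (α - γ) := by
  rcases eq_or_ne γ α with rfl | hne
  · have h1 : rho (γ - γ) = 1 := by simp [rho]
    have h2 : 0 ≤ ∫ ξ, ‖F ξ‖ := integral_nonneg fun _ => norm_nonneg _
    rw [dslope_same, h1, mul_one]
    linarith [h.abs_deriv_le γ]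
  · rw [dslope_eq_diffQuot f hne]
    exact h.abs_diffQuot_le_rho _ _

lemma hasDerivAt_dslope_right (hf : Differentiable ℝ f) (h : γ ≠ α) :
    HasDerivAt (dslope f α) ((diffQuot f α (α - γ) - deriv f γ) / (α - γ)) γ := by
  have h0 : α - γ ≠ 0 := sub_ne_zero.2 h.symm
  have h1 : HasDerivAt (fun γ => (f α - f γ) / (α - γ))
      ((-deriv f γ * (α - γ) - (f α - f γ) * (-1)) / (α - γ) ^ 2) γ :=
    ((hf γ).hasDerivAt.const_sub (f α)).div ((hasDerivAt_id γ).const_sub α) h0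
  have h2 : HasDerivAt (dslope f α)
      ((-deriv f γ * (α - γ) - (f α - f γ) * (-1)) / (α - γ) ^ 2) γ := by
    refine h1.congr_of_eventuallyEq ?_
    filter_upwards [isOpen_ne.mem_nhds h] with x hx
    rw [dslope_eq_diffQuot f hx, diffQuot, sub_sub_cancel]
  refine h2.congr_deriv ?_
  rw [diffQuot, sub_sub_cancel]
  field_simp
  ring

lemma hasDerivAt_dslope_left (hf : Differentiable ℝ f) (h : α ≠ γ) :
    HasDerivAt (fun α => dslope f α γ) ((deriv f α - diffQuot f α (α - γ)) / (α - γ)) α := by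
  have h1 := hasDerivAt_dslope_right hf h
  have h2 : (fun α => dslope f α γ) = dslope f γ := funext fun x => dslope_symm f x γ
  rw [h2]
  refine h1.congr_deriv ?_
  have h0 : α - γ ≠ 0 := sub_ne_zero.2 h
  have h0' : γ - α ≠ 0 := sub_ne_zero.2 h.symm
  rw [diffQuot, diffQuot, sub_sub_cancel, sub_sub_cancel]
  rw [← neg_sub α γ]
  field_simp
  ring

lemma Reg1.differentiable (h : Reg1 f F) : Differentiable ℝ f :=
  fun α => (h.hasDerivAt α).differentiableAt

/-- The decay constant of the kernels of `f`. -/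
def decayC (F : ℝ → ℂ) : ℝ := kerC F + (n1 F + 2 * ∫ ξ, ‖F ξ‖)

lemma abs_mul_le_of_le_one {x y B : ℝ} (hx : |x| ≤ 1) (hy : |y| ≤ B) : |x * y| ≤ B := by
  rw [abs_mul]
  exact (mul_le_of_le_one_left (abs_nonneg _) hx).trans hy

lemma Prof.measurable_kk (hp : Prof p Φ P P')
    (h : Reg1 f F) : Measurable fun q : ℝ × ℝ => kk p f q.1 q.2 := by
  have h1 := h.measurable_diffQuot
  have h2 := h.continuous_deriv.measurable
  have h3 := hp.meas
  unfold kk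
  fun_prop

lemma Prof.measurable_lk (hp : Prof p Φ P P')
    (h : Reg1 f F) : Measurable fun q : ℝ × ℝ => lk p f q.1 q.2 := by
  have h1 := h.measurable_diffQuot
  have h2 := h.continuous_deriv.measurable
  have h3 := hp.meas
  unfold lk
  fun_prop

lemma Prof.ker (hp : Prof p Φ P P') (h : Reg2 f F) :
    Ker (kk p f) (lk p f) (pot Φ f) (decayC F) := by
  have hn1 := n1_nonneg F
  have hn : 0 ≤ ∫ ξ, ‖F ξ‖ := integral_nonneg fun _ => norm_nonneg _
  have hkc := kerC_nonneg F
  have hle : kerC F ≤ decayC F := by rw [decayC]; linarith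
  have hle' : n1 F + 2 * ∫ ξ, ‖F ξ‖ ≤ decayC F := by rw [decayC]; linarith
  have hd := h.toReg1.differentiable
  have hm0 : Measurable fun q : ℝ × ℝ => dslope f q.1 q.2 := by
    have h1 : (fun q : ℝ × ℝ => dslope f q.1 q.2)
        = fun q => if q.2 = q.1 then deriv f q.1 else diffQuot f q.1 (q.1 - q.2) := by
      ext q
      split_ifs with hq
      · rw [hq, dslope_same]
      · exact dslope_eq_diffQuot f hq
    rw [h1]
    refine Measurable.ite (measurableSet_eq_fun measurable_snd measurable_fst)
      (h.toReg1.continuous_deriv.measurable.comp measurable_fst) ?_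
    exact h.toReg1.measurable_diffQuot.comp (measurable_fst.prodMk (measurable_fst.sub measurable_snd))
  have hΦc : ∀ x, ContinuousAt Φ x := fun x => (hp.hasDerivAt x).continuousAt
  have hΦm : Measurable Φ := (continuous_iff_continuousAt.2 hΦc).measurable
  refine ⟨⟨hp.measurable_kk h.toReg1, fun α β => ?_⟩, ⟨hp.measurable_lk h.toReg1, fun α β => ?_⟩,
    hΦm.comp hm0, fun α γ => ?_, fun α => ?_, fun γ => ?_, fun α γ hne => ?_, fun α γ hne => ?_⟩
  · exact (abs_mul_le_of_le_one (hp.le_one _) (h.abs_ker_left α β)).trans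
      (mul_le_mul_of_nonneg_right hle (rho_pos β).le)
  · exact (abs_mul_le_of_le_one (hp.le_one _) (h.abs_ker_right α β)).trans
      (mul_le_mul_of_nonneg_right hle (rho_pos β).le)
  · exact (hp.abs_le _).trans ((h.toReg1.abs_dslope_le α γ).trans
      (mul_le_mul_of_nonneg_right hle' (rho_pos _).le))
  · exact ContinuousAt.comp (g := Φ) (hΦc _) (continuousAt_dslope_same.2 (hd α))
  · have h2 : (fun α => dslope f α γ) = dslope f γ := funext fun x => dslope_symm f x γ
    have h3 : ContinuousAt (fun α => dslope f α γ) γ := by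
      rw [h2]; exact continuousAt_dslope_same.2 (hd γ)
    exact ContinuousAt.comp (g := Φ) (f := fun α => dslope f α γ) (hΦc _) h3
  · have h1 := (hp.hasDerivAt (dslope f α γ)).comp γ (hasDerivAt_dslope_right hd hne)
    refine h1.congr_deriv ?_
    rw [dslope_eq_diffQuot f hne, kk, sub_sub_cancel]
    ring
  · have h1 := HasDerivAt.comp α (h₂ := Φ) (h := fun α => dslope f α γ) (hp.hasDerivAt (dslope f α γ))
      (hasDerivAt_dslope_left hd hne)
    refine h1.congr_deriv ?_
    rw [dslope_eq_diffQuot f hne.symm, lk]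

lemma ae_snd_ne_zero : ∀ᵐ p : ℝ × ℝ, p.2 ≠ 0 := by
  have : ∀ᵐ x : ℝ, x ≠ 0 := by simp [ae_iff, measure_singleton]
  exact Measure.quasiMeasurePreserving_snd.ae this

/-- Reduction of bounds for `G(α,β)/β·β` to bounds for `G`. -/
lemma BB.of_kernel (hG : BB G C)
    (hk : Measurable fun p : ℝ × ℝ => k p.1 p.2)
    (he : ∀ α β, β ≠ 0 → ((k α β * β : ℝ) : ℂ) = G (α, β)) :
    BB (fun p => ((k p.1 p.2 * p.2 : ℝ) : ℂ)) C := by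
  refine hG.congr_ae (measurable_ofReal.comp (hk.mul measurable_snd)) (fun p => ?_) ?_
  · rcases eq_or_ne p.2 0 with h | h
    · simpa [h] using hG.nonneg
    · rw [he _ _ h]; exact hG.bdd _
  · filter_upwards [ae_snd_ne_zero] with p hp
    exact he _ _ hp

lemma Reg1.bb_left (h : Reg1 f F) :
    BB (fun p => ((deriv f (p.1 - p.2) : ℝ) : ℂ)) (n1 F) := by simpa using h.bb_deriv 1

lemma Reg1.bb_right (h : Reg1 f F) :
    BB (fun p => ((deriv f p.1 : ℝ) : ℂ)) (n1 F) := by simpa using h.bb_deriv 0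

lemma Prof.kerBB (hp : Prof p Φ P P') (h : Reg2 f F)
    (ha : n1 F ≤ a) (ha1 : a < 1) :
    KerBB (kk p f) (lk p f) (pot Φ f) (decayC F) (P a * (2 * a)) := by
  have hq := h.toReg1.bb_diffQuot.mono ha
  have hP := hp.bb _ a ha1 hq
  refine { hp.ker h with bbk := ?_, bbl := ?_ }
  · refine BB.of_kernel ((hP.mul ((h.toReg1.bb_left.mono ha).sub hq)).mono (by rw [two_mul]))
      (hp.measurable_kk h.toReg1) fun α β hβ => ?_
    rw [kk]
    have : (β : ℂ) ≠ 0 := ofReal_ne_zero.2 hβ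
    push_cast
    field_simp
  · refine BB.of_kernel ((hP.mul ((h.toReg1.bb_right.mono ha).sub hq)).mono (by rw [two_mul]))
      (hp.measurable_lk h.toReg1) fun α β hβ => ?_
    rw [lk]
    have : (β : ℂ) ≠ 0 := ofReal_ne_zero.2 hβ
    push_cast
    field_simp

lemma diffQuot_sub (f g : ℝ → ℝ) (α β : ℝ) :
    diffQuot (fun x => f x - g x) α β = diffQuot f α β - diffQuot g α β := by
  rw [diffQuot, diffQuot, diffQuot]; ring

lemma deriv_sub_fun {G : ℝ → ℂ} (hf : Reg1 f F) (hg : Reg1 g G) (α : ℝ) :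
    deriv (fun x => f x - g x) α = deriv f α - deriv g α :=
  deriv_fun_sub (hf.differentiable α) (hg.differentiable α)

lemma Prof.kerBB_sub (hp : Prof p Φ P P') {G : ℝ → ℂ}
    (hf : Reg2 f F) (hg : Reg2 g G) (haf : n1 F ≤ a) (hag : n1 G ≤ a) (ha1 : a < 1) :
    KerBB (fun α β => kk p f α β - kk p g α β) (fun α β => lk p f α β - lk p g α β)
      (fun α β => pot Φ f α β - pot Φ g α β) (decayC F + decayC G)
      ((P' a * (2 * a) + P a * 2) * n1 (fun ξ => F ξ - G ξ)) := by
  have hd := hf.toReg1.sub hg.toReg1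
  set b := n1 (fun ξ => F ξ - G ξ) with hb
  have qf := hf.toReg1.bb_diffQuot.mono haf
  have qg := hg.toReg1.bb_diffQuot.mono hag
  have qd := hd.bb_diffQuot
  have hqd : BB (fun q => ((diffQuot f q.1 q.2 : ℝ) : ℂ) - (diffQuot g q.1 q.2 : ℝ)) b := by
    simpa only [diffQuot_sub, ofReal_sub] using qd
  have hPg := hp.bb _ a ha1 qg
  have hPs := hp.bb_sub _ _ a b ha1 qf qg hqd
  refine { (hp.ker hf).sub (hp.ker hg) with bbk := ?_, bbl := ?_ }
  · have hl : BB (fun p => ((deriv f (p.1 - p.2) : ℝ) : ℂ) - (deriv g (p.1 - p.2) : ℝ)) b := by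
      simpa only [deriv_sub_fun hf.toReg1 hg.toReg1, ofReal_sub] using hd.bb_left
    refine BB.of_kernel (k := fun α β => kk p f α β - kk p g α β) (((hPs.mul ((hf.toReg1.bb_left.mono haf).sub qf)).add
      (hPg.mul (hl.sub hqd))).mono (D := (P' a * (2 * a) + P a * 2) * b) (le_of_eq (by ring)))
      ((hp.measurable_kk hf.toReg1).sub (hp.measurable_kk hg.toReg1)) fun α β hβ => ?_
    rw [kk, kk]
    have : (β : ℂ) ≠ 0 := ofReal_ne_zero.2 hβ
    push_cast
    field_simp
    ring
  · have hl : BB (fun p => ((deriv f p.1 : ℝ) : ℂ) - (deriv g p.1 : ℝ)) b := by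
      simpa only [deriv_sub_fun hf.toReg1 hg.toReg1, ofReal_sub] using hd.bb_right
    refine BB.of_kernel (k := fun α β => lk p f α β - lk p g α β) (((hPs.mul ((hf.toReg1.bb_right.mono haf).sub qf)).add
      (hPg.mul (hl.sub hqd))).mono (D := (P' a * (2 * a) + P a * 2) * b) (le_of_eq (by ring)))
      ((hp.measurable_lk hf.toReg1).sub (hp.measurable_lk hg.toReg1)) fun α β hβ => ?_
    rw [lk, lk]
    have : (β : ℂ) ≠ 0 := ofReal_ne_zero.2 hβ
    push_cast
    field_simp
    ring

/-- Differentiation of the operator for kernels with quadratic decay. -/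
lemma Ker.hasDerivAt_of_decay {l A : ℝ → ℝ → ℝ} {D E : ℝ} (h : Ker k l A D)
    (hE : ∀ α β, |l α β| ≤ E * rho β ^ 2) {w : ℝ → ℝ} {W : ℝ → ℂ} (hw : Reg1 w W) (α : ℝ) :
    (Integrable fun β => l α β * deriv w (α - β)) ∧
      HasDerivAt (tk k w) (tk l (deriv w) α) α := by
  have hlm : ∀ α, AEStronglyMeasurable fun β => l α β := fun α =>
    (h.hl.meas.comp (measurable_const.prodMk measurable_id)).aestronglyMeasurable
  have key : ∀ (v : ℝ → ℝ) (V : ℝ → ℂ), Reg1 v V → ∀ α,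
      (Integrable fun β => l α β * deriv v (α - β)) ∧
      |tk l (deriv v) α| ≤ (E * ∫ β, rho β ^ 2) * n1 V := by
    intro v V hv α
    have hb : ∀ β, ‖l α β * deriv v (α - β)‖ ≤ n1 V * (E * rho β ^ 2) := fun β => by
      rw [norm_mul, mul_comm]
      exact mul_le_mul (hv.abs_deriv_le _) (hE α β) (norm_nonneg _) (n1_nonneg V)
    have hi : Integrable fun β => n1 V * (E * rho β ^ 2) :=
      (integrable_rho_sq.const_mul E).const_mul (n1 V)
    have hvm : AEStronglyMeasurable fun β => deriv v (α - β) :=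
      (hv.continuous_deriv.comp (by fun_prop)).aestronglyMeasurable
    refine ⟨hi.mono' ((hlm α).mul hvm) (Eventually.of_forall hb), ?_⟩
    refine (norm_integral_le_of_norm_le hi (Eventually.of_forall hb)).trans_eq ?_
    rw [integral_const_mul, integral_const_mul]
    ring
  refine ⟨(key w W hw α).1, ?_⟩
  set v : ℕ → ℝ → ℝ := fun n => phys fun ξ => cut n ξ * W ξ with hv
  have hvr : ∀ n, Reg1 (v n) (fun ξ => cut n ξ * W ξ) := fun n =>
    (hw.toHasSpec.cut n.cast_nonneg).1
  have hvd : ∀ n : ℕ, MemLp (dspec fun ξ => cut n ξ * W ξ) 2 := fun n =>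
    (hw.toHasSpec.cut n.cast_nonneg).2
  have hdiff : ∀ n, Reg1 (fun x => v n x - w x) (fun ξ => cut n ξ * W ξ - W ξ) := fun n =>
    (hvr n).sub hw
  refine hasDerivAt_of_tendstoUniformly (f := fun n => tk k (v n)) (f' := fun n => tk l (deriv (v n)))
    (l := atTop) ?_ (Eventually.of_forall fun n x => h.hasDerivAt (hvr n).memLp_fun
      (HasSpec.deriv (hvr n) (hvd n)).memLp_fun (hvr n).hasDerivAt_deriv x) ?_ α
  · rw [Metric.tendstoUniformly_iff]
    intro ε hε
    have h0 := (tendsto_n1_cut hw.integrable.1 hw.int1).const_mul (E * ∫ β, rho β ^ 2)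
    rw [mul_zero] at h0
    filter_upwards [h0.eventually (gt_mem_nhds hε)] with n hn α
    rw [dist_comm, Real.dist_eq]
    have h1 := (key _ _ (hdiff n) α).2
    have h2 : tk l (deriv fun x => v n x - w x) α = tk l (deriv (v n)) α - tk l (deriv w) α := by
      rw [tk, tk, tk, ← integral_sub (key _ _ (hvr n) α).1 (key _ _ hw α).1]
      congr with β
      rw [deriv_sub_fun (hvr n) hw]
      ring
    rw [h2] at h1
    exact h1.trans_lt hn
  · intro x
    have h0 := (tendsto_l2_cut hw.memLp).const_mul (D * (rhoNorm * √(2 * Real.pi)))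
    rw [mul_zero] at h0
    rw [tendsto_iff_dist_tendsto_zero]
    refine squeeze_zero (fun _ => dist_nonneg) (fun n => ?_) h0
    have h1 := h.hk.abs_tk_le (hdiff n).memLp_fun x
    rw [tk_sub h.hk (hvr n).memLp_fun hw.memLp_fun, (hdiff n).toHasSpec.l2_eq] at h1
    rw [Real.dist_eq]
    exact h1.trans_eq (by ring)

end

section

variable {C D : ℝ} {U W : ℝ → ℂ} {u v w : ℝ → ℝ} {A k l : ℝ → ℝ → ℝ}

lemma lintegral_inv_one_add_sq (ξ : ℝ) :
    ∫⁻ t in Ioi (0 : ℝ), ENNReal.ofReal (ξ ^ 2 / (1 + t ^ 2 * ξ ^ 2))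
      = ENNReal.ofReal (Real.pi / 2) * ENNReal.ofReal |ξ| := by
  rcases eq_or_ne ξ 0 with rfl | hξ
  · simp
  have hb := abs_pos.2 hξ
  have e : ∀ t : ℝ, ξ ^ 2 / (1 + t ^ 2 * ξ ^ 2) = ξ ^ 2 * (1 + (|ξ| * t) ^ 2)⁻¹ := fun t => by
    rw [mul_pow, sq_abs, div_eq_mul_inv, mul_comm (t ^ 2)]
  have hi : Integrable (fun t : ℝ => ξ ^ 2 * (1 + (|ξ| * t) ^ 2)⁻¹) :=
    (integrable_inv_one_add_sq.comp_mul_left' hb.ne').const_mul _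
  simp only [e]
  rw [← ofReal_integral_eq_lintegral_ofReal hi.integrableOn
    (Eventually.of_forall fun t => by positivity), integral_const_mul,
    integral_comp_mul_left_Ioi (fun x => (1 + x ^ 2)⁻¹) 0 hb, mul_zero, integral_Ioi_inv_one_add_sq,
    Real.arctan_zero, sub_zero, smul_eq_mul, ← ENNReal.ofReal_mul (by positivity), ← sq_abs]
  congr 1
  field_simp

/-- The density weighted by `|ξ|^{1/2}`. -/
def hspec (U : ℝ → ℂ) (ξ : ℝ) : ℂ := (√|ξ| : ℝ) * U ξ

lemma norm_hspec_sq (U : ℝ → ℂ) (ξ : ℝ) : ‖hspec U ξ‖ ^ 2 = |ξ| * ‖U ξ‖ ^ 2 := by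
  rw [hspec, norm_mul, norm_real, mul_pow, Real.norm_eq_abs, sq_abs, Real.sq_sqrt (abs_nonneg _)]

lemma enorm_hspec_sq (U : ℝ → ℂ) (ξ : ℝ) :
    ‖hspec U ξ‖ₑ ^ 2 = ENNReal.ofReal |ξ| * ‖U ξ‖ₑ ^ 2 := by
  rw [← ofReal_norm, ← ofReal_norm, ← ENNReal.ofReal_pow (norm_nonneg _),
    ← ENNReal.ofReal_pow (norm_nonneg _), ← ENNReal.ofReal_mul (abs_nonneg _), norm_hspec_sq]

lemma aestronglyMeasurable_hspec (hU : AEStronglyMeasurable U) :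
    AEStronglyMeasurable (hspec U) :=
  AEStronglyMeasurable.mul (by fun_prop) hU

lemma lintegral_sq_eq_l2 (hU : MemLp U 2) :
    ∫⁻ ξ, ‖U ξ‖ₑ ^ 2 = ENNReal.ofReal (l2 U ^ 2) := by
  rw [l2_sq, ofReal_integral_eq_lintegral_ofReal (integrable_sq hU)
    (Eventually.of_forall fun _ => by positivity)]
  congr with ξ
  rw [ENNReal.ofReal_pow (norm_nonneg _), ofReal_norm]

lemma memLp_of_lintegral_sq_le (hU : AEStronglyMeasurable U) {c : ℝ} (hc : 0 ≤ c)
    (h : ∫⁻ ξ, ‖U ξ‖ₑ ^ 2 ≤ ENNReal.ofReal (c ^ 2)) : MemLp U 2 ∧ l2 U ≤ c := by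
  have e : ∀ ξ, ENNReal.ofReal (‖U ξ‖ ^ 2) = ‖U ξ‖ₑ ^ 2 := fun ξ => by
    rw [ENNReal.ofReal_pow (norm_nonneg _), ofReal_norm]
  have hm : MemLp U 2 := by
    rw [memLp_two_iff_integrable_sq_norm hU]
    refine ⟨hU.norm.pow 2, ?_⟩
    rw [hasFiniteIntegral_iff_ofReal (Eventually.of_forall fun _ => by positivity)]
    simp only [e]
    exact h.trans_lt ENNReal.ofReal_lt_top
  refine ⟨hm, ?_⟩
  rw [lintegral_sq_eq_l2 hm, ENNReal.ofReal_le_ofReal_iff (by positivity)] at h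
  exact abs_le_of_sq_le_sq' h hc |>.2

lemma HasSpec.eq_of_ae {V : ℝ → ℂ} (hu : HasSpec u U) (hv : HasSpec v V)
    (h : U =ᵐ[volume] V) : u = v := by
  ext α
  have := hu.eq α
  rw [ift_congr_ae h, ← hv.eq] at this
  exact ofReal_injective this

lemma fhat_add (hu : MemLp u 2) (hv : MemLp v 2) :
    fhat (fun x => u x + v x) =ᵐ[volume] fun ξ => fhat u ξ + fhat v ξ := by
  have h := fhat_lin hu hv 1 1
  simpa using h

lemma interpolation_weight {s x y : ℝ} (hs : 0 ≤ s) :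
    s / (1 + s) * (x + y) ^ 2 ≤ x ^ 2 + s * y ^ 2 := by
  rw [div_mul_eq_mul_div, div_le_iff₀ (by positivity)]
  nlinarith [sq_nonneg (x - s * y)]

lemma KerBB.integral_weight_le (h : KerBB k l A D C)
    (hw : HasSpec w W) {t : ℝ} (ht : 0 < t) :
    ∫ ξ, ξ ^ 2 / (1 + t ^ 2 * ξ ^ 2) * ‖fhat (tk k w) ξ‖ ^ 2
      ≤ (Real.pi * C) ^ 2 * ∫ ξ, ξ ^ 2 / (1 + t ^ 2 * ξ ^ 2) * ‖W ξ‖ ^ 2 := by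
  have hC := h.bbk.nonneg
  have hp := Real.pi_pos
  set m0 : ℝ → ℝ := fun ξ => t ^ 2 * ξ ^ 2 / (1 + t ^ 2 * ξ ^ 2) with hm0
  set m1 : ℝ → ℝ := fun ξ => 1 / (1 + t ^ 2 * ξ ^ 2) with hm1
  have hw0 := hw.mul_symbol (m := m0) (M := 1) (by rw [hm0]; fun_prop) (fun ξ => by
    rw [hm0]; dsimp only
    rw [abs_of_nonneg (by positivity), div_le_one (by positivity)]; linarith)
    (fun ξ => by simp [hm0])
  have hw1 := hw.mul_symbol (m := m1) (M := 1) (by rw [hm1]; fun_prop) (fun ξ => by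
    rw [hm1]; dsimp only
    rw [abs_of_nonneg (by positivity), div_le_one (by positivity)]
    nlinarith [mul_nonneg (sq_nonneg t) (sq_nonneg ξ)]) (fun ξ => by simp [hm1])
  have hb : ∀ ξ, |ξ| * ‖(m1 ξ : ℂ) * W ξ‖ ≤ t⁻¹ * ‖W ξ‖ := fun ξ => by
    rw [norm_mul, norm_real, Real.norm_eq_abs, ← mul_assoc]
    refine mul_le_mul_of_nonneg_right ?_ (norm_nonneg _)
    rw [hm1]; dsimp only
    rw [abs_of_nonneg (by positivity : 0 ≤ 1 / (1 + t ^ 2 * ξ ^ 2)), mul_one_div,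
      div_le_iff₀ (by positivity), ← sq_abs ξ, ← div_eq_inv_mul, le_div_iff₀ ht]
    nlinarith [sq_nonneg (t * |ξ| - 1)]
  have hw1r : Reg1 (phys fun ξ => m1 ξ * W ξ) (fun ξ => m1 ξ * W ξ) := { hw1 with
    int1 := (hw.integrable.norm.const_mul t⁻¹).mono'
      (measurable_id.abs.aestronglyMeasurable.mul hw1.integrable.1.norm)
      (Eventually.of_forall fun ξ => by
        rw [Real.norm_of_nonneg (by positivity)]; exact hb ξ) }
  have hw1d : MemLp (dspec fun ξ => m1 ξ * W ξ) 2 :=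
    MemLp.of_le_mul (c := t⁻¹) hw.memLp (aestronglyMeasurable_dspec hw1.integrable.1)
      (Eventually.of_forall fun ξ => by rw [norm_dspec]; exact hb ξ)
  have hsum : w = fun x => phys (fun ξ => m0 ξ * W ξ) x + phys (fun ξ => m1 ξ * W ξ) x := by
    refine hw.eq_of_ae (hw0.add hw1) (Eventually.of_forall fun ξ => ?_)
    dsimp only
    rw [← add_mul, ← ofReal_add, hm0, hm1]
    dsimp only
    rw [← add_div, add_comm, div_self (by positivity), ofReal_one, one_mul]
  set w0 := phys fun ξ => m0 ξ * W ξ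
  set w1 := phys fun ξ => m1 ξ * W ξ
  have h0 := h.hk.memLp_tk h.bbk hw0
  have h1 := h.hk.memLp_tk h.bbk hw1
  have h1d := h.l2_dspec_le hw1r hw1d
  have hw01 : MemLp (fun x => w0 x + w1 x) 2 := hw0.memLp_fun.add hw1.memLp_fun
  have htk : tk k w = fun α => tk k w0 α + tk k w1 α := by
    ext α
    have := tk_sub h.hk hw01 hw1.memLp_fun α
    simp only [add_sub_cancel_right] at this
    rw [hsum]
    change _ = tk k w0 α + tk k w1 α
    have e0 : tk k (fun x => w0 x) α = tk k w0 α := rfl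
    rw [e0] at this
    linarith
  have hae : fhat (tk k w) =ᵐ[volume] fun ξ => fhat (tk k w0) ξ + fhat (tk k w1) ξ := by
    rw [htk]; exact fhat_add h0.1 h1.1
  have i0 := integrable_sq (memLp_fhat h0.1)
  have i1 := integrable_sq h1d.1
  have s0 : l2 (fhat (tk k w0)) ^ 2 ≤ (Real.pi * C) ^ 2 * l2 (fun ξ => m0 ξ * W ξ) ^ 2 := by
    rw [← mul_pow]; exact pow_le_pow_left₀ (l2_nonneg _) h0.2 2
  have s1 : l2 (dspec (fhat (tk k w1))) ^ 2
      ≤ (Real.pi * C) ^ 2 * l2 (dspec fun ξ => m1 ξ * W ξ) ^ 2 := by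
    rw [← mul_pow]; exact pow_le_pow_left₀ (l2_nonneg _) h1d.2 2
  have j0 := integrable_sq hw0.memLp
  have j1 := integrable_sq hw1d
  calc ∫ ξ, ξ ^ 2 / (1 + t ^ 2 * ξ ^ 2) * ‖fhat (tk k w) ξ‖ ^ 2
      ≤ ∫ ξ, ((t ^ 2)⁻¹ * ‖fhat (tk k w0) ξ‖ ^ 2 + ‖dspec (fhat (tk k w1)) ξ‖ ^ 2) := by
        refine integral_mono_of_nonneg (Eventually.of_forall fun ξ => by positivity)
          ((i0.const_mul _).add i1) ?_
        filter_upwards [hae] with ξ hξ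
        rw [hξ, norm_dspec]
        have hn := norm_add_le (fhat (tk k w0) ξ) (fhat (tk k w1) ξ)
        have hn2 := pow_le_pow_left₀ (norm_nonneg _) hn 2
        have hi := interpolation_weight (s := t ^ 2 * ξ ^ 2) (x := ‖fhat (tk k w0) ξ‖)
          (y := ‖fhat (tk k w1) ξ‖) (by positivity)
        have hq : ξ ^ 2 / (1 + t ^ 2 * ξ ^ 2)
            = (t ^ 2)⁻¹ * (t ^ 2 * ξ ^ 2 / (1 + t ^ 2 * ξ ^ 2)) := by field_simp
        rw [hq, mul_assoc]
        have ht2 : (0 : ℝ) < (t ^ 2)⁻¹ := by positivity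
        calc (t ^ 2)⁻¹ * (t ^ 2 * ξ ^ 2 / (1 + t ^ 2 * ξ ^ 2)
              * ‖fhat (tk k w0) ξ + fhat (tk k w1) ξ‖ ^ 2)
            ≤ (t ^ 2)⁻¹ * (t ^ 2 * ξ ^ 2 / (1 + t ^ 2 * ξ ^ 2)
              * (‖fhat (tk k w0) ξ‖ + ‖fhat (tk k w1) ξ‖) ^ 2) := by gcongr
          _ ≤ (t ^ 2)⁻¹ * (‖fhat (tk k w0) ξ‖ ^ 2 + t ^ 2 * ξ ^ 2 * ‖fhat (tk k w1) ξ‖ ^ 2) := by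
              gcongr
          _ = _ := by
              rw [mul_pow, sq_abs]
              field_simp
    _ = (t ^ 2)⁻¹ * l2 (fhat (tk k w0)) ^ 2 + l2 (dspec (fhat (tk k w1))) ^ 2 := by
        rw [integral_add (i0.const_mul _) i1, integral_const_mul, l2_sq, l2_sq]
    _ ≤ (Real.pi * C) ^ 2 * ((t ^ 2)⁻¹ * l2 (fun ξ => m0 ξ * W ξ) ^ 2
          + l2 (dspec fun ξ => m1 ξ * W ξ) ^ 2) := by
        have := mul_le_mul_of_nonneg_left s0 (by positivity : (0 : ℝ) ≤ (t ^ 2)⁻¹)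
        linarith
    _ = _ := by
        rw [l2_sq, l2_sq, ← integral_const_mul, ← integral_add (j0.const_mul _) j1]
        congr 2 with ξ
        rw [norm_dspec, norm_mul, norm_mul, norm_real, norm_real, mul_pow, mul_pow, mul_pow,
          sq_abs, Real.norm_eq_abs, Real.norm_eq_abs, sq_abs, sq_abs, hm0, hm1]
        dsimp only
        field_simp
        ring

/-- The `Ḣ^{1/2}` bound, by quadratic interpolation between `L²` and `Ḣ¹`. -/
lemma KerBB.l2_hspec_le (h : KerBB k l A D C)
    (hw : HasSpec w W) (hW : MemLp (hspec W) 2) :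
    MemLp (hspec (fhat (tk k w))) 2 ∧ l2 (hspec (fhat (tk k w))) ≤ Real.pi * C * l2 (hspec W) := by
  have hC := h.bbk.nonneg
  have hp := Real.pi_pos
  have hS := h.hk.memLp_tk h.bbk hw
  have hfm := memLp_fhat hS.1
  have hswap : ∀ U : ℝ → ℂ, AEStronglyMeasurable U →
      ∫⁻ t in Ioi (0 : ℝ), ∫⁻ ξ, ENNReal.ofReal (ξ ^ 2 / (1 + t ^ 2 * ξ ^ 2)) * ‖U ξ‖ₑ ^ 2
        = ENNReal.ofReal (Real.pi / 2) * ∫⁻ ξ, ‖hspec U ξ‖ₑ ^ 2 := by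
    intro U hU
    rw [lintegral_lintegral_swap, ← lintegral_const_mul']
    · congr with ξ
      rw [lintegral_mul_const _ (by fun_prop), lintegral_inv_one_add_sq, enorm_hspec_sq, mul_assoc]
    · exact ENNReal.ofReal_ne_top
    · exact AEMeasurable.mul (by fun_prop) (hU.comp_snd.enorm.pow_const 2)
  have hconv : ∀ U : ℝ → ℂ, MemLp U 2 → ∀ t : ℝ, 0 < t →
      ∫⁻ ξ, ENNReal.ofReal (ξ ^ 2 / (1 + t ^ 2 * ξ ^ 2)) * ‖U ξ‖ₑ ^ 2
        = ENNReal.ofReal (∫ ξ, ξ ^ 2 / (1 + t ^ 2 * ξ ^ 2) * ‖U ξ‖ ^ 2) := by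
    intro U hU t ht
    rw [ofReal_integral_eq_lintegral_ofReal]
    · congr with ξ
      rw [ENNReal.ofReal_mul (by positivity), ENNReal.ofReal_pow (norm_nonneg _), ofReal_norm]
    · refine (integrable_sq hU).bdd_mul (c := (t ^ 2)⁻¹) (Measurable.aestronglyMeasurable (by fun_prop))
        (Eventually.of_forall fun ξ => ?_)
      rw [Real.norm_of_nonneg (by positivity), div_le_iff₀ (by positivity), mul_add, ← mul_assoc,
        inv_mul_cancel₀ (by positivity)]
      have : (0 : ℝ) ≤ (t ^ 2)⁻¹ * 1 := by positivity
      linarith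
    · exact Eventually.of_forall fun ξ => by positivity
  have key : ENNReal.ofReal (Real.pi / 2) * ∫⁻ ξ, ‖hspec (fhat (tk k w)) ξ‖ₑ ^ 2
      ≤ ENNReal.ofReal (Real.pi / 2) *
        (ENNReal.ofReal ((Real.pi * C) ^ 2) * ∫⁻ ξ, ‖hspec W ξ‖ₑ ^ 2) := by
    rw [mul_left_comm, ← hswap _ hfm.1, ← hswap _ hw.memLp.1,
      ← lintegral_const_mul' _ _ ENNReal.ofReal_ne_top]
    refine lintegral_mono_ae ((ae_restrict_iff' measurableSet_Ioi).2 (Eventually.of_forall ?_))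
    intro t ht
    rw [hconv _ hfm t ht, hconv _ hw.memLp t ht, ← ENNReal.ofReal_mul (by positivity)]
    exact ENNReal.ofReal_le_ofReal (h.integral_weight_le hw ht)
  rw [ENNReal.mul_le_mul_iff_right (by simp [hp]) ENNReal.ofReal_ne_top, lintegral_sq_eq_l2 hW,
    ← ENNReal.ofReal_mul (by positivity), ← mul_pow] at key
  exact memLp_of_lintegral_sq_le (aestronglyMeasurable_hspec hfm.1)
    (mul_nonneg (by positivity) (l2_nonneg _)) key

end

section

variable {ν : (ℝ → ℂ) → ℝ} {C D a : ℝ} {F G U V W : ℝ → ℂ} {f g w : ℝ → ℝ} {A k l : ℝ → ℝ → ℝ}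

lemma KBound.const_mul (h : KBound k D) (c : ℝ) :
    KBound (fun α β => c * k α β) (|c| * D) :=
  ⟨h.meas.const_mul c, fun α β => by
    rw [abs_mul, mul_assoc]; exact mul_le_mul_of_nonneg_left (h.le α β) (abs_nonneg c)⟩

lemma KerBB.const_mul (h : KerBB k l A D C) (c : ℝ) :
    KerBB (fun α β => c * k α β) (fun α β => c * l α β) (fun α β => c * A α β) (|c| * D)
      (|c| * C) where
  hk := h.hk.const_mul c
  hl := h.hl.const_mul c
  meas := h.meas.const_mul c
  le α γ := by rw [abs_mul, mul_assoc]; exact mul_le_mul_of_nonneg_left (h.le α γ) (abs_nonneg c)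
  cont_right α := (h.cont_right α).const_mul c
  cont_left γ := (h.cont_left γ).const_mul c
  deriv_right α γ hne := ((h.deriv_right α γ hne).const_mul c).congr_deriv (by ring)
  deriv_left α γ hne := (h.deriv_left α γ hne).const_mul c
  bbk := by
    have := h.bbk.const_mul c
    rw [norm_real, Real.norm_eq_abs] at this
    simpa only [ofReal_mul, mul_assoc] using this
  bbl := by
    have := h.bbl.const_mul c
    rw [norm_real, Real.norm_eq_abs] at this
    simpa only [ofReal_mul, mul_assoc] using this

/-- The operator with kernel `k` is bounded by `C` on `L²`, `Ḣ^{1/2}` and `Ḟ^{1,1}`. -/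
def Op (k : ℝ → ℝ → ℝ) (C : ℝ) : Prop := ∃ l A D, KerBB k l A D (C / Real.pi)

lemma pi_mul_div_pi (C : ℝ) : Real.pi * (C / Real.pi) = C :=
  mul_div_cancel₀ C Real.pi_ne_zero

lemma KerBB.op {k' : ℝ → ℝ → ℝ} {C' : ℝ} (h : KerBB k l A D C) (hk : k' = k)
    (hC : C' = Real.pi * C) : Op k' C' := by
  refine ⟨l, A, D, ?_⟩
  rw [hk, hC, mul_div_cancel_left₀ _ Real.pi_ne_zero]
  exact h

lemma Op.nonneg (h : Op k C) : 0 ≤ C := by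
  obtain ⟨l, A, D, h⟩ := h
  have := mul_nonneg Real.pi_pos.le h.bbk.nonneg
  rwa [pi_mul_div_pi] at this

lemma Op.kbound (h : Op k C) : ∃ D, KBound k D := by
  obtain ⟨l, A, D, h⟩ := h
  exact ⟨D, h.hk⟩

lemma Op.reg1 (h : Op k C) (hw : Reg1 w W) :
    Reg1 (tk k w) (fhat (tk k w)) := by
  obtain ⟨l, A, D, h⟩ := h
  exact (h.reg1 hw).1

lemma Op.n1_le (h : Op k C) (hw : Reg1 w W) :
    n1 (fhat (tk k w)) ≤ C * n1 W := by
  obtain ⟨l, A, D, h⟩ := h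
  have := (h.reg1 hw).2
  rwa [pi_mul_div_pi] at this

lemma Op.l2_le (h : Op k C) (hw : HasSpec w W) :
    l2 (fhat (tk k w)) ≤ C * l2 W := by
  obtain ⟨l, A, D, h⟩ := h
  have := (h.hk.memLp_tk h.bbk hw).2
  rwa [pi_mul_div_pi] at this

lemma Op.l2_hspec_le (h : Op k C)
    (hw : HasSpec w W) (hW : MemLp (hspec W) 2) :
    MemLp (hspec (fhat (tk k w))) 2 ∧ l2 (hspec (fhat (tk k w))) ≤ C * l2 (hspec W) := by
  obtain ⟨l, A, D, h⟩ := h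
  have := h.l2_hspec_le hw hW
  rwa [pi_mul_div_pi] at this

/-- The kernel of the double layer potential. -/
def kD (f : ℝ → ℝ) (α β : ℝ) : ℝ := -Real.pi⁻¹ * kk prof0 f α β

/-- The kernel of the operator whose derivative is the nonlinear term `N₂`. -/
def kS (f : ℝ → ℝ) (α β : ℝ) : ℝ := (2 * Real.pi)⁻¹ * kk prof1 f α β

/-- The bound of the double layer potential. -/
def kapD (a : ℝ) : ℝ := 2 * a / (1 - a ^ 2)

/-- The bound of the single layer type operator. -/
def kapS (a : ℝ) : ℝ := a ^ 2 / (1 - a ^ 2)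

/-- The Lipschitz constant of the double layer potential. -/
def kapD' (a : ℝ) : ℝ := 2 * (1 + a ^ 2) / (1 - a ^ 2) ^ 2

/-- The Lipschitz constant of the single layer type operator. -/
def kapS' (a : ℝ) : ℝ := 2 * a / (1 - a ^ 2) ^ 2

lemma one_sub_sq_pos (ha : n1 F ≤ a) (ha1 : a < 1) : 0 < 1 - a ^ 2 := by
  have := (n1_nonneg F).trans ha
  nlinarith

lemma op_kD (h : Reg2 f F) (ha : n1 F ≤ a) (ha1 : a < 1) :
    Op (kD f) (kapD a) := by
  refine ((isProf_prof0.kerBB h ha ha1).const_mul (-Real.pi⁻¹)).op rfl ?_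
  have hp := Real.pi_pos
  rw [abs_neg, abs_of_pos (by positivity), kapD]
  field_simp

lemma op_kS (h : Reg2 f F) (ha : n1 F ≤ a) (ha1 : a < 1) :
    Op (kS f) (kapS a) := by
  refine ((isProf_prof1.kerBB h ha ha1).const_mul (2 * Real.pi)⁻¹).op rfl ?_
  have hp := Real.pi_pos
  rw [abs_of_pos (by positivity), kapS]
  field_simp

lemma op_kD_sub (hf : Reg2 f F) (hg : Reg2 g G) (haf : n1 F ≤ a)
    (hag : n1 G ≤ a) (ha1 : a < 1) :
    Op (fun α β => kD f α β - kD g α β) (kapD' a * n1 (fun ξ => F ξ - G ξ)) := by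
  refine ((isProf_prof0.kerBB_sub hf hg haf hag ha1).const_mul (-Real.pi⁻¹)).op ?_ ?_
  · ext α β
    rw [kD, kD]
    ring
  have hp := Real.pi_pos
  have hq := one_sub_sq_pos haf ha1
  rw [abs_neg, abs_of_pos (by positivity), kapD']
  field_simp
  ring

lemma op_kS_sub (hf : Reg2 f F) (hg : Reg2 g G) (haf : n1 F ≤ a)
    (hag : n1 G ≤ a) (ha1 : a < 1) :
    Op (fun α β => kS f α β - kS g α β) (kapS' a * n1 (fun ξ => F ξ - G ξ)) := by
  refine ((isProf_prof1.kerBB_sub hf hg haf hag ha1).const_mul (2 * Real.pi)⁻¹).op ?_ ?_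
  · ext α β
    rw [kS, kS]
    ring
  have hp := Real.pi_pos
  have hq := one_sub_sq_pos haf ha1
  rw [abs_of_pos (by positivity), kapS']
  field_simp
  ring

lemma dlKernel_eq (f w : ℝ → ℝ) (α β : ℝ) :
    dlKernel f w α β = -(kk prof0 f α β * w (α - β)) := by
  rw [dlKernel, kk, prof0]
  ring

lemma DL_eq (f w : ℝ → ℝ) : DL f w = tk (kD f) w := by
  ext α
  simp only [DL, tk, dlKernel_eq, kD, mul_assoc, integral_neg, integral_const_mul]
  ring

lemma n2Kernel_eq (f w : ℝ → ℝ) (α β : ℝ) :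
    n2Kernel f w α β = lk prof1 f α β * deriv w (α - β) := by
  rw [n2Kernel, lk, prof1]
  ring

lemma Reg2.integrable_dlKernel (hf : Reg2 f F) (hw : MemLp w 2) (α : ℝ) :
    Integrable (dlKernel f w α) := by
  have := ((isProf_prof0.ker hf).hk.integrable hw α).1.neg
  exact this.congr (Eventually.of_forall fun β => (dlKernel_eq f w α β).symm)

lemma Reg2.hasDerivAt_tk_kS (hf : Reg2 f F) (hw : Reg1 w W) (α : ℝ) :
    Integrable (n2Kernel f w α) ∧ HasDerivAt (tk (kS f) w) (N2 f w α) α := by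
  have hE : ∀ α β, |lk prof1 f α β| ≤ (n1 F + 2 * ∫ ξ, ‖F ξ‖) * kerC F * rho β ^ 2 := by
    intro α β
    have h1 : |prof1 (diffQuot f α β)| ≤ |diffQuot f α β| := by
      rw [prof1, abs_mul]
      refine mul_le_of_le_one_right (abs_nonneg _) ?_
      exact isProf_prof0.le_one (diffQuot f α β)
    have h2 := h1.trans (hf.toReg1.abs_diffQuot_le_rho α β)
    have h3 := hf.abs_ker_right α β
    rw [lk, abs_mul]
    refine (mul_le_mul h2 h3 (abs_nonneg _) ((abs_nonneg _).trans h2)).trans_eq (by ring)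
  have h := (isProf_prof1.ker hf).hasDerivAt_of_decay hE hw α
  refine ⟨h.1.congr (Eventually.of_forall fun β => (n2Kernel_eq f w α β).symm), ?_⟩
  have h2 := h.2.const_mul (2 * Real.pi)⁻¹
  have e1 : tk (kS f) w = fun α => (2 * Real.pi)⁻¹ * tk (kk prof1 f) w α := by
    ext α
    simp only [tk, kS, mul_assoc, integral_const_mul]
  rw [e1]
  refine h2.congr_deriv ?_
  simp only [N2, n2Kernel_eq, tk]

/-- Spectral densities in `L² ∩ Ḟ^{1,1}`. -/
structure Dens (U : ℝ → ℂ) : Prop where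
  memLp : MemLp U 2
  int1 : Integrable fun ξ => |ξ| * ‖U ξ‖

lemma Reg1.dens {u : ℝ → ℝ} (h : Reg1 u U) : Dens U := ⟨h.memLp, h.int1⟩

lemma Dens.integrable (h : Dens U) : Integrable U :=
  integrable_of_memLp_of_int1 h.memLp h.int1

lemma Dens.add (hU : Dens U) (hV : Dens V) : Dens fun ξ => U ξ + V ξ :=
  ⟨hU.memLp.add hV.memLp, integrable_weight_add abs_nonneg measurable_id.abs hU.int1 hV.int1
    hU.memLp.1 hV.memLp.1⟩

lemma Dens.sub (hU : Dens U) (hV : Dens V) : Dens fun ξ => U ξ - V ξ :=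
  ⟨hU.memLp.sub hV.memLp, integrable_weight_sub abs_nonneg measurable_id.abs hU.int1 hV.int1
    hU.memLp.1 hV.memLp.1⟩

lemma Dens.mul_symbol (hU : Dens U) {s : ℝ → ℂ} {M : ℝ} (hs : Measurable s)
    (hM : ∀ ξ, ‖s ξ‖ ≤ M) : Dens fun ξ => s ξ * U ξ := by
  have hb : ∀ ξ, ‖s ξ * U ξ‖ ≤ M * ‖U ξ‖ := fun ξ => by
    rw [norm_mul]; exact mul_le_mul_of_nonneg_right (hM ξ) (norm_nonneg _)
  have hm := hs.aestronglyMeasurable.mul hU.memLp.1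
  refine ⟨MemLp.of_le_mul (c := M) hU.memLp hm (Eventually.of_forall hb),
    (hU.int1.const_mul M).mono' (measurable_id.abs.aestronglyMeasurable.mul hm.norm)
      (Eventually.of_forall fun ξ => ?_)⟩
  rw [Real.norm_of_nonneg (by positivity), mul_left_comm]
  exact mul_le_mul_of_nonneg_left (hb ξ) (abs_nonneg _)

lemma Dens.const_mul (hU : Dens U) (c : ℂ) : Dens fun ξ => c * U ξ :=
  hU.mul_symbol measurable_const fun _ => le_rfl

/-- The norms in which the equation is estimated; `ok` is the domain of finiteness. -/
structure Nrm (ν : (ℝ → ℂ) → ℝ) (ok : (ℝ → ℂ) → Prop) : Prop where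
  nonneg : ∀ U, 0 ≤ ν U
  congr : ∀ U V, U =ᵐ[volume] V → ok U → ok V ∧ ν V = ν U
  zero : ok (fun _ => 0) ∧ ν (fun _ => 0) = 0
  add : ∀ U V, Dens U → Dens V → ok U → ok V →
    ok (fun ξ => U ξ + V ξ) ∧ ν (fun ξ => U ξ + V ξ) ≤ ν U + ν V
  mul : ∀ (U s : ℝ → ℂ) (M : ℝ), Dens U → ok U → Measurable s → 0 ≤ M → (∀ ξ, ‖s ξ‖ ≤ M) →
    ok (fun ξ => s ξ * U ξ) ∧ ν (fun ξ => s ξ * U ξ) ≤ M * ν U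
  op : ∀ k C w W, Op k C → Reg1 w W → ok W → ok (fhat (tk k w)) ∧ ν (fhat (tk k w)) ≤ C * ν W
  lim : ∀ (U : ℕ → ℝ → ℂ) (V : ℝ → ℂ) (c : ℝ), 0 ≤ c → (∀ n, Dens (U n)) → MemLp V 2 →
    Tendsto (fun n => l2 fun ξ => U n ξ - V ξ) atTop (𝓝 0) → (∀ n, ok (U n)) → (∀ n, ν (U n) ≤ c) →
    ok V ∧ ν V ≤ c

lemma nrm_n1 : Nrm n1 (fun U => Integrable fun ξ => |ξ| * ‖U ξ‖) where
  nonneg := n1_nonneg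
  congr U V h hU := ⟨hU.congr (h.mono fun x hx => by simp only [hx]), (n1_congr_ae h).symm⟩
  zero := ⟨by simp, by simp [n1]⟩
  add U V hU hV _ _ := ⟨(hU.add hV).int1, n1_add_le hU.int1 hV.int1⟩
  mul U s M hU _ hs _ hM := by
    refine ⟨(hU.mul_symbol hs hM).int1, ?_⟩
    rw [n1, n1, ← integral_const_mul]
    refine integral_mono (hU.mul_symbol hs hM).int1 (hU.int1.const_mul M) fun ξ => ?_
    dsimp only
    rw [norm_mul, mul_left_comm M]
    gcongr
    exact hM ξ
  op k C w W h hw _ := ⟨(h.reg1 hw).int1, h.n1_le hw⟩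
  lim U V c hc hU hV h _ hn := by
    refine integrable_of_lintegral_le (q := fun ξ => |ξ|) hV.1 measurable_id.abs abs_nonneg hc ?_
    have := lintegral_le_of_tendsto_l2 (fun n => (hU n).memLp) hV h
      (q := fun ξ => ENNReal.ofReal |ξ|) (by fun_prop) (fun _ => ENNReal.ofReal_ne_top) (e := 1)
      (c := ENNReal.ofReal c) (fun n => by
        simp only [pow_one]
        rw [lintegral_eq_ofReal_integral abs_nonneg (hU n).int1]
        exact ENNReal.ofReal_le_ofReal (hn n))
    simpa only [pow_one] using this

lemma nrm_l2 : Nrm l2 (fun U => MemLp U 2) where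
  nonneg := l2_nonneg
  congr U V h hU := ⟨(memLp_congr_ae h).1 hU, (l2_congr_ae h).symm⟩
  zero := ⟨MemLp.zero, by simp [l2]⟩
  add U V hU hV _ _ := ⟨(hU.add hV).memLp, l2_add_le hU.memLp hV.memLp⟩
  mul U s M hU _ hs h0 hM := by
    refine ⟨(hU.mul_symbol hs hM).memLp, ?_⟩
    have h1 : ‖(M : ℂ)‖ = M := by rw [norm_real, Real.norm_of_nonneg h0]
    have := l2_mono (U := fun ξ => s ξ * U ξ) (hU.const_mul (M : ℂ)).memLp
      (Eventually.of_forall fun ξ => by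
        rw [norm_mul, norm_mul, h1]; gcongr; exact hM ξ)
    rwa [l2_const_mul, h1] at this
  op k C w W h hw _ := ⟨(h.reg1 hw).memLp, h.l2_le hw.toHasSpec⟩
  lim U V c hc hU hV h _ hn := by
    refine memLp_of_lintegral_sq_le hV.1 hc ?_
    have := lintegral_le_of_tendsto_l2 (fun n => (hU n).memLp) hV h
      (q := fun _ => 1) measurable_const (fun _ => ENNReal.one_ne_top) (e := 2)
      (c := ENNReal.ofReal (c ^ 2)) (fun n => by
        simp only [one_mul]
        rw [lintegral_sq_eq_l2 (hU n).memLp]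
        exact ENNReal.ofReal_le_ofReal (pow_le_pow_left₀ (l2_nonneg _) (hn n) 2))
    simpa only [one_mul] using this

lemma hspec_add (U V : ℝ → ℂ) : hspec (fun ξ => U ξ + V ξ) = fun ξ => hspec U ξ + hspec V ξ := by
  ext ξ; rw [hspec, hspec, hspec]; ring

lemma nrm_hspec : Nrm (fun U => l2 (hspec U)) (fun U => MemLp (hspec U) 2) where
  nonneg U := l2_nonneg _
  congr U V h hU := by
    have h' : hspec U =ᵐ[volume] hspec V := h.mono fun x hx => by rw [hspec, hspec, hx]
    exact ⟨(memLp_congr_ae h').1 hU, (l2_congr_ae h').symm⟩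
  zero := by
    have : hspec (fun _ => 0) = fun _ => 0 := by ext ξ; simp [hspec]
    rw [this]
    exact ⟨MemLp.zero, by simp [l2]⟩
  add U V _ _ hU hV := by
    rw [hspec_add]
    exact ⟨hU.add hV, l2_add_le hU hV⟩
  mul U s M hU hh hs h0 hM := by
    have h1 : ‖(M : ℂ)‖ = M := by rw [norm_real, Real.norm_of_nonneg h0]
    have hb : ∀ ξ, ‖hspec (fun ξ => s ξ * U ξ) ξ‖ ≤ ‖(M : ℂ) * hspec U ξ‖ := fun ξ => by
      rw [hspec, hspec, norm_mul, norm_mul, norm_mul, norm_mul, h1, mul_left_comm M]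
      gcongr; exact hM ξ
    have hm : MemLp (hspec fun ξ => s ξ * U ξ) 2 := by
      refine (hh.const_mul (M : ℂ)).of_le (aestronglyMeasurable_hspec
        (hU.mul_symbol hs hM).memLp.1) (Eventually.of_forall hb)
    refine ⟨hm, ?_⟩
    have := l2_mono (hh.const_mul (M : ℂ)) (Eventually.of_forall hb)
    rwa [l2_const_mul, h1] at this
  op k C w W h hw hW := h.l2_hspec_le hw.toHasSpec hW
  lim U V c hc hU hV h hok hn := by
    refine memLp_of_lintegral_sq_le (aestronglyMeasurable_hspec hV.1) hc ?_
    have := lintegral_le_of_tendsto_l2 (fun n => (hU n).memLp) hV h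
      (q := fun ξ => ENNReal.ofReal |ξ|) (by fun_prop) (fun _ => ENNReal.ofReal_ne_top) (e := 2)
      (c := ENNReal.ofReal (c ^ 2)) (fun n => by
        simp only [← enorm_hspec_sq]
        rw [lintegral_sq_eq_l2 (hok n)]
        exact ENNReal.ofReal_le_ofReal (pow_le_pow_left₀ (l2_nonneg _) (hn n) 2))
    simpa only [← enorm_hspec_sq] using this

lemma Nrm.const_mul {ok : (ℝ → ℂ) → Prop} (h : Nrm ν ok) (c : ℂ)
    (hU : Dens U) (ho : ok U) : ok (fun ξ => c * U ξ) ∧ ν (fun ξ => c * U ξ) ≤ ‖c‖ * ν U :=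
  h.mul U (fun _ => c) ‖c‖ hU ho measurable_const (norm_nonneg c) fun _ => le_rfl

lemma Nrm.sub {ok : (ℝ → ℂ) → Prop} (h : Nrm ν ok)
    (hU : Dens U) (hV : Dens V) (hoU : ok U) (hoV : ok V) :
    ok (fun ξ => U ξ - V ξ) ∧ ν (fun ξ => U ξ - V ξ) ≤ ν U + ν V := by
  have h1 := h.const_mul (-1) hV hoV
  have h2 := h.add _ _ hU (hV.const_mul (-1)) hoU h1.1
  simp only [neg_mul, one_mul, norm_neg, norm_one, ← sub_eq_add_neg] at h1 h2
  exact ⟨h2.1, h2.2.trans (by linarith [h1.2])⟩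

/-- Completeness of `L²` for geometrically convergent sequences of densities. -/
lemma exists_l2_limit {U : ℕ → ℝ → ℂ} (hU : ∀ n, MemLp (U n) 2) {c r : ℝ} (hr : r < 1)
    (h : ∀ n, l2 (fun ξ => U n ξ - U (n + 1) ξ) ≤ c * r ^ n) :
    ∃ V, MemLp V 2 ∧ Tendsto (fun n => l2 fun ξ => U n ξ - V ξ) atTop (𝓝 0) := by
  have hd : ∀ {X Y : ℝ → ℂ} (hX : MemLp X 2) (hY : MemLp Y 2),
      dist (hX.toLp X) (hY.toLp Y) = l2 fun ξ => X ξ - Y ξ := by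
    intro X Y hX hY
    rw [dist_eq_norm, ← MemLp.toLp_sub, Lp.norm_toLp]
    have : eLpNorm (X - Y) 2 volume = ENNReal.ofReal (l2 fun ξ => X ξ - Y ξ) :=
      eLpNorm_eq_l2 (hX.sub hY)
    rw [this, ENNReal.toReal_ofReal (l2_nonneg _)]
  have hc : CauchySeq fun n => (hU n).toLp (U n) :=
    cauchySeq_of_le_geometric r c hr fun n => by rw [hd]; exact h n
  obtain ⟨x, hx⟩ := cauchySeq_tendsto_of_complete hc
  refine ⟨x, Lp.memLp x, ?_⟩
  rw [tendsto_iff_dist_tendsto_zero] at hx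
  refine hx.congr fun n => ?_
  conv_lhs => rw [← Lp.toLp_coeFn x (Lp.memLp x)]
  rw [hd]

end

section

variable {Aμ Aρ C a m : ℝ} {F U V W : ℝ → ℂ} {f v w : ℝ → ℝ}

lemma Reg1.fhat {u : ℝ → ℝ} (h : Reg1 u U) : Reg1 u (fhat u) :=
  h.congr h.fhat_ae_eq.symm

/-- `w` is the potential jump of the interface `f`, with spectral density `W`. -/
structure IsOm (Aμ Aρ : ℝ) (f w : ℝ → ℝ) (W : ℝ → ℂ) : Prop extends Reg1 w W where
  jump : ∀ α, w α = Aμ * tk (kD f) w α - 2 * Aρ * f α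

/-- The amplification factor `1/(1 - m κ)` of the potential jump. -/
def ampl (m a : ℝ) : ℝ := (1 - a ^ 2) / (1 - a ^ 2 - 2 * m * a)

lemma Adm.ampl_pos (h : Adm m a) : 0 < ampl m a := div_pos h.q_pos h.disc

lemma Adm.ampl_eq (h : Adm m a) : ampl m a = 1 + m * kapD a * ampl m a := by
  have h1 := h.q_pos.ne'
  have h2 := h.disc.ne'
  rw [ampl, kapD]
  generalize hd : 1 - a ^ 2 - 2 * m * a = d at *
  generalize hq : 1 - a ^ 2 = q at *
  field_simp
  rw [← hd, ← hq]
  ring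

lemma Adm.kapD_nonneg (h : Adm m a) : 0 ≤ kapD a :=
  div_nonneg (mul_nonneg zero_le_two h.nonneg) h.q_pos.le

lemma Adm.kapS_nonneg (h : Adm m a) : 0 ≤ kapS a :=
  div_nonneg (sq_nonneg _) h.q_pos.le

lemma Adm.kapD'_nonneg (h : Adm m a) : 0 ≤ kapD' a := by
  have := h.q_pos
  rw [kapD']; positivity

lemma Adm.kapS'_nonneg (h : Adm m a) : 0 ≤ kapS' a := by
  have := h.q_pos
  have := h.nonneg
  rw [kapS']; positivity

lemma Adm.contr (h : Adm m a) : 0 ≤ m * kapD a ∧ m * kapD a < 1 := by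
  refine ⟨mul_nonneg h.m_nonneg h.kapD_nonneg, ?_⟩
  rw [kapD, ← mul_div_assoc, div_lt_one h.q_pos]
  linarith [h.disc]

/-- Solving `x ≤ mκ x + y`. -/
lemma Adm.le_ampl_mul {x y : ℝ} (h : Adm m a) (hx : x ≤ m * kapD a * x + y) :
    x ≤ ampl m a * y := by
  have h1 := h.ampl_eq
  have h2 := h.ampl_pos
  have h3 := mul_le_mul_of_nonneg_left hx h2.le
  have h4 : ampl m a * (m * kapD a * x) = (ampl m a - 1) * x := by linear_combination (-x) * h1
  linarith

lemma IsOm.spec_ae (h : IsOm Aμ Aρ f w W)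
    (hf : Reg1 f F) (hop : Op (kD f) C) :
    W =ᵐ[volume] fun ξ => (Aμ : ℂ) * fhat (tk (kD f) w) ξ - ((2 * Aρ : ℝ) : ℂ) * F ξ := by
  have h1 := ((hop.reg1 h.toReg1).const_mul Aμ).sub (hf.const_mul (2 * Aρ))
  have h2 : (fun α => Aμ * tk (kD f) w α - 2 * Aρ * f α) = w := funext fun α => (h.jump α).symm
  rw [h2] at h1
  exact h.toHasSpec.ae_unique h1.toHasSpec

/-- The fixed point iteration for the potential jump. -/
def omIter (Aμ Aρ : ℝ) (f : ℝ → ℝ) : ℕ → ℝ → ℝ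
  | 0 => fun _ => 0
  | n + 1 => fun α => Aμ * tk (kD f) (omIter Aμ Aρ f n) α - 2 * Aρ * f α

lemma reg1_zero : Reg1 (fun _ => 0) (fun _ => 0) := { hasSpec_zero with int1 := by simp }

lemma reg1_omIter (hf : Reg1 f F) (hop : Op (kD f) C)
    (n : ℕ) : Reg1 (omIter Aμ Aρ f n) (fhat (omIter Aμ Aρ f n)) := by
  induction n with
  | zero => exact reg1_zero.fhat
  | succ n ih => exact (((hop.reg1 ih).const_mul Aμ).sub (hf.const_mul (2 * Aρ))).fhat

lemma fhat_omIter_succ (hf : Reg1 f F)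
    (hop : Op (kD f) C) (n : ℕ) :
    fhat (omIter Aμ Aρ f (n + 1)) =ᵐ[volume] fun ξ =>
      (Aμ : ℂ) * fhat (tk (kD f) (omIter Aμ Aρ f n)) ξ - ((2 * Aρ : ℝ) : ℂ) * F ξ :=
  (((hop.reg1 (reg1_omIter hf hop n)).const_mul Aμ).sub (hf.const_mul (2 * Aρ))).fhat_ae_eq

/-- Differences of the operator are bounded by differences of densities. -/
lemma Op.l2_sub_le {k : ℝ → ℝ → ℝ} (h : Op k C)
    (hv : Reg1 v V) (hw : Reg1 w W) :
    l2 (fun ξ => fhat (tk k v) ξ - fhat (tk k w) ξ) ≤ C * l2 fun ξ => V ξ - W ξ := by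
  obtain ⟨D, hk⟩ := h.kbound
  have h1 := h.l2_le (hv.sub hw).toHasSpec
  have h2 : tk k (fun x => v x - w x) = fun α => tk k v α - tk k w α :=
    funext fun α => tk_sub hk hv.memLp_fun hw.memLp_fun α
  rw [h2, l2_congr_ae (fhat_sub (h.reg1 hv).memLp_fun (h.reg1 hw).memLp_fun)] at h1
  exact h1

lemma l2_eq_zero_iff (hU : MemLp U 2) : l2 U = 0 ↔ U =ᵐ[volume] 0 := by
  have h := eLpNorm_eq_zero_iff (p := 2) hU.1 (by norm_num)
  rw [eLpNorm_eq_l2 hU, ENNReal.ofReal_eq_zero] at h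
  rw [← h]
  exact ⟨fun h => h.le, fun h' => le_antisymm h' (l2_nonneg _)⟩

/-- Solvability of the equation for the potential jump. -/
lemma exists_isOm (hA : Adm |Aμ| a) (hρ : 0 ≤ Aρ)
    (hf : Reg2 f F) (ha : n1 F ≤ a) :
    ∃ w W, IsOm Aμ Aρ f w W ∧ ∀ ν ok, Nrm ν ok → ok F →
      ok W ∧ ν W ≤ 2 * Aρ * ampl |Aμ| a * ν F := by
  have hop := op_kD hf ha hA.lt_one
  have hf1 := hf.toReg1
  set u := omIter Aμ Aρ f with hu
  set κ := |Aμ| * kapD a with hκ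
  have hreg : ∀ n, Reg1 (u n) (fhat (u n)) := reg1_omIter hf1 hop
  have hsucc : ∀ n, fhat (u (n + 1)) =ᵐ[volume] fun ξ =>
      (Aμ : ℂ) * fhat (tk (kD f) (u n)) ξ - ((2 * Aρ : ℝ) : ℂ) * F ξ := fhat_omIter_succ hf1 hop
  have hbd : ∀ ν ok, Nrm ν ok → ok F → ∀ n, ok (fhat (u n)) ∧
      ν (fhat (u n)) ≤ 2 * Aρ * ampl |Aμ| a * ν F := by
    intro ν ok hν hokF n
    have hp := hA.ampl_pos
    induction n with
    | zero =>
      have h1 := hν.congr _ _ (reg1_zero.toHasSpec.fhat_ae_eq.symm) hν.zero.1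
      refine ⟨h1.1, ?_⟩
      rw [show u 0 = fun _ => 0 from rfl, h1.2, hν.zero.2]
      have := hν.nonneg F
      positivity
    | succ n ih =>
      have h1 := hν.op _ _ _ _ hop (hreg n) ih.1
      have d1 := (hop.reg1 (hreg n)).dens
      have h2 := hν.const_mul (Aμ : ℂ) d1 h1.1
      have h3 := hν.const_mul ((2 * Aρ : ℝ) : ℂ) hf1.dens hokF
      have h4 := hν.sub (d1.const_mul _) (hf1.dens.const_mul _) h2.1 h3.1
      have h5 := hν.congr _ _ (hsucc n).symm h4.1
      refine ⟨h5.1, ?_⟩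
      rw [h5.2]
      refine h4.2.trans ?_
      have e2 := h2.2
      have e3 := h3.2
      rw [norm_real, Real.norm_eq_abs] at e2 e3
      rw [abs_of_nonneg (by positivity : 0 ≤ 2 * Aρ)] at e3
      have e4 : |Aμ| * ν (fhat (tk (kD f) (u n))) ≤ κ * (2 * Aρ * ampl |Aμ| a * ν F) := by
        rw [hκ, mul_assoc]
        exact mul_le_mul_of_nonneg_left (h1.2.trans
          (mul_le_mul_of_nonneg_left ih.2 hop.nonneg)) (abs_nonneg _)
      have e5 := hA.ampl_eq
      calc _ ≤ κ * (2 * Aρ * ampl |Aμ| a * ν F) + 2 * Aρ * ν F := by linarith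
        _ = 2 * Aρ * (1 + |Aμ| * kapD a * ampl |Aμ| a) * ν F := by rw [hκ]; ring
        _ = _ := by rw [← e5]
  have hstep : ∀ n, l2 (fun ξ => fhat (u (n + 1)) ξ - fhat (u (n + 1 + 1)) ξ)
      ≤ κ * l2 (fun ξ => fhat (u n) ξ - fhat (u (n + 1)) ξ) := by
    intro n
    have h1 := hop.l2_sub_le (hreg n) (hreg (n + 1))
    have h2 : (fun ξ => fhat (u (n + 1)) ξ - fhat (u (n + 1 + 1)) ξ) =ᵐ[volume]
        fun ξ => (Aμ : ℂ) * (fhat (tk (kD f) (u n)) ξ - fhat (tk (kD f) (u (n + 1))) ξ) := by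
      filter_upwards [hsucc n, hsucc (n + 1)] with ξ e1 e2
      rw [e1, e2]
      ring
    rw [l2_congr_ae h2, l2_const_mul, norm_real, Real.norm_eq_abs, hκ, mul_assoc]
    exact mul_le_mul_of_nonneg_left h1 (abs_nonneg _)
  have hgeo : ∀ n, l2 (fun ξ => fhat (u n) ξ - fhat (u (n + 1)) ξ)
      ≤ l2 (fun ξ => fhat (u 0) ξ - fhat (u 1) ξ) * κ ^ n := by
    intro n
    induction n with
    | zero => simp
    | succ n ih =>
      refine (hstep n).trans ((mul_le_mul_of_nonneg_left ih hA.contr.1).trans_eq ?_)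
      ring
  obtain ⟨V, hV, hlim⟩ := exists_l2_limit (fun n => (hreg n).memLp) hA.contr.2 hgeo
  have hlimν : ∀ ν ok, Nrm ν ok → ok F → ok V ∧ ν V ≤ 2 * Aρ * ampl |Aμ| a * ν F := by
    intro ν ok hν hokF
    have hp := hA.ampl_pos
    have := hν.nonneg F
    exact hν.lim _ V _ (by positivity) (fun n => (hreg n).dens) hV hlim
      (fun n => (hbd ν ok hν hokF n).1) (fun n => (hbd ν ok hν hokF n).2)
  have hV1 := (hlimν _ _ nrm_n1 hf1.int1).1
  have hsymm : ∀ᵐ ξ, conj (V (-ξ)) = V ξ := by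
    obtain ⟨ns, _, hns⟩ := exists_subseq_ae (fun n => (hreg n).memLp) hV hlim
    have hns' : ∀ᵐ ξ, Tendsto (fun n => fhat (u (ns n)) (-ξ)) atTop (𝓝 (V (-ξ))) :=
      (Measure.measurePreserving_neg (volume : Measure ℝ)).quasiMeasurePreserving.ae hns
    have hcs : ∀ᵐ ξ, ∀ n, conj (fhat (u n) (-ξ)) = fhat (u n) ξ :=
      ae_all_iff.2 fun n => (hreg n).toHasSpec.conj_symm
    filter_upwards [hns, hns', hcs] with ξ h1 h2 h3
    refine tendsto_nhds_unique ((continuous_conj.tendsto _).comp h2) (h1.congr fun n => ?_)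
    exact (h3 _).symm
  have hVi := integrable_of_memLp_of_int1 hV hV1
  have hw : Reg1 (phys V) V := { hasSpec_phys hVi hV hsymm with int1 := hV1 }
  refine ⟨phys V, V, { hw with jump := ?_ }, hlimν⟩
  have hrhs := ((hop.reg1 hw).const_mul Aμ).sub (hf1.const_mul (2 * Aρ))
  have hae : V =ᵐ[volume] fun ξ =>
      (Aμ : ℂ) * fhat (tk (kD f) (phys V)) ξ - ((2 * Aρ : ℝ) : ℂ) * F ξ := by
    have hz : l2 (fun ξ => V ξ -
        ((Aμ : ℂ) * fhat (tk (kD f) (phys V)) ξ - ((2 * Aρ : ℝ) : ℂ) * F ξ)) = 0 := by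
      refine le_antisymm ?_ (l2_nonneg _)
      have t1 := (tendsto_add_atTop_iff_nat 1).2 hlim
      have t2 := t1.add (hlim.const_mul κ)
      simp only [mul_zero, add_zero] at t2
      refine ge_of_tendsto t2 (Eventually.of_forall fun n => ?_)
      have d1 : MemLp (fun ξ => V ξ - fhat (u (n + 1)) ξ) 2 := hV.sub (hreg (n + 1)).memLp
      have d2 : MemLp (fun ξ => (Aμ : ℂ) *
          (fhat (tk (kD f) (u n)) ξ - fhat (tk (kD f) (phys V)) ξ)) 2 :=
        ((hop.reg1 (hreg n)).memLp.sub (hop.reg1 hw).memLp).const_mul _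
      have h1 := l2_add_le d1 d2
      have h2 : (fun ξ => V ξ - fhat (u (n + 1)) ξ + (Aμ : ℂ) *
          (fhat (tk (kD f) (u n)) ξ - fhat (tk (kD f) (phys V)) ξ)) =ᵐ[volume] fun ξ => V ξ -
          ((Aμ : ℂ) * fhat (tk (kD f) (phys V)) ξ - ((2 * Aρ : ℝ) : ℂ) * F ξ) := by
        filter_upwards [hsucc n] with ξ e1
        rw [e1]
        ring
      rw [l2_congr_ae h2] at h1
      refine h1.trans (add_le_add ?_ ?_)
      · apply le_of_eq
        simp only [l2, norm_sub_rev]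
      · rw [l2_const_mul, norm_real, Real.norm_eq_abs, hκ, mul_assoc]
        exact mul_le_mul_of_nonneg_left (hop.l2_sub_le (hreg n) hw) (abs_nonneg _)
    replace hz := (l2_eq_zero_iff (hV.sub hrhs.memLp)).1 hz
    filter_upwards [hz] with ξ hξ
    exact sub_eq_zero.1 hξ
  intro α
  exact congrFun (hw.toHasSpec.eq_of_ae hrhs.toHasSpec hae) α

/-- Uniqueness of the potential jump. -/
lemma IsOm.unique (hA : Adm |Aμ| a) (hf : Reg2 f F)
    (ha : n1 F ≤ a) (hv : IsOm Aμ Aρ f v V) (hw : IsOm Aμ Aρ f w W) :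
    v = w := by
  have hop := op_kD hf ha hA.lt_one
  refine hv.toHasSpec.eq_of_ae hw.toHasSpec ?_
  have h1 : (fun ξ => V ξ - W ξ) =ᵐ[volume] fun ξ =>
      (Aμ : ℂ) * (fhat (tk (kD f) v) ξ - fhat (tk (kD f) w) ξ) := by
    filter_upwards [hv.spec_ae hf.toReg1 hop, hw.spec_ae hf.toReg1 hop] with ξ e1 e2
    rw [e1, e2]
    ring
  have h2 : l2 (fun ξ => V ξ - W ξ) ≤ |Aμ| * kapD a * l2 (fun ξ => V ξ - W ξ) := by
    conv_lhs => rw [l2_congr_ae h1, l2_const_mul, norm_real, Real.norm_eq_abs]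
    rw [mul_assoc]
    exact mul_le_mul_of_nonneg_left (hop.l2_sub_le hv.toReg1 hw.toReg1) (abs_nonneg _)
  have h3 : l2 (fun ξ => V ξ - W ξ) = 0 := by
    have := hA.contr.2
    have := l2_nonneg (fun ξ => V ξ - W ξ)
    nlinarith
  replace h3 := (l2_eq_zero_iff (hv.memLp.sub hw.memLp)).1 h3
  filter_upwards [h3] with ξ hξ
  exact sub_eq_zero.1 hξ

lemma IsOm.bound (hA : Adm |Aμ| a) (hρ : 0 ≤ Aρ)
    (hf : Reg2 f F) (ha : n1 F ≤ a) (hw : IsOm Aμ Aρ f w W)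
    {ν : (ℝ → ℂ) → ℝ} {ok : (ℝ → ℂ) → Prop} (hν : Nrm ν ok) (hok : ok F) :
    ok W ∧ ν W ≤ 2 * Aρ * ampl |Aμ| a * ν F := by
  obtain ⟨v, V, hv, hb⟩ := exists_isOm hA hρ hf ha
  have h1 := IsOm.unique hA hf ha hv hw
  subst h1
  have h2 := hν.congr _ _ (hv.toHasSpec.ae_unique hw.toHasSpec) (hb ν ok hν hok).1
  exact ⟨h2.1, h2.2.trans_le (hb ν ok hν hok).2⟩

end

section

variable {ν : (ℝ → ℂ) → ℝ} {Aμ Aρ a m : ℝ} {F G V W : ℝ → ℂ} {f g v w : ℝ → ℝ}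

/-- The symbol `i sgn ξ`. -/
def isgn (ξ : ℝ) : ℂ := I * ((SignType.sign ξ : ℝ) : ℂ)

lemma measurable_isgn : Measurable isgn := measurable_sign_ofReal.const_mul I

lemma norm_isgn_le (ξ : ℝ) : ‖isgn ξ‖ ≤ 1 := by
  rw [isgn, norm_mul, norm_I, one_mul, norm_real]
  rcases lt_trichotomy ξ 0 with h | h | h <;> simp [h, sign_neg, sign_pos]

lemma abs_mul_isgn (ξ : ℝ) : ((|ξ| : ℝ) : ℂ) * isgn ξ = I * ξ := by
  rw [isgn]
  rcases lt_trichotomy ξ 0 with h | h | h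
  · simp [abs_of_neg h, sign_neg h, mul_comm]
  · simp [h]
  · simp [abs_of_pos h, sign_pos h, mul_comm]

/-- The density `M` of the nonlinearity, which reads `|ξ| M(ξ)`. -/
def mspec (Aμ : ℝ) (f w : ℝ → ℝ) (ξ : ℝ) : ℂ :=
  ((Aμ / 2 : ℝ) : ℂ) * fhat (tk (kD f) w) ξ + isgn ξ * fhat (tk (kS f) w) ξ

lemma dens_mspec (hf : Reg2 f F) (h1 : n1 F < 1)
    (hw : Reg1 w W) : Dens (mspec Aμ f w) :=
  (((op_kD hf le_rfl h1).reg1 hw).dens.const_mul _).add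
    (((op_kS hf le_rfl h1).reg1 hw).dens.mul_symbol measurable_isgn norm_isgn_le)

lemma Nrm.mspec_le {ok : (ℝ → ℂ) → Prop} (hν : Nrm ν ok)
    (hf : Reg2 f F) (ha : n1 F ≤ a) (ha1 : a < 1) (hw : Reg1 w W)
    (hok : ok W) :
    ok (mspec Aμ f w) ∧ ν (mspec Aμ f w) ≤ (|Aμ| / 2 * kapD a + kapS a) * ν W := by
  have oD := op_kD hf ha ha1
  have oS := op_kS hf ha ha1
  have dD := (oD.reg1 hw).dens
  have dS := (oS.reg1 hw).dens
  have h1 := hν.op _ _ _ _ oD hw hok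
  have h2 := hν.op _ _ _ _ oS hw hok
  have h3 := hν.const_mul ((Aμ / 2 : ℝ) : ℂ) dD h1.1
  have h4 := hν.mul _ isgn 1 dS h2.1 measurable_isgn zero_le_one norm_isgn_le
  have h5 := hν.add _ _ (dD.const_mul _) (dS.mul_symbol measurable_isgn norm_isgn_le) h3.1 h4.1
  refine ⟨h5.1, h5.2.trans ?_⟩
  have h6 := h3.2
  rw [norm_real, Real.norm_eq_abs, abs_div, abs_two] at h6
  have h7 := mul_le_mul_of_nonneg_left h1.2 (by positivity : 0 ≤ |Aμ| / 2)
  linarith [h4.2, h2.2]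

/-- Two-slot difference estimate. -/
lemma Nrm.op_sub_le {ok : (ℝ → ℂ) → Prop} (hν : Nrm ν ok) {k k' : ℝ → ℝ → ℝ}
    {C B C' : ℝ} (hk : Op k B) (hk' : Op k' C) (hs : Op (fun α β => k α β - k' α β) C')
    (hw : Reg1 w W) (hv : Reg1 v V) (hokW : ok W) (hokV : ok V) :
    ok (fun ξ => fhat (tk k w) ξ - fhat (tk k' v) ξ) ∧
      ν (fun ξ => fhat (tk k w) ξ - fhat (tk k' v) ξ) ≤ C' * ν W + C * ν (fun ξ => W ξ - V ξ) := by
  obtain ⟨D, hD⟩ := hk.kbound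
  obtain ⟨D', hD'⟩ := hk'.kbound
  have hokd := hν.sub hw.dens hv.dens hokW hokV
  have h1 := hν.op _ _ _ _ hs hw hokW
  have h2 := hν.op _ _ _ _ hk' (hw.sub hv) hokd.1
  have r1 := hs.reg1 hw
  have r2 := hk'.reg1 (hw.sub hv)
  have h3 := hν.add _ _ r1.dens r2.dens h1.1 h2.1
  have hfun : (fun α => tk (fun α β => k α β - k' α β) w α + tk k' (fun x => w x - v x) α)
      = fun α => tk k w α - tk k' v α := by
    ext α
    rw [tk_kernel_sub hD hD' hw.memLp_fun, tk_sub hD' hw.memLp_fun hv.memLp_fun]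
    ring
  have e1 := fhat_add r1.memLp_fun r2.memLp_fun
  rw [hfun] at e1
  have e2 := fhat_sub (hk.reg1 hw).memLp_fun (hk'.reg1 hv).memLp_fun
  have h4 := hν.congr _ _ (e1.symm.trans e2) h3.1
  exact ⟨h4.1, h4.2.trans_le (h3.2.trans (add_le_add h1.2 h2.2))⟩

lemma IsOm.sub_le {ok : (ℝ → ℂ) → Prop} (hν : Nrm ν ok)
    (hA : Adm |Aμ| a) (hρ : 0 ≤ Aρ) (hf : Reg2 f F) (hg : Reg2 g G)
    (haf : n1 F ≤ a) (hag : n1 G ≤ a) (hw : IsOm Aμ Aρ f w W)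
    (hv : IsOm Aμ Aρ g v V) (hokF : ok F) (hokG : ok G) :
    ν (fun ξ => W ξ - V ξ) ≤ ampl |Aμ| a *
      (|Aμ| * (kapD' a * n1 (fun ξ => F ξ - G ξ)) * ν W + 2 * Aρ * ν (fun ξ => F ξ - G ξ)) := by
  have oF := op_kD hf haf hA.lt_one
  have oG := op_kD hg hag hA.lt_one
  have oS := op_kD_sub hf hg haf hag hA.lt_one
  have hokW := (hw.bound hA hρ hf haf hν hokF).1
  have hokV := (hv.bound hA hρ hg hag hν hokG).1
  refine hA.le_ampl_mul ?_
  have h1 := hν.op_sub_le oF oG oS hw.toReg1 hv.toReg1 hokW hokV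
  have dd := (oF.reg1 hw.toReg1).dens.sub (oG.reg1 hv.toReg1).dens
  have h2 := hν.const_mul (Aμ : ℂ) dd h1.1
  have hFG := hν.sub hf.toReg1.dens hg.toReg1.dens hokF hokG
  have dF := hf.toReg1.dens.sub hg.toReg1.dens
  have h3 := hν.const_mul ((2 * Aρ : ℝ) : ℂ) dF hFG.1
  have h4 := hν.sub (dd.const_mul _) (dF.const_mul _) h2.1 h3.1
  have hae : (fun ξ => (Aμ : ℂ) * (fhat (tk (kD f) w) ξ - fhat (tk (kD g) v) ξ)
      - ((2 * Aρ : ℝ) : ℂ) * (F ξ - G ξ)) =ᵐ[volume] fun ξ => W ξ - V ξ := by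
    filter_upwards [hw.spec_ae hf.toReg1 oF, hv.spec_ae hg.toReg1 oG] with ξ e1 e2
    rw [e1, e2]
    ring
  rw [(hν.congr _ _ hae h4.1).2]
  refine h4.2.trans ?_
  have e2 := h2.2
  have e3 := h3.2
  rw [norm_real, Real.norm_eq_abs] at e2 e3
  rw [abs_of_nonneg (by positivity : 0 ≤ 2 * Aρ)] at e3
  have e4 := mul_le_mul_of_nonneg_left h1.2 (abs_nonneg Aμ)
  rw [← (hν.congr _ _ hae h4.1).2]
  rw [(hν.congr _ _ hae h4.1).2] at e4 ⊢
  linarith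

lemma Nrm.mspec_sub_le {ok : (ℝ → ℂ) → Prop} (hν : Nrm ν ok)
    (hA : Adm |Aμ| a) (hρ : 0 ≤ Aρ) (hf : Reg2 f F) (hg : Reg2 g G)
    (haf : n1 F ≤ a) (hag : n1 G ≤ a) (hw : IsOm Aμ Aρ f w W)
    (hv : IsOm Aμ Aρ g v V) (hokF : ok F) (hokG : ok G) :
    ν (fun ξ => mspec Aμ f w ξ - mspec Aμ g v ξ) ≤
      (|Aμ| / 2 * kapD' a + kapS' a) * n1 (fun ξ => F ξ - G ξ) * ν W
        + (|Aμ| / 2 * kapD a + kapS a) * ν (fun ξ => W ξ - V ξ) := by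
  have hokW := (hw.bound hA hρ hf haf hν hokF).1
  have hokV := (hv.bound hA hρ hg hag hν hokG).1
  have oF := op_kD hf haf hA.lt_one
  have oG := op_kD hg hag hA.lt_one
  have pF := op_kS hf haf hA.lt_one
  have pG := op_kS hg hag hA.lt_one
  have h1 := hν.op_sub_le oF oG (op_kD_sub hf hg haf hag hA.lt_one) hw.toReg1 hv.toReg1 hokW hokV
  have h2 := hν.op_sub_le pF pG (op_kS_sub hf hg haf hag hA.lt_one) hw.toReg1 hv.toReg1 hokW hokV
  have d1 := (oF.reg1 hw.toReg1).dens.sub (oG.reg1 hv.toReg1).dens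
  have d2 := (pF.reg1 hw.toReg1).dens.sub (pG.reg1 hv.toReg1).dens
  have h3 := hν.const_mul ((Aμ / 2 : ℝ) : ℂ) d1 h1.1
  have h4 := hν.mul _ isgn 1 d2 h2.1 measurable_isgn zero_le_one norm_isgn_le
  have h5 := hν.add _ _ (d1.const_mul _) (d2.mul_symbol measurable_isgn norm_isgn_le) h3.1 h4.1
  have he : (fun ξ => mspec Aμ f w ξ - mspec Aμ g v ξ) = fun ξ =>
      ((Aμ / 2 : ℝ) : ℂ) * (fhat (tk (kD f) w) ξ - fhat (tk (kD g) v) ξ)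
        + isgn ξ * (fhat (tk (kS f) w) ξ - fhat (tk (kS g) v) ξ) := by
    ext ξ
    rw [mspec, mspec]
    ring
  rw [he]
  refine h5.2.trans ?_
  have h6 := h3.2
  rw [norm_real, Real.norm_eq_abs, abs_div, abs_two] at h6
  have h7 := mul_le_mul_of_nonneg_left h1.2 (by positivity : 0 ≤ |Aμ| / 2)
  linarith [h4.2, h2.2]

lemma Adm.ampl_nonneg (h : Adm m a) : 0 ≤ ampl m a := h.ampl_pos.le

/-- The Lipschitz estimate of the nonlinearity in `Ḟ^{1,1}`. -/
lemma n1_mspec_sub_le (hA : Adm |Aμ| a) (hρ : 0 ≤ Aρ)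
    (hf : Reg2 f F) (hg : Reg2 g G) (haf : n1 F ≤ a) (hag : n1 G ≤ a)
    (hw : IsOm Aμ Aρ f w W) (hv : IsOm Aμ Aρ g v V) :
    n1 (fun ξ => mspec Aμ f w ξ - mspec Aμ g v ξ) ≤
      Aρ * loss |Aμ| a * n1 (fun ξ => F ξ - G ξ) := by
  have h1 := nrm_n1.mspec_sub_le hA hρ hf hg haf hag hw hv hf.int1 hg.int1
  have h2 := hw.sub_le nrm_n1 hA hρ hf hg haf hag hv hf.int1 hg.int1
  have h3 := (hw.bound hA hρ hf haf nrm_n1 hf.int1).2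
  set b := n1 (fun ξ => F ξ - G ξ) with hb
  have hb0 : 0 ≤ b := n1_nonneg _
  have hX := hA.ampl_nonneg
  have hD := hA.kapD_nonneg
  have hS := hA.kapS_nonneg
  have hD' := hA.kapD'_nonneg
  have hS' := hA.kapS'_nonneg
  have hm := hA.m_nonneg
  have h4 : n1 W ≤ 2 * Aρ * ampl |Aμ| a * a :=
    h3.trans (mul_le_mul_of_nonneg_left haf (by positivity))
  have h5 : n1 (fun ξ => W ξ - V ξ) ≤ ampl |Aμ| a *
      (|Aμ| * (kapD' a * b) * (2 * Aρ * ampl |Aμ| a * a) + 2 * Aρ * b) := by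
    refine h2.trans ?_
    gcongr
  calc _ ≤ (|Aμ| / 2 * kapD' a + kapS' a) * b * (2 * Aρ * ampl |Aμ| a * a)
        + (|Aμ| / 2 * kapD a + kapS a) * (ampl |Aμ| a *
      (|Aμ| * (kapD' a * b) * (2 * Aρ * ampl |Aμ| a * a) + 2 * Aρ * b)) := by
        refine h1.trans ?_
        gcongr
    _ = _ := by
        rw [loss, kapD, kapS, kapD', kapS', ampl]
        ring

lemma Adm.half_le_loss (h : Adm m a) :
    (m / 2 * kapD a + kapS a) * (2 * ampl m a) ≤ loss m a := by
  have hX := h.ampl_nonneg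
  have hD := h.kapD_nonneg
  have hS := h.kapS_nonneg
  have hD' := h.kapD'_nonneg
  have hS' := h.kapS'_nonneg
  have hm := h.m_nonneg
  have ha := h.nonneg
  have e : loss m a = (m / 2 * kapD' a + kapS' a) * (2 * a * ampl m a)
      + (m / 2 * kapD a + kapS a) * (ampl m a * (2 * m * kapD' a * a * ampl m a))
      + (m / 2 * kapD a + kapS a) * (2 * ampl m a) := by
    rw [loss, kapD, kapS, kapD', kapS', ampl]
    ring
  have h1 : 0 ≤ (m / 2 * kapD' a + kapS' a) * (2 * a * ampl m a) := by positivity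
  have h2 : 0 ≤ (m / 2 * kapD a + kapS a) * (ampl m a * (2 * m * kapD' a * a * ampl m a)) := by
    positivity
  linarith

lemma Adm.loss_nonneg (h : Adm m a) : 0 ≤ loss m a := by
  refine le_trans ?_ h.half_le_loss
  have hX := h.ampl_nonneg
  have hD := h.kapD_nonneg
  have hS := h.kapS_nonneg
  have hm := h.m_nonneg
  positivity

/-- The nonlinearity is bounded by the linear part in all norms. -/
lemma IsOm.mspec_le {ok : (ℝ → ℂ) → Prop} (hν : Nrm ν ok)
    (hA : Adm |Aμ| a) (hρ : 0 ≤ Aρ) (hf : Reg2 f F) (haf : n1 F ≤ a)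
    (hw : IsOm Aμ Aρ f w W) (hok : ok F) :
    ok (mspec Aμ f w) ∧ ν (mspec Aμ f w) ≤ Aρ * loss |Aμ| a * ν F := by
  have h1 := hw.bound hA hρ hf haf hν hok
  have h2 := hν.mspec_le (Aμ := Aμ) hf haf hA.lt_one hw.toReg1 h1.1
  refine ⟨h2.1, h2.2.trans ?_⟩
  have hD := hA.kapD_nonneg
  have hS := hA.kapS_nonneg
  have hF := hν.nonneg F
  calc _ ≤ (|Aμ| / 2 * kapD a + kapS a) * (2 * Aρ * ampl |Aμ| a * ν F) := by gcongr; exact h1.2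
    _ = (|Aμ| / 2 * kapD a + kapS a) * (2 * ampl |Aμ| a) * (Aρ * ν F) := by ring
    _ ≤ loss |Aμ| a * (Aρ * ν F) := by gcongr; exact hA.half_le_loss
    _ = _ := by ring

end

section

variable {Aμ Aρ s : ℝ} {F U W : ℝ → ℂ} {f u w : ℝ → ℝ}

/-- The density of the translate `u(· + ε)`. -/
def shiftSpec (ε : ℝ) (U : ℝ → ℂ) (ξ : ℝ) : ℂ := cexp (I * ξ * ε) * U ξ

lemma norm_shiftSpec (ε : ℝ) (U : ℝ → ℂ) (ξ : ℝ) : ‖shiftSpec ε U ξ‖ = ‖U ξ‖ := by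
  rw [shiftSpec, norm_mul, norm_cexp_I_mul, one_mul]

lemma HasSpec.shift (h : HasSpec u U) (ε : ℝ) :
    HasSpec (fun x => u (x + ε)) (shiftSpec ε U) := by
  have hm : AEStronglyMeasurable (shiftSpec ε U) :=
    AEStronglyMeasurable.mul (by fun_prop) h.integrable.1
  refine ⟨?_, ?_, fun α => ?_⟩
  · exact h.integrable.mono hm (Eventually.of_forall fun ξ => (norm_shiftSpec ε U ξ).le)
  · exact h.memLp.of_le hm (Eventually.of_forall fun ξ => (norm_shiftSpec ε U ξ).le)
  · rw [h.eq, ift, ift]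
    congr with ξ
    have e : cexp (I * ξ * ((α + ε : ℝ) : ℂ)) = cexp (I * ξ * ε) * cexp (I * ξ * α) := by
      rw [← Complex.exp_add]
      push_cast
      ring_nf
    rw [shiftSpec, e]
    ring

lemma Reg1.shift (h : Reg1 u U) (ε : ℝ) :
    Reg1 (fun x => u (x + ε)) (shiftSpec ε U) :=
  { h.toHasSpec.shift ε with int1 := by simpa only [norm_shiftSpec] using h.int1 }

lemma Reg2.shift (h : Reg2 u U) (ε : ℝ) :
    Reg2 (fun x => u (x + ε)) (shiftSpec ε U) :=
  { h.toReg1.shift ε with int2 := by simpa only [norm_shiftSpec] using h.int2 }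

lemma kk_shift (p f : ℝ → ℝ) (ε α β : ℝ) : kk p (fun x => f (x + ε)) α β = kk p f (α + ε) β := by
  rw [kk, kk, deriv_comp_add_const]
  simp only [diffQuot, sub_add_eq_add_sub]

lemma tk_kD_shift (f w : ℝ → ℝ) (ε : ℝ) :
    tk (kD fun x => f (x + ε)) (fun x => w (x + ε)) = fun α => tk (kD f) w (α + ε) := by
  ext α
  simp only [tk, kD, kk_shift, sub_add_eq_add_sub]

lemma tk_kS_shift (f w : ℝ → ℝ) (ε : ℝ) :
    tk (kS fun x => f (x + ε)) (fun x => w (x + ε)) = fun α => tk (kS f) w (α + ε) := by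
  ext α
  simp only [tk, kS, kk_shift, sub_add_eq_add_sub]

lemma IsOm.shift (h : IsOm Aμ Aρ f w W) (ε : ℝ) :
    IsOm Aμ Aρ (fun x => f (x + ε)) (fun x => w (x + ε)) (shiftSpec ε W) :=
  { h.toReg1.shift ε with jump := fun α => by rw [tk_kD_shift]; exact h.jump _ }

lemma mspec_shift (hf : Reg2 f F) (h1 : n1 F < 1)
    (hw : Reg1 w W) (ε : ℝ) :
    mspec Aμ (fun x => f (x + ε)) (fun x => w (x + ε)) =ᵐ[volume] shiftSpec ε (mspec Aμ f w) := by
  have e1 := (((op_kD hf le_rfl h1).reg1 hw).toHasSpec.shift ε).fhat_ae_eq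
  have e2 := (((op_kS hf le_rfl h1).reg1 hw).toHasSpec.shift ε).fhat_ae_eq
  filter_upwards [e1, e2] with ξ x1 x2
  rw [mspec, tk_kD_shift, tk_kS_shift, x1, x2, shiftSpec, shiftSpec, shiftSpec, mspec]
  ring

lemma n1_shift_sub (ε : ℝ) (U : ℝ → ℂ) :
    n1 (fun ξ => shiftSpec ε U ξ - U ξ) = ∫ ξ : ℝ, |ξ| * (‖cexp (I * ξ * ε) - 1‖ * ‖U ξ‖) := by
  rw [n1]
  congr with ξ
  rw [shiftSpec, ← norm_mul, sub_mul, one_mul]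

lemma norm_cexp_sub_one_le (ξ ε : ℝ) : ‖cexp (I * ξ * ε) - 1‖ ≤ |ξ| * |ε| := by
  have := Real.norm_exp_I_mul_ofReal_sub_one_le (x := ξ * ε)
  rw [Real.norm_eq_abs, abs_mul] at this
  push_cast at this
  rwa [← mul_assoc] at this

lemma tendsto_cexp_sub_one (ξ : ℝ) :
    Tendsto (fun n : ℕ => ‖cexp (I * ξ * ((1 / ((n : ℝ) + 1) : ℝ) : ℂ)) - 1‖ * ((n : ℝ) + 1)) atTop
      (𝓝 |ξ|) := by
  have h1 : HasDerivAt (fun ε : ℝ => cexp (I * ξ * ε)) (I * ξ) 0 := by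
    have : HasDerivAt (fun x : ℝ => I * ξ * (x : ℂ)) (I * ξ) 0 := by
      simpa using (ofRealCLM.hasDerivAt (x := (0 : ℝ))).const_mul (I * (ξ : ℂ))
    simpa using this.cexp
  have h2 := h1.tendsto_slope_zero
  have h3 : Tendsto (fun n : ℕ => 1 / ((n : ℝ) + 1)) atTop (𝓝[≠] 0) :=
    tendsto_nhdsWithin_iff.2 ⟨tendsto_one_div_add_atTop_nhds_zero_nat,
      Eventually.of_forall fun n => by
        have : (0 : ℝ) < 1 / ((n : ℝ) + 1) := by positivity
        exact this.ne'⟩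
  have h4 := (h2.comp h3).norm
  have e : ‖I * (ξ : ℂ)‖ = |ξ| := by rw [norm_mul, norm_I, one_mul, norm_real, Real.norm_eq_abs]
  rw [e] at h4
  refine h4.congr fun n => ?_
  simp only [Function.comp_def, zero_add, ofReal_zero, mul_zero, Complex.exp_zero]
  rw [norm_smul, one_div, inv_inv, Real.norm_of_nonneg (by positivity), mul_comm]

/-- The `Ḟ^{2,1}` bound of the density of the nonlinearity. -/
lemma IsOm.n2_mspec_le {a : ℝ} (hA : Adm |Aμ| a) (hρ : 0 ≤ Aρ)
    (hf : Reg2 f F) (haf : n1 F ≤ a) (hw : IsOm Aμ Aρ f w W) :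
    (Integrable fun ξ => |ξ| ^ 2 * ‖mspec Aμ f w ξ‖) ∧
      n2 (mspec Aμ f w) ≤ Aρ * loss |Aμ| a * n2 F := by
  have hd := dens_mspec (Aμ := Aμ) hf (haf.trans_lt hA.lt_one) hw.toReg1
  have hl := hA.loss_nonneg
  set M := mspec Aμ f w with hM
  have hstep : ∀ ε : ℝ, 0 < ε → (∫ ξ : ℝ, |ξ| * (‖cexp (I * ξ * ε) - 1‖ * ‖M ξ‖))
      ≤ Aρ * loss |Aμ| a * n2 F * ε := by
    intro ε hε
    have hn : n1 (shiftSpec ε F) ≤ a := by simpa only [n1, norm_shiftSpec] using haf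
    have h1 := n1_mspec_sub_le hA hρ (hf.shift ε) hf hn haf (hw.shift ε) hw
    have h2 := mspec_shift (Aμ := Aμ) hf (haf.trans_lt hA.lt_one) hw.toReg1 ε
    have h3 : (fun ξ => mspec Aμ (fun x => f (x + ε)) (fun x => w (x + ε)) ξ - M ξ) =ᵐ[volume]
        fun ξ => shiftSpec ε M ξ - M ξ := by
      filter_upwards [h2] with ξ hξ
      rw [hξ]
    rw [n1_congr_ae h3, n1_shift_sub, n1_shift_sub] at h1
    refine h1.trans ?_
    rw [mul_assoc _ (n2 F)]
    refine mul_le_mul_of_nonneg_left ?_ (by positivity)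
    rw [n2, ← integral_mul_const]
    refine integral_mono_of_nonneg (Eventually.of_forall fun ξ => by positivity)
      (hf.int2.mul_const ε) (Eventually.of_forall fun ξ => ?_)
    have := norm_cexp_sub_one_le ξ ε
    rw [abs_of_pos hε] at this
    calc |ξ| * (‖cexp (I * ξ * ε) - 1‖ * ‖F ξ‖) ≤ |ξ| * (|ξ| * ε * ‖F ξ‖) := by gcongr
      _ = _ := by ring
  have hB : 0 ≤ Aρ * loss |Aμ| a * n2 F := by have := n2_nonneg F; positivity
  refine integrable_of_lintegral_le (q := fun ξ => |ξ| ^ 2) hd.memLp.1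
    (measurable_id.abs.pow_const 2) (fun _ => by positivity) hB ?_
  set q : ℕ → ℝ → ℝ := fun n ξ =>
    |ξ| * (‖cexp (I * ξ * ((1 / ((n : ℝ) + 1) : ℝ) : ℂ)) - 1‖ * ((n : ℝ) + 1)) with hq
  have hq0 : ∀ n ξ, 0 ≤ q n ξ := fun n ξ => by rw [hq]; positivity
  have hqm : ∀ n, Measurable (q n) := fun n => by rw [hq]; fun_prop
  have hqle : ∀ n ξ, q n ξ ≤ ((n : ℝ) + 1) * 2 * |ξ| := fun n ξ => by
    have h2 : ‖cexp (I * ξ * ((1 / ((n : ℝ) + 1) : ℝ) : ℂ)) - 1‖ ≤ 2 := by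
      refine (norm_sub_le _ _).trans ?_
      rw [norm_cexp_I_mul, norm_one]; norm_num
    rw [hq]
    dsimp only
    nlinarith [mul_le_mul_of_nonneg_left (mul_le_mul_of_nonneg_right h2
      (by positivity : (0 : ℝ) ≤ (n : ℝ) + 1)) (abs_nonneg ξ)]
  have hqint : ∀ n, Integrable fun ξ => q n ξ * ‖M ξ‖ := fun n => by
    refine (hd.int1.const_mul (((n : ℝ) + 1) * 2)).mono'
      ((hqm n).aestronglyMeasurable.mul hd.memLp.1.norm) (Eventually.of_forall fun ξ => ?_)
    rw [Real.norm_of_nonneg (mul_nonneg (hq0 n ξ) (norm_nonneg _)), ← mul_assoc]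
    exact mul_le_mul_of_nonneg_right (hqle n ξ) (norm_nonneg _)
  have hlim : ∀ ξ, Tendsto (fun n => q n ξ) atTop (𝓝 (|ξ| ^ 2)) := fun ξ => by
    rw [sq]
    exact (tendsto_cexp_sub_one ξ).const_mul |ξ|
  calc ∫⁻ ξ, ENNReal.ofReal (|ξ| ^ 2) * ‖M ξ‖ₑ
      = ∫⁻ ξ, liminf (fun n => ENNReal.ofReal (q n ξ) * ‖M ξ‖ₑ) atTop := by
        congr with ξ
        refine (Tendsto.liminf_eq ?_).symm
        exact ENNReal.Tendsto.mul_const (ENNReal.tendsto_ofReal (hlim ξ)) (Or.inr enorm_ne_top)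
    _ ≤ liminf (fun n => ∫⁻ ξ, ENNReal.ofReal (q n ξ) * ‖M ξ‖ₑ) atTop :=
        lintegral_liminf_le' fun n => (hqm n).ennreal_ofReal.aemeasurable.mul hd.memLp.1.enorm
    _ ≤ ENNReal.ofReal (Aρ * loss |Aμ| a * n2 F) := by
        refine liminf_le_of_le ⟨0, by simp⟩ fun b hb => ?_
        obtain ⟨n, hn⟩ := hb.exists
        refine hn.trans ?_
        rw [lintegral_eq_ofReal_integral (hq0 n) (hqint n)]
        refine ENNReal.ofReal_le_ofReal ?_
        have h1 := hstep (1 / ((n : ℝ) + 1)) (by positivity)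
        have h2 : ∫ ξ, q n ξ * ‖M ξ‖ = ((n : ℝ) + 1) *
            ∫ ξ : ℝ, |ξ| * (‖cexp (I * ξ * ((1 / ((n : ℝ) + 1) : ℝ) : ℂ)) - 1‖ * ‖M ξ‖) := by
          rw [← integral_const_mul]
          congr with ξ
          rw [hq]
          ring
        rw [h2]
        have hn1 : (0 : ℝ) < (n : ℝ) + 1 := by positivity
        refine (mul_le_mul_of_nonneg_left h1 hn1.le).trans_eq ?_
        field_simp

/-- The density of the right-hand side of the evolution equation. -/
def rspec (Aμ Aρ : ℝ) (f w : ℝ → ℝ) (F : ℝ → ℂ) (ξ : ℝ) : ℂ :=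
  ((|ξ| : ℝ) : ℂ) * (mspec Aμ f w ξ - Aρ * F ξ)

lemma Dens.integrable_abs_mul (h : Dens U) :
    Integrable fun ξ => ((|ξ| : ℝ) : ℂ) * U ξ := by
  have hm : AEStronglyMeasurable fun ξ => ((|ξ| : ℝ) : ℂ) * U ξ :=
    AEStronglyMeasurable.mul (by fun_prop) h.memLp.1
  rw [← integrable_norm_iff hm]
  simpa using h.int1

lemma Lam_eq (h : HasSpec u U) (α : ℝ) :
    Lam u α = (ift (fun ξ => ((|ξ| : ℝ) : ℂ) * U ξ) α).re := by
  rw [Lam, ← ift]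
  congr 1
  refine ift_congr_ae ?_ α
  filter_upwards [h.fhat_ae_eq] with ξ hξ
  rw [hξ]

lemma rhs_eq (hf : Reg2 f F) (h1 : n1 F < 1)
    (hw : Reg1 w W) (α : ℝ) : rhs Aμ Aρ f w α = (ift (rspec Aμ Aρ f w F) α).re := by
  have rD := (op_kD hf le_rfl h1).reg1 hw
  have rS := (op_kS hf le_rfl h1).reg1 hw
  have iF := hf.toReg1.dens.integrable_abs_mul
  have iD := rD.dens.integrable_abs_mul
  have hN : N2 f w α = (ift (dspec (fhat (tk (kS f) w))) α).re := by
    rw [← rS.deriv_eq, ofReal_re]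
    exact (hf.hasDerivAt_tk_kS hw α).2.deriv.symm
  have he : rspec Aμ Aρ f w F = fun ξ =>
      ((Aμ / 2 : ℝ) : ℂ) * (((|ξ| : ℝ) : ℂ) * fhat (tk (kD f) w) ξ) + dspec (fhat (tk (kS f) w)) ξ
        - (Aρ : ℂ) * (((|ξ| : ℝ) : ℂ) * F ξ) := by
    ext ξ
    rw [rspec, mspec, dspec, ← abs_mul_isgn]
    ring
  have i1 : Integrable fun ξ => ((Aμ / 2 : ℝ) : ℂ) * (((|ξ| : ℝ) : ℂ) * fhat (tk (kD f) w) ξ) :=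
    iD.const_mul _
  have i2 : Integrable (dspec (fhat (tk (kS f) w))) := rS.integrable_dspec
  have i3 : Integrable fun ξ => (Aρ : ℂ) * (((|ξ| : ℝ) : ℂ) * F ξ) := iF.const_mul _
  rw [he, ift_sub (U := fun ξ => _ + _) (i1.add i2) i3, ift_add i1 i2, ift_const_mul, ift_const_mul,
    rhs, DL_eq, Lam_eq hf.toHasSpec, Lam_eq rD.toHasSpec, hN]
  simp only [sub_re, add_re, re_ofReal_mul]
  ring

/-- Norms in terms of densities. -/
lemma FNorm_eq (h : HasSpec u U) (s : ℝ) :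
    FNorm s u = ∫⁻ ξ, ENNReal.ofReal (|ξ| ^ s) * ‖U ξ‖ₑ := by
  rw [FNorm, if_pos h.memLp_fun]
  refine lintegral_congr_ae ?_
  filter_upwards [h.fhat_ae_eq] with ξ hξ
  rw [hξ]

lemma Reg1.FNorm_one (h : Reg1 u U) :
    FNorm 1 u = ENNReal.ofReal (n1 U) := by
  rw [FNorm_eq h.toHasSpec]
  simp only [Real.rpow_one]
  exact lintegral_eq_ofReal_integral abs_nonneg h.int1

lemma memLp_of_FNorm_lt_top (h : FNorm s u < ⊤) : MemLp u 2 := by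
  by_contra hc
  rw [FNorm, if_neg hc] at h
  exact lt_irrefl _ h

lemma lintegral_of_FNorm_lt_top (h : FNorm s u < ⊤) :
    FNorm s u = ∫⁻ ξ, ENNReal.ofReal (|ξ| ^ s) * ‖fhat u ξ‖ₑ := by
  rw [FNorm, if_pos (memLp_of_FNorm_lt_top h)]

lemma reg1_of_FNorm (hc : Continuous u) (h : FNorm 1 u < ⊤) : Reg1 u (fhat u) := by
  have hm := memLp_of_FNorm_lt_top h
  rw [lintegral_of_FNorm_lt_top h] at h
  simp only [Real.rpow_one] at h
  have h1 := integrable_of_lintegral_le (q := fun ξ => |ξ|) (memLp_fhat hm).1 measurable_id.abs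
    abs_nonneg ENNReal.toReal_nonneg (ENNReal.ofReal_toReal h.ne).ge
  exact { hasSpec_fhat hc hm (integrable_of_memLp_of_int1 (memLp_fhat hm) h1.1) with int1 := h1.1 }

lemma reg2_of_FNorm (hc : Continuous u) (h : FNorm 1 u < ⊤) (h2 : FNorm 2 u < ⊤) :
    Reg2 u (fhat u) := by
  have hm := memLp_of_FNorm_lt_top h
  rw [lintegral_of_FNorm_lt_top h2] at h2
  simp only [Real.rpow_two] at h2
  have h3 := integrable_of_lintegral_le (q := fun ξ => |ξ| ^ 2) (memLp_fhat hm).1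
    (measurable_id.abs.pow_const 2)
    (fun _ => by positivity) ENNReal.toReal_nonneg (ENNReal.ofReal_toReal h2.ne).ge
  exact { reg1_of_FNorm hc h with int2 := h3.1 }

lemma IsPotentialJump.isOm (h : IsPotentialJump Aμ Aρ f w) :
    IsOm Aμ Aρ f w (fhat w) :=
  { reg1_of_FNorm h.continuous h.norm_lt_top with
    jump := fun α => by rw [← DL_eq]; exact h.eq α }

lemma IsOm.isPotentialJump (h : IsOm Aμ Aρ f w W)
    (hf : Reg2 f F) : IsPotentialJump Aμ Aρ f w where
  continuous := h.continuous
  memLp := h.memLp_fun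
  norm_lt_top := by rw [h.toReg1.FNorm_one]; exact ENNReal.ofReal_lt_top
  integrable_dl := hf.integrable_dlKernel h.memLp_fun
  integrable_n2 α := (hf.hasDerivAt_tk_kS h.toReg1 α).1
  eq α := by rw [DL_eq]; exact h.jump α

end

section

variable {U V : ℝ → ℂ}

/-- Densities in `L² ∩ Ḟ^{1,1} ∩ Ḟ^{2,1}`. -/
structure Dens2 (U : ℝ → ℂ) : Prop extends Dens U where
  int2 : Integrable fun ξ => |ξ| ^ 2 * ‖U ξ‖

lemma Dens2.reg2 (h : Dens2 U) : Reg2 (phys U) (sym U) :=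
  { hasSpec_sym h.integrable h.memLp with
    int1 := (integral_weight_sym_le abs_nonneg abs_neg measurable_id.abs h.memLp.1 h.int1).1
    int2 := (integral_weight_sym_le (q := fun ξ => |ξ| ^ 2) (fun _ => by positivity)
      (fun ξ => by rw [abs_neg]) (measurable_id.abs.pow_const 2) h.memLp.1 h.int2).1 }

lemma Dens2.congr (h : Dens2 U) (hUV : U =ᵐ[volume] V) : Dens2 V where
  memLp := h.memLp.ae_eq hUV
  int1 := h.int1.congr (by filter_upwards [hUV] with ξ hξ; rw [hξ])
  int2 := h.int2.congr (by filter_upwards [hUV] with ξ hξ; rw [hξ])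

lemma phys_congr_ae (h : U =ᵐ[volume] V) : phys U = phys V := by
  ext α
  rw [phys, ift_congr_ae h, phys]

lemma sym_sub (U V : ℝ → ℂ) : (fun ξ => sym U ξ - sym V ξ) = sym fun ξ => U ξ - V ξ := by
  ext ξ
  simp only [sym, map_sub]
  ring

lemma Dens.n1_sym_le (h : Dens U) : n1 (sym U) ≤ n1 U :=
  (integral_weight_sym_le abs_nonneg abs_neg measurable_id.abs h.memLp.1 h.int1).2

lemma Dens2.n2_sym_le (h : Dens2 U) : n2 (sym U) ≤ n2 U :=
  (integral_weight_sym_le (q := fun ξ => |ξ| ^ 2) (fun _ => by positivity)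
      (fun ξ => by rw [abs_neg]) (measurable_id.abs.pow_const 2) h.memLp.1 h.int2).2

lemma sym_eq (U : ℝ → ℂ) : sym U = fun ξ => (2 : ℂ)⁻¹ * (U ξ + conj (U (-ξ))) := by
  ext ξ
  rw [sym]
  ring

lemma memLp_sym (h : MemLp U 2) : MemLp (sym U) 2 := by
  rw [sym_eq]
  exact (h.add (memLp_conj (memLp_comp_neg h))).const_mul _

lemma l2_sym_le (h : MemLp U 2) : l2 (sym U) ≤ l2 U := by
  have e : l2 (fun ξ => conj (U (-ξ))) = l2 U := by
    rw [l2, l2]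
    congr 1
    simp only [norm_conj]
    exact integral_neg_eq_self (fun ξ => ‖U ξ‖ ^ 2) volume
  have h1 := l2_add_le h (memLp_conj (memLp_comp_neg h))
  rw [sym_eq, l2_const_mul]
  rw [e] at h1
  simp only [norm_inv, Complex.norm_ofNat]
  linarith

lemma hspec_sym (U : ℝ → ℂ) : hspec (sym U) = sym (hspec U) := by
  ext ξ
  simp only [hspec, sym, map_mul, conj_ofReal, abs_neg]
  ring

section Nonlinearity

open Classical in
/-- The potential jump of the interface `f`. -/
def om (Aμ Aρ : ℝ) (f : ℝ → ℝ) : ℝ → ℝ :=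
  if h : ∃ w, ∃ W, IsOm Aμ Aρ f w W then h.choose else 0

/-- The nonlinearity, as a map of densities (after division by `|ξ|`). -/
def nl (Aμ Aρ : ℝ) (U : ℝ → ℂ) : ℝ → ℂ := mspec Aμ (phys U) (om Aμ Aρ (phys U))

lemma isOm_om_of {Aμ Aρ a : ℝ} (hA : Adm |Aμ| a) (hρ : 0 ≤ Aρ) {f : ℝ → ℝ} {F : ℝ → ℂ}
    (hf : Reg2 f F) (ha : n1 F ≤ a) : ∃ W, IsOm Aμ Aρ f (om Aμ Aρ f) W := by
  obtain ⟨w, W, h, -⟩ := exists_isOm hA hρ hf ha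
  have hex : ∃ w, ∃ W, IsOm Aμ Aρ f w W := ⟨w, W, h⟩
  rw [om, dif_pos hex]
  exact hex.choose_spec

variable {Aμ Aρ a : ℝ} {U V : ℝ → ℂ}

lemma isOm_om (hA : Adm |Aμ| a) (hρ : 0 ≤ Aρ) (hU : Dens2 U) (ha : n1 U ≤ a) :
    ∃ W, IsOm Aμ Aρ (phys U) (om Aμ Aρ (phys U)) W :=
  isOm_om_of hA hρ hU.reg2 (hU.n1_sym_le.trans ha)

lemma dens2_nl (hA : Adm |Aμ| a) (hρ : 0 ≤ Aρ) (hU : Dens2 U) (ha : n1 U ≤ a) :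
    Dens2 (nl Aμ Aρ U) := by
  obtain ⟨W, hW⟩ := isOm_om hA hρ hU ha
  have h1 := hU.n1_sym_le.trans ha
  exact { dens_mspec hU.reg2 (h1.trans_lt hA.lt_one) hW.toReg1 with
    int2 := (hW.n2_mspec_le hA hρ hU.reg2 h1).1 }

lemma n1_nl_le (hA : Adm |Aμ| a) (hρ : 0 ≤ Aρ) (hU : Dens2 U) (ha : n1 U ≤ a) :
    n1 (nl Aμ Aρ U) ≤ Aρ * loss |Aμ| a * n1 U := by
  obtain ⟨W, hW⟩ := isOm_om hA hρ hU ha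
  have h1 := hU.n1_sym_le
  exact (hW.mspec_le nrm_n1 hA hρ hU.reg2 (h1.trans ha) hU.reg2.int1).2.trans
    (mul_le_mul_of_nonneg_left h1 (mul_nonneg hρ hA.loss_nonneg))

lemma n2_nl_le (hA : Adm |Aμ| a) (hρ : 0 ≤ Aρ) (hU : Dens2 U) (ha : n1 U ≤ a) :
    n2 (nl Aμ Aρ U) ≤ Aρ * loss |Aμ| a * n2 U := by
  obtain ⟨W, hW⟩ := isOm_om hA hρ hU ha
  exact (hW.n2_mspec_le hA hρ hU.reg2 (hU.n1_sym_le.trans ha)).2.trans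
    (mul_le_mul_of_nonneg_left hU.n2_sym_le (mul_nonneg hρ hA.loss_nonneg))

lemma l2_nl_le (hA : Adm |Aμ| a) (hρ : 0 ≤ Aρ) (hU : Dens2 U) (ha : n1 U ≤ a) :
    l2 (nl Aμ Aρ U) ≤ Aρ * loss |Aμ| a * l2 U := by
  obtain ⟨W, hW⟩ := isOm_om hA hρ hU ha
  exact (hW.mspec_le nrm_l2 hA hρ hU.reg2 (hU.n1_sym_le.trans ha) hU.reg2.memLp).2.trans
    (mul_le_mul_of_nonneg_left (l2_sym_le hU.memLp) (mul_nonneg hρ hA.loss_nonneg))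

lemma l2_hspec_nl_le (hA : Adm |Aμ| a) (hρ : 0 ≤ Aρ) (hU : Dens2 U) (ha : n1 U ≤ a)
    (hh : MemLp (hspec U) 2) : MemLp (hspec (nl Aμ Aρ U)) 2 ∧
      l2 (hspec (nl Aμ Aρ U)) ≤ Aρ * loss |Aμ| a * l2 (hspec U) := by
  obtain ⟨W, hW⟩ := isOm_om hA hρ hU ha
  have h1 := hW.mspec_le nrm_hspec hA hρ hU.reg2 (hU.n1_sym_le.trans ha)
    (by rw [hspec_sym]; exact memLp_sym hh)
  refine ⟨h1.1, h1.2.trans (mul_le_mul_of_nonneg_left ?_ (mul_nonneg hρ hA.loss_nonneg))⟩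
  rw [hspec_sym]
  exact l2_sym_le hh

lemma n1_nl_sub_le (hA : Adm |Aμ| a) (hρ : 0 ≤ Aρ) (hU : Dens2 U) (hV : Dens2 V) (hUa : n1 U ≤ a)
    (hVa : n1 V ≤ a) : n1 (fun ξ => nl Aμ Aρ U ξ - nl Aμ Aρ V ξ) ≤
      Aρ * loss |Aμ| a * n1 (fun ξ => U ξ - V ξ) := by
  obtain ⟨W, hW⟩ := isOm_om hA hρ hU hUa
  obtain ⟨W', hW'⟩ := isOm_om hA hρ hV hVa
  refine (n1_mspec_sub_le hA hρ hU.reg2 hV.reg2 (hU.n1_sym_le.trans hUa) (hV.n1_sym_le.trans hVa)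
    hW hW').trans (mul_le_mul_of_nonneg_left ?_ (mul_nonneg hρ hA.loss_nonneg))
  rw [sym_sub]
  exact (hU.toDens.sub hV.toDens).n1_sym_le

lemma exists_l2_nl_sub_le (hA : Adm |Aμ| a) (hρ : 0 ≤ Aρ) : ∃ C, 0 ≤ C ∧ ∀ U V, Dens2 U → Dens2 V →
    n1 U ≤ a → n1 V ≤ a → l2 (fun ξ => nl Aμ Aρ U ξ - nl Aμ Aρ V ξ) ≤
      C * (n1 (fun ξ => U ξ - V ξ) * l2 U + l2 (fun ξ => U ξ - V ξ)) := by
  have hX := hA.ampl_nonneg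
  have hD := hA.kapD_nonneg
  have hS := hA.kapS_nonneg
  have hD' := hA.kapD'_nonneg
  have hS' := hA.kapS'_nonneg
  set b := |Aμ| / 2 * kapD a + kapS a with hb
  set b' := |Aμ| / 2 * kapD' a + kapS' a with hb'
  have hb0 : 0 ≤ b := by positivity
  have hb0' : 0 ≤ b' := by positivity
  set c := 2 * Aρ * ampl |Aμ| a with hc
  have hc0 : 0 ≤ c := by positivity
  set c' := ampl |Aμ| a * (|Aμ| * kapD' a) with hc'
  have hc0' : 0 ≤ c' := by positivity
  refine ⟨b' * c + b * (c' * c + c), by positivity, fun U V hU hV hUa hVa => ?_⟩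
  obtain ⟨W, hW⟩ := isOm_om hA hρ hU hUa
  obtain ⟨W', hW'⟩ := isOm_om hA hρ hV hVa
  have h1 := nrm_l2.mspec_sub_le hA hρ hU.reg2 hV.reg2 (hU.n1_sym_le.trans hUa)
    (hV.n1_sym_le.trans hVa) hW hW' hU.reg2.memLp hV.reg2.memLp
  have h2 := hW.sub_le nrm_l2 hA hρ hU.reg2 hV.reg2 (hU.n1_sym_le.trans hUa)
    (hV.n1_sym_le.trans hVa) hW' hU.reg2.memLp hV.reg2.memLp
  have h3 := (hW.bound hA hρ hU.reg2 (hU.n1_sym_le.trans hUa) nrm_l2 hU.reg2.memLp).2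
  rw [sym_sub] at h1 h2
  have i1 := (hU.toDens.sub hV.toDens).n1_sym_le
  have i2 := l2_sym_le (hU.toDens.sub hV.toDens).memLp
  have i3 := l2_sym_le hU.memLp
  set x := n1 (fun ξ => U ξ - V ξ)
  set y := l2 (fun ξ => U ξ - V ξ)
  have hx : 0 ≤ x := n1_nonneg _
  have hy : 0 ≤ y := l2_nonneg _
  have hu : 0 ≤ l2 U := l2_nonneg _
  have hW0 : 0 ≤ l2 W := l2_nonneg _
  have h3' : l2 W ≤ c * l2 U := h3.trans (mul_le_mul_of_nonneg_left i3 hc0)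
  have h2' : l2 (fun ξ => W ξ - W' ξ) ≤ c' * x * (c * l2 U) + c * y := by
    refine h2.trans ?_
    calc ampl |Aμ| a * (|Aμ| * (kapD' a * n1 (sym fun ξ => U ξ - V ξ)) * l2 W
          + 2 * Aρ * l2 (sym fun ξ => U ξ - V ξ))
        ≤ ampl |Aμ| a * (|Aμ| * (kapD' a * x) * (c * l2 U) + 2 * Aρ * y) := by gcongr
      _ = _ := by rw [hc', hc]; ring
  calc l2 (fun ξ => nl Aμ Aρ U ξ - nl Aμ Aρ V ξ)
      ≤ b' * n1 (sym fun ξ => U ξ - V ξ) * l2 W + b * l2 (fun ξ => W ξ - W' ξ) := h1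
    _ ≤ b' * x * (c * l2 U) + b * (c' * x * (c * l2 U) + c * y) := by gcongr
    _ ≤ (b' * c + b * (c' * c + c)) * (x * l2 U + y) := by
        have : 0 ≤ b' * c * y + b * c' * c * y + b * c * (x * l2 U) := by positivity
        nlinarith [this]

end Nonlinearity

/-- A continuous function whose upper right slope is at most `-d` decreases at rate `d`. -/
lemma add_integral_le_of_slope_le {φ d : ℝ → ℝ} {T : ℝ} (hφ : ContinuousOn φ (Icc 0 T))
    (hd : ContinuousOn d (Icc 0 T))
    (h : ∀ s ∈ Ico 0 T, ∀ ε > 0, ∀ᶠ t in 𝓝[>] s, φ t ≤ φ s + (t - s) * (ε - d s)) :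
    ∀ t ∈ Icc 0 T, φ t + ∫ s in (0 : ℝ)..t, d s ≤ φ 0 := by
  have hB : ∀ x ∈ Icc 0 T, HasDerivWithinAt (fun t => φ 0 - ∫ s in (0 : ℝ)..t, d s) (-d x)
      (Icc 0 T) x := fun x hx => by
    have : Fact (x ∈ Icc 0 T) := ⟨hx⟩
    have hi : IntervalIntegrable d volume 0 x := by
      refine (hd.mono ?_).intervalIntegrable
      rw [uIcc_of_le hx.1]
      exact Icc_subset_Icc_right hx.2
    have := intervalIntegral.integral_hasDerivWithinAt_right hi (s := Icc 0 T) (t := Icc 0 T)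
      (hd.stronglyMeasurableAtFilter_nhdsWithin measurableSet_Icc x) (hd x hx)
    simpa using this.const_sub (φ 0)
  have key := image_le_of_liminf_slope_right_le_deriv_boundary hφ
    (B := fun t => φ 0 - ∫ s in (0 : ℝ)..t, d s) (B' := fun s => -d s) (by simp)
    (fun x hx => (hB x hx).continuousWithinAt)
    (fun x hx => ((hB x ⟨hx.1, hx.2.le⟩).mono_of_mem_nhdsWithin
      (Icc_mem_nhdsGE_of_mem hx))) ?_
  · intro t ht
    have := key ht
    linarith
  · intro s hs r hr
    refine Eventually.frequently ?_
    have hε : 0 < (r + d s) / 2 := by linarith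
    filter_upwards [h s hs _ hε, self_mem_nhdsWithin] with t ht hst
    have hst : 0 < t - s := sub_pos.2 hst
    rw [slope_def_field, div_lt_iff₀ hst]
    nlinarith

end

section

variable {N : ℝ} {U V : ℝ → ℂ} {q : ℝ → ℝ}

/-- The Hilbert space of square integrable densities. -/
abbrev L2 : Type := Lp (α := ℝ) ℂ 2 volume

lemma L2.memLp (X : L2) : MemLp (X : ℝ → ℂ) 2 := Lp.memLp X

lemma L2.norm_eq (X : L2) : ‖X‖ = l2 X := by
  rw [Lp.norm_def, eLpNorm_eq_l2 X.memLp, ENNReal.toReal_ofReal (l2_nonneg _)]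

lemma L2.norm_toLp (hU : MemLp U 2) : ‖hU.toLp U‖ = l2 U := by
  rw [L2.norm_eq, l2_congr_ae hU.coeFn_toLp]

/-- Weighted `L¹` norm of a density. -/
def nw (q : ℝ → ℝ) (U : ℝ → ℂ) : ℝ := ∫ ξ, q ξ * ‖U ξ‖

lemma nw_congr_ae (q : ℝ → ℝ) (h : U =ᵐ[volume] V) : nw q U = nw q V := by
  refine integral_congr_ae ?_
  filter_upwards [h] with ξ hξ
  rw [hξ]

lemma integrable_weight (hq : MemLp q 2) (hU : MemLp U 2) :
    Integrable fun ξ => q ξ * ‖U ξ‖ :=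
  MemLp.integrable_mul hq hU.norm

lemma nw_le (hq0 : ∀ ξ, 0 ≤ q ξ) (hq : MemLp q 2) (hU : MemLp U 2) :
    nw q U ≤ l2 (fun ξ => (q ξ : ℂ)) * l2 U := by
  have h := integral_norm_mul_le (U := fun ξ => (q ξ : ℂ)) (V := U) (memLp_ofReal hq) hU
  refine (le_of_eq ?_).trans h
  rw [nw]
  congr with ξ
  rw [norm_real, Real.norm_of_nonneg (hq0 ξ)]

lemma nw_add_le (hq0 : ∀ ξ, 0 ≤ q ξ) (hq : MemLp q 2) (hU : MemLp U 2)
    (hV : MemLp V 2) : nw q (fun ξ => U ξ + V ξ) ≤ nw q U + nw q V := by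
  rw [nw, nw, nw, ← integral_add (integrable_weight hq hU) (integrable_weight hq hV)]
  refine integral_mono (integrable_weight hq (hU.add hV))
    ((integrable_weight hq hU).add (integrable_weight hq hV)) fun ξ => ?_
  simp only [← mul_add]
  exact mul_le_mul_of_nonneg_left (norm_add_le _ _) (hq0 ξ)

lemma abs_nw_sub_le (hq0 : ∀ ξ, 0 ≤ q ξ) (hq : MemLp q 2) (X Y : L2) :
    |nw q X - nw q Y| ≤ l2 (fun ξ => (q ξ : ℂ)) * ‖X - Y‖ := by
  have key : ∀ X Y : L2, nw q X - nw q Y ≤ l2 (fun ξ => (q ξ : ℂ)) * ‖X - Y‖ := fun X Y => by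
    have h1 : (X : ℝ → ℂ) =ᵐ[volume] fun ξ => (Y : ℝ → ℂ) ξ + (X - Y : L2) ξ := by
      filter_upwards [Lp.coeFn_sub X Y] with ξ hξ
      rw [hξ, Pi.sub_apply]
      ring
    rw [nw_congr_ae q h1, L2.norm_eq]
    have h2 := nw_add_le hq0 hq Y.memLp (X - Y).memLp
    have h3 := nw_le hq0 hq (X - Y).memLp
    linarith
  rw [abs_le]
  have := key Y X
  rw [norm_sub_rev] at this
  exact ⟨by linarith, key X Y⟩

lemma continuous_nw (hq0 : ∀ ξ, 0 ≤ q ξ) (hq : MemLp q 2) :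
    Continuous fun X : L2 => nw q X := by
  refine (LipschitzWith.of_dist_le_mul
    (K := ⟨l2 (fun ξ => (q ξ : ℂ)), l2_nonneg _⟩) fun X Y => ?_).continuous
  rw [Real.dist_eq, dist_eq_norm]
  exact abs_nw_sub_le hq0 hq X Y

/-- A damped evolution decreases weighted `L¹` norms, up to the source. -/
lemma nw_slope_le {κ : ℝ → ℝ} (hq0 : ∀ ξ, 0 ≤ q ξ) (hq : MemLp q 2) (hκ : Measurable κ)
    (hκ0 : ∀ ξ, 0 ≤ κ ξ) {K : ℝ} (hκK : ∀ ξ, κ ξ ≤ K) {X : ℝ → L2} {V : L2} {s : ℝ}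
    (hX : HasDerivWithinAt X V (Ioi s) s) {Y : ℝ → ℂ} (hY : MemLp Y 2)
    (hV : (V : ℝ → ℂ) =ᵐ[volume] fun ξ => Y ξ - (κ ξ : ℂ) * X s ξ) {ε : ℝ} (hε : 0 < ε) :
    ∀ᶠ t in 𝓝[>] s, nw q (X t) ≤ nw q (X s)
      + (t - s) * (ε - ((∫ ξ, q ξ * (κ ξ * ‖X s ξ‖)) - nw q Y)) := by
  set c := l2 (fun ξ => (q ξ : ℂ)) with hc
  have hc0 : 0 ≤ c := l2_nonneg _
  have h1 := (hasDerivWithinAt_iff_isLittleO.1 hX).def (c := ε / (c + 1)) (by positivity)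
  have h2 : ∀ᶠ t in 𝓝[>] s, t < s + (|K| + 1)⁻¹ :=
    nhdsWithin_le_nhds (Iio_mem_nhds (by have : 0 < (|K| + 1)⁻¹ := by positivity
                                         linarith))
  filter_upwards [h1, h2, self_mem_nhdsWithin] with t ht ht2 hst
  have hst : 0 < t - s := sub_pos.2 hst
  set h := t - s with hh
  set r : L2 := X t - X s - h • V with hr
  have hrn : ‖r‖ ≤ ε / (c + 1) * h := by rwa [Real.norm_of_nonneg hst.le] at ht
  have hhK : ∀ ξ, h * κ ξ ≤ 1 := fun ξ => by
    have e1 : h ≤ (|K| + 1)⁻¹ := by linarith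
    have e2 : κ ξ ≤ |K| + 1 := (hκK ξ).trans (by linarith [le_abs_self K])
    calc h * κ ξ ≤ (|K| + 1)⁻¹ * (|K| + 1) := by have := hκ0 ξ; gcongr
      _ = 1 := inv_mul_cancel₀ (by positivity)
  have hpt : ∀ᵐ ξ, q ξ * ‖X t ξ‖ ≤ q ξ * ‖X s ξ‖ - h * (q ξ * (κ ξ * ‖X s ξ‖)) + h * (q ξ * ‖Y ξ‖)
      + q ξ * ‖r ξ‖ := by
    have e1 : (r : ℝ → ℂ) =ᵐ[volume] fun ξ => X t ξ - X s ξ - (h : ℂ) * V ξ := by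
      filter_upwards [Lp.coeFn_sub (X t - X s) (h • V), Lp.coeFn_sub (X t) (X s),
        Lp.coeFn_smul h V] with ξ x1 x2 x3
      rw [hr, x1, Pi.sub_apply, x2, x3, Pi.sub_apply, Pi.smul_apply, real_smul]
    filter_upwards [e1, hV] with ξ x1 x2
    have e2 : X t ξ = ((1 - h * κ ξ : ℝ) : ℂ) * X s ξ + (h : ℂ) * Y ξ + r ξ := by
      rw [x1, x2]
      push_cast
      ring
    have e3 : ‖X t ξ‖ ≤ (1 - h * κ ξ) * ‖X s ξ‖ + h * ‖Y ξ‖ + ‖r ξ‖ := by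
      rw [e2]
      refine (norm_add₃_le).trans ?_
      rw [norm_mul, norm_mul, norm_real, norm_real, Real.norm_of_nonneg hst.le,
        Real.norm_of_nonneg (by linarith [hhK ξ])]
    have := mul_le_mul_of_nonneg_left e3 (hq0 ξ)
    linarith
  have i1 := integrable_weight hq (X s).memLp
  have i2 : Integrable fun ξ => q ξ * (κ ξ * ‖X s ξ‖) := by
    refine (i1.const_mul |K|).mono' (hq.1.mul (hκ.aestronglyMeasurable.mul (X s).memLp.1.norm))
      (Eventually.of_forall fun ξ => ?_)
    have := hκ0 ξ
    have := hq0 ξ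
    rw [Real.norm_of_nonneg (by positivity)]
    have e := (hκK ξ).trans (le_abs_self K)
    calc q ξ * (κ ξ * ‖X s ξ‖) ≤ q ξ * (|K| * ‖X s ξ‖) := by gcongr
      _ = _ := by ring
  have i3 := integrable_weight hq hY
  have i4 := integrable_weight hq r.memLp
  have hint : nw q (X t) ≤ nw q (X s) - h * (∫ ξ, q ξ * (κ ξ * ‖X s ξ‖)) + h * nw q Y + nw q r := by
    have i5 : Integrable fun ξ => q ξ * ‖X s ξ‖ - h * (q ξ * (κ ξ * ‖X s ξ‖)) :=
      i1.sub (i2.const_mul h)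
    have i6 : Integrable fun ξ =>
        q ξ * ‖X s ξ‖ - h * (q ξ * (κ ξ * ‖X s ξ‖)) + h * (q ξ * ‖Y ξ‖) := i5.add (i3.const_mul h)
    rw [nw, nw, nw, nw, ← integral_const_mul, ← integral_const_mul,
      ← integral_sub i1 (i2.const_mul h), ← integral_add i5 (i3.const_mul h), ← integral_add i6 i4]
    exact integral_mono_ae (integrable_weight hq (X t).memLp) (i6.add i4) hpt
  have hrq : nw q r ≤ ε * h := by
    have e := nw_le hq0 hq r.memLp
    rw [← L2.norm_eq] at e
    refine e.trans ((mul_le_mul_of_nonneg_left hrn hc0).trans ?_)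
    have : c * (ε / (c + 1) * h) = c / (c + 1) * (ε * h) := by ring
    rw [this]
    exact mul_le_of_le_one_left (by positivity) ((div_le_one (by positivity)).2 (by linarith))
  nlinarith

lemma norm_cut_mul_le (N ξ : ℝ) (z : ℂ) : ‖(cut N ξ : ℂ) * z‖ ≤ ‖z‖ := by
  rw [norm_mul, norm_real]
  exact mul_le_of_le_one_left (norm_nonneg _) (abs_cut_le N ξ)

lemma cut_mul_self (N ξ : ℝ) : cut N ξ * cut N ξ = cut N ξ := by
  unfold cut; split_ifs <;> simp

lemma aesm_cut_mul (N : ℝ) (hU : AEStronglyMeasurable U) :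
    AEStronglyMeasurable fun ξ => (cut N ξ : ℂ) * U ξ :=
  (measurable_ofReal.comp (measurable_cut N)).aestronglyMeasurable.mul hU

lemma memLp_cut_mul (N : ℝ) (hU : MemLp U 2) : MemLp (fun ξ => (cut N ξ : ℂ) * U ξ) 2 :=
  hU.of_le (aesm_cut_mul N hU.1) (Eventually.of_forall fun ξ => norm_cut_mul_le N ξ _)

/-- The weights `1_{|ξ| ≤ N} |ξ|^j`. -/
def qw (N : ℝ) (j : ℕ) (ξ : ℝ) : ℝ := cut N ξ * |ξ| ^ j

lemma qw_nonneg (N : ℝ) (j : ℕ) (ξ : ℝ) : 0 ≤ qw N j ξ := mul_nonneg (cut_nonneg N ξ) (by positivity)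

lemma measurable_qw (N : ℝ) (j : ℕ) : Measurable (qw N j) :=
  (measurable_cut N).mul (measurable_id.abs.pow_const j)

lemma qw_le (hN : 0 ≤ N) (j : ℕ) (ξ : ℝ) : qw N j ξ ≤ N ^ j := by
  unfold qw cut
  split_ifs with h
  · rw [one_mul]
    exact pow_le_pow_left₀ (abs_nonneg _) h j
  · rw [zero_mul]
    positivity

lemma memLp_qw (hN : 0 ≤ N) (j : ℕ) : MemLp (qw N j) 2 := by
  have h0 : MemLp ((Icc (-N) N).indicator fun _ => N ^ j) 2 (volume : Measure ℝ) :=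
    memLp_indicator_const 2 measurableSet_Icc _ (Or.inr (by simp))
  refine h0.of_le (measurable_qw N j).aestronglyMeasurable (Eventually.of_forall fun ξ => ?_)
  rw [Real.norm_of_nonneg (qw_nonneg N j ξ)]
  by_cases h : |ξ| ≤ N
  · rw [indicator_of_mem (show ξ ∈ Icc (-N) N from abs_le.1 h)]
    exact (qw_le hN j ξ).trans (le_abs_self _)
  · rw [qw, cut, if_neg h, zero_mul]
    exact norm_nonneg _

lemma weight_cut_mul (N : ℝ) (j : ℕ) (U : ℝ → ℂ) (ξ : ℝ) :
    |ξ| ^ j * ‖(cut N ξ : ℂ) * U ξ‖ = qw N j ξ * ‖U ξ‖ := by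
  rw [norm_mul, norm_real, Real.norm_of_nonneg (cut_nonneg N ξ), qw]
  ring

lemma integrable_weight_cut_mul (hN : 0 ≤ N) (j : ℕ) (hU : MemLp U 2) :
    Integrable fun ξ => |ξ| ^ j * ‖(cut N ξ : ℂ) * U ξ‖ := by
  simp only [weight_cut_mul]
  exact integrable_weight (memLp_qw hN j) hU

lemma dens2_cut_mul (hN : 0 ≤ N) (hU : MemLp U 2) :
    Dens2 fun ξ => (cut N ξ : ℂ) * U ξ where
  memLp := memLp_cut_mul N hU
  int1 := by simpa using integrable_weight_cut_mul hN 1 hU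
  int2 := integrable_weight_cut_mul hN 2 hU

lemma n1_cut_mul (N : ℝ) (U : ℝ → ℂ) : n1 (fun ξ => (cut N ξ : ℂ) * U ξ) = nw (qw N 1) U := by
  rw [n1, nw]
  congr with ξ
  rw [← weight_cut_mul, pow_one]

lemma n2_cut_mul (N : ℝ) (U : ℝ → ℂ) : n2 (fun ξ => (cut N ξ : ℂ) * U ξ) = nw (qw N 2) U := by
  rw [n2, nw]
  congr with ξ
  rw [← weight_cut_mul]

/-- Spectral truncation. -/
def cutL (N : ℝ) : L2 →L[ℝ] L2 :=
  LinearMap.mkContinuous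
    { toFun := fun X => (memLp_cut_mul N X.memLp).toLp _
      map_add' := fun X Y => by
        rw [← MemLp.toLp_add, MemLp.toLp_eq_toLp_iff]
        filter_upwards [Lp.coeFn_add X Y] with ξ hξ
        rw [hξ, Pi.add_apply, Pi.add_apply, mul_add]
      map_smul' := fun c X => by
        rw [RingHom.id_apply, ← MemLp.toLp_const_smul, MemLp.toLp_eq_toLp_iff]
        filter_upwards [Lp.coeFn_smul c X] with ξ hξ
        rw [hξ, Pi.smul_apply, Pi.smul_apply, mul_smul_comm] }
    1 fun X => by
      rw [one_mul, LinearMap.coe_mk, AddHom.coe_mk, L2.norm_toLp, L2.norm_eq]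
      exact l2_mono X.memLp (Eventually.of_forall fun ξ => norm_cut_mul_le N ξ _)

lemma coeFn_cutL (N : ℝ) (X : L2) : (cutL N X : ℝ → ℂ) =ᵐ[volume] fun ξ => (cut N ξ : ℂ) * X ξ :=
  (memLp_cut_mul N X.memLp).coeFn_toLp

lemma norm_cutL_le (N : ℝ) (X : L2) : ‖cutL N X‖ ≤ ‖X‖ := by
  rw [L2.norm_eq, l2_congr_ae (coeFn_cutL N X), L2.norm_eq]
  exact l2_mono X.memLp (Eventually.of_forall fun ξ => norm_cut_mul_le N ξ _)

end

section

variable {N R r : ℝ} {U : ℝ → ℂ} {q : ℝ → ℝ}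

/-- The radial retraction onto the unit ball of a seminorm is `2`-Lipschitz. -/
lemma seminorm_retract_sub_le {E : Type*} [AddCommGroup E] [Module ℝ E] (p : Seminorm ℝ E)
    (x y : E) : p ((max 1 (p x))⁻¹ • x - (max 1 (p y))⁻¹ • y) ≤ 2 * p (x - y) := by
  set a := max 1 (p x) with ha
  set b := max 1 (p y) with hb
  have ha1 : 1 ≤ a := le_max_left _ _
  have hb1 : 1 ≤ b := le_max_left _ _
  have hby : p y ≤ b := le_max_right _ _
  have e : a⁻¹ • x - b⁻¹ • y = a⁻¹ • (x - y) + (a⁻¹ - b⁻¹) • y := by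
    rw [smul_sub, sub_smul]
    abel
  have hab : |a - b| ≤ p (x - y) := by
    refine (abs_max_sub_max_le_max _ _ _ _).trans ?_
    rw [sub_self, abs_zero, max_eq_right (abs_nonneg _)]
    exact abs_sub_map_le_sub p x y
  rw [e]
  refine (map_add_le_add p _ _).trans ?_
  rw [map_smul_eq_mul, map_smul_eq_mul, Real.norm_eq_abs, Real.norm_eq_abs,
    abs_of_pos (by positivity : 0 < a⁻¹)]
  have h1 : a⁻¹ * p (x - y) ≤ p (x - y) :=
    mul_le_of_le_one_left (apply_nonneg p _) (inv_le_one_of_one_le₀ ha1)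
  have h2 : |a⁻¹ - b⁻¹| * p y ≤ p (x - y) := by
    have e2 : a⁻¹ - b⁻¹ = (b - a) / (a * b) := by field_simp
    rw [e2, abs_div, abs_sub_comm, abs_of_pos (by positivity : 0 < a * b), div_mul_eq_mul_div,
      div_le_iff₀ (by positivity)]
    have := apply_nonneg p y
    have := abs_nonneg (a - b)
    have := apply_nonneg p (x - y)
    calc |a - b| * p y ≤ p (x - y) * b := by gcongr
      _ ≤ p (x - y) * (a * b) := by
        gcongr
        exact le_mul_of_one_le_left (by positivity) ha1
  linarith

lemma cutL_cutL (N : ℝ) (X : L2) : cutL N (cutL N X) = cutL N X := by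
  refine Lp.ext ?_
  filter_upwards [coeFn_cutL N (cutL N X), coeFn_cutL N X] with ξ h1 h2
  rw [h1, h2, ← mul_assoc, ← ofReal_mul, cut_mul_self]

section Truncated

variable {N : ℝ} {X Y : L2}

lemma ae_eq_of_cutL (hX : cutL N X = X) :
    (X : ℝ → ℂ) =ᵐ[volume] fun ξ => (cut N ξ : ℂ) * X ξ := by
  conv_lhs => rw [← hX]
  exact coeFn_cutL N X

lemma dens2_of_cutL (hN : 0 ≤ N) (hX : cutL N X = X) : Dens2 X :=
  (dens2_cut_mul hN X.memLp).congr (ae_eq_of_cutL hX).symm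

lemma n1_of_cutL (hX : cutL N X = X) : n1 X = nw (qw N 1) X := by
  rw [n1_congr_ae (ae_eq_of_cutL hX), n1_cut_mul]

lemma n2_of_cutL (hX : cutL N X = X) : n2 X = nw (qw N 2) X := by
  rw [n2_congr_ae (ae_eq_of_cutL hX), n2_cut_mul]

lemma nw_smul (q : ℝ → ℝ) (c : ℝ) (X : L2) : nw q (c • X : L2) = |c| * nw q X := by
  have h : ((c • X : L2) : ℝ → ℂ) =ᵐ[volume] fun ξ => (c : ℂ) * X ξ := by
    filter_upwards [Lp.coeFn_smul c X] with ξ hξ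
    rw [hξ, Pi.smul_apply, real_smul]
  rw [nw_congr_ae q h, nw, nw, ← integral_const_mul]
  congr with ξ
  rw [norm_mul, norm_real, Real.norm_eq_abs]
  ring

lemma nw_L2_add_le (hq0 : ∀ ξ, 0 ≤ q ξ) (hq : MemLp q 2) (X Y : L2) :
    nw q (X + Y : L2) ≤ nw q X + nw q Y := by
  rw [nw_congr_ae q (Lp.coeFn_add X Y)]
  exact nw_add_le hq0 hq X.memLp Y.memLp

/-- The seminorm that measures the distance of a truncated density to the admissible region. -/
def truncSeminorm {N r R : ℝ} (hN : 0 ≤ N) (hr : 0 < r) (hR : 0 < R) : Seminorm ℝ L2 :=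
  Seminorm.of (fun X => nw (qw N 1) X / r + ‖cutL N X‖ / R)
    (fun X Y => by
      have h1 := nw_L2_add_le (qw_nonneg N 1) (memLp_qw hN 1) X Y
      have h2 : ‖cutL N (X + Y)‖ ≤ ‖cutL N X‖ + ‖cutL N Y‖ := by
        rw [map_add]; exact norm_add_le _ _
      have h3 := div_le_div_of_nonneg_right h1 hr.le
      have h4 := div_le_div_of_nonneg_right h2 hR.le
      rw [add_div] at h3 h4
      linarith)
    (fun c X => by
      rw [nw_smul, map_smul, norm_smul, Real.norm_eq_abs]
      ring)

lemma truncSeminorm_apply (hN : 0 ≤ N) (hr : 0 < r) (hR : 0 < R) (X : L2) :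
    truncSeminorm hN hr hR X = nw (qw N 1) X / r + ‖cutL N X‖ / R := rfl

lemma nw_cutL (N : ℝ) (j : ℕ) (X : L2) : nw (qw N j) (cutL N X) = nw (qw N j) X := by
  rw [nw_congr_ae _ (coeFn_cutL N X), nw, nw]
  congr with ξ
  rw [norm_mul, norm_real, Real.norm_of_nonneg (cut_nonneg N ξ), qw]
  linear_combination (|ξ| ^ j * ‖X ξ‖) * cut_mul_self N ξ

lemma nw_nonneg (hq0 : ∀ ξ, 0 ≤ q ξ) (U : ℝ → ℂ) : 0 ≤ nw q U :=
  integral_nonneg fun ξ => mul_nonneg (hq0 ξ) (norm_nonneg _)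

/-- The right-hand side of the truncated equation. -/
def galSpec (Aμ Aρ N : ℝ) (U : ℝ → ℂ) (ξ : ℝ) : ℂ :=
  (qw N 1 ξ : ℂ) * (nl Aμ Aρ U ξ - Aρ * U ξ)

lemma norm_qw_mul_le (hN : 0 ≤ N) (ξ : ℝ) (z : ℂ) : ‖(qw N 1 ξ : ℂ) * z‖ ≤ N * ‖z‖ := by
  rw [norm_mul, norm_real, Real.norm_of_nonneg (qw_nonneg N 1 ξ)]
  have := qw_le hN 1 ξ
  rw [pow_one] at this
  gcongr

lemma memLp_qw_mul (hN : 0 ≤ N) (hU : MemLp U 2) :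
    MemLp (fun ξ => (qw N 1 ξ : ℂ) * U ξ) 2 :=
  hU.of_le_mul ((measurable_ofReal.comp (measurable_qw N 1)).aestronglyMeasurable.mul hU.1)
    (Eventually.of_forall fun ξ => norm_qw_mul_le hN ξ _)

lemma l2_qw_mul_le (hN : 0 ≤ N) (hU : MemLp U 2) :
    l2 (fun ξ => (qw N 1 ξ : ℂ) * U ξ) ≤ N * l2 U := by
  have h : l2 (fun ξ => (N : ℂ) * U ξ) = N * l2 U := by
    rw [l2_const_mul, norm_real, Real.norm_of_nonneg hN]
  rw [← h]
  refine l2_mono (hU.const_mul _) (Eventually.of_forall fun ξ => ?_)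
  rw [norm_mul (N : ℂ), norm_real N, Real.norm_of_nonneg hN]
  exact norm_qw_mul_le hN ξ _

open Classical in
/-- The truncated vector field on the Hilbert space. -/
def galL (Aμ Aρ N : ℝ) (X : L2) : L2 :=
  if h : MemLp (galSpec Aμ Aρ N X) 2 then h.toLp _ else 0

variable {Aμ Aρ r : ℝ}

lemma memLp_galSpec (hA : Adm |Aμ| r) (hρ : 0 ≤ Aρ) (hN : 0 ≤ N) (hX : cutL N X = X)
    (hr : n1 X ≤ r) : MemLp (galSpec Aμ Aρ N X) 2 :=
  memLp_qw_mul hN ((dens2_nl hA hρ (dens2_of_cutL hN hX) hr).memLp.sub (X.memLp.const_mul _))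

lemma coeFn_galL (hA : Adm |Aμ| r) (hρ : 0 ≤ Aρ) (hN : 0 ≤ N) (hX : cutL N X = X)
    (hr : n1 X ≤ r) : (galL Aμ Aρ N X : ℝ → ℂ) =ᵐ[volume] galSpec Aμ Aρ N X := by
  rw [galL, dif_pos (memLp_galSpec hA hρ hN hX hr)]
  exact MemLp.coeFn_toLp _

lemma norm_galL_le (hA : Adm |Aμ| r) (hρ : 0 ≤ Aρ) (hN : 0 ≤ N) (hX : cutL N X = X)
    (hr : n1 X ≤ r) : ‖galL Aμ Aρ N X‖ ≤ N * (Aρ * loss |Aμ| r + Aρ) * ‖X‖ := by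
  have hd := dens2_nl hA hρ (dens2_of_cutL hN hX) hr
  have h1 := l2_nl_le hA hρ (dens2_of_cutL hN hX) hr
  have h2 := l2_sub_le hd.memLp (X.memLp.const_mul (Aρ : ℂ))
  have h3 := l2_qw_mul_le hN (hd.memLp.sub (X.memLp.const_mul (Aρ : ℂ)))
  rw [l2_const_mul, norm_real, Real.norm_of_nonneg hρ] at h2
  rw [L2.norm_eq, l2_congr_ae (coeFn_galL hA hρ hN hX hr), L2.norm_eq]
  calc l2 (galSpec Aμ Aρ N X) ≤ N * l2 (fun ξ => nl Aμ Aρ X ξ - Aρ * X ξ) := h3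
    _ ≤ N * (Aρ * loss |Aμ| r * l2 X + Aρ * l2 X) := by gcongr; linarith
    _ = _ := by ring

lemma norm_galL_sub_le (hA : Adm |Aμ| r) (hρ : 0 ≤ Aρ) (hN : 0 ≤ N) :
    ∃ C, 0 ≤ C ∧ ∀ X Y : L2, cutL N X = X → cutL N Y = Y → n1 X ≤ r → n1 Y ≤ r → ‖X‖ ≤ R →
      ‖galL Aμ Aρ N X - galL Aμ Aρ N Y‖ ≤ C * (nw (qw N 1) (X - Y : L2) * R + ‖X - Y‖) := by
  obtain ⟨C, hC0, hC⟩ := exists_l2_nl_sub_le hA hρ (Aμ := Aμ)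
  refine ⟨N * (C + Aρ), by positivity, fun X Y hX hY hXr hYr hR => ?_⟩
  have dX := dens2_nl hA hρ (dens2_of_cutL hN hX) hXr
  have dY := dens2_nl hA hρ (dens2_of_cutL hN hY) hYr
  have h0 := hC X Y (dens2_of_cutL hN hX) (dens2_of_cutL hN hY) hXr hYr
  have hXY : cutL N (X - Y) = X - Y := by rw [map_sub, hX, hY]
  have hs := Lp.coeFn_sub X Y
  have e1 : n1 (fun ξ => X ξ - Y ξ) = nw (qw N 1) (X - Y : L2) := by
    rw [← n1_of_cutL hXY]
    exact (n1_congr_ae hs).symm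
  have e2 : l2 (fun ξ => X ξ - Y ξ) = ‖X - Y‖ := by
    rw [L2.norm_eq]
    exact (l2_congr_ae hs).symm
  rw [e1, e2, ← L2.norm_eq] at h0
  have ms : MemLp (fun ξ => X ξ - Y ξ) 2 := X.memLp.sub Y.memLp
  have h2 := l2_sub_le (dX.memLp.sub dY.memLp) (ms.const_mul (Aρ : ℂ))
  rw [l2_const_mul, norm_real, Real.norm_of_nonneg hρ, e2] at h2
  have h3 := l2_qw_mul_le hN ((dX.memLp.sub dY.memLp).sub (ms.const_mul (Aρ : ℂ)))
  have e3 : ‖galL Aμ Aρ N X - galL Aμ Aρ N Y‖ = l2 fun ξ => (qw N 1 ξ : ℂ) *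
      ((nl Aμ Aρ X ξ - nl Aμ Aρ Y ξ) - Aρ * (X ξ - Y ξ)) := by
    rw [L2.norm_eq]
    refine l2_congr_ae ?_
    filter_upwards [Lp.coeFn_sub (galL Aμ Aρ N X) (galL Aμ Aρ N Y), coeFn_galL hA hρ hN hX hXr,
      coeFn_galL hA hρ hN hY hYr] with ξ x1 x2 x3
    rw [x1, Pi.sub_apply, x2, x3, galSpec, galSpec]
    ring
  have hn : 0 ≤ nw (qw N 1) (X - Y : L2) := nw_nonneg (qw_nonneg N 1) _
  have hR0 : 0 ≤ R := (norm_nonneg X).trans hR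
  have hle : nw (qw N 1) (X - Y : L2) * ‖X‖ ≤ nw (qw N 1) (X - Y : L2) * R := by gcongr
  rw [e3]
  refine h3.trans ?_
  rw [mul_assoc N]
  refine mul_le_mul_of_nonneg_left ?_ hN
  have hq : 0 ≤ nw (qw N 1) (X - Y : L2) * R := mul_nonneg hn hR0
  calc _ ≤ C * (nw (qw N 1) (X - Y : L2) * ‖X‖ + ‖X - Y‖) + Aρ * ‖X - Y‖ :=
        h2.trans (by gcongr; exact h0)
    _ ≤ C * (nw (qw N 1) (X - Y : L2) * R + ‖X - Y‖)
          + Aρ * (nw (qw N 1) (X - Y : L2) * R + ‖X - Y‖) := by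
        gcongr
        linarith
    _ = _ := by ring

lemma cutL_galL (hA : Adm |Aμ| r) (hρ : 0 ≤ Aρ) (hN : 0 ≤ N) (hX : cutL N X = X)
    (hr : n1 X ≤ r) : cutL N (galL Aμ Aρ N X) = galL Aμ Aρ N X := by
  refine Lp.ext ?_
  filter_upwards [coeFn_cutL N (galL Aμ Aρ N X), coeFn_galL hA hρ hN hX hr] with ξ h1 h2
  rw [h1, h2, galSpec, ← mul_assoc, ← ofReal_mul, qw, ← mul_assoc, cut_mul_self]

end Truncated

/-- The truncated equation whose vector field is composed with a retraction has global solutions. -/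
lemma exists_retracted_solution {Aμ Aρ T : ℝ} (hA : Adm |Aμ| r) (hρ : 0 ≤ Aρ) (hN : 0 ≤ N)
    (hr : 0 < r) (hR : 0 < R) (hT : 0 ≤ T) (X₀ : L2) (hX₀ : cutL N X₀ = X₀) :
    ∃ (X : ℝ → L2) (θ : ℝ → ℝ), X 0 = X₀ ∧ ContinuousOn (fun t => galL Aμ Aρ N (θ t • X t)) (Icc 0 T) ∧
      ∀ t ∈ Icc 0 T, cutL N (X t) = X t ∧
        HasDerivWithinAt X (galL Aμ Aρ N (θ t • X t)) (Icc 0 T) t ∧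
        0 ≤ θ t ∧ n1 (θ t • X t : L2) ≤ r ∧ (n1 (X t) / r + ‖X t‖ / R ≤ 1 → θ t = 1) := by
  set p := truncSeminorm hN hr hR with hp
  set ret : L2 → L2 := fun X => cutL N ((max 1 (p X))⁻¹ • X) with hret
  have hretc : ∀ X, cutL N (ret X) = ret X := fun X => cutL_cutL N _
  have hpcut : ∀ X, p (cutL N X) = p X := fun X => by
    rw [hp, truncSeminorm_apply, truncSeminorm_apply, nw_cutL, cutL_cutL]
  have hn1p : ∀ X : L2, nw (qw N 1) X ≤ r * p X := fun X => by
    rw [hp, truncSeminorm_apply, mul_add, mul_div_cancel₀ _ hr.ne']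
    have : 0 ≤ r * (‖cutL N X‖ / R) := by positivity
    linarith
  have hnp : ∀ X, ‖cutL N X‖ ≤ R * p X := fun X => by
    rw [hp, truncSeminorm_apply, mul_add, mul_div_cancel₀ _ hR.ne']
    have := nw_nonneg (qw_nonneg N 1) X
    have : 0 ≤ R * (nw (qw N 1) X / r) := by positivity
    linarith
  have hpret : ∀ X, p (ret X) ≤ 1 := fun X => by
    rw [hret]
    dsimp only
    rw [hpcut, map_smul_eq_mul, Real.norm_of_nonneg (by positivity), inv_mul_le_iff₀ (by positivity),
      mul_one]
    exact le_max_right _ _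
  have hretr : ∀ X, n1 (ret X) ≤ r := fun X => by
    rw [n1_of_cutL (hretc X)]
    refine (hn1p _).trans ?_
    have := hpret X
    nlinarith
  have hretR : ∀ X, ‖ret X‖ ≤ R := fun X => by
    rw [← hretc X]
    refine (hnp _).trans ?_
    have := hpret X
    nlinarith
  obtain ⟨C, hC0, hC⟩ := norm_galL_sub_le (R := R) hA hρ hN (Aμ := Aμ)
  set q := l2 (fun ξ => (qw N 1 ξ : ℂ)) with hq
  have hq0 : 0 ≤ q := l2_nonneg _
  have hpn : ∀ X, p X ≤ (q / r + 1 / R) * ‖X‖ := fun X => by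
    rw [hp, truncSeminorm_apply]
    have h1 := nw_le (qw_nonneg N 1) (memLp_qw hN 1) X.memLp
    rw [← L2.norm_eq, ← hq] at h1
    have h2 := norm_cutL_le N X
    calc nw (qw N 1) X / r + ‖cutL N X‖ / R ≤ q * ‖X‖ / r + ‖X‖ / R := by gcongr
      _ = _ := by ring
  set vf : L2 → L2 := fun X => galL Aμ Aρ N (ret X) with hvf
  set K := C * (r * R + R) * (2 * (q / r + 1 / R)) with hK
  have hK0 : 0 ≤ K := by positivity
  have hlip : ∀ X Y, ‖vf X - vf Y‖ ≤ K * ‖X - Y‖ := fun X Y => by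
    have h1 := hC (ret X) (ret Y) (hretc X) (hretc Y) (hretr X) (hretr Y) (hretR X)
    have h2 : p (ret X - ret Y) ≤ 2 * p (X - Y) := by
      rw [hret]
      dsimp only
      rw [← map_sub, hpcut]
      exact seminorm_retract_sub_le p X Y
    have h3 := hn1p (ret X - ret Y)
    have h4 := hnp (ret X - ret Y)
    rw [map_sub, hretc, hretc] at h4
    have h5 := hpn (X - Y)
    refine h1.trans ?_
    calc C * (nw (qw N 1) (ret X - ret Y : L2) * R + ‖ret X - ret Y‖)
        ≤ C * (r * p (ret X - ret Y) * R + R * p (ret X - ret Y)) := by gcongr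
      _ = C * (r * R + R) * p (ret X - ret Y) := by ring
      _ ≤ C * (r * R + R) * (2 * ((q / r + 1 / R) * ‖X - Y‖)) := by
        gcongr
        linarith
      _ = K * ‖X - Y‖ := by rw [hK]; ring
  set B := N * (Aρ * loss |Aμ| r + Aρ) * R with hB
  have hl := hA.loss_nonneg
  have hB0 : 0 ≤ B := by positivity
  have hbd : ∀ X, ‖vf X‖ ≤ B := fun X =>
    (norm_galL_le hA hρ hN (hretc X) (hretr X)).trans (mul_le_mul_of_nonneg_left (hretR X) (by positivity))
  have hlw : LipschitzWith ⟨K, hK0⟩ vf := LipschitzWith.of_dist_le_mul fun X Y => by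
    rw [dist_eq_norm, dist_eq_norm]
    exact hlip X Y
  have hpl : IsPicardLindelof (fun _ => vf) (⟨0, ⟨le_rfl, hT⟩⟩ : Icc (0 : ℝ) T) X₀
      ⟨B * T, by positivity⟩ 0 ⟨B, hB0⟩ ⟨K, hK0⟩ := by
    refine IsPicardLindelof.of_time_independent (fun X _ => hbd X) hlw.lipschitzOnWith ?_
    simp only [sub_zero, max_eq_left hT, NNReal.coe_zero]
    exact le_rfl
  obtain ⟨Z, hZ0, hZ⟩ := hpl.exists_eq_forall_mem_Icc_hasDerivWithinAt₀
  have hθ : ∀ X, ret X = (max 1 (p (cutL N X)))⁻¹ • cutL N X := fun X => by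
    rw [hpcut, hret]
    dsimp only
    rw [map_smul]
  refine ⟨fun t => cutL N (Z t), fun t => (max 1 (p (cutL N (Z t))))⁻¹, ?_, ?_, fun t ht => ?_⟩
  · have hZ0 : Z 0 = X₀ := hZ0
    dsimp only
    rw [hZ0, hX₀]
  · simp only [← hθ]
    exact hlw.continuous.comp_continuousOn fun t ht => (hZ t ht).continuousWithinAt
  · refine ⟨cutL_cutL N _, ?_, by positivity, ?_, fun h => ?_⟩
    · have h1 := (cutL N).hasFDerivAt.comp_hasDerivWithinAt t (hZ t ht)
      rw [← hθ]
      have : cutL N (vf (Z t)) = galL Aμ Aρ N (ret (Z t)) := cutL_galL hA hρ hN (hretc _) (hretr _)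
      rw [this] at h1
      exact h1
    · rw [← hθ]
      exact hretr _
    · have : p (cutL N (Z t)) ≤ 1 := by
        rw [hp, truncSeminorm_apply, cutL_cutL, ← n1_of_cutL (cutL_cutL N (Z t))]
        exact h
      dsimp only
      rw [max_eq_left this, inv_one]

end

section

lemma coeFn_smul_L2 (c : ℝ) (X : L2) :
    ((c • X : L2) : ℝ → ℂ) =ᵐ[volume] fun ξ => (c : ℂ) * X ξ := by
  filter_upwards [Lp.coeFn_smul c X] with ξ hξ
  rw [hξ, Pi.smul_apply, real_smul]

lemma nw_qw_mul_le {N : ℝ} {U : ℝ → ℂ} (hU : Integrable fun ξ => |ξ| ^ 2 * ‖U ξ‖) :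
    nw (qw N 1) (fun ξ => (qw N 1 ξ : ℂ) * U ξ) ≤ n2 U := by
  refine integral_mono_of_nonneg (Eventually.of_forall fun ξ =>
    mul_nonneg (qw_nonneg N 1 ξ) (norm_nonneg _)) hU (Eventually.of_forall fun ξ => ?_)
  dsimp only
  rw [norm_mul, norm_real, Real.norm_of_nonneg (qw_nonneg N 1 ξ), qw, pow_one]
  have h : cut N ξ ^ 2 ≤ 1 := by
    have := abs_cut_le N ξ
    rw [sq, cut_mul_self]
    exact (le_abs_self _).trans this
  have h2 : 0 ≤ |ξ| ^ 2 * ‖U ξ‖ := by positivity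
  nlinarith

section Apriori

variable {Aμ Aρ a N θ : ℝ} {X : ℝ → L2} {V : L2} {s : ℝ}

lemma n1_slope_of_gal (hA : Adm |Aμ| a) (hρ : 0 ≤ Aρ) (hN : 0 ≤ N)
    (hX : HasDerivWithinAt X V (Ioi s) s) (hs : cutL N (X s) = X s) (hθ : 0 ≤ θ)
    (ha : n1 (θ • X s : L2) ≤ a)
    (hV : (V : ℝ → ℂ) =ᵐ[volume] galSpec Aμ Aρ N (θ • X s : L2)) {ε : ℝ} (hε : 0 < ε) :
    ∀ᶠ t in 𝓝[>] s, nw (qw N 1) (X t) ≤ nw (qw N 1) (X s)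
      + (t - s) * (ε - Aρ * (1 - loss |Aμ| a) * θ * nw (qw N 2) (X s)) := by
  have hW : cutL N (θ • X s) = θ • X s := by rw [map_smul, hs]
  have hd := dens2_of_cutL hN hW
  have hnl := dens2_nl hA hρ hd ha
  set Y : ℝ → ℂ := fun ξ => (qw N 1 ξ : ℂ) * nl Aμ Aρ (θ • X s : L2) ξ with hY
  have hYm : MemLp Y 2 := memLp_qw_mul hN hnl.memLp
  have hκ0 : ∀ ξ, 0 ≤ Aρ * θ * qw N 1 ξ := fun ξ => by have := qw_nonneg N 1 ξ; positivity
  have hκK : ∀ ξ, Aρ * θ * qw N 1 ξ ≤ Aρ * θ * N := fun ξ => by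
    have := qw_le hN 1 ξ
    rw [pow_one] at this
    gcongr
  have hV' : (V : ℝ → ℂ) =ᵐ[volume] fun ξ => Y ξ - ((Aρ * θ * qw N 1 ξ : ℝ) : ℂ) * X s ξ := by
    filter_upwards [hV, coeFn_smul_L2 θ (X s)] with ξ h1 h2
    rw [h1, galSpec, h2, hY]
    push_cast
    ring
  have key := nw_slope_le (qw_nonneg N 1) (memLp_qw hN 1)
    ((measurable_qw N 1).const_mul (Aρ * θ)) hκ0 hκK hX hYm hV' hε
  have e1 : ∫ ξ, qw N 1 ξ * (Aρ * θ * qw N 1 ξ * ‖X s ξ‖) = Aρ * θ * nw (qw N 2) (X s) := by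
    rw [nw, ← integral_const_mul]
    congr with ξ
    rw [qw, qw]
    linear_combination (Aρ * θ * |ξ| ^ 2 * ‖X s ξ‖) * cut_mul_self N ξ
  have e2 : nw (qw N 1) Y ≤ Aρ * loss |Aμ| a * (θ * nw (qw N 2) (X s)) := by
    refine (nw_qw_mul_le hnl.int2).trans ((n2_nl_le hA hρ hd ha).trans_eq ?_)
    rw [n2_of_cutL hW, nw_smul, abs_of_nonneg hθ]
  filter_upwards [key, self_mem_nhdsWithin] with t ht hst
  have hst : 0 < t - s := sub_pos.2 hst
  refine ht.trans ?_
  rw [e1]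
  have : (ε - (Aρ * θ * nw (qw N 2) (X s) - nw (qw N 1) Y)) ≤
      ε - Aρ * (1 - loss |Aμ| a) * θ * nw (qw N 2) (X s) := by linarith
  have := mul_le_mul_of_nonneg_left this hst.le
  linarith

lemma memLp_hspec_of_cutL {X : L2} (hX : cutL N X = X) : MemLp (hspec X) 2 := by
  have hb : ∀ᵐ ξ : ℝ, ‖hspec X ξ‖ ≤ √|N| * ‖X ξ‖ := by
    filter_upwards [ae_eq_of_cutL hX] with ξ hξ
    rw [hspec, norm_mul, norm_real, Real.norm_of_nonneg (Real.sqrt_nonneg _)]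
    by_cases h : |ξ| ≤ N
    · have : √|ξ| ≤ √|N| := Real.sqrt_le_sqrt (h.trans (le_abs_self N))
      gcongr
    · rw [hξ, cut, if_neg h]
      simp
  exact X.memLp.of_le_mul (aestronglyMeasurable_hspec X.memLp.1) hb

/-- The truncated evolution does not increase the `L²` norm. -/
lemma inner_gal_nonpos (hA : Adm |Aμ| a) (hl : loss |Aμ| a ≤ 1) (hρ : 0 ≤ Aρ) (hN : 0 ≤ N) {X : L2}
    (hX : cutL N X = X) (hθ : 0 ≤ θ) (ha : n1 (θ • X : L2) ≤ a)
    (hV : (V : ℝ → ℂ) =ᵐ[volume] galSpec Aμ Aρ N (θ • X : L2)) : inner ℝ X V ≤ 0 := by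
  have hW : cutL N (θ • X) = θ • X := by rw [map_smul, hX]
  have hd := dens2_of_cutL hN hW
  have hh := memLp_hspec_of_cutL hX
  have hnl := l2_hspec_nl_le hA hρ hd ha (memLp_hspec_of_cutL hW)
  set M := nl Aμ Aρ (θ • X : L2) with hM
  have e0 : l2 (hspec (θ • X : L2)) = θ * l2 (hspec X) := by
    have : hspec (θ • X : L2) =ᵐ[volume] fun ξ => (θ : ℂ) * hspec X ξ := by
      filter_upwards [coeFn_smul_L2 θ X] with ξ hξ
      rw [hspec, hξ, hspec]
      ring
    rw [l2_congr_ae this, l2_const_mul, norm_real, Real.norm_of_nonneg hθ]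
  have i1 := integrable_norm_mul hh hnl.1
  have i2 := integrable_sq hh
  have hpt : ∀ᵐ ξ, (inner ℂ (X ξ) (V ξ)).re ≤
      ‖hspec X ξ‖ * ‖hspec M ξ‖ - Aρ * θ * ‖hspec X ξ‖ ^ 2 := by
    filter_upwards [hV, coeFn_smul_L2 θ X, ae_eq_of_cutL hX] with ξ h1 h2 h3
    rw [h1, galSpec, h2]
    have e1 : ‖hspec X ξ‖ * ‖hspec M ξ‖ = |ξ| * (‖X ξ‖ * ‖M ξ‖) := by
      rw [hspec, hspec, norm_mul, norm_mul, norm_real, Real.norm_of_nonneg (Real.sqrt_nonneg _)]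
      linear_combination (‖X ξ‖ * ‖M ξ‖) * Real.mul_self_sqrt (abs_nonneg ξ)
    rw [e1, norm_hspec_sq]
    by_cases h : |ξ| ≤ N
    · have e2 : (inner ℂ (X ξ) ((qw N 1 ξ : ℂ) * (M ξ - Aρ * (θ * X ξ)))).re
          = |ξ| * ((inner ℂ (X ξ) (M ξ)).re - Aρ * θ * ‖X ξ‖ ^ 2) := by
        have e3 : X ξ * conj (X ξ) = ((‖X ξ‖ ^ 2 : ℝ) : ℂ) := by
          rw [mul_conj, normSq_eq_norm_sq]
        have : inner ℂ (X ξ) ((qw N 1 ξ : ℂ) * (M ξ - Aρ * (θ * X ξ)))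
            = ((|ξ| : ℝ) : ℂ) * (inner ℂ (X ξ) (M ξ) - ((Aρ * θ * ‖X ξ‖ ^ 2 : ℝ) : ℂ)) := by
          simp only [RCLike.inner_apply, qw, cut, if_pos h, pow_one, one_mul]
          rw [ofReal_mul (Aρ * θ), ← e3]
          push_cast
          ring
        rw [this, re_ofReal_mul, sub_re, ofReal_re]
      rw [e2, mul_sub]
      have : (inner ℂ (X ξ) (M ξ)).re ≤ ‖X ξ‖ * ‖M ξ‖ :=
        (re_le_norm _).trans (norm_inner_le_norm _ _)
      have := mul_le_mul_of_nonneg_left this (abs_nonneg ξ)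
      linarith
    · have : X ξ = 0 := by rw [h3, cut, if_neg h]; simp
      simp [this]
  have e4 : inner ℝ X V = ∫ ξ, (inner ℂ (X ξ) (V ξ)).re := by
    rw [L2.inner_def]
    rfl
  rw [e4]
  calc ∫ ξ, (inner ℂ (X ξ) (V ξ)).re
      ≤ ∫ ξ, (‖hspec X ξ‖ * ‖hspec M ξ‖ - Aρ * θ * ‖hspec X ξ‖ ^ 2) :=
        integral_mono_ae (L2.integrable_inner (𝕜 := ℂ) X V).re (i1.sub (i2.const_mul _)) hpt
    _ = (∫ ξ, ‖hspec X ξ‖ * ‖hspec M ξ‖) - Aρ * θ * l2 (hspec X) ^ 2 := by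
        rw [integral_sub i1 (i2.const_mul _), integral_const_mul, l2_sq]
    _ ≤ l2 (hspec X) * (Aρ * loss |Aμ| a * (θ * l2 (hspec X))) - Aρ * θ * l2 (hspec X) ^ 2 := by
        have h1 := integral_norm_mul_le hh hnl.1
        have h2 := hnl.2
        rw [e0] at h2
        have := mul_le_mul_of_nonneg_left h2 (l2_nonneg (hspec X))
        linarith
    _ = -(Aρ * θ * (1 - loss |Aμ| a) * l2 (hspec X) ^ 2) := by ring
    _ ≤ 0 := by
        have : 0 ≤ 1 - loss |Aμ| a := by linarith
        have : 0 ≤ Aρ * θ * (1 - loss |Aμ| a) * l2 (hspec X) ^ 2 := by positivity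
        linarith

end Apriori

/-- `X` solves the equation truncated at frequency `N`, with derivative `V`. -/
structure Galerkin (Aμ Aρ N T : ℝ) (X V : ℝ → L2) : Prop where
  deriv : ∀ t ∈ Icc 0 T, HasDerivWithinAt X (V t) (Icc 0 T) t
  cont : ContinuousOn V (Icc 0 T)
  supp : ∀ t ∈ Icc 0 T, cutL N (X t) = X t
  eq : ∀ t ∈ Icc 0 T, (V t : ℝ → ℂ) =ᵐ[volume] galSpec Aμ Aρ N (X t)

lemma Galerkin.continuousOn {Aμ Aρ N T : ℝ} {X V : ℝ → L2} (h : Galerkin Aμ Aρ N T X V) :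
    ContinuousOn X (Icc 0 T) := fun t ht => (h.deriv t ht).continuousWithinAt

lemma HasDerivWithinAt.right {X : ℝ → L2} {V : L2} {s T : ℝ} (hs : s ∈ Ico 0 T)
    (h : HasDerivWithinAt X V (Icc 0 T) s) : HasDerivWithinAt X V (Ioi s) s :=
  h.mono_of_mem_nhdsWithin (Icc_mem_nhdsGT_of_mem hs)

/-- Global solutions of the truncated equations, with uniform bounds. -/
lemma exists_galerkin {Aμ Aρ a r N T : ℝ} (hA : Adm |Aμ| r) (hl : loss |Aμ| r ≤ 1)
    (hAa : Adm |Aμ| a) (har : a < r) (hρ : 0 ≤ Aρ) (hN : 0 ≤ N) (hT : 0 ≤ T) (U₀ : L2)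
    (hU₀ : Dens U₀) (hU₀a : n1 U₀ ≤ a) :
    ∃ X V : ℝ → L2, Galerkin Aμ Aρ N T X V ∧ X 0 = cutL N U₀ ∧ ∀ t ∈ Icc 0 T, ‖X t‖ ≤ ‖U₀‖ ∧
      n1 (X t) + Aρ * (1 - loss |Aμ| a) * ∫ s in (0 : ℝ)..t, nw (qw N 2) (X s) ≤ a ∧
      n1 (X t) ≤ a := by
  have ha0 := hAa.nonneg
  have hr : 0 < r := ha0.trans_lt har
  have hra : 0 < 1 - a / r := by rw [sub_pos, div_lt_one hr]; exact har
  set R := ‖U₀‖ / (1 - a / r) + 1 with hRdef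
  have hR : 0 < R := by positivity
  obtain ⟨X, θ, h0, hc, h⟩ := exists_retracted_solution (T := T) hA hρ hN hr hR hT (cutL N U₀)
    (cutL_cutL N U₀)
  have hXc : ContinuousOn X (Icc 0 T) := fun t ht => (h t ht).2.1.continuousWithinAt
  have hWc : ∀ t ∈ Icc 0 T, cutL N (θ t • X t) = θ t • X t := fun t ht => by
    rw [map_smul, (h t ht).1]
  have hVeq : ∀ t ∈ Icc 0 T, (galL Aμ Aρ N (θ t • X t) : ℝ → ℂ) =ᵐ[volume]
      galSpec Aμ Aρ N (θ t • X t : L2) := fun t ht =>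
    coeFn_galL hA hρ hN (hWc t ht) (h t ht).2.2.2.1
  have hnwc : ∀ j, ContinuousOn (fun t => nw (qw N j) (X t)) (Icc 0 T) := fun j =>
    (continuous_nw (qw_nonneg N j) (memLp_qw hN j)).comp_continuousOn hXc
  have hX0 : nw (qw N 1) (X 0) ≤ a := by
    rw [h0, nw_cutL, ← n1_cut_mul]
    exact (n1_mul_cut_le hU₀.int1 N).trans hU₀a
  have hn1 : ∀ t ∈ Icc 0 T, nw (qw N 1) (X t) ≤ a := by
    intro t ht
    have := add_integral_le_of_slope_le (d := fun _ => 0) (hnwc 1) continuousOn_const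
      (fun s hs ε hε => ?_) t ht
    · simp only [intervalIntegral.integral_zero, add_zero] at this
      exact this.trans hX0
    · obtain ⟨x1, x2, x3, x4, -⟩ := h s ⟨hs.1, hs.2.le⟩
      filter_upwards [n1_slope_of_gal hA hρ hN (HasDerivWithinAt.right hs x2) x1 x3 x4
        (hVeq s ⟨hs.1, hs.2.le⟩) hε, self_mem_nhdsWithin] with t ht hst
      have hst : 0 < t - s := sub_pos.2 hst
      have : 0 ≤ 1 - loss |Aμ| r := by linarith
      have := nw_nonneg (qw_nonneg N 2) (X s)
      have : 0 ≤ Aρ * (1 - loss |Aμ| r) * θ s * nw (qw N 2) (X s) := by positivity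
      refine ht.trans ?_
      have := mul_nonneg hst.le this
      linarith
  have hl2 : ∀ t ∈ Icc 0 T, ‖X t‖ ≤ ‖U₀‖ := by
    have hanti : AntitoneOn (fun t => ‖X t‖ ^ 2) (Icc 0 T) := by
      refine antitoneOn_of_deriv_nonpos (convex_Icc 0 T) (hXc.norm.pow 2) ?_ ?_
      · intro t ht
        rw [interior_Icc] at ht
        have := ((h t ⟨ht.1.le, ht.2.le⟩).2.1.hasDerivAt (Icc_mem_nhds ht.1 ht.2)).norm_sq
        exact this.differentiableAt.differentiableWithinAt
      · intro t ht
        rw [interior_Icc] at ht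
        have htI : t ∈ Icc 0 T := ⟨ht.1.le, ht.2.le⟩
        have := ((h t htI).2.1.hasDerivAt (Icc_mem_nhds ht.1 ht.2)).norm_sq
        rw [this.deriv]
        obtain ⟨x1, x2, x3, x4, -⟩ := h t htI
        have := inner_gal_nonpos hA hl hρ hN x1 x3 x4 (hVeq t htI)
        linarith
    intro t ht
    have h1 := hanti (left_mem_Icc.2 hT) ht ht.1
    have h2 : ‖X t‖ ≤ ‖X 0‖ := le_of_sq_le_sq h1 (norm_nonneg _)
    rw [h0] at h2
    exact h2.trans (norm_cutL_le N U₀)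
  have hθ1 : ∀ t ∈ Icc 0 T, θ t = 1 := fun t ht => by
    refine (h t ht).2.2.2.2 ?_
    have h1 := hn1 t ht
    rw [← n1_of_cutL (h t ht).1] at h1
    have h2 := hl2 t ht
    have h3 : ‖U₀‖ / R ≤ 1 - a / r := by
      rw [div_le_iff₀ hR, hRdef, mul_add, mul_div_cancel₀ _ hra.ne']
      linarith
    calc n1 (X t) / r + ‖X t‖ / R ≤ a / r + ‖U₀‖ / R := by gcongr
      _ ≤ 1 := by linarith
  have hg : Galerkin Aμ Aρ N T X (fun t => galL Aμ Aρ N (θ t • X t)) :=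
    ⟨fun t ht => (h t ht).2.1, hc, fun t ht => (h t ht).1, fun t ht => by
      have := hVeq t ht
      rw [hθ1 t ht, one_smul] at this ⊢
      exact this⟩
  refine ⟨X, _, hg, h0, fun t ht => ⟨hl2 t ht, ?_, ?_⟩⟩
  · have := add_integral_le_of_slope_le (d := fun s => Aρ * (1 - loss |Aμ| a) * nw (qw N 2) (X s))
      (hnwc 1) ((hnwc 2).const_mul _) (fun s hs ε hε => ?_) t ht
    · rw [intervalIntegral.integral_const_mul, ← n1_of_cutL (h t ht).1] at this
      exact this.trans hX0
    · have hsI : s ∈ Icc 0 T := ⟨hs.1, hs.2.le⟩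
      have e := hg.eq s hsI
      have e1 := hn1 s hsI
      rw [← n1_of_cutL (h s hsI).1] at e1
      have := n1_slope_of_gal (θ := 1) hAa hρ hN (HasDerivWithinAt.right hs (hg.deriv s hsI))
        (h s hsI).1 zero_le_one (by rwa [one_smul]) (by rwa [one_smul]) hε
      simpa only [mul_one] using this
  · have := hn1 t ht
    rwa [← n1_of_cutL (h t ht).1] at this

end

section

variable {Y : L2} {Aμ Aρ M N a : ℝ}

lemma abs_qw_sub_le (hM : 0 < M) (hMN : M ≤ N) (ξ : ℝ) :
    |qw N 1 ξ - qw M 1 ξ| ≤ M⁻¹ * |ξ| ^ 2 := by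
  unfold qw cut
  by_cases h : |ξ| ≤ M
  · rw [if_pos h, if_pos (h.trans hMN), sub_self, abs_zero]
    positivity
  · rw [if_neg h, zero_mul, sub_zero, pow_one, sq, ← mul_assoc]
    push Not at h
    have h1 : 1 ≤ M⁻¹ * |ξ| := by
      rw [← div_eq_inv_mul, one_le_div hM]
      exact h.le
    split_ifs
    · rw [one_mul, abs_abs]
      exact le_mul_of_one_le_left (abs_nonneg _) h1
    · rw [zero_mul, abs_zero]
      positivity

lemma cutL_of_le (hMN : M ≤ N) (hY : cutL M Y = Y) : cutL N Y = Y := by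
  refine Lp.ext ?_
  filter_upwards [coeFn_cutL N Y, ae_eq_of_cutL hY] with ξ h1 h2
  rw [h1, h2, ← mul_assoc, ← ofReal_mul]
  congr 2
  unfold cut
  by_cases h : |ξ| ≤ M
  · rw [if_pos h, if_pos (h.trans hMN), one_mul]
  · rw [if_neg h, mul_zero]

lemma qw_mul_of_cutL (hMN : M ≤ N) (hY : cutL M Y = Y) :
    ∀ᵐ ξ : ℝ, (qw M 1 ξ : ℂ) * Y ξ = (qw N 1 ξ : ℂ) * Y ξ := by
  filter_upwards [ae_eq_of_cutL hY] with ξ h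
  by_cases hξ : |ξ| ≤ M
  · rw [qw, qw, cut, cut, if_pos hξ, if_pos (hξ.trans hMN)]
  · have : Y ξ = 0 := by rw [h, cut, if_neg hξ]; simp
    rw [this, mul_zero, mul_zero]

/-- Stability of the truncated equations. -/
lemma Galerkin.sub_le {S T : ℝ} (hA : Adm |Aμ| a) (hl : loss |Aμ| a < 1) (hρ : 0 < Aρ)
    (hM : 0 < M) (hMN : M ≤ N) (hTS : T ≤ S) {X V Y W : ℝ → L2} (hX : Galerkin Aμ Aρ N S X V)
    (hY : Galerkin Aμ Aρ M T Y W) (hXa : ∀ t ∈ Icc 0 S, n1 (X t) ≤ a)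
    (hYa : ∀ t ∈ Icc 0 T, n1 (Y t) ≤ a) {U₀ : L2} (hU₀ : Dens U₀) (hU₀a : n1 U₀ ≤ a)
    (hX0 : X 0 = cutL N U₀) (hY0 : Y 0 = cutL M U₀) {t : ℝ} (ht : t ∈ Icc 0 T)
    (hYt : Aρ * (1 - loss |Aμ| a) * ∫ s in (0 : ℝ)..t, nw (qw M 2) (Y s) ≤ a) :
    nw (qw N 0) (X t - Y t : L2)
      + Aρ * (1 - loss |Aμ| a) * ∫ s in (0 : ℝ)..t, nw (qw N 1) (X s - Y s : L2)
      ≤ M⁻¹ * (a / (1 - loss |Aμ| a)) := by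
  have hN : 0 ≤ N := hM.le.trans hMN
  have hlpos : 0 < 1 - loss |Aμ| a := by linarith
  have hl0 := hA.loss_nonneg
  have hsub : Icc 0 T ⊆ Icc 0 S := Icc_subset_Icc_right hTS
  have hc : ContinuousOn (fun s => X s - Y s) (Icc 0 T) :=
    (hX.continuousOn.mono hsub).sub hY.continuousOn
  have hnwc : ∀ j, ContinuousOn (fun s => nw (qw N j) (X s - Y s : L2)) (Icc 0 T) := fun j =>
    (continuous_nw (qw_nonneg N j) (memLp_qw hN j)).comp_continuousOn hc
  have hYc : ContinuousOn (fun s => nw (qw M 2) (Y s)) (Icc 0 T) :=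
    (continuous_nw (qw_nonneg M 2) (memLp_qw hM.le 2)).comp_continuousOn hY.continuousOn
  have key := add_integral_le_of_slope_le
    (d := fun s => Aρ * (1 - loss |Aμ| a) * nw (qw N 1) (X s - Y s : L2)
      - M⁻¹ * (Aρ * loss |Aμ| a) * nw (qw M 2) (Y s))
    (hnwc 0) (((hnwc 1).const_mul _).sub (hYc.const_mul _)) (fun s hs ε hε => ?_) t ht
  · have hi : ∀ {g : ℝ → ℝ}, ContinuousOn g (Icc 0 T) → IntervalIntegrable g volume 0 t :=
      fun hg => (hg.mono (by rw [uIcc_of_le ht.1]; exact Icc_subset_Icc_right ht.2)).intervalIntegrable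
    rw [intervalIntegral.integral_sub ((hi (hnwc 1)).const_mul _) ((hi hYc).const_mul _),
      intervalIntegral.integral_const_mul, intervalIntegral.integral_const_mul] at key
    have h0 : nw (qw N 0) (X 0 - Y 0 : L2) ≤ M⁻¹ * a := by
      have e : ((X 0 - Y 0 : L2) : ℝ → ℂ) =ᵐ[volume]
          fun ξ => ((cut N ξ - cut M ξ : ℝ) : ℂ) * U₀ ξ := by
        filter_upwards [Lp.coeFn_sub (X 0) (Y 0), coeFn_cutL N U₀, coeFn_cutL M U₀] with ξ x1 x2 x3
        rw [x1, Pi.sub_apply, hX0, hY0, x2, x3]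
        push_cast
        ring
      rw [nw_congr_ae _ e]
      refine le_trans ?_ (mul_le_mul_of_nonneg_left hU₀a (inv_nonneg.2 hM.le))
      rw [n1, ← integral_const_mul, nw]
      refine integral_mono_of_nonneg (Eventually.of_forall fun ξ =>
        mul_nonneg (qw_nonneg N 0 ξ) (norm_nonneg _)) (hU₀.int1.const_mul _)
        (Eventually.of_forall fun ξ => ?_)
      dsimp only
      rw [norm_mul, norm_real, Real.norm_eq_abs, qw, pow_zero, mul_one, ← mul_assoc, ← mul_assoc]
      refine mul_le_mul_of_nonneg_right ?_ (norm_nonneg _)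
      unfold cut
      by_cases h : |ξ| ≤ M
      · rw [if_pos h, if_pos (h.trans hMN), sub_self, abs_zero, mul_zero]
        positivity
      · push Not at h
        have h1 : 1 ≤ M⁻¹ * |ξ| := by
          rw [← div_eq_inv_mul, one_le_div hM]
          exact h.le
        rw [if_neg (not_le.2 h)]
        split_ifs
        · simpa using h1
        · simp only [sub_self, abs_zero, mul_zero]
          positivity
    have h1 : Aρ * ∫ s in (0 : ℝ)..t, nw (qw M 2) (Y s) ≤ a / (1 - loss |Aμ| a) := by
      rw [le_div_iff₀ hlpos]
      linarith
    have h2 : M⁻¹ * (Aρ * loss |Aμ| a) * ∫ s in (0 : ℝ)..t, nw (qw M 2) (Y s) ≤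
        M⁻¹ * (loss |Aμ| a * (a / (1 - loss |Aμ| a))) := by
      calc _ = M⁻¹ * (loss |Aμ| a * (Aρ * ∫ s in (0 : ℝ)..t, nw (qw M 2) (Y s))) := by ring
        _ ≤ _ := by
          have : 0 ≤ M⁻¹ := inv_nonneg.2 hM.le
          gcongr
    have h3 : M⁻¹ * a + M⁻¹ * (loss |Aμ| a * (a / (1 - loss |Aμ| a)))
        = M⁻¹ * (a / (1 - loss |Aμ| a)) := by field_simp; ring
    linarith
  · have hsT : s ∈ Icc 0 T := ⟨hs.1, hs.2.le⟩
    have hsS := hsub hsT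
    have sX := hX.supp s hsS
    have sY := hY.supp s hsT
    have sH : cutL N (X s - Y s) = X s - Y s := by rw [map_sub, sX, cutL_of_le hMN sY]
    have dX := dens2_of_cutL hN sX
    have dY := dens2_of_cutL hM.le sY
    have nX := dens2_nl hA hρ.le dX (hXa s hsS)
    have nY := dens2_nl hA hρ.le dY (hYa s hsT)
    set A := nl Aμ Aρ (X s) with hAdef
    set B := nl Aμ Aρ (Y s) with hBdef
    set Z : ℝ → ℂ := fun ξ => (qw N 1 ξ : ℂ) * A ξ - (qw M 1 ξ : ℂ) * B ξ with hZ
    have hZm : MemLp Z 2 := (memLp_qw_mul hN nX.memLp).sub (memLp_qw_mul hM.le nY.memLp)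
    have hder : HasDerivWithinAt (fun s => X s - Y s) (V s - W s) (Ioi s) s :=
      (HasDerivWithinAt.right ⟨hs.1, hs.2.trans_le hTS⟩ (hX.deriv s hsS)).sub
        (HasDerivWithinAt.right hs (hY.deriv s hsT))
    have hV : ((V s - W s : L2) : ℝ → ℂ) =ᵐ[volume]
        fun ξ => Z ξ - ((Aρ * qw N 1 ξ : ℝ) : ℂ) * (X s - Y s : L2) ξ := by
      filter_upwards [Lp.coeFn_sub (V s) (W s), hX.eq s hsS, hY.eq s hsT, Lp.coeFn_sub (X s) (Y s),
        qw_mul_of_cutL hMN sY] with ξ x1 x2 x3 x4 x5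
      rw [x1, Pi.sub_apply, x2, x3, x4, Pi.sub_apply, galSpec, galSpec, hZ]
      push_cast
      linear_combination (Aρ : ℂ) * x5
    have hκ0 : ∀ ξ, 0 ≤ Aρ * qw N 1 ξ := fun ξ => by have := qw_nonneg N 1 ξ; positivity
    have hκK : ∀ ξ, Aρ * qw N 1 ξ ≤ Aρ * N := fun ξ => by
      have := qw_le hN 1 ξ
      rw [pow_one] at this
      gcongr
    have key := nw_slope_le (qw_nonneg N 0) (memLp_qw hN 0) ((measurable_qw N 1).const_mul Aρ)
      hκ0 hκK hder hZm hV hε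
    have e1 : ∫ ξ, qw N 0 ξ * (Aρ * qw N 1 ξ * ‖(X s - Y s : L2) ξ‖)
        = Aρ * nw (qw N 1) (X s - Y s : L2) := by
      rw [nw, ← integral_const_mul]
      congr with ξ
      rw [qw, qw]
      linear_combination (Aρ * |ξ| * ‖(X s - Y s : L2) ξ‖) * cut_mul_self N ξ
    have e2 : nw (qw N 0) Z ≤ Aρ * loss |Aμ| a * nw (qw N 1) (X s - Y s : L2)
        + M⁻¹ * (Aρ * loss |Aμ| a * nw (qw M 2) (Y s)) := by
      have i1 : Integrable fun ξ => |ξ| * ‖A ξ - B ξ‖ := (nX.toDens.sub nY.toDens).int1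
      have i2 : Integrable fun ξ => M⁻¹ * (|ξ| ^ 2 * ‖B ξ‖) := nY.int2.const_mul _
      have hb : nw (qw N 0) Z ≤ n1 (fun ξ => A ξ - B ξ) + M⁻¹ * n2 B := by
        rw [n1, n2, ← integral_const_mul, ← integral_add i1 i2, nw]
        refine integral_mono_of_nonneg (Eventually.of_forall fun ξ =>
          mul_nonneg (qw_nonneg N 0 ξ) (norm_nonneg _)) (i1.add i2) (Eventually.of_forall fun ξ => ?_)
        dsimp only
        have hz : Z ξ = (qw N 1 ξ : ℂ) * (A ξ - B ξ) + ((qw N 1 ξ - qw M 1 ξ : ℝ) : ℂ) * B ξ := by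
          rw [hZ]
          push_cast
          ring
        have hq1 : qw N 1 ξ ≤ |ξ| := by
          rw [qw, pow_one]
          exact mul_le_of_le_one_left (abs_nonneg _) ((le_abs_self _).trans (abs_cut_le N ξ))
        have hq0 : qw N 0 ξ ≤ 1 := by simpa using qw_le hN 0 ξ
        have hq2 := abs_qw_sub_le hM hMN ξ
        have hzn : ‖Z ξ‖ ≤ |ξ| * ‖A ξ - B ξ‖ + M⁻¹ * (|ξ| ^ 2 * ‖B ξ‖) := by
          rw [hz]
          refine (norm_add_le _ _).trans ?_
          rw [norm_mul, norm_mul, norm_real, norm_real, Real.norm_of_nonneg (qw_nonneg N 1 ξ),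
            Real.norm_eq_abs, ← mul_assoc M⁻¹]
          gcongr
        exact (mul_le_of_le_one_left (norm_nonneg _) hq0).trans hzn
      have h1 := n1_nl_sub_le hA hρ.le dX dY (hXa s hsS) (hYa s hsT)
      have h2 := n2_nl_le hA hρ.le dY (hYa s hsT)
      have e3 : n1 (fun ξ => X s ξ - Y s ξ) = nw (qw N 1) (X s - Y s : L2) := by
        rw [← n1_of_cutL sH]
        exact (n1_congr_ae (Lp.coeFn_sub (X s) (Y s))).symm
      rw [e3] at h1
      rw [n2_of_cutL sY] at h2
      refine hb.trans (add_le_add h1 (mul_le_mul_of_nonneg_left h2 (inv_nonneg.2 hM.le)))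
    filter_upwards [key, self_mem_nhdsWithin] with t ht hst
    have hst : 0 < t - s := sub_pos.2 hst
    refine ht.trans ?_
    rw [e1]
    refine add_le_add le_rfl (mul_le_mul_of_nonneg_left ?_ hst.le)
    linarith

/-- The approximating sequence. -/
structure Approx (Aμ Aρ a : ℝ) (U₀ : L2) (X V : ℕ → ℝ → L2) : Prop where
  gal : ∀ k, Galerkin Aμ Aρ (2 ^ k) (2 ^ k) (X k) (V k)
  init : ∀ k, X k 0 = cutL (2 ^ k) U₀
  norm_le : ∀ k, ∀ t ∈ Icc (0 : ℝ) (2 ^ k), ‖X k t‖ ≤ ‖U₀‖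
  energy : ∀ k, ∀ t ∈ Icc (0 : ℝ) (2 ^ k), n1 (X k t)
    + Aρ * (1 - loss |Aμ| a) * ∫ s in (0 : ℝ)..t, nw (qw (2 ^ k) 2) (X k s) ≤ a
  n1_le : ∀ k, ∀ t ∈ Icc (0 : ℝ) (2 ^ k), n1 (X k t) ≤ a
  cauchy : ∀ k, ∀ t ∈ Icc (0 : ℝ) (2 ^ k), nw (qw (2 ^ (k + 1)) 0) (X (k + 1) t - X k t : L2)
    + Aρ * (1 - loss |Aμ| a) *
        ∫ s in (0 : ℝ)..t, nw (qw (2 ^ (k + 1)) 1) (X (k + 1) s - X k s : L2)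
      ≤ (2 ^ k)⁻¹ * (a / (1 - loss |Aμ| a))

lemma exists_approx {r : ℝ} (hA : Adm |Aμ| r) (hl : loss |Aμ| r ≤ 1)
    (hAa : Adm |Aμ| a) (hla : loss |Aμ| a < 1) (har : a < r) (hρ : 0 < Aρ) (U₀ : L2)
    (hU₀ : Dens U₀) (hU₀a : n1 U₀ ≤ a) : ∃ X V, Approx Aμ Aρ a U₀ X V := by
  have h := fun k : ℕ => exists_galerkin (N := 2 ^ k) (T := 2 ^ k) hA hl hAa har hρ.le
    (by positivity) (by positivity) U₀ hU₀ hU₀a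
  choose X V hg h0 hb using h
  refine ⟨X, V, hg, h0, fun k t ht => (hb k t ht).1, fun k t ht => (hb k t ht).2.1,
    fun k t ht => (hb k t ht).2.2, fun k t ht => ?_⟩
  have h2 : (2 : ℝ) ^ k ≤ 2 ^ (k + 1) := pow_le_pow_right₀ (by norm_num) (Nat.le_succ k)
  refine (hg (k + 1)).sub_le hAa hla hρ (by positivity) h2 h2 (hg k)
    (fun t ht => (hb (k + 1) t ht).2.2) (fun t ht => (hb k t ht).2.2) hU₀ hU₀a (h0 _) (h0 _) ht ?_
  have := (hb k t ht).2.1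
  have := n1_nonneg (X k t)
  linarith

end

section

variable {N : ℝ} {U : ℝ → ℂ} {q : ℝ → ℝ}

lemma liminf_add_liminf_le {x y : ℕ → ℝ≥0∞} {c : ℝ≥0∞} (h : ∀ᶠ k in atTop, x k + y k ≤ c) :
    liminf x atTop + liminf y atTop ≤ c := by
  rw [liminf_eq_iSup_iInf_of_nat, liminf_eq_iSup_iInf_of_nat]
  have hm : ∀ z : ℕ → ℝ≥0∞, Monotone fun n => ⨅ i ≥ n, z i := fun z n m hnm =>
    le_iInf₂ fun i hi => iInf₂_le i (hnm.trans hi)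
  rw [ENNReal.iSup_add_iSup_of_monotone (hm x) (hm y)]
  refine iSup_le fun n => ?_
  obtain ⟨m, hm⟩ := eventually_atTop.1 h
  refine le_trans (add_le_add (iInf₂_le (max n m) (le_max_left _ _))
    (iInf₂_le (max n m) (le_max_left _ _))) (hm _ (le_max_right _ _))

section Limits

variable {U : ℕ → ℝ → ℂ} {F : ℝ → ℂ}

lemma aemeasurable_weight (hq : Measurable q) {W : ℝ → ℂ} (hW : AEStronglyMeasurable W) :
    AEMeasurable fun ξ => ENNReal.ofReal (q ξ) * ‖W ξ‖ₑ :=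
  hq.ennreal_ofReal.aemeasurable.mul hW.enorm

lemma exists_ae_limit (hU : ∀ k, AEStronglyMeasurable (U k))
    (h : ∑' k, ∫⁻ ξ, ‖U (k + 1) ξ - U k ξ‖ₑ ≠ ⊤) :
    ∃ F : ℝ → ℂ, ∀ᵐ ξ, Tendsto (fun k => U k ξ) atTop (𝓝 (F ξ)) := by
  have hm : ∀ k, AEMeasurable fun ξ => ‖U (k + 1) ξ - U k ξ‖ₑ := fun k =>
    ((hU (k + 1)).sub (hU k)).enorm
  rw [← lintegral_tsum hm] at h
  refine ⟨fun ξ => limUnder atTop fun k => U k ξ, ?_⟩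
  filter_upwards [ae_lt_top' (AEMeasurable.tsum hm) h] with ξ hξ
  refine tendsto_nhds_limUnder (cauchySeq_tendsto_of_complete ?_)
  refine cauchySeq_of_edist_le_of_tsum_ne_top _ (fun n => ?_) hξ.ne
  rw [edist_comm, edist_eq_enorm_sub]

lemma lintegral_weight_le_liminf (hq : Measurable q)
    (hU : ∀ k, AEStronglyMeasurable (U k))
    (hF : ∀ᵐ ξ, Tendsto (fun k => U k ξ) atTop (𝓝 (F ξ))) :
    ∫⁻ ξ, ENNReal.ofReal (q ξ) * ‖F ξ‖ₑ ≤
      liminf (fun k => ∫⁻ ξ, ENNReal.ofReal (q ξ) * ‖U k ξ‖ₑ) atTop := by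
  refine le_trans (le_of_eq ?_) (lintegral_liminf_le' fun k => aemeasurable_weight hq (hU k))
  refine lintegral_congr_ae ?_
  filter_upwards [hF] with ξ hξ
  exact (Tendsto.liminf_eq (ENNReal.Tendsto.const_mul hξ.enorm (Or.inr ENNReal.ofReal_ne_top))).symm

lemma tendsto_lintegral_weight_sub (hq : Measurable q)
    (hU : ∀ k, AEStronglyMeasurable (U k))
    (hF : ∀ᵐ ξ, Tendsto (fun k => U k ξ) atTop (𝓝 (F ξ)))
    (h : ∑' k, ∫⁻ ξ, ENNReal.ofReal (q ξ) * ‖U (k + 1) ξ - U k ξ‖ₑ ≠ ⊤) :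
    Tendsto (fun k => ∫⁻ ξ, ENNReal.ofReal (q ξ) * ‖U k ξ - F ξ‖ₑ) atTop (𝓝 0) := by
  refine tendsto_of_tendsto_of_tendsto_of_le_of_le tendsto_const_nhds
    (ENNReal.tendsto_sum_nat_add _ h) (fun _ => zero_le) fun n => ?_
  dsimp only
  rw [← lintegral_tsum (f := fun k ξ => ENNReal.ofReal (q ξ) * ‖U (k + n + 1) ξ - U (k + n) ξ‖ₑ)
    fun k => aemeasurable_weight hq ((hU (k + n + 1)).sub (hU (k + n)))]
  refine lintegral_mono_ae ?_
  filter_upwards [hF] with ξ hξ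
  have := edist_le_tsum_of_edist_le_of_tendsto (fun k => ‖U (k + 1) ξ - U k ξ‖ₑ)
    (fun k => by rw [edist_comm, edist_eq_enorm_sub]) hξ n
  rw [edist_eq_enorm_sub] at this
  rw [ENNReal.tsum_mul_left]
  refine mul_le_mul_right (this.trans_eq ?_) _
  simp only [add_comm n]

end Limits

lemma lintegral_weight_sym_le (hqe : ∀ ξ, q (-ξ) = q ξ) (hq : Measurable q)
    (hU : AEStronglyMeasurable U) :
    ∫⁻ ξ, ENNReal.ofReal (q ξ) * ‖sym U ξ‖ₑ ≤ ∫⁻ ξ, ENNReal.ofReal (q ξ) * ‖U ξ‖ₑ := by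
  set A := ∫⁻ ξ, ENNReal.ofReal (q ξ) * ‖U ξ‖ₑ with hA
  have e : ∫⁻ ξ, ENNReal.ofReal (q ξ) * ‖U (-ξ)‖ₑ = A := by
    rw [hA, ← lintegral_neg_eq_self]
    simp only [hqe, neg_neg]
  have hpt : ∀ ξ, ENNReal.ofReal (q ξ) * ‖sym U ξ‖ₑ ≤
      2⁻¹ * (ENNReal.ofReal (q ξ) * ‖U ξ‖ₑ + ENNReal.ofReal (q ξ) * ‖U (-ξ)‖ₑ) := fun ξ => by
    rw [← mul_add, mul_left_comm]
    refine mul_le_mul_right ?_ _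
    have h1 : sym U ξ = (2 : ℂ)⁻¹ * (U ξ + conj (U (-ξ))) := by rw [sym]; ring
    rw [h1, enorm_mul]
    have h2 : ‖(2 : ℂ)⁻¹‖ₑ = 2⁻¹ := by
      rw [enorm_inv two_ne_zero]
      congr 1
      rw [← ofReal_norm, Complex.norm_ofNat]
      simp
    rw [h2]
    refine mul_le_mul_right ((enorm_add_le _ _).trans_eq ?_) _
    congr 1
    rw [← ofReal_norm, norm_conj, ofReal_norm]
  refine (lintegral_mono hpt).trans ?_
  rw [lintegral_const_mul' _ _ (by simp), lintegral_add_left' (aemeasurable_weight hq hU), e,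
    ← hA, ← two_mul, ← mul_assoc, ENNReal.inv_mul_cancel (by simp) (by simp), one_mul]

lemma FNorm_phys_le (hi : Integrable U) (h2 : MemLp U 2) {s : ℝ} :
    FNorm s (phys U) ≤ ∫⁻ ξ, ENNReal.ofReal (|ξ| ^ s) * ‖U ξ‖ₑ := by
  rw [FNorm_eq (hasSpec_sym hi h2)]
  exact lintegral_weight_sym_le (q := fun ξ => |ξ| ^ s) (fun ξ => by rw [abs_neg])
    (measurable_id.abs.pow_const s) h2.1

lemma ift_sym (hU : Integrable U) (α : ℝ) : ift (sym U) α = ((ift U α).re : ℂ) := by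
  rw [sym_eq, ift_const_mul, ift_add hU (integrable_conj hU.comp_neg), ift_conj, add_conj,
    ofReal_mul, ofReal_ofNat, inv_mul_cancel_left₀ two_ne_zero]

lemma ift_sym_re (hU : Integrable U) (α : ℝ) : (ift (sym U) α).re = (ift U α).re := by
  rw [ift_sym hU, ofReal_re]

/-- Evaluation at a point of a truncated density, as an inner product. -/
lemma inner_eval (hN : 0 ≤ N) (α : ℝ) : ∃ e : L2, ∀ Y : L2, cutL N Y = Y →
    inner ℝ e Y = (ift Y α).re := by
  have hm : MemLp (fun ξ : ℝ => (qw N 0 ξ : ℂ) * cexp (-(I * ξ * α))) 2 := by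
    refine (memLp_ofReal (memLp_qw hN 0)).of_le ?_ (Eventually.of_forall fun ξ => ?_)
    · exact (measurable_ofReal.comp (measurable_qw N 0)).aestronglyMeasurable.mul (by fun_prop)
    · rw [norm_mul]
      have := norm_cexp_I_mul ξ (-α)
      rw [ofReal_neg, mul_neg] at this
      rw [this, mul_one]
  refine ⟨hm.toLp _, fun Y hY => ?_⟩
  have hYi : Integrable (Y : ℝ → ℂ) := (dens2_of_cutL hN hY).toDens.integrable
  have h1 : inner ℝ (hm.toLp _) Y = ∫ ξ, (Y ξ * cexp (I * ξ * α)).re := by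
    rw [L2.inner_def]
    refine integral_congr_ae ?_
    filter_upwards [hm.coeFn_toLp, ae_eq_of_cutL hY] with ξ x1 x2
    rw [x1, real_inner_eq_re_inner ℂ, RCLike.inner_apply]
    change (Y ξ * conj _).re = _
    rw [map_mul, conj_ofReal, ← exp_conj, map_neg, map_mul, map_mul, conj_I, conj_ofReal,
      conj_ofReal]
    congr 1
    have e1 : -(-I * (ξ : ℂ) * α) = I * ξ * α := by ring
    rw [e1, ← mul_assoc]
    congr 1
    rw [mul_comm]
    conv_rhs => rw [x2]
    rw [qw, pow_zero, mul_one]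
  rw [h1, ift]
  exact integral_re (integrable_mul_cexp hYi α)

lemma Galerkin.phys_eq {Aμ Aρ T : ℝ} (hN : 0 ≤ N) {X V : ℝ → L2} (h : Galerkin Aμ Aρ N T X V)
    (hV : ∀ t ∈ Icc 0 T, cutL N (V t) = V t) (α : ℝ) :
    ContinuousOn (fun t => (ift (V t) α).re) (Icc 0 T) ∧ ∀ t ∈ Icc 0 T,
      phys (X t) α = phys (X 0) α + ∫ s in (0 : ℝ)..t, (ift (V s) α).re := by
  obtain ⟨e, he⟩ := inner_eval hN α
  have hVc : ContinuousOn (fun t => (ift (V t) α).re) (Icc 0 T) := by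
    refine ContinuousOn.congr (f := fun t => inner ℝ e (V t)) (continuousOn_const.inner h.cont)
      fun t ht => ?_
    exact (he _ (hV t ht)).symm
  refine ⟨hVc, fun t ht => ?_⟩
  have hsub : Icc 0 t ⊆ Icc 0 T := Icc_subset_Icc_right ht.2
  have h1 := intervalIntegral.integral_eq_sub_of_hasDerivAt_of_le (f := fun s => inner ℝ e (X s))
    (f' := fun s => (ift (V s) α).re) ht.1 (continuousOn_const.inner (h.continuousOn.mono hsub))
    (fun s hs => ?_) ((hVc.mono (by rw [uIcc_of_le ht.1]; exact hsub)).intervalIntegrable)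
  · rw [h1, he _ (h.supp t ht), he _ (h.supp 0 ⟨le_rfl, ht.1.trans ht.2⟩), phys, phys]
    ring
  · have hsT : s ∈ Icc 0 T := ⟨hs.1.le, hs.2.le.trans ht.2⟩
    have hd := (h.deriv s hsT).hasDerivAt (Icc_mem_nhds hs.1 (hs.2.trans_le ht.2))
    have := (hasDerivAt_const s e).inner ℝ hd
    rw [inner_zero_left, add_zero, he _ (hV s hsT)] at this
    exact this

end

section

variable {k : ℕ} {t : ℝ}

lemma tendsto_ift_of_lintegral {U : ℕ → ℝ → ℂ} {F : ℝ → ℂ} (hU : ∀ᶠ k in atTop, Integrable (U k))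
    (hF : AEStronglyMeasurable F)
    (h : Tendsto (fun k => ∫⁻ ξ, ‖U k ξ - F ξ‖ₑ) atTop (𝓝 0)) (α : ℝ) :
    Tendsto (fun k => ift (U k) α) atTop (𝓝 (ift F α)) := by
  have hFi : Integrable F := by
    obtain ⟨k, hk, hk2⟩ := (hU.and (h.eventually (gt_mem_nhds ENNReal.zero_lt_top))).exists
    have : Integrable fun ξ => U k ξ - F ξ := ⟨hk.1.sub hF, hk2⟩
    refine (hk.sub this).congr (Eventually.of_forall fun ξ => ?_)
    simp
  refine tendsto_integral_of_L1 _ (integrable_mul_cexp hFi α).aestronglyMeasurable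
    (hU.mono fun k hk => integrable_mul_cexp hk α) ?_
  refine h.congr fun k => lintegral_congr fun ξ => ?_
  rw [← sub_mul, enorm_mul]
  have : ‖cexp (I * ξ * α)‖ₑ = 1 := by rw [← ofReal_norm, norm_cexp_I_mul, ENNReal.ofReal_one]
  rw [this, mul_one]

lemma tsum_ofReal_geometric_ne_top (c : ℝ) (m : ℕ) :
    ∑' k : ℕ, ENNReal.ofReal (((2 : ℝ) ^ (k + m))⁻¹ * c) ≠ ⊤ := by
  refine Summable.tsum_ofReal_ne_top ?_
  have h : Summable fun k : ℕ => (2⁻¹ : ℝ) ^ k * ((2 ^ m)⁻¹ * c) :=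
    (summable_geometric_of_lt_one (by norm_num) (by norm_num)).mul_right _
  refine h.congr fun k => ?_
  rw [pow_add, mul_inv, inv_pow]
  ring

namespace Approx

variable {Aμ Aρ a : ℝ} {U₀ : L2} {X V : ℕ → ℝ → L2}

lemma exists_index (T : ℝ) : ∃ m : ℕ, ∀ k, T ≤ 2 ^ (k + m) := by
  obtain ⟨m, hm⟩ := pow_unbounded_of_one_lt T (one_lt_two : (1 : ℝ) < 2)
  exact ⟨m, fun k => hm.le.trans (pow_le_pow_right₀ one_le_two (Nat.le_add_left m k))⟩

lemma supp_sub (h : Approx Aμ Aρ a U₀ X V) (ht : t ∈ Icc (0 : ℝ) (2 ^ k)) :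
    cutL (2 ^ (k + 1)) (X (k + 1) t - X k t) = X (k + 1) t - X k t := by
  have h2 : (2 : ℝ) ^ k ≤ 2 ^ (k + 1) := pow_le_pow_right₀ one_le_two (Nat.le_succ k)
  rw [map_sub, (h.gal (k + 1)).supp t ⟨ht.1, ht.2.trans h2⟩, cutL_of_le h2 ((h.gal k).supp t ht)]

lemma dens2 (h : Approx Aμ Aρ a U₀ X V) (ht : t ∈ Icc (0 : ℝ) (2 ^ k)) :
    Dens2 (X k t) := dens2_of_cutL (by positivity) ((h.gal k).supp t ht)

lemma lintegral_sub_le (h : Approx Aμ Aρ a U₀ X V) (hρ : 0 ≤ Aρ) (hl : loss |Aμ| a < 1)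
    (ht : t ∈ Icc (0 : ℝ) (2 ^ k)) :
    ∫⁻ ξ, ‖X (k + 1) t ξ - X k t ξ‖ₑ ≤ ENNReal.ofReal ((2 ^ k)⁻¹ * (a / (1 - loss |Aμ| a))) := by
  have hs := h.supp_sub ht
  have hi : Integrable ((X (k + 1) t - X k t : L2) : ℝ → ℂ) :=
    (dens2_of_cutL (by positivity) hs).toDens.integrable
  have e1 : ∫⁻ ξ, ‖X (k + 1) t ξ - X k t ξ‖ₑ = ∫⁻ ξ, ‖(X (k + 1) t - X k t : L2) ξ‖ₑ := by
    refine lintegral_congr_ae ?_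
    filter_upwards [Lp.coeFn_sub (X (k + 1) t) (X k t)] with ξ hξ
    rw [hξ, Pi.sub_apply]
  rw [e1, ← ofReal_integral_norm_eq_lintegral_enorm hi]
  refine ENNReal.ofReal_le_ofReal (le_trans (le_of_eq ?_) ((le_add_of_nonneg_right ?_).trans
    (h.cauchy k t ht)))
  · refine integral_congr_ae ?_
    filter_upwards [ae_eq_of_cutL hs] with ξ hξ
    rw [qw, pow_zero, mul_one, ← Real.norm_of_nonneg (cut_nonneg (2 ^ (k + 1)) ξ), ← norm_real,
      ← norm_mul, ← hξ]
  · have : 0 ≤ 1 - loss |Aμ| a := by linarith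
    exact mul_nonneg (mul_nonneg hρ this)
      (intervalIntegral.integral_nonneg ht.1 fun s _ => nw_nonneg (qw_nonneg _ _) _)

lemma exists_limit (h : Approx Aμ Aρ a U₀ X V) (hρ : 0 ≤ Aρ) (hl : loss |Aμ| a < 1) :
    ∃ F : ℝ → ℝ → ℂ, ∀ t, 0 ≤ t → (∀ᵐ ξ, Tendsto (fun k => X k t ξ) atTop (𝓝 (F t ξ))) ∧
      Tendsto (fun k => ∫⁻ ξ, ‖X k t ξ - F t ξ‖ₑ) atTop (𝓝 0) := by
  have key : ∀ t : ℝ, ∃ G : ℝ → ℂ, 0 ≤ t → (∀ᵐ ξ, Tendsto (fun k => X k t ξ) atTop (𝓝 (G ξ))) ∧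
      Tendsto (fun k => ∫⁻ ξ, ‖X k t ξ - G ξ‖ₑ) atTop (𝓝 0) := by
    intro t
    by_cases ht : 0 ≤ t
    · obtain ⟨m, hm⟩ := exists_index t
      have hs : ∑' k, ∫⁻ ξ, ‖X (k + 1 + m) t ξ - X (k + m) t ξ‖ₑ ≠ ⊤ := by
        refine ne_top_of_le_ne_top (tsum_ofReal_geometric_ne_top (a / (1 - loss |Aμ| a)) m)
          (ENNReal.tsum_le_tsum fun k => ?_)
        rw [add_right_comm]
        exact h.lintegral_sub_le hρ hl ⟨ht, hm k⟩
      have hU : ∀ k, AEStronglyMeasurable (X (k + m) t : ℝ → ℂ) := fun k => (X (k + m) t).memLp.1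
      obtain ⟨G, hG⟩ := exists_ae_limit (U := fun k => X (k + m) t) hU hs
      refine ⟨G, fun _ => ⟨?_, ?_⟩⟩
      · filter_upwards [hG] with ξ hξ
        exact (tendsto_add_atTop_iff_nat m).1 hξ
      · have := tendsto_lintegral_weight_sub (q := fun _ => 1) measurable_const hU hG (by simpa using hs)
        simp only [ENNReal.ofReal_one, one_mul] at this
        exact (tendsto_add_atTop_iff_nat m).1 this
    · exact ⟨0, fun h => absurd h ht⟩
  choose F hF using key
  exact ⟨F, hF⟩

variable {F : ℝ → ℝ → ℂ}

lemma eventually_mem (ht : 0 ≤ t) : ∀ᶠ k : ℕ in atTop, t ∈ Icc (0 : ℝ) (2 ^ k) := by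
  obtain ⟨m, hm⟩ := exists_index t
  filter_upwards [eventually_ge_atTop m] with k hk
  have := hm (k - m)
  rw [Nat.sub_add_cancel hk] at this
  exact ⟨ht, this⟩

lemma aesm (hF : ∀ t, 0 ≤ t → (∀ᵐ ξ, Tendsto (fun k => X k t ξ) atTop (𝓝 (F t ξ))))
    (ht : 0 ≤ t) : AEStronglyMeasurable (F t) :=
  aestronglyMeasurable_of_tendsto_ae atTop (fun k => (X k t).memLp.1) (hF t ht)

lemma eLpNorm_le (h : Approx Aμ Aρ a U₀ X V)
    (hF : ∀ t, 0 ≤ t → (∀ᵐ ξ, Tendsto (fun k => X k t ξ) atTop (𝓝 (F t ξ))))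
    (ht : 0 ≤ t) : MemLp (F t) 2 ∧ l2 (F t) ≤ ‖U₀‖ := by
  have h1 : eLpNorm (F t) 2 volume ≤ ENNReal.ofReal ‖U₀‖ := by
    refine (Lp.eLpNorm_lim_le_liminf_eLpNorm (fun k => (X k t).memLp.1) (F t) (hF t ht)).trans ?_
    refine liminf_le_of_frequently_le' (Eventually.frequently ?_)
    filter_upwards [eventually_mem ht] with k hk
    rw [eLpNorm_eq_l2 (X k t).memLp, ← L2.norm_eq]
    exact ENNReal.ofReal_le_ofReal (h.norm_le k t hk)
  have hm : MemLp (F t) 2 := ⟨aesm hF ht, h1.trans_lt ENNReal.ofReal_lt_top⟩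
  refine ⟨hm, ?_⟩
  rwa [eLpNorm_eq_l2 hm, ENNReal.ofReal_le_ofReal_iff (norm_nonneg _)] at h1

lemma lintegral_weight_le (hF : ∀ t, 0 ≤ t → (∀ᵐ ξ, Tendsto (fun k => X k t ξ) atTop (𝓝 (F t ξ))))
    (h : Approx Aμ Aρ a U₀ X V) (ht : 0 ≤ t) :
    ∫⁻ ξ, ENNReal.ofReal |ξ| * ‖F t ξ‖ₑ ≤ liminf (fun k => ENNReal.ofReal (n1 (X k t))) atTop ∧
    ∫⁻ ξ, ENNReal.ofReal (|ξ| ^ 2) * ‖F t ξ‖ₑ ≤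
      liminf (fun k => ENNReal.ofReal (nw (qw (2 ^ k) 2) (X k t))) atTop := by
  constructor
  · refine (lintegral_weight_le_liminf measurable_id.abs (fun k => (X k t).memLp.1)
      (hF t ht)).trans (le_of_eq (liminf_congr ?_))
    filter_upwards [eventually_mem ht] with k hk
    exact lintegral_eq_ofReal_integral abs_nonneg (h.dens2 hk).int1
  · refine (lintegral_weight_le_liminf (measurable_id.abs.pow_const 2) (fun k => (X k t).memLp.1)
      (hF t ht)).trans (le_of_eq (liminf_congr ?_))
    filter_upwards [eventually_mem ht] with k hk
    rw [← n2_of_cutL ((h.gal k).supp t hk)]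
    exact lintegral_eq_ofReal_integral (fun _ => by positivity) (h.dens2 hk).int2

lemma dens (hF : ∀ t, 0 ≤ t → (∀ᵐ ξ, Tendsto (fun k => X k t ξ) atTop (𝓝 (F t ξ))))
    (h : Approx Aμ Aρ a U₀ X V) (ha : 0 ≤ a) (ht : 0 ≤ t) :
    Dens (F t) ∧ n1 (F t) ≤ a := by
  have h1 : ∫⁻ ξ, ENNReal.ofReal |ξ| * ‖F t ξ‖ₑ ≤ ENNReal.ofReal a := by
    refine (lintegral_weight_le hF h ht).1.trans
      (liminf_le_of_frequently_le' (Eventually.frequently ?_))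
    filter_upwards [eventually_mem ht] with k hk
    exact ENNReal.ofReal_le_ofReal (h.n1_le k t hk)
  have h2 := integrable_of_lintegral_le (q := fun ξ => |ξ|) (aesm hF ht) measurable_id.abs
    abs_nonneg ha h1
  exact ⟨⟨(h.eLpNorm_le hF ht).1, h2.1⟩, h2.2⟩

lemma continuousOn_nw (h : Approx Aμ Aρ a U₀ X V) (k j : ℕ) :
    ContinuousOn (fun s => nw (qw (2 ^ k) j) (X k s)) (Icc 0 (2 ^ k)) :=
  (continuous_nw (qw_nonneg _ j) (memLp_qw (by positivity) j)).comp_continuousOn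
    (h.gal k).continuousOn

lemma setLIntegral_ofReal {g : ℝ → ℝ} (ht : 0 ≤ t) (hg : ContinuousOn g (Icc 0 t))
    (hg0 : ∀ s ∈ Icc 0 t, 0 ≤ g s) :
    ∫⁻ s in Icc 0 t, ENNReal.ofReal (g s) = ENNReal.ofReal (∫ s in (0 : ℝ)..t, g s) := by
  rw [intervalIntegral.integral_of_le ht, ← integral_Icc_eq_integral_Ioc]
  refine (ofReal_integral_eq_lintegral_ofReal (hg.integrableOn_Icc) ?_).symm
  exact (ae_restrict_iff' measurableSet_Icc).2 (Eventually.of_forall hg0)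

/-- The energy inequality of the limit. -/
lemma energy_limit (hF : ∀ t, 0 ≤ t → (∀ᵐ ξ, Tendsto (fun k => X k t ξ) atTop (𝓝 (F t ξ))))
    (h : Approx Aμ Aρ a U₀ X V) {σ : ℝ} (hσ : σ = Aρ * (1 - loss |Aμ| a)) (hσ0 : 0 ≤ σ)
    (ht : 0 ≤ t) :
    (∫⁻ ξ, ENNReal.ofReal |ξ| * ‖F t ξ‖ₑ) + ENNReal.ofReal σ *
      ∫⁻ s in Icc 0 t, liminf (fun k => ENNReal.ofReal (nw (qw (2 ^ k) 2) (X k s))) atTop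
      ≤ ENNReal.ofReal a := by
  set m := (exists_index t).choose with hmdef
  have hm : ∀ k, t ≤ 2 ^ (k + m) := (exists_index t).choose_spec
  have hsub : ∀ k, Icc 0 t ⊆ Icc (0 : ℝ) (2 ^ (k + m)) := fun k => Icc_subset_Icc_right (hm k)
  have hc : ∀ k, ContinuousOn (fun s => nw (qw (2 ^ (k + m)) 2) (X (k + m) s)) (Icc 0 t) := fun k =>
    (h.continuousOn_nw (k + m) 2).mono (hsub k)
  have e1 : ∀ s, liminf (fun k => ENNReal.ofReal (nw (qw (2 ^ k) 2) (X k s))) atTop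
      = liminf (fun k => ENNReal.ofReal (nw (qw (2 ^ (k + m)) 2) (X (k + m) s))) atTop := fun s =>
    (liminf_nat_add (fun k => ENNReal.ofReal (nw (qw (2 ^ k) 2) (X k s))) m).symm
  have e2 : ∫⁻ s in Icc 0 t, liminf (fun k => ENNReal.ofReal (nw (qw (2 ^ k) 2) (X k s))) atTop ≤
      liminf (fun k => ∫⁻ s in Icc 0 t, ENNReal.ofReal (nw (qw (2 ^ (k + m)) 2) (X (k + m) s)))
        atTop := by
    simp only [e1]
    exact lintegral_liminf_le' fun k =>
      ((hc k).aemeasurable measurableSet_Icc).ennreal_ofReal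
  have e3 : ∫⁻ ξ, ENNReal.ofReal |ξ| * ‖F t ξ‖ₑ ≤
      liminf (fun k => ENNReal.ofReal (n1 (X (k + m) t))) atTop := by
    refine (lintegral_weight_le hF h ht).1.trans_eq ?_
    exact (liminf_nat_add (fun k => ENNReal.ofReal (n1 (X k t))) m).symm
  refine (add_le_add e3 (mul_le_mul_right e2 _)).trans ?_
  rw [← ENNReal.liminf_const_mul_of_ne_top ENNReal.ofReal_ne_top]
  refine liminf_add_liminf_le (Eventually.of_forall fun k => ?_)
  rw [setLIntegral_ofReal ht (hc k) fun s _ => nw_nonneg (qw_nonneg _ _) _,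
    ← ENNReal.ofReal_mul hσ0, ← ENNReal.ofReal_add (n1_nonneg _) (mul_nonneg hσ0
      (intervalIntegral.integral_nonneg ht fun s _ => nw_nonneg (qw_nonneg _ _) _)), hσ]
  exact ENNReal.ofReal_le_ofReal (h.energy (k + m) t ⟨ht, hm k⟩)

end Approx

end

section

variable {Aμ Aρ T a s : ℝ} {U : ℝ → ℂ}

lemma aemeasurable_liminf {u : ℕ → ℝ → ℝ≥0∞} {μ : Measure ℝ} (hu : ∀ k, AEMeasurable (u k) μ) :
    AEMeasurable (fun s => liminf (fun k => u k s) atTop) μ := by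
  simp only [liminf_eq_iSup_iInf_of_nat]
  exact AEMeasurable.iSup fun n => AEMeasurable.iInf fun i => AEMeasurable.iInf fun _ => hu i

lemma Galerkin.supp_deriv {N : ℝ} {X V : ℝ → L2} (h : Galerkin Aμ Aρ N T X V) {t : ℝ}
    (ht : t ∈ Icc 0 T) : cutL N (V t) = V t := by
  refine Lp.ext ?_
  filter_upwards [coeFn_cutL N (V t), h.eq t ht] with ξ h1 h2
  rw [h1, h2, galSpec, ← mul_assoc, ← ofReal_mul, qw, ← mul_assoc, cut_mul_self]

/-- The right-hand side of the evolution equation, as a map of densities. -/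
def rnl (Aμ Aρ : ℝ) (U : ℝ → ℂ) (ξ : ℝ) : ℂ := ((|ξ| : ℝ) : ℂ) * (nl Aμ Aρ U ξ - Aρ * U ξ)

lemma integrable_rnl (hA : Adm |Aμ| a) (hρ : 0 ≤ Aρ) (hU : Dens2 U)
    (ha : n1 U ≤ a) : Integrable (rnl Aμ Aρ U) :=
  ((dens2_nl hA hρ hU ha).toDens.sub (hU.toDens.const_mul Aρ)).integrable_abs_mul

lemma rhs_eq_ift_rnl (hA : Adm |Aμ| a) (hρ : 0 ≤ Aρ) (hU : Dens2 U)
    (ha : n1 U ≤ a) (α : ℝ) :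
    rhs Aμ Aρ (phys U) (om Aμ Aρ (phys U)) α = (ift (rnl Aμ Aρ U) α).re := by
  obtain ⟨W, hW⟩ := isOm_om hA hρ hU ha
  have i1 := (dens2_nl hA hρ hU ha).toDens.integrable_abs_mul
  have i2 := hU.toDens.integrable_abs_mul
  have i3 := hU.reg2.toReg1.dens.integrable_abs_mul
  rw [rhs_eq hU.reg2 ((hU.n1_sym_le.trans ha).trans_lt hA.lt_one) hW.toReg1]
  have e1 : rspec Aμ Aρ (phys U) (om Aμ Aρ (phys U)) (sym U) = fun ξ =>
      ((|ξ| : ℝ) : ℂ) * nl Aμ Aρ U ξ - (Aρ : ℂ) * (((|ξ| : ℝ) : ℂ) * sym U ξ) := by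
    ext ξ
    rw [rspec, nl]
    ring
  have e2 : rnl Aμ Aρ U = fun ξ =>
      ((|ξ| : ℝ) : ℂ) * nl Aμ Aρ U ξ - (Aρ : ℂ) * (((|ξ| : ℝ) : ℂ) * U ξ) := by
    ext ξ
    rw [rnl]
    ring
  have e3 : (fun ξ => ((|ξ| : ℝ) : ℂ) * sym U ξ) = sym fun ξ => ((|ξ| : ℝ) : ℂ) * U ξ := by
    ext ξ
    simp only [sym, map_mul, conj_ofReal, abs_neg]
    ring
  rw [e1, e2, ift_sub i1 (i3.const_mul _), ift_sub i1 (i2.const_mul _), ift_const_mul,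
    ift_const_mul, e3, sub_re, sub_re, re_ofReal_mul, re_ofReal_mul, ift_sym_re i2]

namespace Approx

variable {Aμ Aρ a : ℝ} {U₀ : L2} {X V : ℕ → ℝ → L2} {F : ℝ → ℝ → ℂ}

lemma ae_good (hF : ∀ t, 0 ≤ t → (∀ᵐ ξ, Tendsto (fun k => X k t ξ) atTop (𝓝 (F t ξ))))
    (h : Approx Aμ Aρ a U₀ X V) (hρ : 0 < Aρ) (ha : 0 ≤ a) (hl : loss |Aμ| a < 1)
    (hT : 0 ≤ T) : ∀ᵐ s ∂(volume.restrict (Icc 0 T)), Dens2 (F s) ∧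
      Tendsto (fun k => n1 fun ξ => X k s ξ - F s ξ) atTop (𝓝 0) := by
  have hσ : 0 < Aρ * (1 - loss |Aμ| a) := mul_pos hρ (by linarith)
  obtain ⟨m, hm⟩ := exists_index T
  have hsub : ∀ k, Icc 0 T ⊆ Icc (0 : ℝ) (2 ^ (k + m)) := fun k => Icc_subset_Icc_right (hm k)
  have h1 : ∀ᵐ s ∂(volume.restrict (Icc 0 T)),
      liminf (fun k => ENNReal.ofReal (nw (qw (2 ^ (k + m)) 2) (X (k + m) s))) atTop < ⊤ := by
    refine ae_lt_top' (aemeasurable_liminf fun k =>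
      (((h.continuousOn_nw (k + m) 2).mono (hsub k)).aemeasurable
        measurableSet_Icc).ennreal_ofReal) fun htop => ?_
    have e := energy_limit hF h rfl hσ.le hT
    have e1 : ∀ s, liminf (fun k => ENNReal.ofReal (nw (qw (2 ^ k) 2) (X k s))) atTop
        = liminf (fun k => ENNReal.ofReal (nw (qw (2 ^ (k + m)) 2) (X (k + m) s))) atTop := fun s =>
      (liminf_nat_add (fun k => ENNReal.ofReal (nw (qw (2 ^ k) 2) (X k s))) m).symm
    simp only [e1, htop] at e
    rw [ENNReal.mul_top (by simpa using hσ), add_top, top_le_iff] at e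
    exact ENNReal.ofReal_ne_top e
  set g : ℕ → ℝ → ℝ := fun k s => nw (qw (2 ^ (k + m + 1)) 1) (X (k + m + 1) s - X (k + m) s : L2)
    with hg
  have hgc : ∀ k, ContinuousOn (g k) (Icc 0 T) := fun k =>
    (continuous_nw (qw_nonneg _ 1) (memLp_qw (by positivity) 1)).comp_continuousOn
      (((h.gal (k + m + 1)).continuousOn.mono
        (by rw [add_right_comm]; exact hsub (k + 1))).sub ((h.gal (k + m)).continuousOn.mono (hsub k)))
  have h2 : ∀ᵐ s ∂(volume.restrict (Icc 0 T)), ∑' k, ENNReal.ofReal (g k s) < ⊤ := by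
    have hmeas : ∀ k, AEMeasurable (fun s => ENNReal.ofReal (g k s)) (volume.restrict (Icc 0 T)) :=
      fun k => ((hgc k).aemeasurable measurableSet_Icc).ennreal_ofReal
    refine ae_lt_top' (AEMeasurable.tsum hmeas) ?_
    rw [lintegral_tsum hmeas]
    refine ne_top_of_le_ne_top (tsum_ofReal_geometric_ne_top
      ((a / (1 - loss |Aμ| a)) / (Aρ * (1 - loss |Aμ| a))) m) (ENNReal.tsum_le_tsum fun k => ?_)
    rw [setLIntegral_ofReal hT (hgc k) fun s _ => nw_nonneg (qw_nonneg _ _) _]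
    refine ENNReal.ofReal_le_ofReal ?_
    have := h.cauchy (k + m) T ⟨hT, hm k⟩
    rw [← mul_div_assoc, le_div_iff₀ hσ, mul_comm]
    have h0 := nw_nonneg (qw_nonneg (2 ^ (k + m + 1)) 0) (X (k + m + 1) T - X (k + m) T : L2)
    linarith
  filter_upwards [h1, h2, ae_restrict_mem measurableSet_Icc] with s hs1 hs2 hs
  have hd := dens hF h ha hs.1
  have hD2 : Dens2 (F s) := by
    have hle := (lintegral_weight_le hF h hs.1).2
    rw [← liminf_nat_add _ m] at hle
    have h3 := integrable_of_lintegral_le (q := fun ξ => |ξ| ^ 2) (aesm hF hs.1)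
      (measurable_id.abs.pow_const 2) (fun _ => by positivity) ENNReal.toReal_nonneg
      (hle.trans_eq (ENNReal.ofReal_toReal hs1.ne).symm)
    exact { hd.1 with int2 := h3.1 }
  refine ⟨hD2, ?_⟩
  have hsum : ∑' k, ∫⁻ ξ, ENNReal.ofReal |ξ| * ‖X (k + 1 + m) s ξ - X (k + m) s ξ‖ₑ ≠ ⊤ := by
    refine ne_top_of_le_ne_top hs2.ne (ENNReal.tsum_le_tsum fun k => le_of_eq ?_)
    have hsk : s ∈ Icc (0 : ℝ) (2 ^ (k + m)) := hsub k hs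
    have e := h.supp_sub hsk
    rw [hg, add_right_comm]
    dsimp only
    rw [← n1_of_cutL e, n1, ← lintegral_eq_ofReal_integral abs_nonneg
      (dens2_of_cutL (by positivity) e).int1]
    refine lintegral_congr_ae ?_
    filter_upwards [Lp.coeFn_sub (X (k + m + 1) s) (X (k + m) s)] with ξ hξ
    rw [hξ, Pi.sub_apply]
  have hU : ∀ k, AEStronglyMeasurable (X (k + m) s : ℝ → ℂ) := fun k => (X (k + m) s).memLp.1
  have hconv := tendsto_lintegral_weight_sub (U := fun k => X (k + m) s) measurable_id.abs hU
    ((hF s hs.1).mono fun ξ hξ => (tendsto_add_atTop_iff_nat m).2 hξ) hsum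
  refine (tendsto_add_atTop_iff_nat m).1 ?_
  have := (ENNReal.tendsto_toReal ENNReal.zero_ne_top).comp hconv
  refine this.congr fun k => ?_
  have hk : s ∈ Icc (0 : ℝ) (2 ^ (k + m)) := hsub k hs
  have := lintegral_eq_ofReal_integral abs_nonneg ((h.dens2 hk).toDens.sub hd.1).int1
  simp only [Function.comp_def, id]
  rw [this]
  exact ENNReal.toReal_ofReal (n1_nonneg _)

/-- Convergence of the right-hand sides. -/
lemma tendsto_rhs (h : Approx Aμ Aρ a U₀ X V) (hA : Adm |Aμ| a) (hρ : 0 ≤ Aρ) (hs : 0 ≤ s)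
    (hD : Dens2 (F s)) (hFa : n1 (F s) ≤ a)
    (hn : Tendsto (fun k => n1 fun ξ => X k s ξ - F s ξ) atTop (𝓝 0)) :
    Tendsto (fun k => ∫⁻ ξ, ‖V k s ξ - rnl Aμ Aρ (F s) ξ‖ₑ) atTop (𝓝 0) := by
  have hFn := dens2_nl hA hρ hD hFa
  set M := nl Aμ Aρ (F s) with hM
  have hcut : Tendsto (fun k : ℕ => n1 fun ξ => cut (2 ^ k) ξ * M ξ - M ξ) atTop (𝓝 0) := by
    have := (tendsto_n1_cut hFn.memLp.1 hFn.int1).comp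
      (tendsto_pow_atTop_atTop_of_one_lt (one_lt_two : (1 : ℕ) < 2))
    refine this.congr fun k => ?_
    simp
  have hlim : Tendsto (fun k => ENNReal.ofReal ((Aρ * loss |Aμ| a + Aρ) *
      (n1 fun ξ => X k s ξ - F s ξ) + n1 fun ξ => cut (2 ^ k) ξ * M ξ - M ξ)) atTop (𝓝 0) := by
    have := ENNReal.tendsto_ofReal ((hn.const_mul (Aρ * loss |Aμ| a + Aρ)).add hcut)
    simpa using this
  refine tendsto_of_tendsto_of_tendsto_of_le_of_le' tendsto_const_nhds hlim
    (Eventually.of_forall fun _ => zero_le) ?_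
  filter_upwards [eventually_mem hs] with k hk
  have hX := h.dens2 hk
  have hXn := dens2_nl hA hρ hX (h.n1_le k s hk)
  have i1 : Integrable fun ξ => |ξ| * ‖nl Aμ Aρ (X k s) ξ - M ξ‖ :=
    (hXn.toDens.sub hFn.toDens).int1
  have i2 : Integrable fun ξ => |ξ| * ‖(cut (2 ^ k) ξ : ℂ) * M ξ - M ξ‖ :=
    ((dens2_cut_mul (by positivity) hFn.memLp).toDens.sub hFn.toDens).int1
  have i3 : Integrable fun ξ => |ξ| * ‖X k s ξ - F s ξ‖ := (hX.toDens.sub hD.toDens).int1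
  have i12 : Integrable fun ξ => |ξ| * ‖nl Aμ Aρ (X k s) ξ - M ξ‖
      + |ξ| * ‖(cut (2 ^ k) ξ : ℂ) * M ξ - M ξ‖ := i1.add i2
  have hpt : ∀ᵐ ξ, ‖V k s ξ - rnl Aμ Aρ (F s) ξ‖ ≤ |ξ| * ‖nl Aμ Aρ (X k s) ξ - M ξ‖
      + |ξ| * ‖(cut (2 ^ k) ξ : ℂ) * M ξ - M ξ‖ + Aρ * (|ξ| * ‖X k s ξ - F s ξ‖) := by
    filter_upwards [(h.gal k).eq s hk, ae_eq_of_cutL ((h.gal k).supp s hk)] with ξ x1 x2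
    have e : V k s ξ - rnl Aμ Aρ (F s) ξ = ((|ξ| : ℝ) : ℂ) *
        ((cut (2 ^ k) ξ : ℂ) * (nl Aμ Aρ (X k s) ξ - M ξ)) +
        ((|ξ| : ℝ) : ℂ) * ((cut (2 ^ k) ξ : ℂ) * M ξ - M ξ)
        - (Aρ : ℂ) * (((|ξ| : ℝ) : ℂ) * (X k s ξ - F s ξ)) := by
      rw [x1, galSpec, rnl, qw, pow_one]
      push_cast
      linear_combination ((Aρ : ℂ) * ((|ξ| : ℝ) : ℂ)) * x2
    rw [e]
    refine (norm_sub_le _ _).trans (add_le_add ((norm_add_le _ _).trans (add_le_add ?_ ?_)) ?_)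
    · rw [norm_mul, norm_real, Real.norm_of_nonneg (abs_nonneg ξ)]
      exact mul_le_mul_of_nonneg_left (norm_cut_mul_le _ _ _) (abs_nonneg ξ)
    · rw [norm_mul, norm_real, Real.norm_of_nonneg (abs_nonneg ξ)]
    · rw [norm_mul, norm_mul, norm_real, norm_real, Real.norm_of_nonneg hρ,
        Real.norm_of_nonneg (abs_nonneg ξ)]
  calc ∫⁻ ξ, ‖V k s ξ - rnl Aμ Aρ (F s) ξ‖ₑ
      ≤ ∫⁻ ξ, ENNReal.ofReal (|ξ| * ‖nl Aμ Aρ (X k s) ξ - M ξ‖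
        + |ξ| * ‖(cut (2 ^ k) ξ : ℂ) * M ξ - M ξ‖ + Aρ * (|ξ| * ‖X k s ξ - F s ξ‖)) := by
        refine lintegral_mono_ae ?_
        filter_upwards [hpt] with ξ hξ
        rw [← ofReal_norm]
        exact ENNReal.ofReal_le_ofReal hξ
    _ = ENNReal.ofReal (∫ ξ, (|ξ| * ‖nl Aμ Aρ (X k s) ξ - M ξ‖
        + |ξ| * ‖(cut (2 ^ k) ξ : ℂ) * M ξ - M ξ‖ + Aρ * (|ξ| * ‖X k s ξ - F s ξ‖))) :=
        (ofReal_integral_eq_lintegral_ofReal (i12.add (i3.const_mul Aρ))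
          (Eventually.of_forall fun ξ => add_nonneg (add_nonneg (by positivity) (by positivity))
            (by positivity))).symm
    _ ≤ _ := by
        refine ENNReal.ofReal_le_ofReal ?_
        rw [integral_add i12 (i3.const_mul Aρ), integral_add i1 i2, integral_const_mul]
        have := n1_nl_sub_le hA hρ hX hD (h.n1_le k s hk) hFa
        rw [n1, n1] at this
        rw [n1, n1]
        linarith

lemma abs_rhs_le (h : Approx Aμ Aρ a U₀ X V) (hA : Adm |Aμ| a) (hρ : 0 ≤ Aρ) {k : ℕ}
    (hs : s ∈ Icc (0 : ℝ) (2 ^ k)) (α : ℝ) :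
    ‖(ift (V k s) α).re‖ ≤ (Aρ * loss |Aμ| a + Aρ) * a := by
  have hX := h.dens2 hs
  have hXa := h.n1_le k s hs
  have hXn := dens2_nl hA hρ hX hXa
  have hl := hA.loss_nonneg
  refine (abs_re_le_norm _).trans ((norm_ift_le _ _).trans ?_)
  have i := hXn.int1.add (hX.int1.const_mul Aρ)
  have h1 : ∫ ξ, ‖V k s ξ‖ ≤ n1 (nl Aμ Aρ (X k s)) + Aρ * n1 (X k s) := by
    rw [n1, n1, ← integral_const_mul, ← integral_add hXn.int1 (hX.int1.const_mul Aρ)]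
    refine integral_mono_of_nonneg (Eventually.of_forall fun _ => norm_nonneg _) i ?_
    filter_upwards [(h.gal k).eq s hs] with ξ x1
    rw [x1, galSpec, norm_mul, norm_real, Real.norm_of_nonneg (qw_nonneg _ _ _)]
    have h2 : qw (2 ^ k) 1 ξ ≤ |ξ| := by
      rw [qw, pow_one]
      exact mul_le_of_le_one_left (abs_nonneg _) ((le_abs_self _).trans (abs_cut_le _ ξ))
    have h3 := norm_sub_le (nl Aμ Aρ (X k s) ξ) (Aρ * X k s ξ)
    rw [norm_mul (Aρ : ℂ), norm_real Aρ, Real.norm_of_nonneg hρ] at h3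
    calc _ ≤ |ξ| * (‖nl Aμ Aρ (X k s) ξ‖ + Aρ * ‖X k s ξ‖) := by gcongr
      _ = _ := by ring
  have h2 := n1_nl_le hA hρ hX hXa
  calc _ ≤ Aρ * loss |Aμ| a * n1 (X k s) + Aρ * n1 (X k s) := by linarith
    _ = (Aρ * loss |Aμ| a + Aρ) * n1 (X k s) := by ring
    _ ≤ _ := by gcongr

end Approx

end

section

lemma eLpNorm_phys_le {U : ℝ → ℂ} (h : Dens U) :
    eLpNorm (phys U) 2 volume ≤ ENNReal.ofReal (√(2 * Real.pi) * l2 U) := by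
  have hs := hasSpec_sym h.integrable h.memLp
  have e : eLpNorm (phys U) 2 volume = eLpNorm (fun x => (phys U x : ℂ)) 2 volume :=
    eLpNorm_congr_norm_ae (Eventually.of_forall fun x => by rw [norm_real])
  rw [e, eLpNorm_eq_l2 (memLp_ofReal hs.memLp_fun), hs.l2_eq]
  exact ENNReal.ofReal_le_ofReal (mul_le_mul_of_nonneg_left (l2_sym_le h.memLp) (by positivity))

namespace Approx

variable {Aμ Aρ a : ℝ} {U₀ : L2} {X V : ℕ → ℝ → L2} {F : ℝ → ℝ → ℂ}

lemma isSolution (h : Approx Aμ Aρ a U₀ X V) (hA : Adm |Aμ| a) (hρ : 0 < Aρ)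
    (hl : loss |Aμ| a < 1)
    (hF : ∀ t, 0 ≤ t → (∀ᵐ ξ, Tendsto (fun k => X k t ξ) atTop (𝓝 (F t ξ))) ∧
      Tendsto (fun k => ∫⁻ ξ, ‖X k t ξ - F t ξ‖ₑ) atTop (𝓝 0)) {T : ℝ} (hT : 0 < T) :
    IsSolution Aμ Aρ T fun t => phys (F t) := by
  have ha := hA.nonneg
  have hF1 := fun t ht => (hF t ht).1
  have hσ : 0 < Aρ * (1 - loss |Aμ| a) := mul_pos hρ (by linarith)
  have hd : ∀ t, 0 ≤ t → Dens (F t) ∧ n1 (F t) ≤ a := fun t ht => dens hF1 h ha ht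
  have hgood := ae_good hF1 h hρ ha hl hT.le
  have hlim : ∀ α, ∀ᵐ s ∂(volume.restrict (Icc 0 T)), Tendsto (fun k => (ift (V k s) α).re) atTop
      (𝓝 (rhs Aμ Aρ (phys (F s)) (om Aμ Aρ (phys (F s))) α)) := by
    intro α
    filter_upwards [hgood, ae_restrict_mem measurableSet_Icc] with s hs hsT
    have hFa := (hd s hsT.1).2
    rw [rhs_eq_ift_rnl hA hρ.le hs.1 hFa]
    refine (continuous_re.tendsto _).comp (tendsto_ift_of_lintegral ?_
      (integrable_rnl hA hρ.le hs.1 hFa).1 (h.tendsto_rhs hA hρ.le hsT.1 hs.1 hFa hs.2) α)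
    filter_upwards [eventually_mem hsT.1] with k hk
    exact (dens2_of_cutL (by positivity) ((h.gal k).supp_deriv hk)).toDens.integrable
  obtain ⟨m, hm⟩ := exists_index T
  have hsub : ∀ k, Icc 0 T ⊆ Icc (0 : ℝ) (2 ^ (k + m)) := fun k => Icc_subset_Icc_right (hm k)
  set B := (Aρ * loss |Aμ| a + Aρ) * a with hB
  have hcont : ∀ k α, ContinuousOn (fun s => (ift (V (k + m) s) α).re) (Icc 0 T) := fun k α =>
    (((h.gal (k + m)).phys_eq (by positivity) (fun t ht => (h.gal _).supp_deriv ht) α).1).mono (hsub k)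
  have hlim' : ∀ α, ∀ᵐ s ∂(volume.restrict (Icc 0 T)),
      Tendsto (fun k => (ift (V (k + m) s) α).re) atTop
        (𝓝 (rhs Aμ Aρ (phys (F s)) (om Aμ Aρ (phys (F s))) α)) := fun α =>
    (hlim α).mono fun s hs => (tendsto_add_atTop_iff_nat m).2 hs
  have hint : ∀ α, IntegrableOn (fun s => rhs Aμ Aρ (phys (F s)) (om Aμ Aρ (phys (F s))) α)
      (Icc 0 T) := by
    intro α
    have hmeas : AEStronglyMeasurable (fun s => rhs Aμ Aρ (phys (F s)) (om Aμ Aρ (phys (F s))) α)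
        (volume.restrict (Icc 0 T)) :=
      aestronglyMeasurable_of_tendsto_ae atTop
        (fun k => (hcont k α).aestronglyMeasurable measurableSet_Icc) (hlim' α)
    refine Integrable.of_bound hmeas B ?_
    filter_upwards [hlim' α, ae_restrict_mem measurableSet_Icc] with s hs hsT
    exact le_of_tendsto hs.norm (Eventually.of_forall fun k =>
      h.abs_rhs_le hA hρ.le (hsub k hsT) α)
  refine ⟨fun t ht => ?_, ?_, ?_, fun t => om Aμ Aρ (phys (F t)), ?_, fun α => ⟨?_, fun t ht => ?_⟩⟩
  · exact (hasSpec_sym (hd t ht.1).1.integrable (hd t ht.1).1.memLp).continuous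
  · refine ⟨(√(2 * Real.pi) * ‖U₀‖ + a).toNNReal, ?_⟩
    filter_upwards [ae_restrict_mem measurableSet_Icc] with t ht
    obtain ⟨h1, h2⟩ := hd t ht.1
    constructor
    · refine (eLpNorm_phys_le h1).trans (ENNReal.ofReal_le_ofReal ?_)
      have := mul_le_mul_of_nonneg_left (h.eLpNorm_le hF1 ht.1).2 (Real.sqrt_nonneg (2 * Real.pi))
      linarith
    · refine (FNorm_phys_le h1.integrable h1.memLp).trans ?_
      simp only [Real.rpow_one]
      rw [lintegral_eq_ofReal_integral abs_nonneg h1.int1]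
      refine ENNReal.ofReal_le_ofReal ?_
      rw [n1] at h2
      have : 0 ≤ √(2 * Real.pi) * ‖U₀‖ := by positivity
      linarith
  · have h1 := energy_limit hF1 h rfl hσ.le hT.le
    have h2 : ∫⁻ s in Icc 0 T, FNorm 2 (phys (F s)) ≤
        ∫⁻ s in Icc 0 T, liminf (fun k => ENNReal.ofReal (nw (qw (2 ^ k) 2) (X k s))) atTop := by
      refine setLIntegral_mono' measurableSet_Icc fun s hs => ?_
      refine (FNorm_phys_le (hd s hs.1).1.integrable (hd s hs.1).1.memLp).trans ?_
      simp only [Real.rpow_two]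
      exact (lintegral_weight_le hF1 h hs.1).2
    refine lt_of_le_of_lt h2 (lt_top_iff_ne_top.2 fun htop => ?_)
    rw [htop, ENNReal.mul_top (by simpa using hσ), add_top, top_le_iff] at h1
    exact ENNReal.ofReal_ne_top h1
  · filter_upwards [hgood, ae_restrict_mem measurableSet_Icc] with s hs hsT
    obtain ⟨W, hW⟩ := isOm_om hA hρ.le hs.1 (hd s hsT.1).2
    exact hW.isPotentialJump hs.1.reg2
  · rw [intervalIntegrable_iff_integrableOn_Icc_of_le hT.le]
    exact hint α
  · have hev : ∀ s, 0 ≤ s → Tendsto (fun k => phys (X (k + m) s) α) atTop (𝓝 (phys (F s) α)) := by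
      intro s hs
      refine (continuous_re.tendsto _).comp ((tendsto_add_atTop_iff_nat m).2
        (tendsto_ift_of_lintegral ?_ (aesm hF1 hs) (hF s hs).2 α))
      filter_upwards [eventually_mem hs] with k hk
      exact (h.dens2 hk).toDens.integrable
    have hsub2 : Icc 0 t ⊆ Icc 0 T := Icc_subset_Icc_right ht.2
    have hdct : Tendsto (fun k => ∫ s in (0 : ℝ)..t, (ift (V (k + m) s) α).re) atTop
        (𝓝 (∫ s in (0 : ℝ)..t, rhs Aμ Aρ (phys (F s)) (om Aμ Aρ (phys (F s))) α)) := by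
      refine intervalIntegral.tendsto_integral_filter_of_dominated_convergence (fun _ => B) ?_ ?_
        intervalIntegrable_const ?_
      · refine Eventually.of_forall fun k => ?_
        rw [uIoc_of_le ht.1]
        exact ((hcont k α).mono (Ioc_subset_Icc_self.trans hsub2)).aestronglyMeasurable
          measurableSet_Ioc
      · refine Eventually.of_forall fun k => Eventually.of_forall fun s hs => ?_
        rw [uIoc_of_le ht.1] at hs
        exact h.abs_rhs_le hA hρ.le (hsub k (hsub2 (Ioc_subset_Icc_self hs))) α
      · have := (ae_restrict_iff' measurableSet_Icc).1 (hlim' α)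
        filter_upwards [this] with s hs hst
        rw [uIoc_of_le ht.1] at hst
        exact hs (hsub2 (Ioc_subset_Icc_self hst))
    refine tendsto_nhds_unique (hev t ht.1) (((hev 0 le_rfl).add hdct).congr fun k => ?_)
    exact (((h.gal (k + m)).phys_eq (by positivity) (fun t ht => (h.gal _).supp_deriv ht) α).2 t
      (hsub k ht)).symm

end Approx

/-- Global solutions for small data. -/
theorem exists_solution {Aμ Aρ a r : ℝ} (hA : Adm |Aμ| r) (hl : loss |Aμ| r ≤ 1)
    (hAa : Adm |Aμ| a) (hla : loss |Aμ| a < 1) (har : a < r) (hρ : 0 < Aρ) {U₀ : ℝ → ℂ}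
    (hU₀ : Dens U₀) (hU₀a : n1 U₀ ≤ a) :
    ∃ f : ℝ → ℝ → ℝ, (∀ T, 0 < T → IsSolution Aμ Aρ T f) ∧ f 0 = phys U₀ ∧ ∀ t, 0 ≤ t →
      eLpNorm (f t) 2 volume ≤ ENNReal.ofReal (√(2 * Real.pi) * l2 U₀) ∧
      FNorm 1 (f t) + ENNReal.ofReal (Aρ * (1 - loss |Aμ| a)) * ∫⁻ τ in Icc 0 t, FNorm 2 (f τ)
        ≤ ENNReal.ofReal a := by
  set Y : L2 := hU₀.memLp.toLp U₀ with hY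
  have hYU : (Y : ℝ → ℂ) =ᵐ[volume] U₀ := hU₀.memLp.coeFn_toLp
  have hYd : Dens Y := ⟨Y.memLp, hU₀.int1.congr (by filter_upwards [hYU] with ξ hξ; rw [hξ])⟩
  have ha := hAa.nonneg
  have hσ : 0 < Aρ * (1 - loss |Aμ| a) := mul_pos hρ (by linarith)
  obtain ⟨X, V, h⟩ := exists_approx hA hl hAa hla har hρ Y hYd (by rwa [n1_congr_ae hYU])
  obtain ⟨F, hF⟩ := h.exists_limit hρ.le hla
  have hF1 := fun t ht => (hF t ht).1
  refine ⟨fun t => phys (F t), fun T hT => h.isSolution hAa hρ hla hF hT, ?_, fun t ht => ⟨?_, ?_⟩⟩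
  · refine phys_congr_ae ?_
    have hc : ∀ᵐ ξ, ∀ k : ℕ, X k 0 ξ = (cut (2 ^ k) ξ : ℂ) * Y ξ := by
      rw [ae_all_iff]
      intro k
      rw [h.init k]
      exact coeFn_cutL _ Y
    filter_upwards [hF1 0 le_rfl, hc, hYU] with ξ x1 x2 x3
    refine tendsto_nhds_unique x1 ?_
    have := (tendsto_cut ξ).comp (tendsto_pow_atTop_atTop_of_one_lt (one_lt_two : (1 : ℕ) < 2))
    have h2 := (((continuous_ofReal.tendsto _).comp this).mul_const (Y ξ))
    rw [ofReal_one, one_mul, x3] at h2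
    refine h2.congr fun k => ?_
    rw [x2, x3]
    simp
  · refine (eLpNorm_phys_le (Approx.dens hF1 h ha ht).1).trans (ENNReal.ofReal_le_ofReal ?_)
    have h1 := (h.eLpNorm_le hF1 ht).2
    rw [L2.norm_eq, l2_congr_ae hYU] at h1
    exact mul_le_mul_of_nonneg_left h1 (Real.sqrt_nonneg _)
  · refine le_trans (add_le_add ?_ (mul_le_mul_right ?_ _)) (Approx.energy_limit hF1 h rfl hσ.le ht)
    · have hd := (Approx.dens hF1 h ha ht).1
      have := FNorm_phys_le hd.integrable hd.memLp (s := 1)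
      simpa only [Real.rpow_one] using this
    · refine setLIntegral_mono' measurableSet_Icc fun s hs => ?_
      have hd := (Approx.dens hF1 h ha hs.1).1
      refine (FNorm_phys_le hd.integrable hd.memLp).trans ?_
      simp only [Real.rpow_two]
      exact (Approx.lintegral_weight_le hF1 h hs.1).2

end

section

variable {V W : ℝ → ℂ} {u : ℝ → ℝ} {M : ℝ≥0}

/-- Times with an almost sure property are dense. -/
lemma exists_seq_tendsto_of_ae {T : ℝ} (hT : 0 < T) {p : ℝ → Prop}
    (h : ∀ᵐ t ∂(volume.restrict (Icc 0 T)), p t) {t : ℝ} (ht : t ∈ Icc 0 T) :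
    ∃ s : ℕ → ℝ, (∀ n, s n ∈ Icc 0 T ∧ p (s n)) ∧ Tendsto s atTop (𝓝 t) := by
  have h1 : ∀ᵐ x : ℝ, x ∈ Icc 0 T → p x := (ae_restrict_iff' measurableSet_Icc).1 h
  have hd : Dense {x | x ∈ Icc 0 T → p x} := Measure.dense_of_ae h1
  have h2 : t ∈ closure (Ioo 0 T ∩ {x | x ∈ Icc 0 T → p x}) := by
    refine closure_minimal (hd.open_subset_closure_inter isOpen_Ioo) isClosed_closure ?_
    rwa [closure_Ioo hT.ne]
  obtain ⟨s, hs, hl⟩ := mem_closure_iff_seq_limit.1 h2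
  exact ⟨s, fun n => ⟨Ioo_subset_Icc_self (hs n).1, (hs n).2 (Ioo_subset_Icc_self (hs n).1)⟩, hl⟩

lemma l2_fhat_sq_le (hu : MemLp u 2) {M : ℝ} (hM : 0 ≤ M)
    (h : eLpNorm u 2 volume ≤ ENNReal.ofReal M) : ∫ ξ, ‖fhat u ξ‖ ^ 2 ≤ M ^ 2 := by
  have e : eLpNorm u 2 volume = eLpNorm (fun x => (u x : ℂ)) 2 volume :=
    eLpNorm_congr_norm_ae (Eventually.of_forall fun x => by rw [norm_real])
  rw [e, eLpNorm_eq_l2 (memLp_ofReal hu), ENNReal.ofReal_le_ofReal_iff hM] at h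
  have h1 := pow_le_pow_left₀ (l2_nonneg _) h 2
  rw [l2_sq] at h1
  simp only [norm_real, Real.norm_eq_abs, sq_abs] at h1
  rw [integral_norm_sq_fhat hu]
  have hp : (2 * Real.pi)⁻¹ ≤ 1 := inv_le_one_of_one_le₀ (by linarith [Real.pi_gt_three])
  exact (mul_le_of_le_one_left (integral_nonneg fun _ => sq_nonneg _) hp).trans h1

lemma integral_norm_le_of_n1 {U : ℝ → ℂ} (hU : Dens U) :
    ∫ ξ, ‖U ξ‖ ≤ 2 + (∫ ξ, ‖U ξ‖ ^ 2) + n1 U := by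
  have hi : Integrable ((Icc (-1 : ℝ) 1).indicator fun _ => (1 : ℝ)) :=
    (integrable_indicator_iff measurableSet_Icc).2 (by simp)
  have hv : ∫ ξ, (Icc (-1 : ℝ) 1).indicator (fun _ => (1 : ℝ)) ξ = 2 := by
    rw [integral_indicator measurableSet_Icc]; norm_num
  have h2 := integrable_sq hU.memLp
  have h3 : Integrable fun ξ => (Icc (-1 : ℝ) 1).indicator (fun _ => (1 : ℝ)) ξ + ‖U ξ‖ ^ 2 :=
    hi.add h2
  rw [n1, ← hv, ← integral_add hi h2, ← integral_add h3 hU.int1]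
  refine integral_mono hU.integrable.norm (h3.add hU.int1) fun ξ => ?_
  have h0 := norm_nonneg (U ξ)
  beta_reduce
  by_cases h : ξ ∈ Icc (-1 : ℝ) 1
  · rw [indicator_of_mem h]
    nlinarith [mul_nonneg (abs_nonneg ξ) h0, sq_nonneg (‖U ξ‖ - 1)]
  · rw [indicator_of_notMem h]
    have : 1 ≤ |ξ| := by
      by_contra hc
      exact h (abs_le.1 (not_le.1 hc).le)
    nlinarith [mul_nonneg (sub_nonneg.2 this) h0, sq_nonneg ‖U ξ‖]

lemma abs_le_of_FNorm (hc : Continuous u)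
    (h : eLpNorm u 2 volume ≤ M ∧ FNorm 1 u ≤ M) (α : ℝ) : |u α| ≤ 2 + (M : ℝ) ^ 2 + M := by
  have hr := reg1_of_FNorm hc (h.2.trans_lt ENNReal.coe_lt_top)
  have h1 := h.2
  rw [hr.FNorm_one, ENNReal.ofReal_le_iff_le_toReal ENNReal.coe_ne_top, ENNReal.coe_toReal] at h1
  have h2 := l2_fhat_sq_le hr.memLp_fun M.coe_nonneg
    (h.1.trans (by rw [ENNReal.ofReal_coe_nnreal]))
  have := integral_norm_le_of_n1 hr.dens
  linarith [hr.toHasSpec.abs_le α]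

lemma norm_integral_mul_le_of_lintegral {φ : ℝ → ℂ} {S c : ℝ} (hS : ∀ ξ, ‖φ ξ‖ ≤ S)
    (hc : 0 ≤ c) (h : ∫⁻ ξ, ‖V ξ‖ₑ ≤ ENNReal.ofReal c) : ‖∫ ξ, φ ξ * V ξ‖ ≤ c * S := by
  have hS0 : 0 ≤ S := (norm_nonneg _).trans (hS 0)
  have h1 : ‖∫ ξ, φ ξ * V ξ‖ₑ ≤ ENNReal.ofReal (c * S) := by
    refine (enorm_integral_le_lintegral_enorm _).trans ?_
    calc ∫⁻ ξ, ‖φ ξ * V ξ‖ₑ ≤ ∫⁻ ξ, ENNReal.ofReal S * ‖V ξ‖ₑ := by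
          refine lintegral_mono fun ξ => ?_
          rw [enorm_mul, ← ofReal_norm (φ ξ)]
          gcongr
          exact hS ξ
      _ = ENNReal.ofReal S * ∫⁻ ξ, ‖V ξ‖ₑ := lintegral_const_mul' _ _ ENNReal.ofReal_ne_top
      _ ≤ ENNReal.ofReal S * ENNReal.ofReal c := by gcongr
      _ = ENNReal.ofReal (c * S) := by rw [← ENNReal.ofReal_mul hS0, mul_comm]
  rwa [← ofReal_norm, ENNReal.ofReal_le_ofReal_iff (mul_nonneg hc hS0)] at h1

lemma lintegral_enorm_le_of_weak {V : ℕ → ℝ → ℂ} (hW : LocallyIntegrable W)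
    (hw : ∀ φ : 𝓢(ℝ, ℂ), Tendsto (fun n => ∫ ξ, φ ξ * V n ξ) atTop (𝓝 (∫ ξ, φ ξ * W ξ)))
    {c : ℝ≥0∞} (h : ∀ n, ∫⁻ ξ, ‖V n ξ‖ₑ ≤ c) : ∫⁻ ξ, ‖W ξ‖ₑ ≤ c := by
  rcases eq_or_ne c ⊤ with rfl | hc
  · exact le_top
  rw [← ENNReal.ofReal_toReal hc] at h ⊢
  exact lintegral_le_of_dual hW fun φ S hS => le_of_tendsto (hw φ).norm
    (Eventually.of_forall fun n => norm_integral_mul_le_of_lintegral hS ENNReal.toReal_nonneg (h n))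

lemma tendsto_weak_dspec {V : ℕ → ℝ → ℂ}
    (hw : ∀ φ : 𝓢(ℝ, ℂ), Tendsto (fun n => ∫ ξ, φ ξ * V n ξ) atTop (𝓝 (∫ ξ, φ ξ * W ξ)))
    (φ : 𝓢(ℝ, ℂ)) :
    Tendsto (fun n => ∫ ξ, φ ξ * dspec (V n) ξ) atTop (𝓝 (∫ ξ, φ ξ * dspec W ξ)) := by
  obtain ⟨ψ, hψ⟩ := exists_schwartz_dspec φ
  have e : ∀ V : ℝ → ℂ, ∫ ξ, φ ξ * dspec V ξ = ∫ ξ, ψ ξ * V ξ := fun V => by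
    congr with ξ
    rw [hψ, dspec, dspec]
    ring
  simpa only [e] using hw ψ

lemma locallyIntegrable_dspec (h : LocallyIntegrable V) : LocallyIntegrable (dspec V) :=
  h.continuous_mul (g := fun ξ : ℝ => I * (ξ : ℂ)) (by fun_prop)

lemma enorm_dspec (V : ℝ → ℂ) (ξ : ℝ) : ‖dspec V ξ‖ₑ = ENNReal.ofReal |ξ| * ‖V ξ‖ₑ := by
  rw [← ofReal_norm, norm_dspec, ENNReal.ofReal_mul (abs_nonneg _), ofReal_norm]

lemma FNorm_one_eq (hu : MemLp u 2) : FNorm 1 u = ∫⁻ ξ, ‖dspec (fhat u) ξ‖ₑ := by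
  simp only [FNorm, if_pos hu, Real.rpow_one, enorm_dspec]

lemma FNorm_two_eq (hu : MemLp u 2) :
    FNorm 2 u = ∫⁻ ξ, ‖dspec (dspec (fhat u)) ξ‖ₑ := by
  simp only [FNorm, if_pos hu, enorm_dspec, Real.rpow_two, ← mul_assoc,
    ← ENNReal.ofReal_mul (abs_nonneg _), sq]

/-- The bounds defining the solution class survive pointwise limits, and `fhat` converges weakly. -/
lemma bounds_of_tendsto {u : ℕ → ℝ → ℝ} {v : ℝ → ℝ} (hc : ∀ n, Continuous (u n))
    (hb : ∀ n, eLpNorm (u n) 2 volume ≤ M ∧ FNorm 1 (u n) ≤ M)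
    (hv : Continuous v) (hl : ∀ α, Tendsto (fun n => u n α) atTop (𝓝 (v α))) :
    (eLpNorm v 2 volume ≤ M ∧ FNorm 1 v ≤ M) ∧
      ∀ c, (∀ n, FNorm 2 (u n) ≤ c) → FNorm 2 v ≤ c := by
  have h2 : eLpNorm v 2 volume ≤ M := by
    refine (Lp.eLpNorm_lim_le_liminf_eLpNorm (fun n => (hc n).aestronglyMeasurable) v
      (Eventually.of_forall hl)).trans ?_
    exact (liminf_le_liminf (Eventually.of_forall fun n => (hb n).1)).trans (liminf_const _).le
  have hm : ∀ n, MemLp (u n) 2 := fun n =>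
    ⟨(hc n).aestronglyMeasurable, (hb n).1.trans_lt ENNReal.coe_lt_top⟩
  have hvm : MemLp v 2 := ⟨hv.aestronglyMeasurable, h2.trans_lt ENNReal.coe_lt_top⟩
  have hw : ∀ φ : 𝓢(ℝ, ℂ), Tendsto (fun n => ∫ ξ, φ ξ * fhat (u n) ξ) atTop
      (𝓝 (∫ ξ, φ ξ * fhat v ξ)) := by
    intro φ
    obtain ⟨ψ, hψ, _⟩ := exists_schwartz_ift_neg φ
    simp only [integral_mul_fhat (hm _) φ, integral_mul_fhat hvm φ, ← hψ]
    refine Tendsto.const_mul _ ?_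
    refine tendsto_integral_of_dominated_convergence
      (fun α => ‖ψ α‖ * (2 + (M : ℝ) ^ 2 + M)) (fun n => ?_) (ψ.integrable.norm.mul_const _)
      (fun n => Eventually.of_forall fun α => ?_) (Eventually.of_forall fun α => ?_)
    · have := hc n
      exact (ψ.continuous.mul (continuous_ofReal.comp this)).aestronglyMeasurable
    · rw [norm_mul, norm_real, Real.norm_eq_abs]
      exact mul_le_mul_of_nonneg_left (abs_le_of_FNorm (hc n) (hb n) α) (norm_nonneg _)
    · exact ((continuous_ofReal.tendsto _).comp (hl α)).const_mul _
  have hli : LocallyIntegrable (fhat v) := (memLp_fhat hvm).locallyIntegrable (by norm_num)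
  refine ⟨⟨h2, ?_⟩, fun c h => ?_⟩
  · rw [FNorm_one_eq hvm]
    exact lintegral_enorm_le_of_weak (locallyIntegrable_dspec hli) (tendsto_weak_dspec hw)
      fun n => (FNorm_one_eq (hm n)).symm.trans_le (hb n).2
  · rw [FNorm_two_eq hvm]
    exact lintegral_enorm_le_of_weak (locallyIntegrable_dspec (locallyIntegrable_dspec hli))
      (tendsto_weak_dspec (tendsto_weak_dspec hw))
      fun n => (FNorm_two_eq (hm n)).symm.trans_le (h n)

namespace IsSolution

variable {Aμ Aρ T : ℝ} {f : ℝ → ℝ → ℝ}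

lemma continuousOn_time (h : IsSolution Aμ Aρ T f) (α : ℝ) :
    ContinuousOn (fun t => f t α) (Icc 0 T) := by
  obtain ⟨Ω, _, hΩ⟩ := h.equation
  by_cases hT : 0 ≤ T
  · have h1 := intervalIntegral.continuousOn_primitive_interval' (hΩ α).1 left_mem_uIcc
    rw [uIcc_of_le hT] at h1
    exact (continuousOn_const.add h1).congr fun t ht => (hΩ α).2 t ht
  · rw [Icc_eq_empty hT]
    exact continuousOn_empty _

lemma exists_bound (h : IsSolution Aμ Aρ T f) (hT : 0 < T) :
    ∃ M : ℝ≥0, ∀ t ∈ Icc 0 T, eLpNorm (f t) 2 volume ≤ M ∧ FNorm 1 (f t) ≤ M := by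
  obtain ⟨M, hM⟩ := h.bounded
  refine ⟨M, fun t ht => ?_⟩
  obtain ⟨s, hs, hl⟩ := exists_seq_tendsto_of_ae hT hM ht
  exact (bounds_of_tendsto (fun n => h.continuous _ (hs n).1) (fun n => (hs n).2) (h.continuous t ht)
    fun α => (h.continuousOn_time α t ht).tendsto.comp
      (tendsto_nhdsWithin_iff.2 ⟨hl, Eventually.of_forall fun n => (hs n).1⟩)).1

lemma aemeasurable_FNorm_two (h : IsSolution Aμ Aρ T f) (hT : 0 < T) :
    AEMeasurable (fun t => FNorm 2 (f t)) (volume.restrict (Icc 0 T)) := by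
  obtain ⟨M, hM⟩ := h.exists_bound hT
  have hcl : ∀ c, IsClosed {t | t ∈ Icc 0 T ∧ FNorm 2 (f t) ≤ c} := fun c => by
    refine IsSeqClosed.isClosed fun s t hs hl => ?_
    have ht : t ∈ Icc 0 T := isClosed_Icc.mem_of_tendsto hl (Eventually.of_forall fun n => (hs n).1)
    exact ⟨ht, (bounds_of_tendsto (fun n => h.continuous _ (hs n).1) (fun n => hM _ (hs n).1)
      (h.continuous t ht) fun α => (h.continuousOn_time α t ht).tendsto.comp
        (tendsto_nhdsWithin_iff.2 ⟨hl, Eventually.of_forall fun n => (hs n).1⟩)).2 c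
      fun n => (hs n).2⟩
  refine (aemeasurable_indicator_iff measurableSet_Icc).1 (Measurable.aemeasurable ?_)
  refine measurable_of_Iic fun c => ?_
  have e : (Icc 0 T).indicator (fun t => FNorm 2 (f t)) ⁻¹' Iic c =
      {t | t ∈ Icc 0 T ∧ FNorm 2 (f t) ≤ c} ∪ (Icc 0 T)ᶜ := by
    ext t
    by_cases ht : t ∈ Icc 0 T
    · simp [ht.1, ht.2]
    · simp [show ¬ (0 ≤ t ∧ t ≤ T) from ht]
  rw [e]
  exact (hcl c).measurableSet.union measurableSet_Icc.compl

lemma ae_reg2 (h : IsSolution Aμ Aρ T f) (hT : 0 < T) :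
    ∀ᵐ t ∂(volume.restrict (Icc 0 T)), Reg2 (f t) (fhat (f t)) := by
  obtain ⟨M, hM⟩ := h.exists_bound hT
  filter_upwards [ae_lt_top' (h.aemeasurable_FNorm_two hT) h.integrable.ne,
    ae_restrict_mem measurableSet_Icc] with t h2 ht
  exact reg2_of_FNorm (h.continuous t ht) ((hM t ht).2.trans_lt ENNReal.coe_lt_top) h2

end IsSolution

end

section

variable {T : ℝ} {U : ℝ → ℂ} {f r : ℝ → ℝ → ℝ}

lemma tendsto_floor_mul_div (x : ℝ) :
    Tendsto (fun n : ℕ => (⌊((n : ℝ) + 1) * x⌋ : ℝ) / ((n : ℝ) + 1)) atTop (𝓝 x) := by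
  rw [tendsto_iff_dist_tendsto_zero]
  refine squeeze_zero (fun _ => dist_nonneg) (fun n => ?_) tendsto_one_div_add_atTop_nhds_zero_nat
  have hn : (0 : ℝ) < (n : ℝ) + 1 := by positivity
  have h1 := Int.floor_le (((n : ℝ) + 1) * x)
  have h2 := Int.lt_floor_add_one (((n : ℝ) + 1) * x)
  rw [Real.dist_eq, show (⌊((n : ℝ) + 1) * x⌋ : ℝ) / ((n : ℝ) + 1) - x
    = ((⌊((n : ℝ) + 1) * x⌋ : ℝ) - ((n : ℝ) + 1) * x) / ((n : ℝ) + 1) by field_simp, abs_div,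
    abs_of_pos hn]
  gcongr
  rw [abs_le]
  constructor <;> linarith

lemma aestronglyMeasurable_uncurry_of_ae_continuous {μ : Measure ℝ} [SFinite μ]
    (hm : ∀ α, AEStronglyMeasurable (fun τ => r τ α) μ) (hc : ∀ᵐ τ ∂μ, Continuous (r τ)) :
    AEStronglyMeasurable (Function.uncurry r) (μ.prod volume) := by
  choose v hv he using hm
  have hg : ∀ n : ℕ, Measurable fun p : ℝ × ℝ =>
      v ((⌊((n : ℝ) + 1) * p.2⌋ : ℝ) / ((n : ℝ) + 1)) p.1 := fun n => by
    have h1 : Measurable fun q : ℝ × ℤ => v ((q.2 : ℝ) / ((n : ℝ) + 1)) q.1 :=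
      measurable_from_prod_countable_left fun k => (hv ((k : ℝ) / ((n : ℝ) + 1))).measurable
    exact h1.comp (measurable_fst.prodMk (Int.measurable_floor.comp (measurable_snd.const_mul _)))
  refine aestronglyMeasurable_of_tendsto_ae atTop (fun n => (hg n).aestronglyMeasurable) ?_
  have h2 : ∀ᵐ τ ∂μ, ∀ n : ℕ, ∀ k : ℤ, r τ ((k : ℝ) / ((n : ℝ) + 1))
      = v ((k : ℝ) / ((n : ℝ) + 1)) τ :=
    ae_all_iff.2 fun n => ae_all_iff.2 fun k => he ((k : ℝ) / ((n : ℝ) + 1))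
  filter_upwards [Measure.quasiMeasurePreserving_fst.ae h2,
    Measure.quasiMeasurePreserving_fst.ae hc] with p h3 h4
  simp only [← h3]
  exact (h4.tendsto p.2).comp (tendsto_floor_mul_div p.2)

lemma integrable_sym (hU : Integrable U) : Integrable (sym U) := by
  rw [sym_eq]
  exact (hU.add (integrable_conj hU.comp_neg)).const_mul _

lemma integral_norm_sym_le (hU : Integrable U) : ∫ ξ, ‖sym U ξ‖ ≤ ∫ ξ, ‖U ξ‖ := by
  have := (integral_weight_sym_le (q := fun _ => 1) (fun _ => zero_le_one) (fun _ => rfl)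
    measurable_const hU.1 (by simpa using hU.norm)).2
  simpa using this

/-- `F` is absolutely continuous in time with derivative `R`, in the sense of distributions in
frequency, and `R` is bounded with values in `L¹`. -/
structure Evol (T C : ℝ) (F R : ℝ → ℝ → ℂ) : Prop where
  memLp : ∀ t ∈ Icc 0 T, MemLp (F t) 2
  bound : ∀ᵐ τ ∂(volume.restrict (Icc 0 T)), Integrable (R τ) ∧ ∫ ξ, ‖R τ ξ‖ ≤ C
  integrable : ∀ φ : 𝓢(ℝ, ℂ), IntegrableOn (fun τ => ∫ ξ, φ ξ * R τ ξ) (Icc 0 T)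
  weak : ∀ φ : 𝓢(ℝ, ℂ), ∀ s ∈ Icc 0 T, ∀ t ∈ Icc 0 T, s ≤ t →
    ∫ ξ, φ ξ * (F t ξ - F s ξ) = ∫ τ in Icc s t, ∫ ξ, φ ξ * R τ ξ

lemma evol_of_representation {C : ℝ} {R : ℝ → ℝ → ℂ}
    (hf : ∀ t ∈ Icc 0 T, MemLp (f t) 2) (hT : 0 ≤ T)
    (hr : ∀ α, IntervalIntegrable (fun τ => r τ α) volume 0 T ∧
      ∀ t ∈ Icc 0 T, f t α = f 0 α + ∫ τ in (0 : ℝ)..t, r τ α)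
    (hR : ∀ᵐ τ ∂(volume.restrict (Icc 0 T)), (Integrable (R τ) ∧ ∫ ξ, ‖R τ ξ‖ ≤ C) ∧
      ∀ α, (r τ α : ℂ) = ift (R τ) α) :
    Evol T C (fun t => fhat (f t)) R := by
  have hint : ∀ ψ : 𝓢(ℝ, ℂ), Integrable (fun p : ℝ × ℝ => ψ p.2 * (r p.1 p.2 : ℂ))
      ((volume.restrict (Icc 0 T)).prod volume) := by
    intro ψ
    have hrm : AEStronglyMeasurable (Function.uncurry r)
        ((volume.restrict (Icc 0 T)).prod volume) := by
      refine aestronglyMeasurable_uncurry_of_ae_continuous (fun α => ?_) ?_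
      · exact ((intervalIntegrable_iff_integrableOn_Icc_of_le hT).1 (hr α).1).1
      · filter_upwards [hR] with τ hτ
        have : r τ = fun α => (ift (R τ) α).re := by
          ext α
          rw [← hτ.2, ofReal_re]
        rw [this]
        exact continuous_re.comp (continuous_ift hτ.1.1)
    have hdom : Integrable (fun p : ℝ × ℝ => C * ‖ψ p.2‖)
        ((volume.restrict (Icc 0 T)).prod volume) :=
      (integrable_const C).mul_prod ψ.integrable.norm
    refine hdom.mono' ?_ ?_
    · exact (ψ.continuous.comp continuous_snd).aestronglyMeasurable.mul
        (continuous_ofReal.comp_aestronglyMeasurable hrm)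
    · filter_upwards [Measure.quasiMeasurePreserving_fst.ae hR] with p hp
      rw [norm_mul, mul_comm]
      refine mul_le_mul_of_nonneg_right ?_ (norm_nonneg _)
      rw [hp.2]
      exact (norm_ift_le _ _).trans hp.1.2
  have hpi : (2 * Real.pi : ℂ) ≠ 0 := by simp [Real.pi_ne_zero]
  have hφ : ∀ φ ψ : 𝓢(ℝ, ℂ), (∀ ξ, ift ψ ξ = 2 * Real.pi * φ ξ) →
      ∀ᵐ τ ∂(volume.restrict (Icc 0 T)),
        ∫ ξ, φ ξ * R τ ξ = (2 * Real.pi : ℂ)⁻¹ * ∫ α, ψ α * (r τ α : ℂ) := by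
    intro φ ψ h
    filter_upwards [hR] with τ hτ
    have h1 := integral_mul_ift ψ.integrable hτ.1.1 1
    simp only [one_mul, h] at h1
    simp only [hτ.2, h1]
    rw [← integral_const_mul]
    congr with ξ
    field_simp
  refine ⟨fun t ht => memLp_fhat (hf t ht), hR.mono fun τ h => h.1, fun φ => ?_,
    fun φ s hs t ht hst => ?_⟩
  · obtain ⟨ψ, -, h2⟩ := exists_schwartz_ift_neg φ
    exact ((hint ψ).integral_prod_left.const_mul (2 * Real.pi : ℂ)⁻¹).congr
      ((hφ φ ψ h2).mono fun τ h => h.symm)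
  · obtain ⟨ψ, h1, h2⟩ := exists_schwartz_ift_neg φ
    have hsub : Icc s t ⊆ Icc 0 T := Icc_subset_Icc hs.1 ht.2
    have hm : ∀ t ∈ Icc 0 T, Integrable fun ξ => φ ξ * fhat (f t) ξ := fun t ht =>
      (φ.memLp 2).integrable_mul (memLp_fhat (hf t ht))
    have hm' : ∀ t ∈ Icc 0 T, Integrable fun α => ψ α * (f t α : ℂ) := fun t ht =>
      (ψ.memLp 2).integrable_mul (memLp_ofReal (hf t ht))
    have hd : ∀ α, ((f t α : ℂ) - f s α) = ∫ τ in Icc s t, (r τ α : ℂ) := by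
      intro α
      have hi := (intervalIntegrable_iff_integrableOn_Icc_of_le hT).1 (hr α).1
      have hi' : ∀ t ∈ Icc 0 T, IntervalIntegrable (fun τ => r τ α) volume 0 t := fun t ht =>
        (intervalIntegrable_iff_integrableOn_Icc_of_le ht.1).2
          (hi.mono_set (Icc_subset_Icc le_rfl ht.2))
      rw [integral_complex_ofReal, ← ofReal_sub, (hr α).2 t ht, (hr α).2 s hs, add_sub_add_left_eq_sub,
        intervalIntegral.integral_interval_sub_left (hi' t ht) (hi' s hs),
        intervalIntegral.integral_of_le hst, integral_Icc_eq_integral_Ioc]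
    have hint' : Integrable (fun p : ℝ × ℝ => ψ p.2 * (r p.1 p.2 : ℂ))
        ((volume.restrict (Icc s t)).prod volume) :=
      (hint ψ).mono_measure (Measure.prod_mono (Measure.restrict_mono hsub le_rfl) le_rfl)
    calc ∫ ξ, φ ξ * (fhat (f t) ξ - fhat (f s) ξ)
        = (∫ ξ, φ ξ * fhat (f t) ξ) - ∫ ξ, φ ξ * fhat (f s) ξ := by
          simp only [mul_sub]
          exact integral_sub (hm t ht) (hm s hs)
      _ = (2 * Real.pi : ℂ)⁻¹ * ∫ α, ψ α * ((f t α : ℂ) - f s α) := by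
          rw [integral_mul_fhat (hf t ht), integral_mul_fhat (hf s hs)]
          simp only [← h1, mul_sub]
          rw [integral_sub (hm' t ht) (hm' s hs), mul_sub]
      _ = (2 * Real.pi : ℂ)⁻¹ * ∫ α, ∫ τ in Icc s t, ψ α * (r τ α : ℂ) := by
          simp only [hd, integral_const_mul]
      _ = (2 * Real.pi : ℂ)⁻¹ * ∫ τ in Icc s t, ∫ α, ψ α * (r τ α : ℂ) := by
          rw [integral_integral_swap]
          exact hint'.swap
      _ = ∫ τ in Icc s t, ∫ ξ, φ ξ * R τ ξ := by
          rw [← integral_const_mul]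
          exact integral_congr_ae ((ae_restrict_of_ae_restrict_of_subset hsub (hφ φ ψ h2)).mono
            fun τ h => h.symm)

lemma IsSolution.evol {Aμ Aρ : ℝ} (h : IsSolution Aμ Aρ T f) (hρ : 0 ≤ Aρ)
    (hT : 0 < T) (hc : ∀ᵐ t ∂(volume.restrict (Icc 0 T)),
      FNorm 1 (f t) < ENNReal.ofReal (threshold |Aμ|)) :
    ∃ Ω : ℝ → ℝ → ℝ,
      Evol T (2 * Aρ) (fun t => fhat (f t))
        (fun t => sym (rspec Aμ Aρ (f t) (Ω t) (fhat (f t)))) ∧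
      ∀ᵐ t ∂(volume.restrict (Icc 0 T)), Reg2 (f t) (fhat (f t)) ∧
        n1 (fhat (f t)) < threshold |Aμ| ∧ IsOm Aμ Aρ (f t) (Ω t) (fhat (Ω t)) := by
  obtain ⟨Ω, h1, h2⟩ := h.equation
  obtain ⟨M, hM⟩ := h.exists_bound hT
  have hgood : ∀ᵐ t ∂(volume.restrict (Icc 0 T)), Reg2 (f t) (fhat (f t)) ∧
      n1 (fhat (f t)) < threshold |Aμ| ∧ IsOm Aμ Aρ (f t) (Ω t) (fhat (Ω t)) := by
    filter_upwards [h1, hc, h.ae_reg2 hT] with t h3 h4 h5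
    rw [h5.toReg1.FNorm_one] at h4
    exact ⟨h5, (ENNReal.ofReal_lt_ofReal_iff_of_nonneg (n1_nonneg _)).1 h4, h3.isOm⟩
  refine ⟨Ω, evol_of_representation (fun t ht => memLp_of_FNorm_lt_top
    ((hM t ht).2.trans_lt ENNReal.coe_lt_top)) hT.le h2 ?_, hgood⟩
  filter_upwards [hgood] with t ⟨h5, h6, h7⟩
  obtain ⟨hA, hl⟩ := adm_of_lt_threshold (abs_nonneg Aμ) (n1_nonneg _) h6
  have hd := dens_mspec (Aμ := Aμ) h5 hA.lt_one h7.toReg1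
  have hD := hd.sub (h5.toReg1.dens.const_mul Aρ)
  have hi : Integrable (rspec Aμ Aρ (f t) (Ω t) (fhat (f t))) := hD.integrable_abs_mul
  have hb : ∫ ξ, ‖rspec Aμ Aρ (f t) (Ω t) (fhat (f t)) ξ‖ ≤ 2 * Aρ := by
    have e : ∫ ξ, ‖rspec Aμ Aρ (f t) (Ω t) (fhat (f t)) ξ‖
        = n1 fun ξ => mspec Aμ (f t) (Ω t) ξ - Aρ * fhat (f t) ξ := by
      rw [n1]
      congr with ξ
      rw [rspec, norm_mul, norm_real, Real.norm_eq_abs, abs_abs]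
    have h8 := n1_sub_le hd.int1 (h5.toReg1.dens.const_mul Aρ).int1
    have h9 := (h7.mspec_le nrm_n1 hA hρ h5 le_rfl h5.int1).2
    rw [n1_const_mul, norm_real, Real.norm_of_nonneg hρ] at h8
    rw [e]
    have h10 := n1_nonneg (fhat (f t))
    have h11 : n1 (fhat (f t)) ≤ 1 := hA.lt_one.le
    have h12 : loss |Aμ| (n1 (fhat (f t))) * n1 (fhat (f t)) ≤ 1 := by
      nlinarith [hA.loss_nonneg]
    nlinarith [mul_le_mul_of_nonneg_left h12 hρ, mul_le_mul_of_nonneg_left h11 hρ]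
  refine ⟨⟨integrable_sym hi, (integral_norm_sym_le hi).trans hb⟩, fun α => ?_⟩
  rw [ift_sym hi, rhs_eq h5 hA.lt_one h7.toReg1]

end

section

variable {K s t : ℝ} {V : ℝ → ℂ}

lemma norm_integral_mul_le {φ : ℝ → ℂ} {S c : ℝ} (hS : ∀ ξ, ‖φ ξ‖ ≤ S) (hV : Integrable V)
    (h : ∫ ξ, ‖V ξ‖ ≤ c) : ‖∫ ξ, φ ξ * V ξ‖ ≤ c * S :=
  norm_integral_mul_le_of_lintegral hS ((integral_nonneg fun _ => norm_nonneg _).trans h)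
    (by rw [← ofReal_integral_norm_eq_lintegral_enorm hV]; exact ENNReal.ofReal_le_ofReal h)

lemma integrable_schwartz_mul (φ : 𝓢(ℝ, ℂ)) (hV : Integrable V) :
    Integrable fun ξ => φ ξ * V ξ := by
  obtain ⟨C, hC⟩ := φ.toBoundedContinuousFunction.isBounded_range.exists_norm_le
  exact hV.bdd_mul (c := C) φ.continuous.aestronglyMeasurable
    (Eventually.of_forall fun ξ => hC _ ⟨ξ, rfl⟩)

namespace Evol

variable {T C : ℝ} {F R : ℝ → ℝ → ℂ}

lemma sub (h : Evol T C F R) {C' : ℝ} {G S : ℝ → ℝ → ℂ} (h' : Evol T C' G S) :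
    Evol T (C + C') (fun t ξ => F t ξ - G t ξ) (fun t ξ => R t ξ - S t ξ) := by
  have key : ∀ φ : 𝓢(ℝ, ℂ), ∀ᵐ τ ∂(volume.restrict (Icc 0 T)),
      ∫ ξ, φ ξ * (R τ ξ - S τ ξ) = (∫ ξ, φ ξ * R τ ξ) - ∫ ξ, φ ξ * S τ ξ := fun φ => by
    filter_upwards [h.bound, h'.bound] with τ h1 h2
    simp only [mul_sub]
    exact integral_sub (integrable_schwartz_mul φ h1.1) (integrable_schwartz_mul φ h2.1)
  refine ⟨fun t ht => (h.memLp t ht).sub (h'.memLp t ht), ?_, fun φ => ?_,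
    fun φ s hs t ht hst => ?_⟩
  · filter_upwards [h.bound, h'.bound] with τ h1 h2
    refine ⟨h1.1.sub h2.1, ?_⟩
    calc ∫ ξ, ‖R τ ξ - S τ ξ‖ ≤ ∫ ξ, (‖R τ ξ‖ + ‖S τ ξ‖) :=
          integral_mono (h1.1.sub h2.1).norm (h1.1.norm.add h2.1.norm) fun ξ => norm_sub_le _ _
      _ = (∫ ξ, ‖R τ ξ‖) + ∫ ξ, ‖S τ ξ‖ := integral_add h1.1.norm h2.1.norm
      _ ≤ C + C' := add_le_add h1.2 h2.2
  · exact ((h.integrable φ).sub (h'.integrable φ)).congr ((key φ).mono fun τ h => h.symm)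
  · have hsub : Icc s t ⊆ Icc 0 T := Icc_subset_Icc hs.1 ht.2
    have hi : ∀ {C : ℝ} {F R : ℝ → ℝ → ℂ}, Evol T C F R → Integrable fun ξ =>
        φ ξ * (F t ξ - F s ξ) := fun h =>
      (φ.memLp 2).integrable_mul ((h.memLp t ht).sub (h.memLp s hs))
    rw [integral_congr_ae (ae_restrict_of_ae_restrict_of_subset hsub (key φ)),
      integral_sub ((h.integrable φ).mono_set hsub) ((h'.integrable φ).mono_set hsub),
      ← h.weak φ s hs t ht hst, ← h'.weak φ s hs t ht hst, ← integral_sub (hi h) (hi h')]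
    congr with ξ
    ring

lemma integral_sub_le (h : Evol T C F R) (hC : 0 ≤ C) (hs : s ∈ Icc 0 T)
    (ht : t ∈ Icc 0 T) :
    Integrable (fun ξ => F t ξ - F s ξ) ∧ ∫ ξ, ‖F t ξ - F s ξ‖ ≤ C * |t - s| := by
  wlog hst : s ≤ t generalizing s t
  · have := this ht hs (not_le.1 hst).le
    rw [abs_sub_comm]
    simp only [norm_sub_rev (F t _)]
    refine ⟨?_, this.2⟩
    exact this.1.neg.congr (Eventually.of_forall fun ξ => neg_sub _ _)
  have hm := (h.memLp t ht).sub (h.memLp s hs)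
  have hsub : Icc s t ⊆ Icc 0 T := Icc_subset_Icc hs.1 ht.2
  have h1 : ∫⁻ ξ, ‖F t ξ - F s ξ‖ₑ ≤ ENNReal.ofReal (C * (t - s)) := by
    refine lintegral_le_of_dual (hm.locallyIntegrable (by norm_num)) fun φ S hS => ?_
    have hb := norm_setIntegral_le_of_norm_le_const_ae (C := C * S) (μ := volume) (s := Icc s t)
      (f := fun τ => ∫ ξ, φ ξ * R τ ξ) (by simp)
      ((ae_restrict_of_ae_restrict_of_subset hsub h.bound).mono fun τ hτ =>
        norm_integral_mul_le hS hτ.1 hτ.2)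
    rw [Real.volume_real_Icc_of_le hst] at hb
    rw [h.weak φ s hs t ht hst]
    linarith
  have h2 := integrable_of_lintegral_le (U := fun ξ => F t ξ - F s ξ) (q := fun _ => 1) hm.1
    measurable_const (fun _ => zero_le_one) (mul_nonneg hC (sub_nonneg.2 hst)) (by simpa using h1)
  simp only [one_mul] at h2
  rw [abs_of_nonneg (sub_nonneg.2 hst)]
  exact ⟨(integrable_norm_iff hm.1).1 h2.1, h2.2⟩

lemma continuousOn_nw (h : Evol T C F R) (hC : 0 ≤ C) (hK : 0 ≤ K) (j : ℕ) :
    ContinuousOn (fun t => nw (qw K j) (F t)) (Icc 0 T) := by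
  have hle : ∀ s ∈ Icc 0 T, ∀ t ∈ Icc 0 T,
      nw (qw K j) (F t) - nw (qw K j) (F s) ≤ K ^ j * C * |t - s| := by
    intro s hs t ht
    have hm := (h.memLp t ht).sub (h.memLp s hs)
    have h1 := nw_add_le (qw_nonneg K j) (memLp_qw hK j) (h.memLp s hs) hm
    have h2 : nw (qw K j) (F t - F s) ≤ K ^ j * ∫ ξ, ‖F t ξ - F s ξ‖ := by
      rw [nw, ← integral_const_mul]
      exact integral_mono (integrable_weight (memLp_qw hK j) hm)
        ((h.integral_sub_le hC hs ht).1.norm.const_mul _)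
        fun ξ => mul_le_mul_of_nonneg_right (qw_le hK j ξ) (norm_nonneg _)
    have h3 := mul_le_mul_of_nonneg_left (h.integral_sub_le hC hs ht).2 (pow_nonneg hK j)
    simp only [Pi.sub_apply, add_sub_cancel] at h1
    linarith
  refine (LipschitzOnWith.of_dist_le_mul (K := ⟨K ^ j * C, by positivity⟩)
    fun t ht s hs => ?_).continuousOn
  rw [Real.dist_eq, Real.dist_eq, abs_le]
  have h1 := hle s hs t ht
  have h2 := hle t ht s hs
  rw [abs_sub_comm] at h2
  constructor
  · change -(K ^ j * C * |t - s|) ≤ _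
    linarith
  · exact h1

lemma lintegral_remainder_le (h : Evol T C F R) (hC : 0 ≤ C) {κ : ℝ} (hκ : 0 ≤ κ)
    {Y : ℝ → ℝ → ℂ} {B : ℝ → ℝ} (hB : IntegrableOn B (Icc 0 T))
    (hY : ∀ᵐ τ ∂(volume.restrict (Icc 0 T)), Integrable (Y τ) ∧ ∫ ξ, ‖Y τ ξ‖ ≤ B τ ∧
      R τ =ᵐ[volume] fun ξ => Y τ ξ - (κ * |ξ| : ℝ) * F τ ξ) (hK : 0 ≤ K)
    (hs : s ∈ Icc 0 T) (ht : t ∈ Icc 0 T) (hst : s ≤ t) :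
    ∫⁻ ξ in Icc (-K) K, ‖F t ξ - F s ξ + (t - s : ℝ) * ((κ * |ξ| : ℝ) * F s ξ)‖ₑ ≤
      ENNReal.ofReal ((∫ τ in Icc s t, B τ) + κ * (K + 1) * C * (t - s) ^ 2) := by
  have hsub : Icc s t ⊆ Icc 0 T := Icc_subset_Icc hs.1 ht.2
  have hm := (h.memLp t ht).sub (h.memLp s hs)
  have hl1 : LocallyIntegrable (fun ξ => F t ξ - F s ξ) := hm.locallyIntegrable (by norm_num)
  have hl2 : LocallyIntegrable fun ξ => ((t - s : ℝ) : ℂ) * ((κ * |ξ| : ℝ) * F s ξ) :=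
    LocallyIntegrable.continuous_mul (by fun_prop)
      (LocallyIntegrable.continuous_mul (by fun_prop)
        ((h.memLp s hs).locallyIntegrable (by norm_num)))
  refine lintegral_Icc_le_of_dual (hl1.add hl2) fun φ S hS hsupp => ?_
  have hS0 : 0 ≤ S := (norm_nonneg _).trans (hS 0)
  have hχ : MemLp (fun ξ => φ ξ * ((κ * |ξ| : ℝ) : ℂ)) 2 := by
    obtain ⟨ψ, hψ⟩ := exists_schwartz_dspec φ
    have h0 : MemLp (fun ξ => (κ : ℂ) * ψ ξ) 2 := (ψ.memLp 2).const_mul _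
    refine h0.of_le ?_ (Eventually.of_forall fun ξ => ?_)
    · exact (φ.continuous.mul (by fun_prop)).aestronglyMeasurable
    · rw [norm_mul, norm_real, Real.norm_of_nonneg (by positivity), norm_mul, norm_real,
        Real.norm_of_nonneg hκ, hψ, norm_dspec]
      linarith
  have hχb : ∀ ξ, ‖φ ξ * ((κ * |ξ| : ℝ) : ℂ)‖ ≤ S * (κ * (K + 1)) := fun ξ => by
    rw [norm_mul, norm_real, Real.norm_of_nonneg (by positivity)]
    by_cases hξ : K + 1 < |ξ|
    · rw [hsupp ξ hξ, norm_zero, zero_mul]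
      positivity
    · have := not_lt.1 hξ
      have := hS ξ
      gcongr
  have hχi : ∀ τ ∈ Icc 0 T, Integrable fun ξ => φ ξ * ((κ * |ξ| : ℝ) : ℂ) * F τ ξ := fun τ hτ =>
    hχ.integrable_mul (h.memLp τ hτ)
  set P : ℂ := ∫ ξ, φ ξ * ((κ * |ξ| : ℝ) : ℂ) * F s ξ with hP
  have e1 : ∫ ξ, φ ξ * (F t ξ - F s ξ + (t - s : ℝ) * ((κ * |ξ| : ℝ) * F s ξ))
      = (∫ ξ, φ ξ * (F t ξ - F s ξ)) + (t - s : ℝ) * P := by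
    have hi : Integrable fun ξ => φ ξ * (F t ξ - F s ξ) := (φ.memLp 2).integrable_mul hm
    rw [hP, ← integral_const_mul, ← integral_add hi ((hχi s hs).const_mul _)]
    congr with ξ
    ring
  have hci : IntegrableOn (fun _ : ℝ => P) (Icc s t) := integrableOn_const (by simp)
  have e2 : (∫ ξ, φ ξ * (F t ξ - F s ξ)) + (t - s : ℝ) * P
      = ∫ τ in Icc s t, ((∫ ξ, φ ξ * R τ ξ) + P) := by
    rw [integral_add ((h.integrable φ).mono_set hsub) hci, ← h.weak φ s hs t ht hst,
      setIntegral_const, Real.volume_real_Icc_of_le hst, real_smul]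
  have hb : ∀ᵐ τ ∂(volume.restrict (Icc s t)),
      ‖(∫ ξ, φ ξ * R τ ξ) + P‖ ≤ B τ * S + C * (t - s) * (S * (κ * (K + 1))) := by
    filter_upwards [ae_restrict_of_ae_restrict_of_subset hsub hY,
      ae_restrict_mem measurableSet_Icc] with τ ⟨y1, y2, y3⟩ hτ
    have hτ' := hsub hτ
    have hd := h.integral_sub_le hC hτ' hs
    have e3 : ∫ ξ, φ ξ * R τ ξ = (∫ ξ, φ ξ * Y τ ξ) - ∫ ξ, φ ξ * ((κ * |ξ| : ℝ) : ℂ) * F τ ξ := by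
      rw [← integral_sub (integrable_schwartz_mul φ y1) (hχi τ hτ')]
      refine integral_congr_ae ?_
      filter_upwards [y3] with ξ hξ
      rw [hξ]
      ring
    have e4 : (∫ ξ, φ ξ * R τ ξ) + P = (∫ ξ, φ ξ * Y τ ξ) +
        ∫ ξ, φ ξ * ((κ * |ξ| : ℝ) : ℂ) * (F s ξ - F τ ξ) := by
      simp only [mul_sub]
      rw [integral_sub (hχi s hs) (hχi τ hτ'), e3, hP]
      ring
    rw [e4]
    refine (norm_add_le _ _).trans (add_le_add (norm_integral_mul_le hS y1 y2) ?_)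
    refine norm_integral_mul_le hχb hd.1 (hd.2.trans ?_)
    rw [abs_sub_comm, abs_of_nonneg (sub_nonneg.2 hτ.1)]
    exact mul_le_mul_of_nonneg_left (by linarith [hτ.2]) hC
  have hBi : Integrable (fun τ => B τ * S) (volume.restrict (Icc s t)) :=
    (hB.mono_set hsub).mul_const S
  have hcr : IntegrableOn (fun _ : ℝ => C * (t - s) * (S * (κ * (K + 1)))) (Icc s t) :=
    integrableOn_const (by simp)
  have hfin := norm_integral_le_of_norm_le (hBi.add hcr) hb
  simp only [Pi.add_apply] at hfin ⊢
  rw [e1, e2]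
  refine hfin.trans (le_of_eq ?_)
  rw [integral_add hBi hcr, integral_mul_const, setIntegral_const, Real.volume_real_Icc_of_le hst,
    smul_eq_mul]
  ring

end Evol

end

section

variable {Aμ Aρ K κ : ℝ} {U : ℝ → ℂ} {B : ℝ → ℝ} {Y : ℝ → ℝ → ℂ}

lemma tendsto_nw_qw_one (hU : Dens U) :
    Tendsto (fun n : ℕ => nw (qw n 1) U) atTop (𝓝 (n1 U)) := by
  refine tendsto_integral_of_dominated_convergence (fun ξ => |ξ| * ‖U ξ‖) (fun n => ?_) hU.int1
    (fun n => Eventually.of_forall fun ξ => ?_) (Eventually.of_forall fun ξ => ?_)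
  · exact (measurable_qw n 1).aestronglyMeasurable.mul hU.memLp.1.norm
  · rw [Real.norm_of_nonneg (mul_nonneg (qw_nonneg _ _ _) (norm_nonneg _)), qw, pow_one]
    refine mul_le_mul_of_nonneg_right ?_ (norm_nonneg _)
    exact mul_le_of_le_one_left (abs_nonneg _) ((le_abs_self _).trans (abs_cut_le _ _))
  · have := ((tendsto_cut ξ).mul_const (|ξ| ^ 1)).mul_const ‖U ξ‖
    simpa only [one_mul, pow_one, qw] using this

lemma nw_qw_one_le (hU : Dens U) (K : ℝ) : nw (qw K 1) U ≤ n1 U := by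
  rw [← n1_cut_mul]
  exact n1_mul_cut_le hU.int1 K

namespace Evol

variable {T C : ℝ} {F R : ℝ → ℝ → ℂ}

lemma aestronglyMeasurable_n1 (h : Evol T C F R) (hC : 0 ≤ C)
    (hd : ∀ᵐ τ ∂(volume.restrict (Icc 0 T)), Dens (F τ)) :
    AEStronglyMeasurable (fun τ => n1 (F τ)) (volume.restrict (Icc 0 T)) :=
  aestronglyMeasurable_of_tendsto_ae atTop
    (fun n : ℕ => (h.continuousOn_nw hC n.cast_nonneg 1).aestronglyMeasurable measurableSet_Icc)
    (hd.mono fun _ hτ => tendsto_nw_qw_one hτ)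

lemma nw_remainder_le (h : Evol T C F R) (hC : 0 ≤ C) (hκ : 0 ≤ κ)
    (hB : IntegrableOn B (Icc 0 T))
    (hY : ∀ᵐ τ ∂(volume.restrict (Icc 0 T)), Integrable (Y τ) ∧ ∫ ξ, ‖Y τ ξ‖ ≤ B τ ∧
      R τ =ᵐ[volume] fun ξ => Y τ ξ - (κ * |ξ| : ℝ) * F τ ξ) (hK : 0 ≤ K) {s t : ℝ}
    (hs : s ∈ Icc 0 T) (ht : t ∈ Icc 0 T) (hst : s ≤ t) (hsmall : (t - s) * (κ * K) ≤ 1) :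
    nw (qw K 0) (F t) ≤ nw (qw K 0) (F s) - (t - s) * (κ * nw (qw K 1) (F s))
      + ((∫ τ in Icc s t, B τ) + κ * (K + 1) * C * (t - s) ^ 2) := by
  have hsub : Icc s t ⊆ Icc 0 T := Icc_subset_Icc hs.1 ht.2
  set Z : ℝ → ℂ := fun ξ => F t ξ - F s ξ + (t - s : ℝ) * ((κ * |ξ| : ℝ) * F s ξ) with hZ
  have hδ := sub_nonneg.2 hst
  have hZm : AEStronglyMeasurable Z :=
    ((h.memLp t ht).1.sub (h.memLp s hs).1).add (AEStronglyMeasurable.mul (by fun_prop)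
      (AEStronglyMeasurable.mul (by fun_prop) (h.memLp s hs).1))
  have hc : 0 ≤ (∫ τ in Icc s t, B τ) + κ * (K + 1) * C * (t - s) ^ 2 := by
    refine add_nonneg (setIntegral_nonneg_of_ae_restrict ?_) (by positivity)
    filter_upwards [ae_restrict_of_ae_restrict_of_subset hsub hY] with τ hτ
    exact (integral_nonneg fun _ => norm_nonneg _).trans hτ.2.1
  have hq : ∫⁻ ξ, ENNReal.ofReal (qw K 0 ξ) * ‖Z ξ‖ₑ = ∫⁻ ξ in Icc (-K) K, ‖Z ξ‖ₑ := by
    rw [← lintegral_indicator measurableSet_Icc]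
    congr with ξ
    rw [qw, cut, pow_zero, mul_one]
    by_cases hξ : |ξ| ≤ K
    · rw [if_pos hξ, indicator_of_mem (show ξ ∈ Icc (-K) K from abs_le.1 hξ), ENNReal.ofReal_one,
        one_mul]
    · rw [if_neg hξ, indicator_of_notMem (show ξ ∉ Icc (-K) K from fun h => hξ (abs_le.2 h)),
        ENNReal.ofReal_zero, zero_mul]
  obtain ⟨hZi, hZb⟩ := integrable_of_lintegral_le hZm (measurable_qw K 0) (qw_nonneg K 0) hc
    (hq.trans_le (h.lintegral_remainder_le hC hκ hB hY hK hs ht hst))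
  have i0 := integrable_weight (memLp_qw hK 0) (h.memLp s hs)
  have i1 := integrable_weight (memLp_qw hK 1) (h.memLp s hs)
  have i2 : Integrable fun ξ => qw K 0 ξ * ‖F s ξ‖ - (t - s) * (κ * (qw K 1 ξ * ‖F s ξ‖)) :=
    i0.sub ((i1.const_mul κ).const_mul (t - s))
  have hmain : nw (qw K 0) (F t) ≤ ∫ ξ, (qw K 0 ξ * ‖F s ξ‖
      - (t - s) * (κ * (qw K 1 ξ * ‖F s ξ‖)) + qw K 0 ξ * ‖Z ξ‖) := by
    refine integral_mono (integrable_weight (memLp_qw hK 0) (h.memLp t ht)) (i2.add hZi) fun ξ => ?_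
    simp only [qw, cut, pow_zero, pow_one, mul_one]
    split_ifs with hξ
    · have h1 : (t - s) * (κ * |ξ|) ≤ 1 := le_trans (by gcongr) hsmall
      have e : F t ξ = ((1 - (t - s) * (κ * |ξ|) : ℝ) : ℂ) * F s ξ + Z ξ := by
        rw [hZ]
        push_cast
        ring
      have h2 : ‖F t ξ‖ ≤ (1 - (t - s) * (κ * |ξ|)) * ‖F s ξ‖ + ‖Z ξ‖ := by
        rw [e]
        refine (norm_add_le _ _).trans (add_le_add_left (le_of_eq ?_) _)
        rw [norm_mul, norm_real, Real.norm_of_nonneg (sub_nonneg.2 h1)]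
      linarith
    · simp
  refine hmain.trans (le_of_eq_of_le (integral_add i2 hZi) (add_le_add (le_of_eq ?_) hZb))
  rw [integral_sub i0 ((i1.const_mul κ).const_mul (t - s)), integral_const_mul, integral_const_mul]
  rfl

lemma integral_nw_le (h : Evol T C F R) (hT : 0 ≤ T) (hC : 0 ≤ C) (hκ : 0 ≤ κ)
    (h0 : F 0 =ᵐ[volume] fun _ => 0)
    (hB : IntegrableOn B (Icc 0 T))
    (hY : ∀ᵐ τ ∂(volume.restrict (Icc 0 T)), Integrable (Y τ) ∧ ∫ ξ, ‖Y τ ξ‖ ≤ B τ ∧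
      R τ =ᵐ[volume] fun ξ => Y τ ξ - (κ * |ξ| : ℝ) * F τ ξ) (hK : 0 ≤ K) :
    ∫ τ in Icc 0 T, κ * nw (qw K 1) (F τ) ≤ ∫ τ in Icc 0 T, B τ := by
  have hBi := (intervalIntegrable_iff_integrableOn_Icc_of_le hT).2 hB
  have hBc : ContinuousOn (fun t => ∫ τ in (0 : ℝ)..t, B τ) (Icc 0 T) := by
    have := intervalIntegral.continuousOn_primitive_interval' hBi left_mem_uIcc
    rwa [uIcc_of_le hT] at this
  have hBt : ∀ t ∈ Icc 0 T, IntervalIntegrable B volume 0 t := fun t ht =>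
    (intervalIntegrable_iff_integrableOn_Icc_of_le ht.1).2
      (hB.mono_set (Icc_subset_Icc le_rfl ht.2))
  have key := add_integral_le_of_slope_le (T := T)
    (φ := fun t => nw (qw K 0) (F t) - ∫ τ in (0 : ℝ)..t, B τ)
    (d := fun t => κ * nw (qw K 1) (F t)) ((h.continuousOn_nw hC hK 0).sub hBc)
    (continuousOn_const.mul (h.continuousOn_nw hC hK 1)) ?_ T ⟨hT, le_rfl⟩
  · have e0 : nw (qw K 0) (F 0) = 0 := by
      rw [nw_congr_ae _ h0, nw]
      simp
    have h1 := nw_nonneg (qw_nonneg K 0) (F T)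
    rw [intervalIntegral.integral_same, e0, sub_zero] at key
    rw [integral_Icc_eq_integral_Ioc, integral_Icc_eq_integral_Ioc,
      ← intervalIntegral.integral_of_le hT, ← intervalIntegral.integral_of_le hT]
    linarith
  · intro s hs ε hε
    have hsT : s ∈ Icc 0 T := Ico_subset_Icc_self hs
    have l1 : Tendsto (fun t : ℝ => (t - s) * (κ * K)) (𝓝[>] s) (𝓝 0) := by
      have : Continuous fun t : ℝ => (t - s) * (κ * K) := by fun_prop
      simpa using (this.tendsto s).mono_left nhdsWithin_le_nhds
    have l2 : Tendsto (fun t : ℝ => κ * (K + 1) * C * (t - s)) (𝓝[>] s) (𝓝 0) := by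
      have : Continuous fun t : ℝ => κ * (K + 1) * C * (t - s) := by fun_prop
      simpa using (this.tendsto s).mono_left nhdsWithin_le_nhds
    filter_upwards [l1.eventually_le_const zero_lt_one, l2.eventually_le_const hε,
      Ioo_mem_nhdsGT hs.2] with t h1 h2 h3
    have htT : t ∈ Icc 0 T := ⟨hs.1.trans h3.1.le, h3.2.le⟩
    have h4 := h.nw_remainder_le hC hκ hB hY hK hsT htT h3.1.le h1
    have e : ∫ τ in Icc s t, B τ = (∫ τ in (0 : ℝ)..t, B τ) - ∫ τ in (0 : ℝ)..s, B τ := by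
      rw [intervalIntegral.integral_interval_sub_left (hBt t htT) (hBt s hsT),
        intervalIntegral.integral_of_le h3.1.le, integral_Icc_eq_integral_Ioc]
    have h5 := mul_le_mul_of_nonneg_left h2 (sub_nonneg.2 h3.1.le)
    rw [e] at h4
    linarith

lemma integral_n1_le (h : Evol T C F R) (hT : 0 ≤ T) (hC : 0 ≤ C) {M : ℝ} (hκ : 0 ≤ κ)
    (h0 : F 0 =ᵐ[volume] fun _ => 0)
    (hd : ∀ᵐ τ ∂(volume.restrict (Icc 0 T)), Dens (F τ) ∧ n1 (F τ) ≤ M)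
    (hB : IntegrableOn B (Icc 0 T))
    (hY : ∀ᵐ τ ∂(volume.restrict (Icc 0 T)), Integrable (Y τ) ∧ ∫ ξ, ‖Y τ ξ‖ ≤ B τ ∧
      R τ =ᵐ[volume] fun ξ => Y τ ξ - (κ * |ξ| : ℝ) * F τ ξ) :
    ∫ τ in Icc 0 T, κ * n1 (F τ) ≤ ∫ τ in Icc 0 T, B τ := by
  refine le_of_tendsto (f := fun n : ℕ => ∫ τ in Icc 0 T, κ * nw (qw n 1) (F τ)) (x := atTop) ?_
    (Eventually.of_forall fun n => h.integral_nw_le hT hC hκ h0 hB hY n.cast_nonneg)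
  refine tendsto_integral_of_dominated_convergence (fun _ => κ * M) (fun n => ?_)
    (integrableOn_const (by simp)) (fun n => ?_) ?_
  · exact ((h.continuousOn_nw hC n.cast_nonneg 1).aestronglyMeasurable measurableSet_Icc).const_mul κ
  · filter_upwards [hd] with τ hτ
    rw [Real.norm_of_nonneg (mul_nonneg hκ (nw_nonneg (qw_nonneg _ _) _))]
    exact mul_le_mul_of_nonneg_left ((nw_qw_one_le hτ.1 n).trans hτ.2) hκ
  · filter_upwards [hd] with τ hτ
    exact (tendsto_nw_qw_one hτ.1).const_mul κ

end Evol

lemma measurable_loss (m : ℝ) : Measurable (loss m) := by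
  unfold loss
  fun_prop

lemma ae_eq_zero_of_n1_eq_zero (hU : Dens U) (h : n1 U = 0) :
    U =ᵐ[volume] fun _ => 0 := by
  have h1 := (integral_eq_zero_iff_of_nonneg (fun ξ => by positivity) hU.int1).1 h
  have h2 : ∀ᵐ ξ : ℝ, ξ ≠ 0 := by simp [ae_iff]
  filter_upwards [h1, h2] with ξ h3 h4
  simpa [h4] using h3

lemma sym_rspec_sub {f g w v : ℝ → ℝ} {F G : ℝ → ℂ} (hF : ∀ᵐ ξ, conj (F (-ξ)) = F ξ)
    (hG : ∀ᵐ ξ, conj (G (-ξ)) = G ξ) :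
    (fun ξ => sym (rspec Aμ Aρ f w F) ξ - sym (rspec Aμ Aρ g v G) ξ) =ᵐ[volume] fun ξ =>
      sym (fun ξ => ((|ξ| : ℝ) : ℂ) * (mspec Aμ f w ξ - mspec Aμ g v ξ)) ξ
        - (Aρ * |ξ| : ℝ) * (F ξ - G ξ) := by
  filter_upwards [hF, hG] with ξ h1 h2
  simp only [sym, rspec, map_mul, map_sub, conj_ofReal, abs_neg, h1, h2]
  push_cast
  ring

theorem IsSolution.unique {T : ℝ} {f g : ℝ → ℝ → ℝ} (hf : IsSolution Aμ Aρ T f)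
    (hg : IsSolution Aμ Aρ T g) (hρ : 0 < Aρ) (hT : 0 < T)
    (hcf : ∀ᵐ t ∂(volume.restrict (Icc 0 T)), FNorm 1 (f t) < ENNReal.ofReal (threshold |Aμ|))
    (hcg : ∀ᵐ t ∂(volume.restrict (Icc 0 T)), FNorm 1 (g t) < ENNReal.ofReal (threshold |Aμ|))
    (h0 : f 0 =ᵐ[volume] g 0) : ∀ t ∈ Icc 0 T, ∀ α, f t α = g t α := by
  obtain ⟨Ω, eF, gF⟩ := hf.evol hρ.le hT hcf
  obtain ⟨Θ, eG, gG⟩ := hg.evol hρ.le hT hcg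
  have eH := eF.sub eG
  set F := fun t => fhat (f t)
  set G := fun t => fhat (g t)
  set H : ℝ → ℝ → ℂ := fun t ξ => F t ξ - G t ξ with hH
  have hC : 0 ≤ 2 * Aρ := by positivity
  set a : ℝ → ℝ := fun τ => max (n1 (F τ)) (n1 (G τ))
  have hgood : ∀ᵐ τ ∂(volume.restrict (Icc 0 T)), Adm |Aμ| (a τ) ∧ loss |Aμ| (a τ) < 1 := by
    filter_upwards [gF, gG] with τ h1 h2
    exact adm_of_lt_threshold (abs_nonneg _) ((n1_nonneg _).trans (le_max_left _ _))
      (max_lt h1.2.1 h2.2.1)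
  have hd : ∀ᵐ τ ∂(volume.restrict (Icc 0 T)), Dens (H τ) ∧ n1 (H τ) ≤ 2 := by
    filter_upwards [gF, gG, hgood] with τ h1 h2 h3
    refine ⟨h1.1.toReg1.dens.sub h2.1.toReg1.dens, ?_⟩
    have h4 := n1_sub_le h1.1.int1 h2.1.int1
    have h5 := (le_max_left (n1 (F τ)) (n1 (G τ))).trans_lt h3.1.lt_one
    have h6 := (le_max_right (n1 (F τ)) (n1 (G τ))).trans_lt h3.1.lt_one
    exact h4.trans (by linarith)
  have mF := eF.aestronglyMeasurable_n1 hC (gF.mono fun τ h => h.1.toReg1.dens)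
  have mG := eG.aestronglyMeasurable_n1 hC (gG.mono fun τ h => h.1.toReg1.dens)
  have mH := eH.aestronglyMeasurable_n1 (add_nonneg hC hC) (hd.mono fun τ h => h.1)
  have mL : AEStronglyMeasurable (fun τ => loss |Aμ| (a τ)) (volume.restrict (Icc 0 T)) :=
    ((measurable_loss _).comp_aemeasurable (mF.aemeasurable.max mG.aemeasurable)).aestronglyMeasurable
  have iH : IntegrableOn (fun τ => Aρ * n1 (H τ)) (Icc 0 T) := by
    refine Integrable.mono' (g := fun _ => Aρ * 2) (integrableOn_const (by simp))
      (mH.const_mul Aρ) ?_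
    filter_upwards [hd] with τ hτ
    rw [Real.norm_of_nonneg (mul_nonneg hρ.le (n1_nonneg _))]
    exact mul_le_mul_of_nonneg_left hτ.2 hρ.le
  have iB : IntegrableOn (fun τ => Aρ * loss |Aμ| (a τ) * n1 (H τ)) (Icc 0 T) := by
    refine Integrable.mono' iH ((mL.const_mul Aρ).mul mH) ?_
    filter_upwards [hgood] with τ hτ
    have h1 := hτ.1.loss_nonneg
    have h2 := n1_nonneg (H τ)
    rw [Real.norm_of_nonneg (by positivity)]
    refine mul_le_mul_of_nonneg_right ?_ h2
    exact mul_le_of_le_one_right hρ.le hτ.2.le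
  have hle := eH.integral_n1_le hT.le (add_nonneg hC hC) hρ.le (Y := fun τ =>
    sym fun ξ => ((|ξ| : ℝ) : ℂ) * (mspec Aμ (f τ) (Ω τ) ξ - mspec Aμ (g τ) (Θ τ) ξ)) (by
      have e : F 0 = G 0 := fhat_congr_ae h0
      exact Eventually.of_forall fun ξ => by simp only [hH, e, sub_self]) hd iB (by
    filter_upwards [gF, gG, hgood] with τ ⟨r1, _, o1⟩ ⟨r2, _, o2⟩ h3
    have l1 : n1 (F τ) ≤ a τ := le_max_left _ _
    have l2 : n1 (G τ) ≤ a τ := le_max_right _ _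
    have hD := (dens_mspec (Aμ := Aμ) r1 (l1.trans_lt h3.1.lt_one) o1.toReg1).sub
      (dens_mspec (Aμ := Aμ) r2 (l2.trans_lt h3.1.lt_one) o2.toReg1)
    have hi := hD.integrable_abs_mul
    refine ⟨integrable_sym hi, (integral_norm_sym_le hi).trans (le_trans (le_of_eq ?_)
      (n1_mspec_sub_le h3.1 hρ.le r1 r2 l1 l2 o1 o2)),
      sym_rspec_sub r1.toHasSpec.conj_symm r2.toHasSpec.conj_symm⟩
    rw [n1]
    congr with ξ
    rw [norm_mul, norm_real, Real.norm_eq_abs, abs_abs])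
  have hnn : 0 ≤ᵐ[volume.restrict (Icc 0 T)]
      fun τ => Aρ * n1 (H τ) - Aρ * loss |Aμ| (a τ) * n1 (H τ) := by
    filter_upwards [hgood] with τ hτ
    have h1 : 0 ≤ Aρ * (1 - loss |Aμ| (a τ)) * n1 (H τ) :=
      mul_nonneg (mul_nonneg hρ.le (by linarith [hτ.2])) (n1_nonneg _)
    change 0 ≤ Aρ * n1 (H τ) - Aρ * loss |Aμ| (a τ) * n1 (H τ)
    linarith
  have hz := (integral_eq_zero_iff_of_nonneg_ae hnn (iH.sub iB)).1
    (le_antisymm (by rw [integral_sub iH iB]; linarith) (integral_nonneg_of_ae hnn))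
  have heq : ∀ᵐ τ ∂(volume.restrict (Icc 0 T)), ∀ α, f τ α = g τ α := by
    filter_upwards [hz, gF, gG, hgood, hd] with τ h1 h2 h3 h4 h5
    have h6 : Aρ * (1 - loss |Aμ| (a τ)) * n1 (H τ) = 0 := by
      have : Aρ * n1 (H τ) - Aρ * loss |Aμ| (a τ) * n1 (H τ) = 0 := h1
      linarith
    have h7 : n1 (H τ) = 0 :=
      (mul_eq_zero.1 h6).resolve_left (mul_pos hρ (by linarith [h4.2])).ne'
    intro α
    have h8 : F τ =ᵐ[volume] G τ :=
      (ae_eq_zero_of_n1_eq_zero h5.1 h7).mono fun ξ hξ => sub_eq_zero.1 hξ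
    have h9 : (f τ α : ℂ) = g τ α := by
      rw [h2.1.eq, h3.1.eq]
      exact ift_congr_ae h8 α
    exact_mod_cast h9
  intro t ht α
  obtain ⟨s, hs, hl⟩ := exists_seq_tendsto_of_ae hT heq ht
  have hl' := tendsto_nhdsWithin_iff.2 ⟨hl, Eventually.of_forall fun n => (hs n).1⟩
  have lf := (hf.continuousOn_time α t ht).tendsto.comp hl'
  have lg := (hg.continuousOn_time α t ht).tendsto.comp hl'
  exact tendsto_nhds_unique (lf.congr fun n => (hs n).2 α) lg

end

section

variable {μ₁ μ₂ : ℝ} {u : ℝ → ℝ}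

lemma dens_fhat (h : FNorm 1 u < ⊤) :
    Dens (fhat u) ∧ n1 (fhat u) ≤ (FNorm 1 u).toReal := by
  have hm := memLp_of_FNorm_lt_top h
  have h' := lintegral_of_FNorm_lt_top h
  simp only [Real.rpow_one] at h'
  have h1 := integrable_of_lintegral_le (q := fun ξ => |ξ|) (memLp_fhat hm).1 measurable_id.abs
    abs_nonneg ENNReal.toReal_nonneg (h'.symm.trans (ENNReal.ofReal_toReal h.ne).symm).le
  exact ⟨⟨memLp_fhat hm, h1.1⟩, h1.2⟩

lemma phys_fhat_ae_eq (hu : MemLp u 2) (hi : Integrable (fhat u)) :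
    phys (fhat u) =ᵐ[volume] u := by
  filter_upwards [ae_eq_ift_fhat hu hi] with α hα
  rw [phys, ← hα, ofReal_re]

lemma ofReal_l2_fhat (hu : MemLp u 2) :
    ENNReal.ofReal (√(2 * Real.pi) * l2 (fhat u)) = eLpNorm u 2 volume := by
  have e : eLpNorm u 2 volume = eLpNorm (fun x => (u x : ℂ)) 2 volume :=
    eLpNorm_congr_norm_ae (Eventually.of_forall fun x => by rw [norm_real])
  rw [e, eLpNorm_eq_l2 (memLp_ofReal hu), l2, l2, integral_norm_sq_fhat hu,
    ← Real.sqrt_mul (by positivity), mul_inv_cancel_left₀ (by positivity)]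
  simp only [norm_real, Real.norm_eq_abs, sq_abs]

lemma abs_atwoodμ_le (h₁ : 0 ≤ μ₁) (h₂ : 0 ≤ μ₂) (h : 0 < μ₁ + μ₂) :
    |atwoodμ μ₁ μ₂| ≤ 1 := by
  rw [atwoodμ, abs_div, div_le_one (abs_pos.2 (by linarith)), abs_of_pos (by linarith : 0 < μ₂ + μ₁),
    abs_le]
  constructor <;> linarith

lemma atwoodρ_pos {ρ₁ ρ₂ : ℝ} (h : 0 < μ₁ + μ₂) (hρ : ρ₁ < ρ₂) : 0 < atwoodρ μ₁ μ₂ ρ₁ ρ₂ :=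
  div_pos (by linarith) (by linarith)

theorem exists_unique_solution {Aμ Aρ : ℝ} (hρ : 0 < Aρ) {f₀ : ℝ → ℝ} (hf₀ : MemLp f₀ 2)
    (hlt : FNorm 1 f₀ < ENNReal.ofReal (threshold |Aμ|)) {σ : ℝ}
    (hσ : σ = Aρ * sigmaOne |Aμ| (FNorm 1 f₀).toReal) :
    0 < σ ∧ ∃ f : ℝ → ℝ → ℝ, (∀ T, 0 < T → IsSolution Aμ Aρ T f) ∧ f 0 =ᵐ[volume] f₀ ∧
      (∀ t, 0 ≤ t → eLpNorm (f t) 2 volume ≤ eLpNorm f₀ 2 volume ∧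
        FNorm 1 (f t) + ENNReal.ofReal σ * ∫⁻ τ in Icc 0 t, FNorm 2 (f τ) ≤ FNorm 1 f₀) ∧
      ∀ T, 0 < T → ∀ g : ℝ → ℝ → ℝ, IsSolution Aμ Aρ T g → g 0 =ᵐ[volume] f₀ →
        (∀ᵐ t ∂(volume.restrict (Icc 0 T)), FNorm 1 (g t) < ENNReal.ofReal (threshold |Aμ|)) →
        ∀ t ∈ Icc 0 T, ∀ α, g t α = f t α := by
  have htop : FNorm 1 f₀ < ⊤ := hlt.trans ENNReal.ofReal_lt_top
  have ha0 : 0 ≤ (FNorm 1 f₀).toReal := ENNReal.toReal_nonneg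
  have hofr := ENNReal.ofReal_toReal htop.ne
  have hac : (FNorm 1 f₀).toReal < threshold |Aμ| := by
    rwa [← hofr, ENNReal.ofReal_lt_ofReal_iff_of_nonneg ha0] at hlt
  obtain ⟨r, hr1, hr2⟩ := exists_between hac
  obtain ⟨hA, hl⟩ := adm_of_lt_threshold (abs_nonneg Aμ) ha0 hac
  obtain ⟨hAr, hlr⟩ := adm_of_lt_threshold (abs_nonneg Aμ) (ha0.trans hr1.le) hr2
  have hσ' : σ = Aρ * (1 - loss |Aμ| (FNorm 1 f₀).toReal) := by
    rw [hσ, loss_eq_one_sub hA]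
    ring
  obtain ⟨hd, hn⟩ := dens_fhat htop
  obtain ⟨f, hsol, hf0, hb⟩ := exists_solution hAr hlr.le hA hl hr1 hρ hd hn
  have hf0' : f 0 =ᵐ[volume] f₀ := hf0 ▸ phys_fhat_ae_eq hf₀ hd.integrable
  rw [← hσ', ofReal_l2_fhat hf₀, hofr] at hb
  refine ⟨hσ' ▸ mul_pos hρ (by linarith), f, hsol, hf0', hb, fun T hT g hg hg0 hgc => ?_⟩
  refine hg.unique (hsol T hT) hρ hT hgc ?_ (hg0.trans hf0'.symm)
  filter_upwards [ae_restrict_mem measurableSet_Icc] with t ht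
  exact (le_self_add.trans (hb t ht.1).2).trans_lt hlt

end

end Muskat

end

theorem theorem2 (μ₁ μ₂ ρ₁ ρ₂ : ℝ) (hμ₁ : 0 ≤ μ₁) (hμ₂ : 0 ≤ μ₂) (hμ : 0 < μ₁ + μ₂)
    (hρ : ρ₁ < ρ₂) :
    |Muskat.threshold 1 - 0.128267| ≤ 0.0000005 ∧
    0 < Muskat.threshold |Muskat.atwoodμ μ₁ μ₂| ∧
    ∀ f₀ : ℝ → ℝ, MeasureTheory.MemLp f₀ 2 (MeasureTheory.volume : MeasureTheory.Measure ℝ) →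
      Muskat.FNorm 1 f₀ < ENNReal.ofReal (Muskat.threshold |Muskat.atwoodμ μ₁ μ₂|) →
      ∀ σ : ℝ, σ = Muskat.atwoodρ μ₁ μ₂ ρ₁ ρ₂ *
          Muskat.sigmaOne |Muskat.atwoodμ μ₁ μ₂| (Muskat.FNorm 1 f₀).toReal →
      0 < σ ∧
      ∃ f : ℝ → ℝ → ℝ,
        (∀ T : ℝ, 0 < T →
          Muskat.IsSolution (Muskat.atwoodμ μ₁ μ₂) (Muskat.atwoodρ μ₁ μ₂ ρ₁ ρ₂) T f) ∧
        f 0 =ᵐ[MeasureTheory.volume] f₀ ∧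
        (∀ t : ℝ, 0 ≤ t →
          MeasureTheory.eLpNorm (f t) 2 MeasureTheory.volume
              ≤ MeasureTheory.eLpNorm f₀ 2 MeasureTheory.volume ∧
          Muskat.FNorm 1 (f t)
              + ENNReal.ofReal σ * ∫⁻ τ in Set.Icc 0 t, Muskat.FNorm 2 (f τ)
            ≤ Muskat.FNorm 1 f₀) ∧
        (∀ T : ℝ, 0 < T → ∀ g : ℝ → ℝ → ℝ,
          Muskat.IsSolution (Muskat.atwoodμ μ₁ μ₂) (Muskat.atwoodρ μ₁ μ₂ ρ₁ ρ₂) T g →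
          g 0 =ᵐ[MeasureTheory.volume] f₀ →
          (∀ᵐ t ∂(MeasureTheory.volume.restrict (Set.Icc 0 T)),
            Muskat.FNorm 1 (g t)
              < ENNReal.ofReal (Muskat.threshold |Muskat.atwoodμ μ₁ μ₂|)) →
          ∀ t ∈ Set.Icc 0 T, ∀ α : ℝ, g t α = f t α) := by
  refine ⟨Muskat.threshold_one, Muskat.threshold_pos (abs_nonneg _)
    (Muskat.abs_atwoodμ_le hμ₁ hμ₂ hμ), fun f₀ hf₀ hlt σ hσ => ?_⟩
  exact Muskat.exists_unique_solution (Muskat.atwoodρ_pos hμ hρ) hf₀ hlt hσ
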